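/- Let $0<q<1$. Put $(a;p)_n=\prod_{i=0}^{n-1}(1-ap^i)$ and $(a;p)_{-n}=1/(ap^{-n};p)_n$ for $n\ge 0$, $(a_1,\dots,a_r;p)_n=\prod_i(a_i;p)_n$, $\left[{N\atop k}\right]=\frac{(q^2;q^2)_N}{(q^2;q^2)_k(q^2;q^2)_{N-k}}$, and let $$R_n(\mu(x);a,b,c,d;p)=\sum_{i=0}^{n}\frac{(p^{-n},abp^{n+1},p^{-x},cdp^{x+1};p)_i}{(p,ap,bdp,cp;p)_i}\,p^i$$ be the $q$-Racah polynomials. Let $M$ be the field of meromorphic functions on $\mathbb C$ (in the variable $\lambda$), $(T_sf)(\lambda)=f(\lambda+s)$ and $\bar f(\lambda)=\overline{f(\bar\lambda)}$. **The algebra.** $A=\mathcal F_R(\mathrm{SL}(2))$ is the complex algebra generated by $\alpha,\beta,\gamma,\delta$ and two copies of the algebra $M$, with commuting images, whose elements are written $f(\lambda)$ and $f(\mu)$, subject to $$f(\lambda)\alpha=\alpha f(\lambda+1),\quad f(\mu)\alpha=\alpha f(\mu+1),\quad f(\lambda)\beta=\beta f(\lambda+1),\quad f(\mu)\beta=\beta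 f(\mu-1),$$ $$f(\lambda)\gamma=\gamma f(\lambda-1),\quad f(\mu)\gamma=\gamma f(\mu+1),\quad f(\lambda)\delta=\delta f(\lambda-1),\quad f(\mu)\delta=\delta f(\mu-1),$$ $$\alpha\beta=qF(\mu-1)\beta\alpha,\quad \alpha\gamma=qF(\lambda)\gamma\alpha,\quad \beta\delta=qF(\lambda)\delta\beta,\quad \gamma\delta=qF(\mu-1)\delta\gamma,$$ $$\alpha\delta-\delta\alpha=H(\lambda,\mu)\gamma\beta,\qquad \beta\gamma-G(\mu)\gamma\beta=I(\lambda,\mu)\delta\alpha,\qquad \alpha\delta-qF(\lambda)\gamma\beta=1,$$ where $F(\lambda)=\frac{q^{2(\lambda+1)}-q^{-2}}{q^{2(\lambda+1)}-1}$, $G(\lambda)=\frac{(q^{2(\lambda+1)}-q^2)(q^{2(\lambda+1)}-q^{-2})}{(q^{2(\lambda+1)}-1)^2}$, $H(\lambda,\mu)=\frac{(q-q^{-1})(q^{2(\lambda+\mu+2)}-1)}{(q^{2(\lambda+1)}-1)(q^{2(\mu+1)}-1)}$, $I(\lambda,\mu)=\frac{(q-q^{-1})(q^{2(\mu+1)}-q^{2(\lambda+1)})}{(q^{2(\lambda+1)}-1)(q^{2(\mu+1)}-1)}$.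 Its coproduct $\Delta$ is the algebra map with $\Delta(\alpha)=\alpha\otimes\alpha+\beta\otimes\gamma$, $\Delta(\beta)=\alpha\otimes\beta+\beta\otimes\delta$, $\Delta(\gamma)=\gamma\otimes\alpha+\delta\otimes\gamma$, $\Delta(\delta)=\gamma\otimes\beta+\delta\otimes\delta$, $\Delta(f(\lambda))=f(\lambda)\otimes1$, $\Delta(f(\mu))=1\otimes f(\mu)$, with values in the matrix tensor product, where $f(\mu)x\otimes y=x\otimes f(\lambda)y$. The antilinear antimultiplicative map $*$ on $A$ is given by $\alpha^*=\delta$, $\beta^*=-q\gamma$, $\gamma^*=-q^{-1}\beta$, $\delta^*=\alpha$, $f(\lambda)^*=\bar f(\lambda)$, $f(\mu)^*=\bar f(\mu)$. **The dynamical representations.** For $\omega\in\mathbb C$, $\pi^\omega$ is the representation of $A$ on $\bigoplus_{k\ge0}Me_k$ given, with $e_{-1}=0$, by $$\pi^\omega(\alpha)ge_k=A_k(T_{-1}g)e_k,\quad \pi^\omega(\beta)ge_k=B_k(T_1g)e_{k-1},\quad \pi^\omega(\gamma)ge_k=-q^{-1}(T_{-1}g)e_{k+1},\quad \pi^\omega(\delta)ge_k=D_k(T_1g)e_k,$$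 $$\pi^\omega(f(\lambda))ge_k=(T_{-\omega-2k}f)ge_k,\qquad \pi^\omega(f(\mu))ge_k=fge_k,$$ $$A_k=q^{-k}\frac{1-q^{2(\lambda-\omega-k+1)}}{1-q^{2(\lambda-\omega-2k+1)}},\quad B_k=\frac{(1-q^{2k})(1-q^{2(\omega+k-1)})}{(1-q^{2(\lambda+1)})(1-q^{2(\omega+2k-\lambda-3)})},\quad D_k=q^k\frac{1-q^{2(\lambda+1-k)}}{1-q^{2(\lambda+1)}}.$$ **Theorem.** For every integer $N\ge0$ there are unique elements $t^N_{kj}\in A$ ($0\le k,j\le N$), the matrix elements, with $\Delta(\gamma^{N-k}\alpha^k)=\sum_{j=0}^Nt^N_{kj}\otimes\gamma^{N-j}\alpha^j$ for $0\le k\le N$. They have the following properties, where identities between functions of $\lambda$ are identities of meromorphic functions, $m,M\ge0$ are integers, $n=\min(M,N)$, and $e_i=0$ for $i<0$. 1. For $\omega\in\mathbb C$ one has $\pi^\omega(t^N_{kj})e_m=T_{kjm}\,e_{m+j-k}$, where $T_{kjm}=T^{\omega N}_{kjm}$ is $$T_{kjm}(\lambda)=(-1)^{j+k}q^{2k(\lambda+1)+m(N-k-j)+(k-j)(N-j+1)}\left[{N\atop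 j}\right]\frac{(q^{2(\lambda+1+k-j-m)};q^2)_{N-k-j}\,(q^{-2(m+j)},q^{-2(\omega-1+m+j)};q^2)_k}{(q^{2(\lambda+1-j)};q^2)_{N-j}\,(q^{2(\lambda-\omega+2+N-2j-2m)};q^2)_k}$$ $$\times R_j(\mu(k);q^{-2(N+1)},q^{-2(\lambda+1)},q^{-2(m+j+1)},q^{2(\lambda-\omega+1-m-j)};q^2).$$ This holds as it stands if $(x;q^2)_{\min(j,k)}\neq0$ for $x=q^{-2(\omega-1+m+j)}$, and for every $\omega$ if the denominators $(x;q^2)_i$, $i\le\min(j,k)$, of $R_j$ are cancelled against the factor $(x;q^2)_k$ by $(x;q^2)_k/(x;q^2)_i=(xq^{2i};q^2)_{k-i}$. 2. Put $\Gamma^N_k(\lambda)=\left[{N\atop k}\right]\frac{(q^{2(k-N-\lambda-1)};q^2)_k}{(q^{-2\lambda};q^2)_k}$. For $0\le k,l\le N$, $$\delta_{kl}=\sum_{j=0}^N(t^N_{jk})^*\frac{\Gamma^N_j(\lambda)}{\Gamma^N_k(\mu)}\,t^N_{jl}=\sum_{j=0}^Nt^N_{kj}(t^N_{lj})^*\frac{\Gamma^N_l(\lambda)}{\Gamma^N_j(\mu)}.$$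 3. Put $\Gamma^\omega_k(\lambda)=\frac{(q^2,q^{2\omega};q^2)_k}{(q^{2(\lambda-k+1)},q^{2(\omega-\lambda+k-1)};q^2)_k}$. Let $\omega\in\mathbb R$ and $g\in M$. If $m+k-j\ge 0$ and $\omega\notin\{0,-1,\dots,-(m+k-1)\}$, then $$\pi^\omega((t^N_{kj})^*)\,ge_m=T_{kj,m+k-j}(\lambda+2j-N)\,\frac{\Gamma^\omega_m(\lambda+2j-N)}{\Gamma^\omega_{m+k-j}(\lambda)}\,g(\lambda+2j-N)\,e_{m+k-j},$$ and if $m+k-j<0$, then $\pi^\omega((t^N_{kj})^*)\,ge_m=0$ (for all $\omega\in\mathbb R$). 4. (First relation of 2, evaluated in $\pi^\omega$.) If $\omega\in\mathbb R$, $\omega\notin\{0,-1,\dots,-(M-1)\}$, then for $0\le k,l\le n$ $$\delta_{kl}=\sum_{j=0}^{n}\frac{\Gamma^\omega_{M-j}(\lambda)\,\Gamma^N_j(\lambda-\omega-2M+2j)}{\Gamma^\omega_{M-k}(\lambda+N-2k)\,\Gamma^N_k(\lambda)}\,T_{jk,M-k}(\lambda)\,T_{jl,M-l}(\lambda).$$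 5. (Orthogonality of $q$-Racah polynomials.) Let $\omega\in\mathbb R$, $\omega\ne1-M+i$ for $0\le i<n$. Write $R_k(\mu(j))=R_k(\mu(j);q^{-2(N+1)},q^{-2(\lambda+1)},q^{-2(M+1)},q^{2(\lambda-\omega+1-M)};q^2)$, $$w_j=\frac{1-q^{2(\lambda-\omega+1-2M)+4j}}{1-q^{2(\lambda-\omega+1-2M)}}\,\frac{(q^{2(\lambda-\omega-2M+1)},q^{-2N},q^{-2M},q^{-2(\omega-1+M)};q^2)_j}{(q^2,q^{2(\lambda-\omega+2+N-2M)},q^{2(\lambda-\omega+2-M)},q^{2(\lambda+1-M)};q^2)_j}\,q^{2j(\lambda+N+1)},$$ $$h_k=\frac{(q^{2(\omega-\lambda-1+2M-N)},q^{-2(\lambda+N)};q^2)_N}{(q^{2(\omega-\lambda-1+M-N)},q^{-2(\lambda+N-M)};q^2)_N}\,\frac{1-q^{-2(\lambda+1+N)}}{1-q^{-2(\lambda+1+N)+4k}}\,\frac{(q^2,q^{-2\lambda},q^{-2(\lambda+N-M)},q^{2(\omega-\lambda-1+M-N)};q^2)_k}{(q^{-2(\lambda+1+N)},q^{-2N},q^{-2M},q^{-2(\omega-1+M)};q^2)_k}\,q^{2k(\lambda-\omega+1-2M)}.$$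 Then $w_j$ and $h_k$ are nonzero for $0\le j,k\le n$, and for $0\le k,l\le n$ $$\sum_{j=0}^{n}w_j\,R_k(\mu(j))\,R_l(\mu(j))=\delta_{kl}\,h_k .$$ 6. (Dual system.) Under the hypotheses of 5, with $\tilde R_j(\mu(k))=R_j(\mu(k);q^{-2(M+1)},q^{2(\lambda-\omega+1-M)},q^{-2(N+1)},q^{-2(\lambda+1)};q^2)$, one has for $0\le i,j\le n$ $$\sum_{k=0}^{n}h_k^{-1}\,\tilde R_i(\mu(k))\,\tilde R_j(\mu(k))=\delta_{ij}\,w_i^{-1}.$$ -/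

import Mathlib

set_option linter.unusedSimpArgs false

namespace DynSU2

section Meromorphic

open Filter Topology

lemma tendsto_codiscrete_of_injective {f : ℂ → ℂ} (hc : Continuous f)
    (hi : Function.Injective f) : Tendsto f (codiscrete ℂ) (codiscrete ℂ) := by
  intro s hs
  rw [mem_map, mem_codiscrete'] at *
  refine ⟨hs.1.preimage hc, ?_⟩
  have := hs.2.preimage' (f := f) hc.continuousOn ?_
  · simpa using this
  · intro x
    exact (Set.subsingleton_singleton.preimage hi).isDiscrete

lemma meromorphic_conj_conj {f : ℂ → ℂ} (hf : Meromorphic f) :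
    Meromorphic (fun z => starRingEnd ℂ (f (starRingEnd ℂ z))) := by
  intro x
  obtain ⟨n, hn⟩ := hf (starRingEnd ℂ x)
  refine ⟨n, ?_⟩
  rw [Complex.analyticAt_iff_eventually_differentiableAt] at hn ⊢
  have ht : Tendsto (starRingEnd ℂ) (𝓝 x) (𝓝 (starRingEnd ℂ x)) :=
    Complex.continuous_conj.tendsto x
  filter_upwards [ht.eventually hn] with z hz
  have := hz.conj_conj
  simp only [Complex.conj_conj] at this
  have key : (fun z => (z - x) ^ n • (starRingEnd ℂ) (f ((starRingEnd ℂ) z))) =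
      starRingEnd ℂ ∘ (fun z => (z - (starRingEnd ℂ) x) ^ n • f z) ∘ starRingEnd ℂ := by
    ext w
    simp
  rw [key]
  exact this

/-- The ring of (classes of) meromorphic functions on `ℂ`, as a subring of the germs along the
codiscrete filter. -/
def merSubring : Subring (Germ (codiscrete ℂ) ℂ) where
  carrier := {g | ∃ f : ℂ → ℂ, Meromorphic f ∧ g = (f : Germ (codiscrete ℂ) ℂ)}
  mul_mem' := by
    rintro _ _ ⟨f, hf, rfl⟩ ⟨g, hg, rfl⟩
    exact ⟨f * g, hf.mul hg, rfl⟩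
  one_mem' := ⟨1, Meromorphic.const 1, rfl⟩
  add_mem' := by
    rintro _ _ ⟨f, hf, rfl⟩ ⟨g, hg, rfl⟩
    exact ⟨f + g, hf.add hg, rfl⟩
  zero_mem' := ⟨0, Meromorphic.const 0, rfl⟩
  neg_mem' := by
    rintro _ ⟨f, hf, rfl⟩
    exact ⟨-f, hf.neg, rfl⟩

/-- The field of meromorphic functions on `ℂ`. -/
def Mer : Type := merSubring

namespace Mer

noncomputable instance : CommRing Mer := inferInstanceAs (CommRing merSubring)

/-- The element of `Mer` given by a meromorphic function. -/
noncomputable def mk (f : ℂ → ℂ) (hf : Meromorphic f) : Mer := ⟨(f : Germ (codiscrete ℂ) ℂ), f, hf, rfl⟩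

lemma ind {P : Mer → Prop} (h : ∀ f hf, P (mk f hf)) (x : Mer) : P x := by
  obtain ⟨_, f, hf, rfl⟩ := x
  exact h f hf

lemma mk_eq_mk {f g : ℂ → ℂ} {hf : Meromorphic f} {hg : Meromorphic g} :
    mk f hf = mk g hg ↔ f =ᶠ[codiscrete ℂ] g := by
  rw [← Germ.coe_eq]
  exact Subtype.ext_iff

lemma mk_add (f g : ℂ → ℂ) (hf : Meromorphic f) (hg : Meromorphic g) :
    mk f hf + mk g hg = mk (f + g) (hf.add hg) := rfl

lemma mk_mul (f g : ℂ → ℂ) (hf : Meromorphic f) (hg : Meromorphic g) :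
    mk f hf * mk g hg = mk (f * g) (hf.mul hg) := rfl

lemma zero_def : (0 : Mer) = mk (fun _ => 0) (Meromorphic.const 0) := rfl

lemma one_def : (1 : Mer) = mk (fun _ => 1) (Meromorphic.const 1) := rfl

instance : (codiscrete ℂ).NeBot := by
  have h : 𝓝[≠] (0 : ℂ) ≤ codiscrete ℂ := by
    intro s hs
    have := mem_codiscrete.1 hs 0
    rwa [Filter.disjoint_principal_right, compl_compl] at this
  exact NeBot.mono inferInstance h

noncomputable instance : Inv Mer :=
  ⟨fun x => ⟨(x.1)⁻¹, by
    obtain ⟨_, f, hf, rfl⟩ := x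
    exact ⟨f⁻¹, hf.inv, rfl⟩⟩⟩

lemma mk_inv (f : ℂ → ℂ) (hf : Meromorphic f) : (mk f hf)⁻¹ = mk f⁻¹ hf.inv := rfl

lemma ne_zero_iff {f : ℂ → ℂ} (hf : Meromorphic f) :
    mk f hf ≠ 0 → ∀ᶠ z in codiscrete ℂ, f z ≠ 0 := by
  intro h
  have h1 : ∃ u, meromorphicOrderAt f u ≠ ⊤ := by
    by_contra! h2
    apply h
    rw [zero_def, mk_eq_mk, EventuallyEq, Filter.Eventually, mem_codiscrete]
    intro x
    rw [Filter.disjoint_principal_right, compl_compl]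
    exact meromorphicOrderAt_eq_top_iff.1 (h2 x)
  rw [hf.exists_meromorphicOrderAt_ne_top_iff_forall] at h1
  exact MeromorphicAt.MeromorphicOn.codiscreteWithin_setOfPred_ne_zero
    hf.meromorphicOn fun u _ => h1 u

noncomputable instance : Field Mer where
  inv := Inv.inv
  exists_pair_ne := by
    refine ⟨0, 1, ?_⟩
    rw [zero_def, one_def, Ne, mk_eq_mk]
    intro h
    obtain ⟨z, hz⟩ := h.exists
    exact zero_ne_one hz
  mul_inv_cancel := by
    intro x
    induction x using ind with
    | h f hf =>
      intro hx
      rw [mk_inv, mk_mul, one_def, mk_eq_mk]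
      filter_upwards [ne_zero_iff hf hx] with z hz
      simp [hz]
  inv_zero := by
    rw [zero_def, mk_inv, mk_eq_mk]
    filter_upwards with z
    simp
  nnqsmul := _
  qsmul := _

/-- Constant functions. -/
noncomputable def const : ℂ →+* Mer where
  toFun c := mk (fun _ => c) (Meromorphic.const c)
  map_one' := rfl
  map_mul' _ _ := rfl
  map_zero' := rfl
  map_add' _ _ := rfl

noncomputable instance : Algebra ℂ Mer := const.toAlgebra

lemma algebraMap_def (c : ℂ) : algebraMap ℂ Mer c = mk (fun _ => c) (Meromorphic.const c) := rfl

/-- The automorphism `T_α` of `Mer`, `(T_α f)(λ) = f(λ + α)`. -/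
noncomputable def shift (α : ℂ) : Mer →ₐ[ℂ] Mer where
  toFun x := ⟨x.1.compTendsto (fun z => z + α)
      (tendsto_codiscrete_of_injective (by fun_prop) (add_left_injective α)), by
    obtain ⟨_, f, hf, rfl⟩ := x
    exact ⟨fun z => f (z + α), by simpa using hf, rfl⟩⟩
  map_one' := rfl
  map_mul' x y := by
    obtain ⟨_, f, hf, rfl⟩ := x
    obtain ⟨_, g, hg, rfl⟩ := y
    rfl
  map_zero' := rfl
  map_add' x y := by
    obtain ⟨_, f, hf, rfl⟩ := x
    obtain ⟨_, g, hg, rfl⟩ := y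
    rfl
  commutes' _ := rfl

lemma shift_mk (α : ℂ) (f : ℂ → ℂ) (hf : Meromorphic f) :
    shift α (mk f hf) = mk (fun z => f (z + α)) (by simpa using hf) := rfl

lemma shift_shift (α β : ℂ) (x : Mer) : shift α (shift β x) = shift (α + β) x := by
  induction x using ind with
  | h f hf => simp only [shift_mk, add_assoc]

@[simp] lemma shift_zero (x : Mer) : shift 0 x = x := by
  induction x using ind with
  | h f hf => simp only [shift_mk, add_zero]

/-- The conjugation `f ↦ f̄` of `Mer`, where `f̄(λ)` is the complex conjugate of `f(λ̄)`. -/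
noncomputable def bar : Mer →+* Mer where
  toFun x := ⟨(x.1.compTendsto (starRingEnd ℂ)
      (tendsto_codiscrete_of_injective Complex.continuous_conj
        (starRingEnd ℂ).injective)).map (starRingEnd ℂ), by
    obtain ⟨_, f, hf, rfl⟩ := x
    exact ⟨_, meromorphic_conj_conj hf, rfl⟩⟩
  map_one' := by
    refine (mk_eq_mk (hf := meromorphic_conj_conj (Meromorphic.const 1))
      (hg := Meromorphic.const 1)).2 ?_
    filter_upwards with z
    simp
  map_mul' x y := by
    obtain ⟨_, f, hf, rfl⟩ := x
    obtain ⟨_, g, hg, rfl⟩ := y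
    refine (mk_eq_mk (hf := meromorphic_conj_conj (hf.mul hg))
      (hg := (meromorphic_conj_conj hf).mul (meromorphic_conj_conj hg))).2 ?_
    filter_upwards with z
    simp
  map_zero' := by
    refine (mk_eq_mk (hf := meromorphic_conj_conj (Meromorphic.const 0))
      (hg := Meromorphic.const 0)).2 ?_
    filter_upwards with z
    simp
  map_add' x y := by
    obtain ⟨_, f, hf, rfl⟩ := x
    obtain ⟨_, g, hg, rfl⟩ := y
    refine (mk_eq_mk (hf := meromorphic_conj_conj (hf.add hg))
      (hg := (meromorphic_conj_conj hf).add (meromorphic_conj_conj hg))).2 ?_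
    filter_upwards with z
    simp

lemma bar_mk (f : ℂ → ℂ) (hf : Meromorphic f) :
    bar (mk f hf) = mk _ (meromorphic_conj_conj hf) := rfl

lemma bar_const (c : ℂ) : bar (algebraMap ℂ Mer c) = algebraMap ℂ Mer (starRingEnd ℂ c) := rfl

end Mer

end Meromorphic

section QNotation

open Polynomial

namespace Mer

lemma meromorphic_qpow (q : Set.Ioo (0 : ℝ) 1) (p : ℂ[X]) :
    Meromorphic (fun z : ℂ => ((q : ℝ) : ℂ) ^ p.eval z) := by
  have hq : ((q : ℝ) : ℂ) ≠ 0 := by exact_mod_cast q.2.1.ne'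
  have : Differentiable ℂ (fun z : ℂ => ((q : ℝ) : ℂ) ^ p.eval z) :=
    p.differentiable.const_cpow (Or.inl hq)
  exact fun z => (this.analyticAt z).meromorphicAt

/-- The function `λ ↦ q ^ p(λ)` in `Mer`, where `p` is a polynomial in the variable `λ = X`. -/
noncomputable def qE (q : Set.Ioo (0 : ℝ) 1) (p : ℂ[X]) : Mer :=
  mk (fun z => ((q : ℝ) : ℂ) ^ p.eval z) (meromorphic_qpow q p)

variable (q : Set.Ioo (0 : ℝ) 1)

lemma q_ne : ((q : ℝ) : ℂ) ≠ 0 := by exact_mod_cast q.2.1.ne'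

lemma qE_add (p p' : ℂ[X]) : qE q (p + p') = qE q p * qE q p' := by
  simp only [qE, mk_mul]
  congr 1
  ext z
  simp [Complex.cpow_add _ _ (q_ne q)]

lemma qE_C (c : ℂ) : qE q (C c) = algebraMap ℂ Mer (((q : ℝ) : ℂ) ^ c) := by
  simp [qE, algebraMap_def]

lemma shift_qE (α : ℂ) (p : ℂ[X]) : shift α (qE q p) = qE q (p.comp (X + C α)) := by
  simp [qE, shift_mk]

end Mer

/-- The `q`-shifted factorial `(a; p)_n`. -/
def qPoch {K : Type*} [Field K] (a p : K) (n : ℕ) : K :=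
  ∏ j ∈ Finset.range n, (1 - a * p ^ j)

/-- The `q`-shifted factorial `(a; p)_n` for integers `n`, where
`(a; p)_{-n} = 1 / (a p ^ (-n); p)_n`. -/
def qPochInt {K : Type*} [Field K] (a p : K) : ℤ → K
  | Int.ofNat n => qPoch a p n
  | Int.negSucc n => (qPoch (a * p ^ (-((n : ℤ) + 1))) p (n + 1))⁻¹

/-- The `q`-binomial coefficient (for `k ≤ n`). -/
def qBinom {K : Type*} [Field K] (p : K) (n k : ℕ) : K :=
  qPoch p p n / (qPoch p p k * qPoch p p (n - k))

/-- The `q`-Racah polynomial `R_n(μ(x); a, b, c, d; p)` at `μ(x) = p ^ (-x) + c d p ^ (x + 1)`,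
that is, the series `₄φ₃(p⁻ⁿ, a b pⁿ⁺¹, p⁻ˣ, c d pˣ⁺¹; a p, b d p, c p; p, p)`, which terminates
after the term with index `n`. -/
def qRacah {K : Type*} [Field K] (n x : ℕ) (a b c d p : K) : K :=
  ∑ i ∈ Finset.range (n + 1),
    qPoch (p ^ (-(n : ℤ))) p i * qPoch (a * b * p ^ (n + 1)) p i * qPoch (p ^ (-(x : ℤ))) p i *
        qPoch (c * d * p ^ (x + 1)) p i /
      (qPoch p p i * qPoch (a * p) p i * qPoch (b * d * p) p i * qPoch (c * p) p i) * p ^ i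

end QNotation

section Algebra

open Polynomial Mer

variable (q : Set.Ioo (0 : ℝ) 1)

/-- `F(λ) = (q^{2(λ+1)} - q^{-2}) / (q^{2(λ+1)} - 1)`. -/
noncomputable def fF : Mer := (qE q (2 * (X + 1)) - qE q (-2)) / (qE q (2 * (X + 1)) - 1)

/-- `G(λ) = (q^{2(λ+1)} - q^2) (q^{2(λ+1)} - q^{-2}) / (q^{2(λ+1)} - 1)^2`. -/
noncomputable def fG : Mer :=
  (qE q (2 * (X + 1)) - qE q 2) * (qE q (2 * (X + 1)) - qE q (-2)) / (qE q (2 * (X + 1)) - 1) ^ 2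

/-- The generators: `α`, `β`, `γ`, `δ` and the two copies `f(λ)`, `f(μ)` of the field `Mer`. -/
inductive Gen : Type
  | a : Gen
  | b : Gen
  | c : Gen
  | d : Gen
  | l (f : Mer) : Gen
  | r (f : Mer) : Gen

section HI

variable {B : Type*} [Ring B] [Algebra ℂ B] (l r : Mer → B)

/-- `H(λ,μ) = (q - q⁻¹) (q^{2(λ+μ+2)} - 1) / ((q^{2(λ+1)} - 1) (q^{2(μ+1)} - 1))`, written in terms
of the two moment maps `l : f ↦ f(λ)` and `r : f ↦ f(μ)`. -/
noncomputable def elH : B :=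
  (((q : ℝ) : ℂ) - ((q : ℝ) : ℂ)⁻¹) •
    ((l (qE q (2 * (X + 1))) * r (qE q (2 * (X + 1))) - 1) *
      (l (qE q (2 * (X + 1)) - 1)⁻¹ * r (qE q (2 * (X + 1)) - 1)⁻¹))

/-- `I(λ,μ) = (q - q⁻¹) (q^{2(μ+1)} - q^{2(λ+1)}) / ((q^{2(λ+1)} - 1) (q^{2(μ+1)} - 1))`. -/
noncomputable def elI : B :=
  (((q : ℝ) : ℂ) - ((q : ℝ) : ℂ)⁻¹) •
    ((r (qE q (2 * (X + 1))) - l (qE q (2 * (X + 1)))) *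
      (l (qE q (2 * (X + 1)) - 1)⁻¹ * r (qE q (2 * (X + 1)) - 1)⁻¹))

end HI

/-- The generator `α` of the free algebra. -/
abbrev xα : FreeAlgebra ℂ Gen := FreeAlgebra.ι ℂ Gen.a
/-- The generator `β` of the free algebra. -/
abbrev xβ : FreeAlgebra ℂ Gen := FreeAlgebra.ι ℂ Gen.b
/-- The generator `γ` of the free algebra. -/
abbrev xγ : FreeAlgebra ℂ Gen := FreeAlgebra.ι ℂ Gen.c
/-- The generator `δ` of the free algebra. -/
abbrev xδ : FreeAlgebra ℂ Gen := FreeAlgebra.ι ℂ Gen.d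
/-- The generator `f(λ)` of the free algebra. -/
abbrev xl (f : Mer) : FreeAlgebra ℂ Gen := FreeAlgebra.ι ℂ (Gen.l f)
/-- The generator `f(μ)` of the free algebra. -/
abbrev xr (f : Mer) : FreeAlgebra ℂ Gen := FreeAlgebra.ι ℂ (Gen.r f)

/-- The defining relations of the dynamical quantum group algebra. The first seven say that
`f ↦ f(λ)` and `f ↦ f(μ)` are homomorphisms of complex algebras with commuting images. Then follow
the commutation relations with `f(λ)`, `f(μ)`, the quadratic relations, and `c = 1` for the
dynamical determinant `c = αδ - q F(λ) γβ`. -/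
inductive Rel : FreeAlgebra ℂ Gen → FreeAlgebra ℂ Gen → Prop
  | l_add (f g : Mer) : Rel (xl (f + g)) (xl f + xl g)
  | l_mul (f g : Mer) : Rel (xl (f * g)) (xl f * xl g)
  | l_const (z : ℂ) : Rel (xl (algebraMap ℂ Mer z)) (algebraMap ℂ _ z)
  | r_add (f g : Mer) : Rel (xr (f + g)) (xr f + xr g)
  | r_mul (f g : Mer) : Rel (xr (f * g)) (xr f * xr g)
  | r_const (z : ℂ) : Rel (xr (algebraMap ℂ Mer z)) (algebraMap ℂ _ z)
  | lr (f g : Mer) : Rel (xl f * xr g) (xr g * xl f)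
  | la (f : Mer) : Rel (xl f * xα) (xα * xl (shift 1 f))
  | ra (f : Mer) : Rel (xr f * xα) (xα * xr (shift 1 f))
  | lb (f : Mer) : Rel (xl f * xβ) (xβ * xl (shift 1 f))
  | rb (f : Mer) : Rel (xr f * xβ) (xβ * xr (shift (-1) f))
  | lc (f : Mer) : Rel (xl f * xγ) (xγ * xl (shift (-1) f))
  | rc (f : Mer) : Rel (xr f * xγ) (xγ * xr (shift 1 f))
  | ld (f : Mer) : Rel (xl f * xδ) (xδ * xl (shift (-1) f))
  | rd (f : Mer) : Rel (xr f * xδ) (xδ * xr (shift (-1) f))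
  | ab : Rel (xα * xβ) (xr (shift (-1) (((q : ℝ) : ℂ) • fF q)) * (xβ * xα))
  | ac : Rel (xα * xγ) (xl (((q : ℝ) : ℂ) • fF q) * (xγ * xα))
  | bd : Rel (xβ * xδ) (xl (((q : ℝ) : ℂ) • fF q) * (xδ * xβ))
  | cd : Rel (xγ * xδ) (xr (shift (-1) (((q : ℝ) : ℂ) • fF q)) * (xδ * xγ))
  | cross₁ : Rel (xα * xδ - xδ * xα) (elH q xl xr * (xγ * xβ))
  | cross₂ : Rel (xβ * xγ - xr (fG q) * (xγ * xβ)) (elI q xl xr * (xδ * xα))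
  | det : Rel (xα * xδ - xl (((q : ℝ) : ℂ) • fF q) * (xγ * xβ)) 1

/-- The algebra `F_R(SL(2))`. -/
abbrev FSL2 : Type := RingQuot (Rel q)

namespace FSL2

/-- The generators in `F_R(SL(2))`. -/
noncomputable def gen (x : Gen) : FSL2 q := RingQuot.mkAlgHom ℂ (Rel q) (FreeAlgebra.ι ℂ x)

/-- The generator `α`. -/
noncomputable def a : FSL2 q := gen q Gen.a
/-- The generator `β`. -/
noncomputable def b : FSL2 q := gen q Gen.b
/-- The generator `γ`. -/
noncomputable def c : FSL2 q := gen q Gen.c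
/-- The generator `δ`. -/
noncomputable def d : FSL2 q := gen q Gen.d

variable {q}

lemma rel {x y : FreeAlgebra ℂ Gen} (h : Rel q x y) :
    RingQuot.mkAlgHom ℂ (Rel q) x = RingQuot.mkAlgHom ℂ (Rel q) y :=
  RingQuot.mkAlgHom_rel ℂ h

variable (q)

/-- The left moment map `f ↦ f(λ)`. -/
noncomputable def l : Mer →ₐ[ℂ] FSL2 q :=
  AlgHom.ofLinearMap
    { toFun := fun f => gen q (Gen.l f)
      map_add' := fun f g => by simpa [gen] using rel (q := q) (Rel.l_add f g)
      map_smul' := fun z f => by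
        have h1 := rel (q := q) (Rel.l_mul (algebraMap ℂ Mer z) f)
        have h2 := rel (q := q) (Rel.l_const z)
        simp only [map_mul, AlgHom.commutes] at h1 h2
        simp only [gen, Algebra.smul_def, h1, h2, RingHom.id_apply] }
    (by simpa [gen] using rel (q := q) (Rel.l_const 1))
    (fun f g => by simpa [gen] using rel (q := q) (Rel.l_mul f g))

/-- The right moment map `f ↦ f(μ)`. -/
noncomputable def r : Mer →ₐ[ℂ] FSL2 q :=
  AlgHom.ofLinearMap
    { toFun := fun f => gen q (Gen.r f)
      map_add' := fun f g => by simpa [gen] using rel (q := q) (Rel.r_add f g)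
      map_smul' := fun z f => by
        have h1 := rel (q := q) (Rel.r_mul (algebraMap ℂ Mer z) f)
        have h2 := rel (q := q) (Rel.r_const z)
        simp only [map_mul, AlgHom.commutes] at h1 h2
        simp only [gen, Algebra.smul_def, h1, h2, RingHom.id_apply] }
    (by simpa [gen] using rel (q := q) (Rel.r_const 1))
    (fun f g => by simpa [gen] using rel (q := q) (Rel.r_mul f g))

end FSL2

/-- `q F(λ)`. -/
noncomputable def fPhi : Mer := ((q : ℝ) : ℂ) • fF q

/-- `(q + q⁻¹) - q F(λ)`, which equals `q⁻¹ / F(λ - 1)`. -/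
noncomputable def fPsi : Mer :=
  algebraMap ℂ Mer (((q : ℝ) : ℂ) + ((q : ℝ) : ℂ)⁻¹) - fPhi q

lemma qE_two_lin (m : ℂ) :
    qE q (2 * (X + C m)) = algebraMap ℂ Mer (((q : ℝ) : ℂ) ^ (2 * m)) * qE q (2 * X) := by
  rw [show (2 * (X + C m) : ℂ[X]) = C (2 * m) + 2 * X by
    rw [C_mul, C_ofNat]; ring, qE_add, qE_C]

lemma q_sq_ne_one : ((q : ℝ) : ℂ) ^ 2 ≠ 1 := by
  have h : (q : ℝ) ^ 2 < 1 := by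
    have := q.2.1; have := q.2.2
    nlinarith
  exact_mod_cast h.ne

lemma shift_one_qE : shift 1 (qE q (2 * X)) = algebraMap ℂ Mer (((q : ℝ) : ℂ) ^ 2) * qE q (2 * X) := by
  rw [shift_qE, show ((2 * X : ℂ[X]).comp (X + C 1)) = 2 * (X + C 1) by simp, qE_two_lin]
  norm_num

lemma qE_two_ne_zero : qE q (2 * X) ≠ 0 := by
  intro h
  have h1 : qE q (2 * X) * qE q (-(2 * X)) = 1 := by
    rw [← qE_add, add_neg_cancel, ← C_0, qE_C]; simp
  rw [h, zero_mul] at h1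
  exact zero_ne_one h1

lemma const_ne_qE (z : ℂ) : qE q (2 * X) ≠ algebraMap ℂ Mer z := by
  intro h
  have h0 := qE_two_ne_zero q
  have h1 := congrArg (shift 1) h
  rw [shift_one_qE, AlgHom.commutes, ← h] at h1
  have h2 : algebraMap ℂ Mer (((q : ℝ) : ℂ) ^ 2) = algebraMap ℂ Mer 1 := by
    rw [map_one]
    exact mul_right_cancel₀ h0 (by rw [h1, one_mul])
  exact q_sq_ne_one q ((algebraMap ℂ Mer).injective h2)

/-- `q^{2(λ+1)}` in terms of `q^{2λ}`. -/
lemma qE_X : qE q (2 * (X + 1)) = algebraMap ℂ Mer (((q : ℝ) : ℂ)) ^ 2 * qE q (2 * X) := by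
  have := qE_two_lin q 1
  rw [C_1] at this
  rw [this, ← map_pow]
  norm_num

lemma lin_ne (u v : ℂ) (h : u ≠ 0 ∨ v ≠ 0) :
    algebraMap ℂ Mer u * qE q (2 * X) + algebraMap ℂ Mer v ≠ 0 := by
  intro h1
  by_cases hu : u = 0
  · subst hu
    rw [map_zero, zero_mul, zero_add] at h1
    exact (h.resolve_left (by simp)) ((map_eq_zero _).1 h1)
  · apply const_ne_qE q (-v / u)
    have hu' : algebraMap ℂ Mer u ≠ 0 := (_root_.map_ne_zero _).2 hu
    rw [map_div₀, map_neg, eq_div_iff hu']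
    linear_combination h1

lemma qE_X_ne : qE q (2 * (X + 1)) - 1 ≠ 0 := by
  have := lin_ne q (((q : ℝ) : ℂ) ^ 2) (-1) (Or.inl (pow_ne_zero _ (q_ne q)))
  rw [qE_X]
  simpa [sub_eq_add_neg] using this

lemma fPhi_eq : fPhi q = algebraMap ℂ Mer ((q : ℝ) : ℂ) +
    algebraMap ℂ Mer (((q : ℝ) : ℂ) - ((q : ℝ) : ℂ)⁻¹) * (qE q (2 * (X + 1)) - 1)⁻¹ := by
  have h := qE_X_ne q
  have hq : algebraMap ℂ Mer ((q : ℝ) : ℂ) ≠ 0 := (_root_.map_ne_zero _).2 (q_ne q)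
  have h2 : qE q (-2) = (algebraMap ℂ Mer ((q : ℝ) : ℂ) ^ 2)⁻¹ := by
    rw [show (-2 : ℂ[X]) = C (-2) by rw [C_neg, C_ofNat], qE_C, ← map_pow, ← map_inv₀]
    congr 1
    rw [Complex.cpow_neg]
    norm_cast
  rw [fPhi, fF, Algebra.smul_def, h2, map_sub, map_inv₀]
  field_simp
  ring

lemma fG_eq : fG q = fPhi q * fPsi q := by
  have h := qE_X_ne q
  have hq : algebraMap ℂ Mer ((q : ℝ) : ℂ) ≠ 0 := (_root_.map_ne_zero _).2 (q_ne q)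
  have h1 : qE q 2 = (algebraMap ℂ Mer ((q : ℝ) : ℂ) ^ 2) := by
    rw [show (2 : ℂ[X]) = C 2 by rw [C_ofNat], qE_C, ← map_pow]
    congr 1
    norm_cast
  have h2 : qE q (-2) = (algebraMap ℂ Mer ((q : ℝ) : ℂ) ^ 2)⁻¹ := by
    rw [show (-2 : ℂ[X]) = C (-2) by rw [C_neg, C_ofNat], qE_C, ← map_pow, ← map_inv₀]
    congr 1
    rw [Complex.cpow_neg]
    norm_cast
  rw [fPsi, fPhi_eq, fG, h1, h2, map_sub, map_add, map_inv₀]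
  field_simp
  ring

section HI

variable {B : Type*} [Ring B] [Algebra ℂ B] (l r : Mer →ₐ[ℂ] B)

lemma elH_eq (hlr : ∀ f g, l f * r g = r g * l f) : elH q l r = l (fPhi q) - r (fPsi q) := by
  have h : qE q (2 * (X + 1)) * (qE q (2 * (X + 1)) - 1)⁻¹ =
      1 + (qE q (2 * (X + 1)) - 1)⁻¹ := by
    have := qE_X_ne q
    field_simp
    ring
  have hl := congrArg l h
  have hr := congrArg r h
  have h1 := fPhi_eq q
  rw [elH, fPsi, h1]
  set x := qE q (2 * (X + 1))
  set J := (x - 1)⁻¹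
  simp only [map_mul, map_add, map_one, map_sub, AlgHom.commutes] at hl hr ⊢
  have h2 : (l x * r x - 1) * (l J * r J) = 1 + l J + r J := by
    have : l x * r x * (l J * r J) = (l x * l J) * (r x * r J) := by
      rw [mul_assoc, ← mul_assoc (r x), ← hlr J x, mul_assoc (l J), ← mul_assoc (l x)]
    rw [sub_mul, this, hl, hr]
    noncomm_ring
  rw [h2, Algebra.smul_def, map_sub]
  noncomm_ring

lemma elI_eq (hlr : ∀ f g, l f * r g = r g * l f) : elI q l r = l (fPhi q) - r (fPhi q) := by
  have h : qE q (2 * (X + 1)) * (qE q (2 * (X + 1)) - 1)⁻¹ =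
      1 + (qE q (2 * (X + 1)) - 1)⁻¹ := by
    have := qE_X_ne q
    field_simp
    ring
  have hl := congrArg l h
  have hr := congrArg r h
  have h1 := fPhi_eq q
  rw [elI, h1]
  set x := qE q (2 * (X + 1))
  set J := (x - 1)⁻¹
  simp only [map_mul, map_add, map_one, map_sub, AlgHom.commutes] at hl hr ⊢
  have h2 : (r x - l x) * (l J * r J) = l J - r J := by
    have : r x * (l J * r J) = l J * (r x * r J) := by
      rw [← mul_assoc, ← hlr J x, mul_assoc]
    rw [sub_mul, this, ← mul_assoc (l x), hl, hr]
    noncomm_ring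
  rw [h2, Algebra.smul_def, map_sub]
  noncomm_ring

end HI

/-- Data satisfying the relations of `F_R(SL(2))`, in a form that is convenient for checking them:
the last three equations are equivalent to the two cross relations and `c = 1`. -/
structure SLData (B : Type*) [Ring B] [Algebra ℂ B] where
  a : B
  b : B
  c : B
  d : B
  l : Mer →ₐ[ℂ] B
  r : Mer →ₐ[ℂ] B
  lr : ∀ f g, l f * r g = r g * l f
  la : ∀ f, l f * a = a * l (shift 1 f)
  ra : ∀ f, r f * a = a * r (shift 1 f)
  lb : ∀ f, l f * b = b * l (shift 1 f)
  rb : ∀ f, r f * b = b * r (shift (-1) f)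
  lc : ∀ f, l f * c = c * l (shift (-1) f)
  rc : ∀ f, r f * c = c * r (shift 1 f)
  ld : ∀ f, l f * d = d * l (shift (-1) f)
  rd : ∀ f, r f * d = d * r (shift (-1) f)
  ab : a * b = r (shift (-1) (fPhi q)) * (b * a)
  ac : a * c = l (fPhi q) * (c * a)
  bd : b * d = l (fPhi q) * (d * b)
  cd : c * d = r (shift (-1) (fPhi q)) * (d * c)
  ad : a * d = 1 + l (fPhi q) * (c * b)
  da : d * a = 1 + r (fPsi q) * (c * b)
  bc : b * c = l (fPhi q) - r (fPhi q) + l (fPhi q) * (r (fPsi q) * (c * b))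

namespace SLData

variable {q} {B : Type*} [Ring B] [Algebra ℂ B] (D : SLData q B)

/-- The map on generators. -/
noncomputable def genMap : Gen → B
  | Gen.a => D.a
  | Gen.b => D.b
  | Gen.c => D.c
  | Gen.d => D.d
  | Gen.l f => D.l f
  | Gen.r f => D.r f

/-- The algebra homomorphism out of `F_R(SL(2))` given by its values on the generators. -/
noncomputable def lift : FSL2 q →ₐ[ℂ] B :=
  RingQuot.liftAlgHom ℂ ⟨FreeAlgebra.lift ℂ D.genMap, by
    intro x y h
    induction h with
    | l_add f g => simp [genMap]
    | l_mul f g => simp [genMap]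
    | l_const z => simp [genMap]
    | r_add f g => simp [genMap]
    | r_mul f g => simp [genMap]
    | r_const z => simp [genMap]
    | lr f g => simpa [genMap] using D.lr f g
    | la f => simpa [genMap] using D.la f
    | ra f => simpa [genMap] using D.ra f
    | lb f => simpa [genMap] using D.lb f
    | rb f => simpa [genMap] using D.rb f
    | lc f => simpa [genMap] using D.lc f
    | rc f => simpa [genMap] using D.rc f
    | ld f => simpa [genMap] using D.ld f
    | rd f => simpa [genMap] using D.rd f
    | ab => simpa [genMap, fPhi] using D.ab
    | ac => simpa [genMap, fPhi] using D.ac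
    | bd => simpa [genMap, fPhi] using D.bd
    | cd => simpa [genMap, fPhi] using D.cd
    | cross₁ =>
      have h : FreeAlgebra.lift ℂ D.genMap (elH q xl xr) = elH q D.l D.r := by
        simp [elH, genMap]
      rw [map_mul, h, elH_eq q D.l D.r D.lr]
      simp only [map_sub, map_mul, FreeAlgebra.lift_ι_apply, genMap, D.ad, D.da]
      noncomm_ring
    | cross₂ =>
      have h : FreeAlgebra.lift ℂ D.genMap (elI q xl xr) = elI q D.l D.r := by
        simp [elI, genMap]
      rw [map_mul, h, elI_eq q D.l D.r D.lr]
      simp only [map_sub, map_mul, FreeAlgebra.lift_ι_apply, genMap, D.bc, D.da, fG_eq]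
      noncomm_ring
    | det =>
      have h := D.ad
      rw [fPhi] at h
      simp [genMap, h]⟩

@[simp] lemma lift_gen (x : Gen) : D.lift (FSL2.gen q x) = D.genMap x := by
  simp [lift, FSL2.gen]

@[simp] lemma lift_a : D.lift (FSL2.a q) = D.a := D.lift_gen _
@[simp] lemma lift_b : D.lift (FSL2.b q) = D.b := D.lift_gen _
@[simp] lemma lift_c : D.lift (FSL2.c q) = D.c := D.lift_gen _
@[simp] lemma lift_d : D.lift (FSL2.d q) = D.d := D.lift_gen _
@[simp] lemma lift_l (f : Mer) : D.lift (FSL2.l q f) = D.l f := D.lift_gen (Gen.l f)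
@[simp] lemma lift_r (f : Mer) : D.lift (FSL2.r q f) = D.r f := D.lift_gen (Gen.r f)

end SLData

namespace FSL2

variable {q}

lemma gen_rel {x y : FreeAlgebra ℂ Gen} (h : Rel q x y) :
    FreeAlgebra.lift ℂ (gen q) x = FreeAlgebra.lift ℂ (gen q) y := by
  have h1 : FreeAlgebra.lift ℂ (gen q) = RingQuot.mkAlgHom ℂ (Rel q) := by
    ext x
    simp [gen]
  rw [h1]
  exact rel h

variable (q)

/-- The tautological `SLData` on `F_R(SL(2))`. -/
noncomputable def data : SLData q (FSL2 q) :=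
  have hl : ∀ f, gen q (Gen.l f) = l q f := fun _ => rfl
  have hr : ∀ f, gen q (Gen.r f) = r q f := fun _ => rfl
  have ha : gen q Gen.a = a q := rfl
  have hb : gen q Gen.b = b q := rfl
  have hc : gen q Gen.c = c q := rfl
  have hd : gen q Gen.d = d q := rfl
  have lr : ∀ f g, l q f * r q g = r q g * l q f := fun f g => by
    simpa [hl, hr] using gen_rel (Rel.lr (q := q) f g)
  have ad : a q * d q = 1 + l q (fPhi q) * (c q * b q) := by
    have h := gen_rel (Rel.det (q := q))
    simp only [map_sub, map_mul, FreeAlgebra.lift_ι_apply, hl, ha, hb, hc, hd, map_one] at h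
    exact sub_eq_iff_eq_add.1 h
  have da : d q * a q = 1 + r q (fPsi q) * (c q * b q) := by
    have h := gen_rel (Rel.cross₁ (q := q))
    have h1 : FreeAlgebra.lift ℂ (gen q) (elH q xl xr) = elH q (l q) (r q) := by
      simp [elH, hl, hr]
    rw [map_mul, h1, elH_eq q _ _ lr] at h
    simp only [map_sub, map_mul, FreeAlgebra.lift_ι_apply, ha, hb, hc, hd, ad] at h
    rw [← sub_eq_zero] at h ⊢
    rw [← neg_eq_zero, ← h, sub_mul]
    abel
  have bc : b q * c q =
      l q (fPhi q) - r q (fPhi q) + l q (fPhi q) * (r q (fPsi q) * (c q * b q)) := by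
    have h := gen_rel (Rel.cross₂ (q := q))
    have h1 : FreeAlgebra.lift ℂ (gen q) (elI q xl xr) = elI q (l q) (r q) := by
      simp [elI, hl, hr]
    rw [map_mul, h1, elI_eq q _ _ lr] at h
    simp only [map_sub, map_mul, FreeAlgebra.lift_ι_apply, ha, hb, hc, hd, hr, da, fG_eq] at h
    rw [← sub_eq_zero] at h ⊢
    rw [← h]
    simp only [sub_mul, mul_add, mul_one, mul_assoc]
    abel
  { a := a q
    b := b q
    c := c q
    d := d q
    l := l q
    r := r q
    lr := lr
    la := fun f => by simpa [hl, ha] using gen_rel (Rel.la (q := q) f)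
    ra := fun f => by simpa [hr, ha] using gen_rel (Rel.ra (q := q) f)
    lb := fun f => by simpa [hl, hb] using gen_rel (Rel.lb (q := q) f)
    rb := fun f => by simpa [hr, hb] using gen_rel (Rel.rb (q := q) f)
    lc := fun f => by simpa [hl, hc] using gen_rel (Rel.lc (q := q) f)
    rc := fun f => by simpa [hr, hc] using gen_rel (Rel.rc (q := q) f)
    ld := fun f => by simpa [hl, hd] using gen_rel (Rel.ld (q := q) f)
    rd := fun f => by simpa [hr, hd] using gen_rel (Rel.rd (q := q) f)
    ab := by
      have h := gen_rel (Rel.ab (q := q))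
      simp only [map_mul, FreeAlgebra.lift_ι_apply] at h
      exact h
    ac := by
      have h := gen_rel (Rel.ac (q := q))
      simp only [map_mul, FreeAlgebra.lift_ι_apply] at h
      exact h
    bd := by
      have h := gen_rel (Rel.bd (q := q))
      simp only [map_mul, FreeAlgebra.lift_ι_apply] at h
      exact h
    cd := by
      have h := gen_rel (Rel.cd (q := q))
      simp only [map_mul, FreeAlgebra.lift_ι_apply] at h
      exact h
    ad := ad
    da := da
    bc := bc }

end FSL2

/-! ### The `*`-structure -/

/-- The opposite algebra of `A`, with complex scalars acting through complex conjugation. -/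
def ConjOp (A : Type*) : Type _ := Aᵐᵒᵖ

namespace ConjOp

section Ring

variable {A : Type*} [Ring A]

noncomputable instance : Ring (ConjOp A) := inferInstanceAs (Ring Aᵐᵒᵖ)

/-- The identity, as a map `A → ConjOp A`. -/
def op (x : A) : ConjOp A := MulOpposite.op x

/-- The identity, as a map `ConjOp A → A`. -/
def unop (x : ConjOp A) : A := MulOpposite.unop x

lemma op_mul (x y : A) : op x * op y = op (y * x) := rfl
lemma op_add (x y : A) : op x + op y = op (x + y) := rfl
lemma op_sub (x y : A) : op x - op y = op (x - y) := rfl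
lemma op_one : (1 : ConjOp A) = op 1 := rfl

end Ring

variable {A : Type*} [Ring A] [Algebra ℂ A]

noncomputable instance : Algebra ℂ (ConjOp A) := Algebra.compHom Aᵐᵒᵖ (starRingEnd ℂ)

lemma algebraMap_def (z : ℂ) :
    algebraMap ℂ (ConjOp A) z = op (algebraMap ℂ A (starRingEnd ℂ z)) := rfl

/-- The homomorphism `Mer → ConjOp A`, `f ↦ l(f̄)`. -/
noncomputable def barHom (l : Mer →ₐ[ℂ] A) : Mer →ₐ[ℂ] ConjOp A where
  toFun f := op (l (bar f))
  map_one' := by rw [map_one, map_one]; rfl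
  map_mul' f g := by rw [op_mul, ← map_mul, ← map_mul, mul_comm g f]
  map_zero' := by rw [map_zero, map_zero]; rfl
  map_add' f g := by rw [op_add, ← map_add, ← map_add]
  commutes' z := by rw [bar_const, AlgHom.commutes, algebraMap_def]

lemma barHom_apply (l : Mer →ₐ[ℂ] A) (f : Mer) : barHom l f = op (l (bar f)) := rfl

end ConjOp

lemma bar_shift (α : ℂ) (f : Mer) : bar (shift α f) = shift (starRingEnd ℂ α) (bar f) := by
  induction f using Mer.ind with
  | h f hf => simp [shift_mk, bar_mk]

lemma bar_qE : bar (qE q (2 * X)) = qE q (2 * X) := by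
  simp only [qE, bar_mk]
  congr 1
  ext z
  have h : ((q : ℝ) : ℂ).arg ≠ Real.pi := by
    rw [Complex.arg_ofReal_of_nonneg q.2.1.le]
    exact Real.pi_pos.ne
  have h2 := Complex.cpow_conj ((q : ℝ) : ℂ) (2 * starRingEnd ℂ z) h
  simp only [map_mul, Complex.conj_conj, Complex.conj_ofReal, map_ofNat] at h2
  simp [h2]

lemma bar_fPhi : bar (fPhi q) = fPhi q := by
  rw [fPhi_eq, qE_X]
  simp [bar_qE, bar_const]

lemma bar_fPsi : bar (fPsi q) = fPsi q := by
  rw [fPsi, map_sub, bar_fPhi, bar_const]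
  simp

namespace FSL2

open ConjOp

/-- The images of the generators under the `*`-structure. -/
noncomputable def starData : SLData q (ConjOp (FSL2 q)) := by
  have hφ : ∀ l : Mer →ₐ[ℂ] FSL2 q, barHom l (fPhi q) = ConjOp.op (l (fPhi q)) := fun l => by
    rw [barHom_apply, bar_fPhi]
  have hψ : ∀ l : Mer →ₐ[ℂ] FSL2 q, barHom l (fPsi q) = ConjOp.op (l (fPsi q)) := fun l => by
    rw [barHom_apply, bar_fPsi]
  have hφ' : ∀ l : Mer →ₐ[ℂ] FSL2 q, barHom l (shift (-1) (fPhi q)) =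
      ConjOp.op (l (shift (-1) (fPhi q))) := fun l => by
    rw [barHom_apply, bar_shift, bar_fPhi]; simp
  have hq := q_ne q
  have hc : ∀ x y : FSL2 q, (-((q : ℝ) : ℂ) • x) * (-((q : ℝ) : ℂ)⁻¹ • y) = x * y := fun x y => by
    rw [smul_mul_smul_comm]; simp [hq]
  have hc' : ∀ x y : FSL2 q, (-((q : ℝ) : ℂ)⁻¹ • x) * (-((q : ℝ) : ℂ) • y) = x * y := fun x y => by
    rw [smul_mul_smul_comm]; simp [hq]
  have hsl : ∀ (z : ℂ) (x y : FSL2 q), (z • x) * y = z • (x * y) := fun z x y => smul_mul_assoc z x y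
  have hsr : ∀ (z : ℂ) (x y : FSL2 q), x * (z • y) = z • (x * y) := fun z x y => mul_smul_comm z x y
  have s1 : ∀ f, shift 1 (shift (-1) f) = f := fun f => by rw [shift_shift]; simp
  have s2 : ∀ f, shift (-1) (shift 1 f) = f := fun f => by rw [shift_shift]; simp
  have la := (data q).la
  have ra := (data q).ra
  have lb := (data q).lb
  have rb := (data q).rb
  have lc := (data q).lc
  have rc := (data q).rc
  have ld := (data q).ld
  have rd := (data q).rd
  have lr := (data q).lr
  have ab := (data q).ab
  have ac := (data q).ac
  have bd := (data q).bd
  have cd := (data q).cd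
  have ad := (data q).ad
  have da := (data q).da
  have bc := (data q).bc
  simp only [data] at la ra lb rb lc rc ld rd lr ab ac bd cd ad da bc
  have lcb : ∀ f, l q f * (c q * b q) = c q * b q * l q f := fun f => by
    rw [← mul_assoc, lc, mul_assoc, lb, s1, mul_assoc]
  have rcb : ∀ f, r q f * (c q * b q) = c q * b q * r q f := fun f => by
    rw [← mul_assoc, rc, mul_assoc, rb, s2, mul_assoc]
  exact
  { a := ConjOp.op (d q)
    b := ConjOp.op (-((q : ℝ) : ℂ) • c q)
    c := ConjOp.op (-((q : ℝ) : ℂ)⁻¹ • b q)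
    d := ConjOp.op (a q)
    l := barHom (l q)
    r := barHom (r q)
    lr := fun f g => by
      simp only [barHom_apply, op_mul, lr]
    la := fun f => by
      simp only [barHom_apply, op_mul, bar_shift, ld, map_one, s2]
    ra := fun f => by
      simp only [barHom_apply, op_mul, bar_shift, rd, map_one, s2]
    lb := fun f => by
      simp only [barHom_apply, op_mul, bar_shift, hsl, hsr, lc, map_one, s2]
    rb := fun f => by
      simp only [barHom_apply, op_mul, bar_shift, hsl, hsr, rc, map_neg, map_one, s1]
    lc := fun f => by
      simp only [barHom_apply, op_mul, bar_shift, hsl, hsr, lb, map_neg, map_one, s1]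
    rc := fun f => by
      simp only [barHom_apply, op_mul, bar_shift, hsl, hsr, rb, map_one, s2]
    ld := fun f => by
      simp only [barHom_apply, op_mul, bar_shift, la, map_neg, map_one, s1]
    rd := fun f => by
      simp only [barHom_apply, op_mul, bar_shift, ra, map_neg, map_one, s1]
    ab := by
      rw [hφ', op_mul, op_mul, op_mul, hsl, hsr, hsl, cd, ← mul_assoc, rd, mul_assoc, rc, s1,
        mul_assoc]
    ac := by
      rw [hφ, op_mul, op_mul, op_mul, hsl, hsr, hsl, bd, ← mul_assoc, ld, mul_assoc, lb, s1,
        mul_assoc]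
    bd := by
      rw [hφ, op_mul, op_mul, op_mul, hsl, hsr, hsl, ac, ← mul_assoc, lc, mul_assoc, la, s1,
        mul_assoc]
    cd := by
      rw [hφ', op_mul, op_mul, op_mul, hsl, hsr, hsl, ab, ← mul_assoc, rb, mul_assoc, ra, s1,
        mul_assoc]
    ad := by
      rw [hφ, op_mul, op_mul, op_mul, hc, op_one, op_add, ad, lcb]
    da := by
      rw [hψ, op_mul, op_mul, op_mul, hc, op_one, op_add, da, rcb]
    bc := by
      rw [hφ, hφ, hψ, op_mul, op_mul, op_mul, op_mul, hc, hc', op_sub, op_add, bc, rcb,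
        ← mul_assoc, lcb, mul_assoc, lr]
      simp only [mul_assoc] }

/-- The `*`-structure of `F_R(SU(2))`: the antilinear antimultiplicative map with `α* = δ`,
`β* = -qγ`, `γ* = -q⁻¹β`, `δ* = α`, `f(λ)* = f̄(λ)`, `f(μ)* = f̄(μ)`. -/
noncomputable def star (x : FSL2 q) : FSL2 q := ConjOp.unop ((starData q).lift x)

end FSL2

/-! ### The coproduct -/

lemma shift_fPhi_mul_fPsi : shift (-1) (fPhi q) * fPsi q = 1 := by
  have hq := q_ne q
  have hs : shift (-1) (qE q (2 * (X + 1))) = qE q (2 * X) := by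
    rw [shift_qE]
    congr 1
    simp
  have h1 := qE_X_ne q
  have h2 : qE q (2 * X) - 1 ≠ 0 := sub_ne_zero.2 (by simpa using const_ne_qE q 1)
  have hs' : shift (-1) (qE q (2 * (X + 1)) - 1)⁻¹ = (qE q (2 * X) - 1)⁻¹ := by
    rw [map_inv₀, map_sub, hs, map_one]
  rw [fPsi, fPhi_eq, map_add, map_mul, AlgHom.commutes, AlgHom.commutes, hs']
  rw [qE_X] at h1 ⊢
  have hQ : algebraMap ℂ Mer ((q : ℝ) : ℂ) ≠ 0 := (_root_.map_ne_zero _).2 hq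
  rw [map_sub, map_add, map_inv₀]
  field_simp
  ring

namespace FSL2

/-- `F_R(SL(2))`, as a vector space over `Mer` through left multiplication by `f(μ)`. -/
def FRight : Type := FSL2 q

/-- `F_R(SL(2))`, as a vector space over `Mer` through left multiplication by `f(λ)`. -/
def FLeft : Type := FSL2 q

/-- The identity, as a map `FRight q → FSL2 q`. -/
def FRight.out {q} (x : FRight q) : FSL2 q := x

/-- The identity, as a map `FLeft q → FSL2 q`. -/
def FLeft.out {q} (x : FLeft q) : FSL2 q := x

noncomputable instance : AddCommGroup (FRight q) := inferInstanceAs (AddCommGroup (FSL2 q))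
noncomputable instance : AddCommGroup (FLeft q) := inferInstanceAs (AddCommGroup (FSL2 q))
noncomputable instance : Module ℂ (FRight q) := inferInstanceAs (Module ℂ (FSL2 q))
noncomputable instance : Module Mer (FRight q) := Module.compHom (FSL2 q) (r q).toRingHom
noncomputable instance : Module Mer (FLeft q) := Module.compHom (FSL2 q) (l q).toRingHom

instance : SMulCommClass Mer ℂ (FRight q) :=
  ⟨fun f z x => mul_smul_comm z (r q f) (show FSL2 q from x)⟩

/-- The tensor product `A ⊗ A` of `A = F_R(SL(2))` with itself over `Mer`, that is, modulo the
relations `f(μ) x ⊗ y = x ⊗ f(λ) y`. It contains the matrix tensor product, which is the direct sum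
of the tensor products of the bihomogeneous components `A_{κν}` and `A_{νρ}`. -/
abbrev TT : Type := TensorProduct Mer (FRight q) (FLeft q)

variable {q}

/-- The element `x ⊗ y`. -/
noncomputable def tm (x y : FSL2 q) : TT q :=
  TensorProduct.tmul Mer (show FRight q from x) (show FLeft q from y)

lemma tm_add_left (x x' y : FSL2 q) : tm (x + x') y = tm x y + tm x' y :=
  TensorProduct.add_tmul _ _ _

lemma tm_add_right (x y y' : FSL2 q) : tm x (y + y') = tm x y + tm x y' :=
  TensorProduct.tmul_add _ _ _

lemma tm_sub_left (x x' y : FSL2 q) : tm (x - x') y = tm x y - tm x' y :=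
  TensorProduct.sub_tmul _ _ _

lemma tm_sub_right (x y y' : FSL2 q) : tm x (y - y') = tm x y - tm x y' :=
  TensorProduct.tmul_sub _ _ _

lemma tm_smul_left (z : ℂ) (x y : FSL2 q) : tm (z • x) y = z • tm x y := rfl

lemma tm_balance (f : Mer) (x y : FSL2 q) : tm (r q f * x) y = tm x (l q f * y) :=
  TensorProduct.smul_tmul f (show FRight q from x) (show FLeft q from y)

lemma tm_smul_right (z : ℂ) (x y : FSL2 q) : tm x (z • y) = z • tm x y := by
  have h := tm_balance (algebraMap ℂ Mer z) x y
  rw [AlgHom.commutes, AlgHom.commutes, ← Algebra.smul_def, ← Algebra.smul_def] at h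
  rw [← h, tm_smul_left]

lemma end_ext {f g : Module.End ℂ (TT q)} (h : ∀ x y, f (tm x y) = g (tm x y)) : f = g := by
  ext t
  induction t using TensorProduct.induction_on with
  | zero => simp
  | tmul x y => exact h x y
  | add s t hs ht => rw [map_add, map_add, hs, ht]

/-- Left multiplication by `x ⊗ y` on `A ⊗ A`. This makes sense if `x` and `y` belong to components
`A_{κν}` and `A_{νρ}` with the same `ν`, where `σ = T_{-ν}`. -/
noncomputable def mulTensor (x y : FSL2 q) (σ : Mer → Mer)
    (hx : ∀ f, x * r q f = r q (σ f) * x) (hy : ∀ f, y * l q f = l q (σ f) * y) :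
    Module.End ℂ (TT q) :=
  let φ : TT q →+ TT q := TensorProduct.liftAddHom
    (AddMonoidHom.mk' (fun s : FRight q => AddMonoidHom.mk'
        (fun t : FLeft q => tm (x * s.out) (y * t.out))
        (fun t t' => by
          rw [← tm_add_right, ← mul_add]
          rfl))
      (fun s s' => by
        ext t
        change tm (x * (s.out + s'.out)) (y * t.out) =
          tm (x * s.out) (y * t.out) + tm (x * s'.out) (y * t.out)
        rw [← tm_add_left, mul_add]))
    (fun f s t => by
      change tm (x * (r q f * s.out)) (y * t.out) = tm (x * s.out) (y * (l q f * t.out))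
      rw [← mul_assoc, hx, mul_assoc, tm_balance, ← mul_assoc y, hy, mul_assoc])
  { toFun := φ
    map_add' := map_add φ
    map_smul' := fun z t => by
      induction t using TensorProduct.induction_on with
      | zero => simp
      | tmul s t =>
        change tm (x * (z • s.out)) (y * t.out) = z • tm (x * s.out) (y * t.out)
        rw [mul_smul_comm, tm_smul_left]
      | add s t hs ht =>
        rw [smul_add, map_add, map_add, hs, ht, smul_add] }

@[simp] lemma mulTensor_tm (x y : FSL2 q) (σ : Mer → Mer)
    (hx : ∀ f, x * r q f = r q (σ f) * x) (hy : ∀ f, y * l q f = l q (σ f) * y) (s t : FSL2 q) :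
    mulTensor x y σ hx hy (tm s t) = tm (x * s) (y * t) := rfl

variable (q)

/-- `f(λ) ⊗ 1`. -/
noncomputable def lTensor : Mer →ₐ[ℂ] Module.End ℂ (TT q) :=
  AlgHom.ofLinearMap
    { toFun := fun f => mulTensor (l q f) 1 id (fun g => (data q).lr f g) (fun _ => by simp)
      map_add' := fun f g => end_ext fun x y => by
        change tm (l q (f + g) * x) (1 * y) = tm (l q f * x) (1 * y) + tm (l q g * x) (1 * y)
        rw [map_add, add_mul, tm_add_left]
      map_smul' := fun z f => end_ext fun x y => by
        change tm (l q (z • f) * x) (1 * y) = z • tm (l q f * x) (1 * y)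
        rw [_root_.map_smul, smul_mul_assoc, tm_smul_left] }
    (end_ext fun x y => by
      change tm (l q 1 * x) (1 * y) = tm x y
      rw [map_one, one_mul, one_mul])
    (fun f g => end_ext fun x y => by
      change tm (l q (f * g) * x) (1 * y) = tm (l q f * (l q g * x)) (1 * (1 * y))
      simp only [map_mul, one_mul, mul_assoc])

/-- `1 ⊗ f(μ)`. -/
noncomputable def rTensor : Mer →ₐ[ℂ] Module.End ℂ (TT q) :=
  AlgHom.ofLinearMap
    { toFun := fun f => mulTensor 1 (r q f) id (fun _ => by simp) (fun g => ((data q).lr g f).symm)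
      map_add' := fun f g => end_ext fun x y => by
        change tm (1 * x) (r q (f + g) * y) = tm (1 * x) (r q f * y) + tm (1 * x) (r q g * y)
        rw [map_add, add_mul, tm_add_right]
      map_smul' := fun z f => end_ext fun x y => by
        change tm (1 * x) (r q (z • f) * y) = z • tm (1 * x) (r q f * y)
        rw [_root_.map_smul, smul_mul_assoc, tm_smul_right] }
    (end_ext fun x y => by
      change tm (1 * x) (r q 1 * y) = tm x y
      rw [map_one, one_mul, one_mul])
    (fun f g => end_ext fun x y => by
      change tm (1 * x) (r q (f * g) * y) = tm (1 * (1 * x)) (r q f * (r q g * y))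
      simp only [map_mul, one_mul, mul_assoc])

@[simp] lemma lTensor_tm (f : Mer) (x y : FSL2 q) :
    lTensor q f (tm x y) = tm (l q f * x) y := by
  change tm (l q f * x) (1 * y) = _
  rw [one_mul]

@[simp] lemma rTensor_tm (f : Mer) (x y : FSL2 q) :
    rTensor q f (tm x y) = tm x (r q f * y) := by
  change tm (1 * x) (r q f * y) = _
  rw [one_mul]

lemma shift_cancel (f : Mer) : shift 1 (shift (-1) f) = f := by rw [shift_shift]; simp
lemma shift_cancel' (f : Mer) : shift (-1) (shift 1 f) = f := by rw [shift_shift]; simp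

lemma a_l (f : Mer) : a q * l q f = l q (shift (-1) f) * a q := by
  have := (data q).la (shift (-1) f); rw [shift_cancel] at this; exact this.symm
lemma a_r (f : Mer) : a q * r q f = r q (shift (-1) f) * a q := by
  have := (data q).ra (shift (-1) f); rw [shift_cancel] at this; exact this.symm
lemma b_l (f : Mer) : b q * l q f = l q (shift (-1) f) * b q := by
  have := (data q).lb (shift (-1) f); rw [shift_cancel] at this; exact this.symm
lemma b_r (f : Mer) : b q * r q f = r q (shift 1 f) * b q := by
  have := (data q).rb (shift 1 f); rw [shift_cancel'] at this; exact this.symm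
lemma c_l (f : Mer) : c q * l q f = l q (shift 1 f) * c q := by
  have := (data q).lc (shift 1 f); rw [shift_cancel'] at this; exact this.symm
lemma c_r (f : Mer) : c q * r q f = r q (shift (-1) f) * c q := by
  have := (data q).rc (shift (-1) f); rw [shift_cancel] at this; exact this.symm
lemma d_l (f : Mer) : d q * l q f = l q (shift 1 f) * d q := by
  have := (data q).ld (shift 1 f); rw [shift_cancel'] at this; exact this.symm
lemma d_r (f : Mer) : d q * r q f = r q (shift 1 f) * d q := by
  have := (data q).rd (shift 1 f); rw [shift_cancel'] at this; exact this.symm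

lemma r_add_psi : r q (fPhi q) + r q (fPsi q) =
    algebraMap ℂ _ (((q : ℝ) : ℂ) + ((q : ℝ) : ℂ)⁻¹) := by
  rw [← map_add, fPsi, add_sub_cancel, AlgHom.commutes]

lemma l_add_psi : l q (fPhi q) + l q (fPsi q) =
    algebraMap ℂ _ (((q : ℝ) : ℂ) + ((q : ℝ) : ℂ)⁻¹) := by
  rw [← map_add, fPsi, add_sub_cancel, AlgHom.commutes]

lemma rel₁ : r q (fPhi q) * (a q * d q) + b q * c q =
    l q (fPhi q) * (r q (fPhi q) * (c q * b q)) + l q (fPhi q) * (d q * a q) := by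
  have h1 := (data q).ad
  have h2 := (data q).da
  have h3 := (data q).bc
  have h4 := (data q).lr (fPhi q) (fPhi q)
  simp only [data] at h1 h2 h3 h4
  rw [h1, h2, h3, mul_add, mul_add, ← mul_assoc (r q _) (l q _), ← h4, mul_one, mul_one]
  simp only [mul_assoc]
  abel

lemma rel₂ : b q * c q + l q (fPsi q) = r q (fPsi q) * (a q * d q) := by
  have h1 := (data q).ad
  have h3 := (data q).bc
  have h4 := (data q).lr (fPhi q) (fPsi q)
  simp only [data] at h1 h3 h4
  have h5 : l q (fPsi q) = r q (fPhi q) + r q (fPsi q) - l q (fPhi q) := by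
    rw [r_add_psi, ← l_add_psi]; abel
  rw [h1, h3, h5, mul_add, ← mul_assoc (r q _) (l q _), ← h4, mul_one]
  simp only [mul_assoc]
  abel

lemma rel₃ : r q (fPhi q) + b q * c q = l q (fPhi q) * (d q * a q) := by
  have h2 := (data q).da
  have h3 := (data q).bc
  simp only [data] at h2 h3
  rw [h2, h3, mul_add, mul_one]
  abel

lemma rel₄ : l q (shift (-1) (fPhi q)) * (a q * d q) + c q * b q =
    r q (shift (-1) (fPhi q)) *
      (l q (shift (-1) (fPhi q)) * (b q * c q) + d q * a q) := by
  have h := shift_fPhi_mul_fPsi q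
  have h1 : r q (shift (-1) (fPhi q)) * r q (fPsi q) = 1 := by rw [← map_mul, h, map_one]
  have h2 : l q (shift (-1) (fPhi q)) * l q (fPsi q) = 1 := by rw [← map_mul, h, map_one]
  have h4 := (data q).lr (shift (-1) (fPhi q))
  simp only [data] at h4
  have h5 : ∀ x, r q (shift (-1) (fPhi q)) * (r q (fPsi q) * x) = x := fun x => by
    rw [← mul_assoc, h1, one_mul]
  have e1 : r q (shift (-1) (fPhi q)) * (l q (shift (-1) (fPhi q)) * (b q * c q)) =
      l q (shift (-1) (fPhi q)) * (a q * d q) - r q (shift (-1) (fPhi q)) := by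
    rw [eq_sub_iff_add_eq, ← mul_assoc, ← h4, mul_assoc]
    rw [← h5 (a q * d q), ← rel₂, mul_add, mul_add, add_right_inj, ← mul_assoc (l q _), h4,
      mul_assoc, h2, mul_one]
  have h6 := (data q).da
  simp only [data] at h6
  rw [mul_add, e1, h6, mul_add, h5, mul_one]
  abel

lemma mul_ab (x : FSL2 q) : a q * (b q * x) = r q (shift (-1) (fPhi q)) * (b q * (a q * x)) := by
  have h := (data q).ab
  simp only [data] at h
  rw [← mul_assoc, h, mul_assoc, mul_assoc]

lemma mul_cd (x : FSL2 q) : c q * (d q * x) = r q (shift (-1) (fPhi q)) * (d q * (c q * x)) := by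
  have h := (data q).cd
  simp only [data] at h
  rw [← mul_assoc, h, mul_assoc, mul_assoc]

lemma mul_ac (x : FSL2 q) : a q * (c q * x) = l q (fPhi q) * (c q * (a q * x)) := by
  have h := (data q).ac
  simp only [data] at h
  rw [← mul_assoc, h, mul_assoc, mul_assoc]

lemma mul_bd (x : FSL2 q) : b q * (d q * x) = l q (fPhi q) * (d q * (b q * x)) := by
  have h := (data q).bd
  simp only [data] at h
  rw [← mul_assoc, h, mul_assoc, mul_assoc]

lemma mul_ad (x : FSL2 q) : a q * (d q * x) = x + l q (fPhi q) * (c q * (b q * x)) := by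
  have h := (data q).ad
  simp only [data] at h
  rw [← mul_assoc, h, add_mul, one_mul, mul_assoc, mul_assoc]

lemma mul_da (x : FSL2 q) : d q * (a q * x) = x + r q (fPsi q) * (c q * (b q * x)) := by
  have h := (data q).da
  simp only [data] at h
  rw [← mul_assoc, h, add_mul, one_mul, mul_assoc, mul_assoc]

lemma mul_lr (f g : Mer) (x : FSL2 q) : l q f * (r q g * x) = r q g * (l q f * x) := by
  have h := (data q).lr f g
  simp only [data] at h
  rw [← mul_assoc, h, mul_assoc]

lemma mul_bc (x : FSL2 q) : b q * (c q * x) = l q (fPhi q) * x - r q (fPhi q) * x +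
    l q (fPhi q) * (r q (fPsi q) * (c q * (b q * x))) := by
  have h := (data q).bc
  simp only [data] at h
  rw [← mul_assoc, h]
  simp only [add_mul, sub_mul, mul_assoc]

lemma mul_psi (x : FSL2 q) : r q (fPsi q) * (r q (shift (-1) (fPhi q)) * x) = x := by
  rw [← mul_assoc, ← map_mul, mul_comm, shift_fPhi_mul_fPsi, map_one, one_mul]

/-- The operators of left multiplication by `Δ` of the generators:
`Δ(α) = α ⊗ α + β ⊗ γ`, `Δ(β) = α ⊗ β + β ⊗ δ`, `Δ(γ) = γ ⊗ α + δ ⊗ γ`, `Δ(δ) = γ ⊗ β + δ ⊗ δ`,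
`Δ(f(λ)) = f(λ) ⊗ 1`, `Δ(f(μ)) = 1 ⊗ f(μ)`. -/
noncomputable def deltaData : SLData q (Module.End ℂ (TT q)) where
  a := mulTensor (a q) (a q) (shift (-1)) (a_r q) (a_l q) +
    mulTensor (b q) (c q) (shift 1) (b_r q) (c_l q)
  b := mulTensor (a q) (b q) (shift (-1)) (a_r q) (b_l q) +
    mulTensor (b q) (d q) (shift 1) (b_r q) (d_l q)
  c := mulTensor (c q) (a q) (shift (-1)) (c_r q) (a_l q) +
    mulTensor (d q) (c q) (shift 1) (d_r q) (c_l q)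
  d := mulTensor (c q) (b q) (shift (-1)) (c_r q) (b_l q) +
    mulTensor (d q) (d q) (shift 1) (d_r q) (d_l q)
  l := lTensor q
  r := rTensor q
  lr f g := end_ext fun x y => by simp
  la f := end_ext fun x y => by
    have h1 := (data q).la f
    have h2 := (data q).lb f
    simp only [data] at h1 h2
    simp only [Module.End.mul_apply, LinearMap.add_apply, mulTensor_tm, map_add, lTensor_tm,
      ← mul_assoc, h1, h2]
  ra f := end_ext fun x y => by
    have h1 := (data q).ra f
    have h2 := (data q).rc f
    simp only [data] at h1 h2
    simp only [Module.End.mul_apply, LinearMap.add_apply, mulTensor_tm, map_add, rTensor_tm,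
      ← mul_assoc, h1, h2]
  lb f := end_ext fun x y => by
    have h1 := (data q).la f
    have h2 := (data q).lb f
    simp only [data] at h1 h2
    simp only [Module.End.mul_apply, LinearMap.add_apply, mulTensor_tm, map_add, lTensor_tm,
      ← mul_assoc, h1, h2]
  rb f := end_ext fun x y => by
    have h1 := (data q).rb f
    have h2 := (data q).rd f
    simp only [data] at h1 h2
    simp only [Module.End.mul_apply, LinearMap.add_apply, mulTensor_tm, map_add, rTensor_tm,
      ← mul_assoc, h1, h2]
  lc f := end_ext fun x y => by
    have h1 := (data q).lc f
    have h2 := (data q).ld f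
    simp only [data] at h1 h2
    simp only [Module.End.mul_apply, LinearMap.add_apply, mulTensor_tm, map_add, lTensor_tm,
      ← mul_assoc, h1, h2]
  rc f := end_ext fun x y => by
    have h1 := (data q).ra f
    have h2 := (data q).rc f
    simp only [data] at h1 h2
    simp only [Module.End.mul_apply, LinearMap.add_apply, mulTensor_tm, map_add, rTensor_tm,
      ← mul_assoc, h1, h2]
  ld f := end_ext fun x y => by
    have h1 := (data q).lc f
    have h2 := (data q).ld f
    simp only [data] at h1 h2
    simp only [Module.End.mul_apply, LinearMap.add_apply, mulTensor_tm, map_add, lTensor_tm,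
      ← mul_assoc, h1, h2]
  rd f := end_ext fun x y => by
    have h1 := (data q).rb f
    have h2 := (data q).rd f
    simp only [data] at h1 h2
    simp only [Module.End.mul_apply, LinearMap.add_apply, mulTensor_tm, map_add, rTensor_tm,
      ← mul_assoc, h1, h2]
  ab := end_ext fun x y => by
    have e := congrArg (· * y) (rel₄ q)
    simp only [add_mul, mul_assoc, mul_add] at e
    have e' := congrArg (tm (b q * (a q * x))) e
    simp only [tm_add_right] at e'
    simp only [Module.End.mul_apply, LinearMap.add_apply, mulTensor_tm, map_add, rTensor_tm]
    rw [mul_ab q x, mul_ab q y, mul_cd q y, tm_balance, tm_balance, mul_lr]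
    linear_combination (norm := abel) e'
  ac := end_ext fun x y => by
    have e := congrArg (· * x) (rel₁ q)
    simp only [add_mul, mul_assoc, mul_add] at e
    have e' := congrArg (fun z => tm z (c q * (a q * y))) e
    simp only [tm_add_left] at e'
    simp only [Module.End.mul_apply, LinearMap.add_apply, mulTensor_tm, map_add, lTensor_tm]
    rw [mul_ac q x, mul_ac q y, mul_bd q x, ← tm_balance, ← tm_balance]
    simp only [mul_lr] at e' ⊢
    linear_combination (norm := abel) e'
  bd := end_ext fun x y => by
    have e := congrArg (· * x) (rel₁ q)
    simp only [add_mul, mul_assoc, mul_add] at e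
    have e' := congrArg (fun z => tm z (d q * (b q * y))) e
    simp only [tm_add_left] at e'
    simp only [Module.End.mul_apply, LinearMap.add_apply, mulTensor_tm, map_add, lTensor_tm]
    rw [mul_ac q x, mul_bd q y, mul_bd q x, ← tm_balance, ← tm_balance]
    simp only [mul_lr] at e' ⊢
    linear_combination (norm := abel) e'
  cd := end_ext fun x y => by
    have e := congrArg (· * y) (rel₄ q)
    simp only [add_mul, mul_assoc, mul_add] at e
    have e' := congrArg (tm (d q * (c q * x))) e
    simp only [tm_add_right] at e'
    simp only [Module.End.mul_apply, LinearMap.add_apply, mulTensor_tm, map_add, rTensor_tm]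
    rw [mul_cd q x, mul_ab q y, mul_cd q y, tm_balance, tm_balance, mul_lr]
    linear_combination (norm := abel) e'
  ad := end_ext fun x y => by
    have e := congrArg (· * x) (rel₁ q)
    simp only [add_mul, mul_assoc, mul_add] at e
    have e' := congrArg (fun z => tm z (c q * (b q * y))) e
    simp only [tm_add_left] at e'
    have e₂ := congrArg (fun z => tm z y) (mul_ad q x)
    simp only [tm_add_left] at e₂
    simp only [Module.End.mul_apply, LinearMap.add_apply, mulTensor_tm, map_add, lTensor_tm,
      Module.End.one_apply]
    rw [mul_ac q x, mul_bd q x, mul_ad q y]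
    simp only [tm_add_right, ← tm_balance]
    simp only [mul_lr] at e' ⊢
    linear_combination (norm := abel) e' + e₂
  da := end_ext fun x y => by
    have e := congrArg (· * y) (rel₂ q)
    simp only [add_mul, mul_assoc] at e
    have e' := congrArg (tm (c q * (b q * x))) e
    simp only [tm_add_right] at e'
    have e₂ := congrArg (fun z => tm z y) (mul_da q x)
    simp only [tm_add_left, tm_balance] at e₂
    simp only [Module.End.mul_apply, LinearMap.add_apply, mulTensor_tm, map_add, rTensor_tm,
      Module.End.one_apply]
    rw [mul_ab q y, mul_cd q y, mul_psi, mul_psi, mul_da q y]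
    simp only [tm_add_right]
    linear_combination (norm := abel) e' + e₂
  bc := end_ext fun x y => by
    have e := congrArg (· * y) (rel₂ q)
    simp only [add_mul, mul_assoc] at e
    have e₁ := congrArg (tm (l q (fPhi q) * (c q * (b q * x)))) e
    simp only [tm_add_right] at e₁
    have f := congrArg (· * x) (rel₃ q)
    simp only [add_mul, mul_assoc] at f
    have e₂ := congrArg (fun z => tm z (r q (fPsi q) * (c q * (b q * y)))) f
    simp only [tm_add_left] at e₂
    have e₃ := congrArg (fun z => tm z y) (mul_bc q x)
    simp only [tm_add_left, tm_sub_left, mul_lr, tm_balance] at e₃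
    have e₄ := congrArg (tm x) (mul_bc q y)
    simp only [tm_add_right, tm_sub_right, ← tm_balance] at e₄
    have e₅ := congrArg (fun z => tm z (b q * (c q * y))) (mul_ad q x)
    simp only [tm_add_left] at e₅
    have e₆ := congrArg (tm (b q * (c q * x))) (mul_da q y)
    simp only [tm_add_right] at e₆
    simp only [Module.End.mul_apply, LinearMap.add_apply, LinearMap.sub_apply, mulTensor_tm,
      map_add, rTensor_tm, lTensor_tm]
    rw [mul_ac q x, mul_bd q x, mul_ab q y, mul_cd q y, mul_psi, mul_psi]
    rw [tm_balance] at e₂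
    have e₇ := tm_balance (fPhi q) x y
    have e₈ := tm_balance (fPhi q) x (r q (fPsi q) * (c q * (b q * y)))
    linear_combination (norm := abel) e₁ + e₂ + e₃ + e₄ + e₅ + e₆ + e₇ + e₈

/-- The coproduct `Δ`, as a map into `A ⊗ A`: one lets the element `Δ(x)` of the matrix tensor
product, acting by left multiplication, act on `1 ⊗ 1`. -/
noncomputable def coproduct (x : FSL2 q) : TT q := (deltaData q).lift x (tm 1 1)

end FSL2

section RepAlgebra

variable {F : Type*} [Field F] (Q Y K z D₀ D₂ D₄ E₀ E₂ E₄ : F)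

lemma alg_ab (hQ : Q ≠ 0) (h1 : E₀ ≠ 0) (h2 : E₂ ≠ 0) (h3 : D₀ ≠ 0) (h4 : D₂ ≠ 0)
    (e1 : E₀ = z - 1) (e2 : E₂ = Q ^ 2 * z - 1) (e3 : D₀ = z - Y * K ^ 4)
    (e4 : D₂ = Q ^ 2 * z - Y * K ^ 4) :
    K * (Q ^ 2 * z - Y * K ^ 2) / (Q ^ 2 * z - Y * K ^ 4) *
      ((1 - (K * Q) ^ 2) * (Q ^ 2 - Y * (K * Q) ^ 2) * Q ^ 2 * z /
        ((1 - z) * (Q ^ 4 * z - Y * (K * Q) ^ 4))) =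
    (Q ^ 2 * z - 1) / (Q * (z - 1)) *
      ((1 - (K * Q) ^ 2) * (Q ^ 2 - Y * (K * Q) ^ 2) * Q ^ 4 * z /
        ((1 - Q ^ 2 * z) * (Q ^ 6 * z - Y * (K * Q) ^ 4)) * (K * Q * (Q ^ 4 * z - Y * (K * Q) ^ 2) /
      (Q ^ 4 * z - Y * (K * Q) ^ 4))) := by
  rw [show Q ^ 4 * z - Y * (K * Q) ^ 4 = Q ^ 4 * D₀ by rw [e3]; ring,
    show Q ^ 6 * z - Y * (K * Q) ^ 4 = Q ^ 4 * D₂ by rw [e4]; ring,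
    show 1 - z = -E₀ by rw [e1]; ring, show 1 - Q ^ 2 * z = -E₂ by rw [e2]; ring,
    ← e1, ← e2, ← e4]
  field_simp

lemma alg_ac (hQ : Q ≠ 0) (h3 : D₀ ≠ 0) (h4 : D₂ ≠ 0) (e3 : D₀ = z - Y * K ^ 4)
    (e4 : D₂ = Q ^ 2 * z - Y * (K * Q) ^ 4) :
    K * Q * (Q ^ 2 * z - Y * (K * Q) ^ 2) / (Q ^ 2 * z - Y * (K * Q) ^ 4) * -Q⁻¹ =
    (Q ^ 4 * z - Y * (K * Q) ^ 4) / (Q * (Q ^ 2 * z - Y * (K * Q) ^ 4)) *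
      (-Q⁻¹ * (K * (z - Y * K ^ 2) / (z - Y * K ^ 4))) := by
  rw [show Q ^ 4 * z - Y * (K * Q) ^ 4 = Q ^ 4 * D₀ by rw [e3]; ring, ← e3, ← e4]
  field_simp

lemma alg_bd (hQ : Q ≠ 0) (h1 : E₂ ≠ 0) (h2 : E₄ ≠ 0) (h3 : D₂ ≠ 0) (h4 : D₄ ≠ 0)
    (e1 : E₂ = Q ^ 2 * z - 1) (e2 : E₄ = Q ^ 4 * z - 1) (e3 : D₂ = Q ^ 2 * z - Y * K ^ 4)
    (e4 : D₄ = Q ^ 4 * z - Y * K ^ 4) (hK : K ≠ 0) :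
    (1 - (K * Q) ^ 2) * (Q ^ 2 - Y * (K * Q) ^ 2) * Q ^ 4 * z /
      ((1 - Q ^ 2 * z) * (Q ^ 6 * z - Y * (K * Q) ^ 4)) *
        (((K * Q) ^ 2 - Q ^ 4 * z) / (K * Q * (1 - Q ^ 4 * z))) =
    (Q ^ 4 * z - Y * K ^ 4) / (Q * (Q ^ 2 * z - Y * K ^ 4)) *
      ((K ^ 2 - Q ^ 2 * z) / (K * (1 - Q ^ 2 * z)) *
        ((1 - (K * Q) ^ 2) * (Q ^ 2 - Y * (K * Q) ^ 2) * Q ^ 6 * z /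
          ((1 - Q ^ 4 * z) * (Q ^ 8 * z - Y * (K * Q) ^ 4)))) := by
  rw [show Q ^ 6 * z - Y * (K * Q) ^ 4 = Q ^ 4 * D₂ by rw [e3]; ring,
    show Q ^ 8 * z - Y * (K * Q) ^ 4 = Q ^ 4 * D₄ by rw [e4]; ring,
    show 1 - Q ^ 4 * z = -E₄ by rw [e2]; ring, show 1 - Q ^ 2 * z = -E₂ by rw [e1]; ring,
    ← e3, ← e4]
  field_simp

lemma alg_cd (hQ : Q ≠ 0) (hK : K ≠ 0) (h1 : E₀ ≠ 0) (h2 : E₂ ≠ 0) (e1 : E₀ = z - 1)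
    (e2 : E₂ = Q ^ 2 * z - 1) :
    -Q⁻¹ * ((K ^ 2 - z) / (K * (1 - z))) = (Q ^ 2 * z - 1) / (Q * (z - 1)) *
      (((K * Q) ^ 2 - Q ^ 2 * z) / (K * Q * (1 - Q ^ 2 * z)) * -Q⁻¹) := by
  rw [show 1 - z = -E₀ by rw [e1]; ring, show 1 - Q ^ 2 * z = -E₂ by rw [e2]; ring, ← e1, ← e2]
  field_simp

lemma alg_ad (hQ : Q ≠ 0) (hK : K ≠ 0) (h1 : E₀ ≠ 0) (h3 : D₄ ≠ 0) (h4 : D₂ ≠ 0)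
    (e1 : E₀ = z - 1) (e3 : D₄ = Q ^ 4 * z - Y * K ^ 4) (e4 : D₂ = Q ^ 2 * z - Y * K ^ 4) :
    K * (Q ^ 2 * z - Y * K ^ 2) / (Q ^ 2 * z - Y * K ^ 4) * ((K ^ 2 - z) / (K * (1 - z))) =
    1 + (Q ^ 4 * z - Y * K ^ 4) / (Q * (Q ^ 2 * z - Y * K ^ 4)) *
      (-Q⁻¹ * ((1 - K ^ 2) * (Q ^ 2 - Y * K ^ 2) * Q ^ 2 * z /
        ((1 - z) * (Q ^ 4 * z - Y * K ^ 4)))) := by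
  rw [show 1 - z = -E₀ by rw [e1]; ring, ← e3, ← e4]
  field_simp
  rw [e1, e4]
  ring

lemma alg_da (hK : K ≠ 0) (h1 : E₀ ≠ 0) (h2 : E₂ ≠ 0) (h3 : D₄ ≠ 0)
    (e1 : E₀ = z - 1) (e2 : E₂ = Q ^ 2 * z - 1) (e3 : D₄ = Q ^ 4 * z - Y * K ^ 4) :
    (K ^ 2 - Q ^ 2 * z) / (K * (1 - Q ^ 2 * z)) * (K * (Q ^ 4 * z - Y * K ^ 2) /
      (Q ^ 4 * z - Y * K ^ 4)) =
    1 + Q * (z - 1) / (Q ^ 2 * z - 1) *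
      (-Q⁻¹ * ((1 - K ^ 2) * (Q ^ 2 - Y * K ^ 2) * Q ^ 2 * z /
        ((1 - z) * (Q ^ 4 * z - Y * K ^ 4)))) := by
  rw [show 1 - z = -E₀ by rw [e1]; ring, show 1 - Q ^ 2 * z = -E₂ by rw [e2]; ring, ← e1, ← e2,
    ← e3]
  field_simp
  rw [e2, e3]
  ring

lemma alg_bc (hQ : Q ≠ 0) (h1 : E₀ ≠ 0) (h2 : E₂ ≠ 0) (h3 : D₄ ≠ 0) (h4 : D₂ ≠ 0)
    (e1 : E₀ = z - 1) (e2 : E₂ = Q ^ 2 * z - 1) (e3 : D₄ = Q ^ 4 * z - Y * K ^ 4)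
    (e4 : D₂ = Q ^ 2 * z - Y * K ^ 4) :
    (1 - (K * Q) ^ 2) * (Q ^ 2 - Y * (K * Q) ^ 2) * Q ^ 4 * z /
      ((1 - Q ^ 2 * z) * (Q ^ 6 * z - Y * (K * Q) ^ 4)) * -Q⁻¹ =
    (Q ^ 4 * z - Y * K ^ 4) / (Q * (Q ^ 2 * z - Y * K ^ 4)) -
      (Q ^ 4 * z - 1) / (Q * (Q ^ 2 * z - 1)) +
      (Q ^ 4 * z - Y * K ^ 4) / (Q * (Q ^ 2 * z - Y * K ^ 4)) * (Q * (z - 1) / (Q ^ 2 * z - 1) *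
        (-Q⁻¹ * ((1 - K ^ 2) * (Q ^ 2 - Y * K ^ 2) * Q ^ 2 * z /
          ((1 - z) * (Q ^ 4 * z - Y * K ^ 4))))) := by
  rw [show Q ^ 6 * z - Y * (K * Q) ^ 4 = Q ^ 4 * D₂ by rw [e4]; ring,
    show 1 - z = -E₀ by rw [e1]; ring, show 1 - Q ^ 2 * z = -E₂ by rw [e2]; ring, ← e1, ← e2,
    ← e3, ← e4]
  field_simp
  rw [e2, e3, e4]
  ring

end RepAlgebra

/-! ### The dynamical representations -/

/-- The space `H^ω`, which is the direct sum of `Mer e_k` for `k ≥ 0`. -/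
abbrev HSpace : Type := ℕ →₀ Mer

/-- The basis vector `e_n`, where `e_n = 0` for `n < 0`. -/
noncomputable def basisVec : ℤ → HSpace
  | Int.ofNat n => Finsupp.single n 1
  | Int.negSucc _ => 0

/-- The operator `g e_k ↦ c_k (T_s g) e_{n(k)}`. -/
noncomputable def opS (s : ℂ) (c : ℕ → Mer) (n : ℕ → ℕ) : Module.End ℂ HSpace :=
  Finsupp.lsum ℂ fun k =>
    (Finsupp.lsingle (n k) : Mer →ₗ[ℂ] HSpace) ∘ₗ LinearMap.mulLeft ℂ (c k) ∘ₗ (shift s).toLinearMap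

@[simp] lemma opS_single (s : ℂ) (c : ℕ → Mer) (n : ℕ → ℕ) (k : ℕ) (g : Mer) :
    opS s c n (Finsupp.single k g) = Finsupp.single (n k) (c k * shift s g) := by
  simp [opS]

/-- The operators `g e_k ↦ (T_{s(k)} f) g e_k`. -/
noncomputable def opMul (s : ℕ → ℂ) : Mer →ₐ[ℂ] Module.End ℂ HSpace :=
  AlgHom.ofLinearMap
    { toFun := fun f => opS 0 (fun k => shift (s k) f) id
      map_add' := fun f g => Finsupp.lhom_ext fun k x => by simp [add_mul]
      map_smul' := fun z f => Finsupp.lhom_ext fun k x => by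
        rw [LinearMap.smul_apply, opS_single, opS_single, RingHom.id_apply, _root_.map_smul,
          smul_mul_assoc, Finsupp.smul_single] }
    (Finsupp.lhom_ext fun k x => by simp)
    (fun f g => Finsupp.lhom_ext fun k x => by
      rw [Module.End.mul_apply]
      simp only [LinearMap.coe_mk, AddHom.coe_mk, opS_single]
      simp [mul_assoc])

@[simp] lemma opMul_single (s : ℕ → ℂ) (f : Mer) (k : ℕ) (g : Mer) :
    opMul s f (Finsupp.single k g) = Finsupp.single k (shift (s k) f * g) := by
  simp [opMul]

/-- `A_k(λ) = q^{-k} (1 - q^{2(λ-ω-k+1)}) / (1 - q^{2(λ-ω-2k+1)})`. -/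
noncomputable def coefA (ω : ℂ) (k : ℕ) : Mer :=
  qE q (-(k : ℂ[X])) * (1 - qE q (2 * (X - C ω - (k : ℂ[X]) + 1))) / (1 - qE q (2 * (X - C ω - 2 * (k : ℂ[X]) + 1)))

/-- `B_k(λ) = (1 - q^{2k}) (1 - q^{2(ω+k-1)}) / ((1 - q^{2(λ+1)}) (1 - q^{2(ω+2k-λ-3)}))`. -/
noncomputable def coefB (ω : ℂ) (k : ℕ) : Mer :=
  (1 - qE q (2 * (k : ℂ[X]))) * (1 - qE q (2 * (C ω + (k : ℂ[X]) - 1))) /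
    ((1 - qE q (2 * (X + 1))) * (1 - qE q (2 * (C ω + 2 * (k : ℂ[X]) - X - 3))))

/-- `D_k(λ) = q^k (1 - q^{2(λ+1-k)}) / (1 - q^{2(λ+1)})`. -/
noncomputable def coefD (k : ℕ) : Mer :=
  qE q (k : ℂ[X]) * (1 - qE q (2 * (X + 1 - (k : ℂ[X])))) / (1 - qE q (2 * (X + 1)))

/-- The constant function `q`. -/
noncomputable def cQ : Mer := algebraMap ℂ Mer ((q : ℝ) : ℂ)

/-- The constant function `q^{2ω}`. -/
noncomputable def cY (ω : ℂ) : Mer := algebraMap ℂ Mer (((q : ℝ) : ℂ) ^ (2 * ω))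

lemma cQ_ne : cQ q ≠ 0 := (_root_.map_ne_zero _).2 (q_ne q)

lemma cY_ne (ω : ℂ) : cY q ω ≠ 0 :=
  (_root_.map_ne_zero _).2 (by simp [Complex.cpow_eq_zero_iff, q_ne q])

lemma qE_intCast (n : ℤ) : qE q n = cQ q ^ n := by
  rw [← map_intCast (C : ℂ →+* ℂ[X]) n, qE_C, cQ, ← map_zpow₀, Complex.cpow_intCast]

lemma qE_natCast (n : ℕ) : qE q n = cQ q ^ n := by
  have := qE_intCast q n
  simpa using this

lemma qE_two_C (ω : ℂ) : qE q (2 * C ω) = cY q ω := by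
  rw [cY, ← qE_C, C_mul, C_ofNat]

lemma qE_neg (p : ℂ[X]) : qE q (-p) = (qE q p)⁻¹ := by
  have h : qE q p * qE q (-p) = 1 := by
    rw [← qE_add, add_neg_cancel, ← C_0, qE_C]; simp
  exact eq_inv_of_mul_eq_one_right h

lemma qE_nat_mul (n : ℕ) (p : ℂ[X]) : qE q (n * p) = qE q p ^ n := by
  induction n with
  | zero => simpa using qE_C q 0
  | succ n ih => rw [Nat.cast_succ, add_mul, one_mul, qE_add, ih, pow_succ]

lemma shift_z (n : ℤ) : shift n (qE q (2 * X)) = cQ q ^ (2 * n) * qE q (2 * X) := by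
  rw [shift_qE, show ((2 * X : ℂ[X]).comp (X + C (n : ℂ))) = ((2 * n : ℤ) : ℂ[X]) + 2 * X by
    simp; ring, qE_add, qE_intCast]

lemma shift_neg_one_z : shift (-1) (qE q (2 * X)) = (cQ q ^ 2)⁻¹ * qE q (2 * X) := by
  have := shift_z q (-1)
  push_cast at this
  rw [this]
  norm_cast

lemma shift_one_z : shift 1 (qE q (2 * X)) = cQ q ^ 2 * qE q (2 * X) := by
  have := shift_z q 1
  push_cast at this
  rw [this]
  norm_cast

lemma shift_om_z (ω : ℂ) (k : ℕ) : shift (-ω - 2 * k) (qE q (2 * X)) =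
    (cY q ω)⁻¹ * ((cQ q ^ k) ^ 4)⁻¹ * qE q (2 * X) := by
  rw [shift_qE, show ((2 * X : ℂ[X]).comp (X + C (-ω - 2 * (k : ℂ)))) =
    -(2 * C ω) + (-((4 * k : ℕ) : ℂ[X]) + 2 * X) by
      simp only [mul_comp, ofNat_comp, X_comp, C_sub, C_neg, C_mul, C_ofNat, map_natCast]
      push_cast
      ring, qE_add, qE_add, qE_neg, qE_neg,
    qE_two_C, qE_natCast, pow_mul', mul_assoc]

/-- Linear polynomials in `q^{2λ}` do not vanish. -/
lemma lin_ne' (m n : ℕ) (ω : ℂ) : cQ q ^ m * qE q (2 * X) - cY q ω * cQ q ^ n ≠ 0 := by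
  have := lin_ne q (((q : ℝ) : ℂ) ^ m) (-(((q : ℝ) : ℂ) ^ (2 * ω) * ((q : ℝ) : ℂ) ^ n))
    (Or.inl (pow_ne_zero _ (q_ne q)))
  simpa [cQ, cY, sub_eq_add_neg] using this

lemma lin_ne₁ (m n : ℕ) : cQ q ^ m * qE q (2 * X) - cQ q ^ n ≠ 0 := by
  have := lin_ne' q m n 0
  simpa [cY] using this

lemma coefA_eq (ω : ℂ) (k : ℕ) : coefA q ω k =
    cQ q ^ k * (cQ q ^ 2 * qE q (2 * X) - cY q ω * (cQ q ^ k) ^ 2) /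
      (cQ q ^ 2 * qE q (2 * X) - cY q ω * (cQ q ^ k) ^ 4) := by
  have hQ := cQ_ne q
  have hY := cY_ne q ω
  have h1 : qE q (2 * (X - C ω - (k : ℂ[X]) + 1)) =
      cQ q ^ 2 * qE q (2 * X) / (cY q ω * (cQ q ^ k) ^ 2) := by
    rw [show (2 * (X - C ω - (k : ℂ[X]) + 1)) =
      ((2 : ℕ) : ℂ[X]) + (2 * X + (-(2 * C ω) + -((2 * k : ℕ) : ℂ[X]))) by push_cast; ring,
      qE_add, qE_add, qE_add, qE_neg, qE_neg, qE_two_C, qE_natCast, qE_natCast, pow_mul']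
    field_simp
  have h2 : qE q (2 * (X - C ω - 2 * (k : ℂ[X]) + 1)) =
      cQ q ^ 2 * qE q (2 * X) / (cY q ω * (cQ q ^ k) ^ 4) := by
    rw [show (2 * (X - C ω - 2 * (k : ℂ[X]) + 1)) =
      ((2 : ℕ) : ℂ[X]) + (2 * X + (-(2 * C ω) + -((4 * k : ℕ) : ℂ[X]))) by push_cast; ring,
      qE_add, qE_add, qE_add, qE_neg, qE_neg, qE_two_C, qE_natCast, qE_natCast, pow_mul']
    field_simp
  have h3 := lin_ne' q 2 (k * 4) ω
  rw [pow_mul] at h3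
  have h4 : 1 - cQ q ^ 2 * qE q (2 * X) / (cY q ω * (cQ q ^ k) ^ 4) ≠ 0 := by
    intro h
    apply h3
    have hK := pow_ne_zero k hQ
    field_simp at h
    linear_combination -h
  rw [coefA, h1, h2, qE_neg, qE_natCast]
  have hK := pow_ne_zero k hQ
  rw [div_eq_div_iff h4 h3]
  field_simp
  ring

lemma coefB_eq (ω : ℂ) (k : ℕ) : coefB q ω k =
    (1 - (cQ q ^ k) ^ 2) * (cQ q ^ 2 - cY q ω * (cQ q ^ k) ^ 2) * cQ q ^ 4 * qE q (2 * X) /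
      ((1 - cQ q ^ 2 * qE q (2 * X)) * (cQ q ^ 6 * qE q (2 * X) - cY q ω * (cQ q ^ k) ^ 4)) := by
  have hQ := cQ_ne q
  have hY := cY_ne q ω
  have hz := qE_two_ne_zero q
  have h0 : qE q (2 * (k : ℂ[X])) = (cQ q ^ k) ^ 2 := by
    rw [show (2 * (k : ℂ[X])) = ((2 * k : ℕ) : ℂ[X]) by push_cast; ring, qE_natCast, pow_mul']
  have h1 : qE q (2 * (C ω + (k : ℂ[X]) - 1)) = cY q ω * (cQ q ^ k) ^ 2 / cQ q ^ 2 := by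
    rw [show (2 * (C ω + (k : ℂ[X]) - 1)) =
      2 * C ω + (((2 * k : ℕ) : ℂ[X]) + -((2 : ℕ) : ℂ[X])) by push_cast; ring,
      qE_add, qE_add, qE_neg, qE_two_C, qE_natCast, qE_natCast, pow_mul']
    field_simp
  have h2 : qE q (2 * (C ω + 2 * (k : ℂ[X]) - X - 3)) =
      cY q ω * (cQ q ^ k) ^ 4 / (cQ q ^ 6 * qE q (2 * X)) := by
    rw [show (2 * (C ω + 2 * (k : ℂ[X]) - X - 3)) =
      2 * C ω + (((4 * k : ℕ) : ℂ[X]) + (-(2 * X) + -((6 : ℕ) : ℂ[X]))) by push_cast; ring,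
      qE_add, qE_add, qE_add, qE_neg, qE_neg, qE_two_C, qE_natCast, qE_natCast, pow_mul']
    field_simp
  have h3 := lin_ne' q 6 (k * 4) ω
  rw [pow_mul] at h3
  have h5 : 1 - cQ q ^ 2 * qE q (2 * X) ≠ 0 := by
    have := lin_ne₁ q 2 0
    rw [← neg_ne_zero]
    simpa using this
  have h4 : 1 - cY q ω * (cQ q ^ k) ^ 4 / (cQ q ^ 6 * qE q (2 * X)) ≠ 0 := by
    intro h
    apply h3
    field_simp at h
    linear_combination h
  rw [coefB, h0, h1, h2, qE_X]
  change _ / ((1 - cQ q ^ 2 * _) * _) = _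
  rw [div_eq_div_iff (mul_ne_zero h5 h4) (mul_ne_zero h5 h3)]
  field_simp

lemma coefD_eq (k : ℕ) : coefD q k =
    ((cQ q ^ k) ^ 2 - cQ q ^ 2 * qE q (2 * X)) / (cQ q ^ k * (1 - cQ q ^ 2 * qE q (2 * X))) := by
  have hQ := cQ_ne q
  have h2 : qE q (2 * (X + 1 - (k : ℂ[X]))) = cQ q ^ 2 * qE q (2 * X) / (cQ q ^ k) ^ 2 := by
    rw [show (2 * (X + 1 - (k : ℂ[X]))) =
      ((2 : ℕ) : ℂ[X]) + (2 * X + -((2 * k : ℕ) : ℂ[X])) by push_cast; ring,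
      qE_add, qE_add, qE_neg, qE_natCast, qE_natCast, pow_mul']
    field_simp
  have h5 : 1 - cQ q ^ 2 * qE q (2 * X) ≠ 0 := by
    have := lin_ne₁ q 2 0
    rw [← neg_ne_zero]
    simpa using this
  rw [coefD, h2, qE_X, qE_natCast]
  change _ / (1 - cQ q ^ 2 * _) = _
  have hK := pow_ne_zero k hQ
  field_simp

lemma fPhi_eq' : fPhi q = (cQ q ^ 4 * qE q (2 * X) - 1) / (cQ q * (cQ q ^ 2 * qE q (2 * X) - 1)) := by
  have hQ := cQ_ne q
  have h5 := lin_ne₁ q 2 0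
  rw [pow_zero] at h5
  rw [fPhi_eq, qE_X, map_sub, map_inv₀]
  change cQ q + (cQ q - (cQ q)⁻¹) * (cQ q ^ 2 * _ - 1)⁻¹ = _
  field_simp
  ring

lemma fPsi_eq' : fPsi q = cQ q * (qE q (2 * X) - 1) / (cQ q ^ 2 * qE q (2 * X) - 1) := by
  have hQ := cQ_ne q
  have h5 := lin_ne₁ q 2 0
  rw [pow_zero] at h5
  rw [fPsi, fPhi_eq', map_add, map_inv₀]
  change cQ q + (cQ q)⁻¹ - _ = _
  field_simp
  ring

lemma lin_ne₂ (m n k : ℕ) (ω : ℂ) :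
    cQ q ^ m * qE q (2 * X) - cY q ω * (cQ q ^ k) ^ 4 * cQ q ^ n ≠ 0 := by
  have := lin_ne' q m (k * 4 + n) ω
  rwa [pow_add, pow_mul, ← mul_assoc] at this

lemma shift_neg_coefB (ω : ℂ) (k : ℕ) : shift (-1) (coefB q ω k) =
    (1 - (cQ q ^ k) ^ 2) * (cQ q ^ 2 - cY q ω * (cQ q ^ k) ^ 2) * cQ q ^ 2 * qE q (2 * X) /
      ((1 - qE q (2 * X)) * (cQ q ^ 4 * qE q (2 * X) - cY q ω * (cQ q ^ k) ^ 4)) := by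
  have hQ := cQ_ne q
  have hsQ : ∀ s, shift s (cQ q) = cQ q := fun s => AlgHom.commutes _ _
  have hsY : ∀ s, shift s (cY q ω) = cY q ω := fun s => AlgHom.commutes _ _
  simp only [coefB_eq, map_div₀, map_mul, map_sub, map_pow, map_one, hsQ, hsY, shift_neg_one_z]
  have e1 : cQ q ^ 2 * ((cQ q ^ 2)⁻¹ * qE q (2 * X)) = qE q (2 * X) := by field_simp
  have e2 : cQ q ^ 6 * ((cQ q ^ 2)⁻¹ * qE q (2 * X)) = cQ q ^ 4 * qE q (2 * X) := by field_simp
  rw [e1, e2]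
  congr 1
  field_simp

lemma shift_one_coefA (ω : ℂ) (k : ℕ) : shift 1 (coefA q ω k) =
    cQ q ^ k * (cQ q ^ 4 * qE q (2 * X) - cY q ω * (cQ q ^ k) ^ 2) /
      (cQ q ^ 4 * qE q (2 * X) - cY q ω * (cQ q ^ k) ^ 4) := by
  have hsQ : ∀ s, shift s (cQ q) = cQ q := fun s => AlgHom.commutes _ _
  have hsY : ∀ s, shift s (cY q ω) = cY q ω := fun s => AlgHom.commutes _ _
  simp only [coefA_eq, map_div₀, map_mul, map_sub, map_pow, hsQ, hsY, shift_one_z]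
  rw [← mul_assoc, ← pow_add]

lemma shift_neg_coefA (ω : ℂ) (k : ℕ) : shift (-1) (coefA q ω k) =
    cQ q ^ k * (qE q (2 * X) - cY q ω * (cQ q ^ k) ^ 2) /
      (qE q (2 * X) - cY q ω * (cQ q ^ k) ^ 4) := by
  have hQ := cQ_ne q
  have hsQ : ∀ s, shift s (cQ q) = cQ q := fun s => AlgHom.commutes _ _
  have hsY : ∀ s, shift s (cY q ω) = cY q ω := fun s => AlgHom.commutes _ _
  simp only [coefA_eq, map_div₀, map_mul, map_sub, map_pow, hsQ, hsY, shift_neg_one_z]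
  have e1 : cQ q ^ 2 * ((cQ q ^ 2)⁻¹ * qE q (2 * X)) = qE q (2 * X) := by field_simp
  rw [e1]

lemma shift_one_coefD (k : ℕ) : shift 1 (coefD q k) =
    ((cQ q ^ k) ^ 2 - cQ q ^ 4 * qE q (2 * X)) / (cQ q ^ k * (1 - cQ q ^ 4 * qE q (2 * X))) := by
  have hsQ : ∀ s, shift s (cQ q) = cQ q := fun s => AlgHom.commutes _ _
  simp only [coefD_eq, map_div₀, map_mul, map_sub, map_pow, map_one, hsQ, shift_one_z]
  rw [← mul_assoc, ← pow_add]

lemma shift_neg_coefD (k : ℕ) : shift (-1) (coefD q k) =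
    ((cQ q ^ k) ^ 2 - qE q (2 * X)) / (cQ q ^ k * (1 - qE q (2 * X))) := by
  have hQ := cQ_ne q
  have hsQ : ∀ s, shift s (cQ q) = cQ q := fun s => AlgHom.commutes _ _
  simp only [coefD_eq, map_div₀, map_mul, map_sub, map_pow, map_one, hsQ, shift_neg_one_z]
  have e1 : cQ q ^ 2 * ((cQ q ^ 2)⁻¹ * qE q (2 * X)) = qE q (2 * X) := by field_simp
  rw [e1]

lemma shift_neg_fPhi : shift (-1) (fPhi q) =
    (cQ q ^ 2 * qE q (2 * X) - 1) / (cQ q * (qE q (2 * X) - 1)) := by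
  have hQ := cQ_ne q
  have hsQ : ∀ s, shift s (cQ q) = cQ q := fun s => AlgHom.commutes _ _
  simp only [fPhi_eq', map_div₀, map_mul, map_sub, map_pow, map_one, hsQ, shift_neg_one_z]
  have e1 : cQ q ^ 2 * ((cQ q ^ 2)⁻¹ * qE q (2 * X)) = qE q (2 * X) := by field_simp
  have e2 : cQ q ^ 4 * ((cQ q ^ 2)⁻¹ * qE q (2 * X)) = cQ q ^ 2 * qE q (2 * X) := by field_simp
  rw [e1, e2]

lemma shift_om_fPhi (ω : ℂ) (k : ℕ) : shift (-ω - 2 * k) (fPhi q) =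
    (cQ q ^ 4 * qE q (2 * X) - cY q ω * (cQ q ^ k) ^ 4) /
      (cQ q * (cQ q ^ 2 * qE q (2 * X) - cY q ω * (cQ q ^ k) ^ 4)) := by
  have hQ := cQ_ne q
  have hY := cY_ne q ω
  have hK := pow_ne_zero k hQ
  have h3 := lin_ne₂ q 2 0 k ω
  rw [pow_zero, mul_one] at h3
  have hsQ : ∀ s, shift s (cQ q) = cQ q := fun s => AlgHom.commutes _ _
  simp only [fPhi_eq', map_div₀, map_mul, map_sub, map_pow, map_one, hsQ, shift_om_z]
  have h4 : cQ q ^ 2 * ((cY q ω)⁻¹ * ((cQ q ^ k) ^ 4)⁻¹ * qE q (2 * X)) - 1 ≠ 0 := by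
    intro h
    apply h3
    field_simp at h
    linear_combination h
  rw [div_eq_div_iff (mul_ne_zero hQ h4) (mul_ne_zero hQ h3)]
  field_simp

lemma qE_neg_one : qE q (-1) = (cQ q)⁻¹ := by
  have := qE_intCast q (-1)
  simpa using this

lemma shift_one_coefB (ω : ℂ) (k : ℕ) : shift 1 (coefB q ω k) =
    (1 - (cQ q ^ k) ^ 2) * (cQ q ^ 2 - cY q ω * (cQ q ^ k) ^ 2) * cQ q ^ 6 * qE q (2 * X) /
      ((1 - cQ q ^ 4 * qE q (2 * X)) * (cQ q ^ 8 * qE q (2 * X) - cY q ω * (cQ q ^ k) ^ 4)) := by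
  have hsQ : ∀ s, shift s (cQ q) = cQ q := fun s => AlgHom.commutes _ _
  have hsY : ∀ s, shift s (cY q ω) = cY q ω := fun s => AlgHom.commutes _ _
  simp only [coefB_eq, map_div₀, map_mul, map_sub, map_pow, map_one, hsQ, hsY, shift_one_z]
  rw [← mul_assoc (cQ q ^ 2), ← pow_add, ← mul_assoc (cQ q ^ 6), ← pow_add]
  congr 1
  ring

lemma lin_ne₃ (m k : ℕ) (ω : ℂ) :
    cQ q ^ m * qE q (2 * X) - cY q ω * (cQ q ^ k) ^ 4 ≠ 0 := by
  simpa using lin_ne₂ q m 0 k ω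

lemma lin_ne₄ (k : ℕ) (ω : ℂ) : qE q (2 * X) - cY q ω * (cQ q ^ k) ^ 4 ≠ 0 := by
  simpa using lin_ne₃ q 0 k ω

lemma lin_ne₅ (m : ℕ) : cQ q ^ m * qE q (2 * X) - 1 ≠ 0 := by
  simpa using lin_ne₁ q m 0

lemma lin_ne₆ : qE q (2 * X) - 1 ≠ 0 := by
  simpa using lin_ne₁ q 0 0

lemma rep_ab (ω : ℂ) (k : ℕ) : coefA q ω k * shift (-1) (coefB q ω (k + 1)) =
    shift (-1) (fPhi q) * (coefB q ω (k + 1) * shift 1 (coefA q ω (k + 1))) := by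
  rw [coefA_eq, shift_neg_coefB, shift_neg_fPhi, coefB_eq, shift_one_coefA, pow_succ (cQ q) k]
  exact alg_ab _ _ _ _ _ _ _ _ (cQ_ne q) (lin_ne₆ q) (lin_ne₅ q 2) (lin_ne₄ q k ω)
    (lin_ne₃ q 2 k ω) rfl rfl rfl rfl

lemma rep_ac (ω : ℂ) (k : ℕ) : coefA q ω (k + 1) * -qE q (-1) =
    shift (-ω - 2 * (k + 1 : ℕ)) (fPhi q) * (-qE q (-1) * shift (-1) (coefA q ω k)) := by
  have h := lin_ne₃ q 2 (k + 1) ω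
  rw [coefA_eq, shift_om_fPhi, shift_neg_coefA, qE_neg_one]
  rw [pow_succ (cQ q) k] at h ⊢
  exact alg_ac _ _ _ _ _ _ (cQ_ne q) (lin_ne₄ q k ω) h rfl rfl

lemma rep_bd (ω : ℂ) (k : ℕ) : coefB q ω (k + 1) * shift 1 (coefD q (k + 1)) =
    shift (-ω - 2 * (k : ℕ)) (fPhi q) * (coefD q k * shift 1 (coefB q ω (k + 1))) := by
  rw [shift_one_coefB, coefB_eq, shift_om_fPhi, shift_one_coefD, coefD_eq, pow_succ (cQ q) k]
  exact alg_bd _ _ _ _ _ _ _ _ (cQ_ne q) (lin_ne₅ q 2) (lin_ne₅ q 4) (lin_ne₃ q 2 k ω)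
    (lin_ne₃ q 4 k ω) rfl rfl rfl rfl (pow_ne_zero k (cQ_ne q))

lemma rep_cd (k : ℕ) : -qE q (-1) * shift (-1) (coefD q k) =
    shift (-1) (fPhi q) * (coefD q (k + 1) * -qE q (-1)) := by
  rw [shift_neg_coefD, shift_neg_fPhi, coefD_eq, qE_neg_one, pow_succ (cQ q) k]
  exact alg_cd _ _ _ _ _ (cQ_ne q) (pow_ne_zero k (cQ_ne q)) (lin_ne₆ q) (lin_ne₅ q 2) rfl rfl

lemma rep_ad (ω : ℂ) (k : ℕ) : coefA q ω k * shift (-1) (coefD q k) =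
    1 + shift (-ω - 2 * k) (fPhi q) * (-qE q (-1) * shift (-1) (coefB q ω k)) := by
  rw [shift_neg_coefD, shift_om_fPhi, coefA_eq, qE_neg_one, shift_neg_coefB]
  exact alg_ad _ _ _ _ _ _ _ (cQ_ne q) (pow_ne_zero k (cQ_ne q)) (lin_ne₆ q) (lin_ne₃ q 4 k ω)
    (lin_ne₃ q 2 k ω) rfl rfl rfl

lemma rep_da (ω : ℂ) (k : ℕ) : coefD q k * shift 1 (coefA q ω k) =
    1 + fPsi q * (-qE q (-1) * shift (-1) (coefB q ω k)) := by
  have hQ := cQ_ne q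
  rw [shift_one_coefA, fPsi_eq', coefD_eq, qE_neg_one, shift_neg_coefB]
  exact alg_da _ _ _ _ _ _ _ (pow_ne_zero k (cQ_ne q)) (lin_ne₆ q) (lin_ne₅ q 2)
    (lin_ne₃ q 4 k ω) rfl rfl rfl

lemma rep_bc (ω : ℂ) (k : ℕ) : coefB q ω (k + 1) * -qE q (-1) =
    shift (-ω - 2 * k) (fPhi q) - fPhi q + shift (-ω - 2 * k) (fPhi q) *
      (fPsi q * (-qE q (-1) * shift (-1) (coefB q ω k))) := by
  rw [coefB_eq, shift_om_fPhi, fPhi_eq', fPsi_eq', qE_neg_one, shift_neg_coefB, pow_succ (cQ q) k]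
  exact alg_bc _ _ _ _ _ _ _ _ (cQ_ne q) (lin_ne₆ q) (lin_ne₅ q 2) (lin_ne₃ q 4 k ω)
    (lin_ne₃ q 2 k ω) rfl rfl rfl rfl

lemma shift_const (s : ℂ) : shift s (-qE q (-1)) = -qE q (-1) := by
  rw [map_neg, qE_neg_one, map_inv₀, cQ, AlgHom.commutes]

lemma coefB_zero (ω : ℂ) : coefB q ω 0 = 0 := by
  rw [coefB_eq]
  simp

lemma single_sub_add₁ (ω : ℂ) (k : ℕ) (u : ℕ → Mer) (v y : Mer) :
    (Finsupp.single (k - 1 + 1) (u (k - 1 + 1) * (v * (shift (-1) (coefB q ω k) * y))) : HSpace) =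
      Finsupp.single k (u k * (v * (shift (-1) (coefB q ω k) * y))) := by
  rcases k with _ | k
  · simp [coefB_zero]
  · simp

lemma single_sub_add₂ (ω : ℂ) (k : ℕ) (t : ℕ → Mer) (u v y : Mer) :
    (Finsupp.single (k - 1 + 1) (t (k - 1 + 1) * (u * (v * (shift (-1) (coefB q ω k) * y)))) : HSpace) =
      Finsupp.single k (t k * (u * (v * (shift (-1) (coefB q ω k) * y)))) := by
  rcases k with _ | k
  · simp [coefB_zero]
  · simp

/-- The operators of the dynamical representation `π^ω` on the generators. -/
noncomputable def repData (ω : ℂ) : SLData q (Module.End ℂ HSpace) where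
  a := opS (-1) (coefA q ω) id
  b := opS 1 (coefB q ω) (fun k => k - 1)
  c := opS (-1) (fun _ => -qE q (-1)) (fun k => k + 1)
  d := opS 1 (coefD q) id
  l := opMul fun k => -ω - 2 * k
  r := opMul fun _ => 0
  lr f g := Finsupp.lhom_ext fun k x => by
    rw [Module.End.mul_apply, Module.End.mul_apply]
    simp only [opMul_single]
    rw [mul_left_comm]
  la f := Finsupp.lhom_ext fun k x => by
    rw [Module.End.mul_apply, Module.End.mul_apply]
    simp only [opMul_single, opS_single, id, map_mul, shift_shift]
    rw [mul_left_comm]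
    ring_nf
  ra f := Finsupp.lhom_ext fun k x => by
    rw [Module.End.mul_apply, Module.End.mul_apply]
    simp only [opMul_single, opS_single, id, map_mul, shift_shift]
    rw [mul_left_comm]
    ring_nf
  lb f := Finsupp.lhom_ext fun k x => by
    rw [Module.End.mul_apply, Module.End.mul_apply]
    simp only [opMul_single, opS_single, id, map_mul, shift_shift]
    rcases k with _ | k
    · simp [coefB_eq]
    rw [mul_left_comm]
    push_cast
    ring_nf
  rb f := Finsupp.lhom_ext fun k x => by
    rw [Module.End.mul_apply, Module.End.mul_apply]
    simp only [opMul_single, opS_single, id, map_mul, shift_shift]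
    rw [mul_left_comm]
    ring_nf
  lc f := Finsupp.lhom_ext fun k x => by
    rw [Module.End.mul_apply, Module.End.mul_apply]
    simp only [opMul_single, opS_single, id, map_mul, shift_shift]
    rw [mul_left_comm]
    push_cast
    ring_nf
  rc f := Finsupp.lhom_ext fun k x => by
    rw [Module.End.mul_apply, Module.End.mul_apply]
    simp only [opMul_single, opS_single, id, map_mul, shift_shift]
    rw [mul_left_comm]
    ring_nf
  ld f := Finsupp.lhom_ext fun k x => by
    rw [Module.End.mul_apply, Module.End.mul_apply]
    simp only [opMul_single, opS_single, id, map_mul, shift_shift]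
    rw [mul_left_comm]
    ring_nf
  rd f := Finsupp.lhom_ext fun k x => by
    rw [Module.End.mul_apply, Module.End.mul_apply]
    simp only [opMul_single, opS_single, id, map_mul, shift_shift]
    rw [mul_left_comm]
    ring_nf
  ab := Finsupp.lhom_ext fun k x => by
    simp only [Module.End.mul_apply, opMul_single, opS_single, map_mul, shift_shift,
      shift_const, id, add_tsub_cancel_right, shift_zero]
    rcases k with _ | k
    · simp [coefB_zero]
    have h := rep_ab q ω k
    refine congrArg (Finsupp.single _) ?_
    norm_num
    linear_combination (x) * h
  ac := Finsupp.lhom_ext fun k x => by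
    simp only [Module.End.mul_apply, opMul_single, opS_single, map_mul, shift_shift,
      shift_const, id, add_tsub_cancel_right, shift_zero]
    have h := rep_ac q ω k
    refine congrArg (Finsupp.single _) ?_
    norm_num at h ⊢
    linear_combination (shift (-2) x) * h
  bd := Finsupp.lhom_ext fun k x => by
    simp only [Module.End.mul_apply, opMul_single, opS_single, map_mul, shift_shift,
      shift_const, id, add_tsub_cancel_right, shift_zero]
    rcases k with _ | k
    · simp [coefB_zero]
    have h := rep_bd q ω k
    refine congrArg (Finsupp.single _) ?_
    norm_num
    linear_combination (shift 2 x) * h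
  cd := Finsupp.lhom_ext fun k x => by
    simp only [Module.End.mul_apply, opMul_single, opS_single, map_mul, shift_shift,
      shift_const, id, add_tsub_cancel_right, shift_zero]
    have h := rep_cd q k
    refine congrArg (Finsupp.single _) ?_
    norm_num at h ⊢
    linear_combination (x) * h
  ad := Finsupp.lhom_ext fun k x => by
    simp only [Module.End.mul_apply, LinearMap.add_apply, LinearMap.sub_apply,
      Module.End.one_apply, opMul_single, opS_single, map_mul, shift_shift, shift_const, id,
      shift_zero, add_tsub_cancel_right]
    have h := rep_ad q ω k
    have hs := single_sub_add₁ q ω k (fun n => shift (-ω - 2 * n) (fPhi q)) (-qE q (-1)) (shift (-1 + 1) x)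
    beta_reduce at hs
    rw [hs, ← Finsupp.single_add]
    refine congrArg (Finsupp.single _) ?_
    norm_num
    linear_combination x * h
  da := Finsupp.lhom_ext fun k x => by
    simp only [Module.End.mul_apply, LinearMap.add_apply, LinearMap.sub_apply,
      Module.End.one_apply, opMul_single, opS_single, map_mul, shift_shift, shift_const, id,
      shift_zero, add_tsub_cancel_right]
    have h := rep_da q ω k
    have hs := single_sub_add₁ q ω k (fun _ => fPsi q) (-qE q (-1)) (shift (-1 + 1) x)
    beta_reduce at hs
    rw [hs, ← Finsupp.single_add]
    refine congrArg (Finsupp.single _) ?_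
    norm_num
    linear_combination x * h
  bc := Finsupp.lhom_ext fun k x => by
    simp only [Module.End.mul_apply, LinearMap.add_apply, LinearMap.sub_apply,
      Module.End.one_apply, opMul_single, opS_single, map_mul, shift_shift, shift_const, id,
      shift_zero, add_tsub_cancel_right]
    have h := rep_bc q ω k
    have hs := single_sub_add₂ q ω k (fun n => shift (-ω - 2 * n) (fPhi q)) (fPsi q) (-qE q (-1)) (shift (-1 + 1) x)
    beta_reduce at hs
    rw [hs, ← Finsupp.single_sub, ← Finsupp.single_add]
    refine congrArg (Finsupp.single _) ?_
    norm_num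
    linear_combination x * h

/-- The dynamical representation `π^ω`. -/
noncomputable def dynRep (ω : ℂ) : FSL2 q →ₐ[ℂ] Module.End ℂ HSpace := (repData q ω).lift

/-! ### Matrix elements and `q`-Racah polynomials -/

namespace FSL2

/-- The elements `t_{kj}`, `0 ≤ k, j ≤ N`, are the matrix elements of the corepresentation `V_N`
on the span of the `γ^{N-k} α^k`, that is, `Δ(γ^{N-k} α^k) = ∑_j t_{kj} ⊗ γ^{N-j} α^j`. -/
def IsMatrixElements (N : ℕ) (t : Fin (N + 1) → Fin (N + 1) → FSL2 q) : Prop :=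
  ∀ k : Fin (N + 1), coproduct q (c q ^ (N - (k : ℕ)) * a q ^ (k : ℕ)) =
    ∑ j : Fin (N + 1), tm (t k j) (c q ^ (N - (j : ℕ)) * a q ^ (j : ℕ))

end FSL2

/-- `(q^p; q²)_n`, where `p` is a polynomial in the variable `λ = X`. -/
noncomputable def qP (p : ℂ[X]) (n : ℕ) : Mer := qPoch (qE q p) (qE q 2) n

/-- The factor of `T_{kjm}^{ωN}` in front of `(q^{-2(ω-1+m+j)}; q²)_k R_j`, that is,
`(-1)^{j+k} q^{2k(λ+1)+m(N-k-j)+(k-j)(N-j+1)} [N, j]_{q²}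
  (q^{2(λ+1+k-j-m)}; q²)_{N-k-j} (q^{-2(m+j)}; q²)_k
  / ((q^{2(λ+1-j)}; q²)_{N-j} (q^{2(λ-ω+2+N-2j-2m)}; q²)_k)`. -/
noncomputable def tFactor (ω : ℂ) (N k j m : ℕ) : Mer :=
  (-1) ^ (j + k) *
    qE q (2 * (k : ℂ[X]) * (X + 1) + (m : ℂ[X]) * ((N : ℂ[X]) - (k : ℂ[X]) - (j : ℂ[X])) +
      ((k : ℂ[X]) - (j : ℂ[X])) * ((N : ℂ[X]) - (j : ℂ[X]) + 1)) *
    qBinom (qE q 2) N j *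
    (qPochInt (qE q (2 * (X + 1 + (k : ℂ[X]) - (j : ℂ[X]) - (m : ℂ[X])))) (qE q 2)
        ((N : ℤ) - k - j) *
      qP q (-2 * ((m : ℂ[X]) + (j : ℂ[X]))) k) /
    (qP q (2 * (X + 1 - (j : ℂ[X]))) (N - j) *
      qP q (2 * (X - C ω + 2 + (N : ℂ[X]) - 2 * (j : ℂ[X]) - 2 * (m : ℂ[X]))) k)

/-- The function `T_{kjm}^{ωN}`. -/
noncomputable def tCoef (ω : ℂ) (N k j m : ℕ) : Mer :=
  tFactor q ω N k j m * qP q (-2 * (C ω - 1 + (m : ℂ[X]) + (j : ℂ[X]))) k *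
    qRacah j k (qE q (-2 * ((N : ℂ[X]) + 1))) (qE q (-2 * (X + 1)))
      (qE q (-2 * ((m : ℂ[X]) + (j : ℂ[X]) + 1)))
      (qE q (2 * (X - C ω + 1 - (m : ℂ[X]) - (j : ℂ[X])))) (qE q 2)

/-- The function `T_{kjm}^{ωN}`, where the denominators `(x; q²)_i`, `x = q^{-2(ω-1+m+j)}`, of the
`q`-Racah polynomial have been cancelled against the factor `(x; q²)_k`, by means of
`(x; q²)_k / (x; q²)_i = (x q^{2i}; q²)_{k-i}`. -/
noncomputable def tCoefReg (ω : ℂ) (N k j m : ℕ) : Mer :=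
  tFactor q ω N k j m *
    ∑ i ∈ Finset.range (min j k + 1),
      qP q (-2 * (j : ℂ[X])) i * qP q (-2 * ((N : ℂ[X]) + X + 1 - (j : ℂ[X]))) i *
        qP q (-2 * (k : ℂ[X])) i *
        qP q (2 * (X - C ω + 1 - 2 * (m : ℂ[X]) - 2 * (j : ℂ[X]) + (k : ℂ[X]))) i *
        qP q (-2 * (C ω - 1 + (m : ℂ[X]) + (j : ℂ[X])) + 2 * (i : ℂ[X])) (k - i) /
      (qP q 2 i * qP q (-2 * (N : ℂ[X])) i * qP q (-2 * ((m : ℂ[X]) + (j : ℂ[X]))) i) *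
        qE q 2 ^ i

/-- `Γ_k^N(λ) = [N, k]_{q²} (q^{2(k-N-λ-1)}; q²)_k / (q^{-2λ}; q²)_k`. -/
noncomputable def gammaN (N k : ℕ) : Mer :=
  qBinom (qE q 2) N k * qP q (2 * ((k : ℂ[X]) - (N : ℂ[X]) - X - 1)) k / qP q (-2 * X) k

/-- `Γ_k^ω(λ) = (q², q^{2ω}; q²)_k / (q^{2(λ-k+1)}, q^{2(ω-λ+k-1)}; q²)_k`. -/
noncomputable def gammaW (ω : ℂ) (k : ℕ) : Mer :=
  qP q 2 k * qP q (2 * C ω) k /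
    (qP q (2 * (X - (k : ℂ[X]) + 1)) k * qP q (2 * (C ω - X + (k : ℂ[X]) - 1)) k)

/-- `R_k(μ(j); q^{-2(N+1)}, q^{-2(λ+1)}, q^{-2(M+1)}, q^{2(λ-ω+1-M)}; q²)`. -/
noncomputable def racah (ω : ℂ) (N M k j : ℕ) : Mer :=
  qRacah k j (qE q (-2 * ((N : ℂ[X]) + 1))) (qE q (-2 * (X + 1))) (qE q (-2 * ((M : ℂ[X]) + 1)))
    (qE q (2 * (X - C ω + 1 - (M : ℂ[X])))) (qE q 2)

/-- `R_j(μ(k); q^{-2(M+1)}, q^{2(λ-ω+1-M)}, q^{-2(N+1)}, q^{-2(λ+1)}; q²)`. -/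
noncomputable def racahDual (ω : ℂ) (N M j k : ℕ) : Mer :=
  qRacah j k (qE q (-2 * ((M : ℂ[X]) + 1))) (qE q (2 * (X - C ω + 1 - (M : ℂ[X]))))
    (qE q (-2 * ((N : ℂ[X]) + 1))) (qE q (-2 * (X + 1))) (qE q 2)

/-- The weight of the point `μ(j)`. -/
noncomputable def racahWeight (ω : ℂ) (N M j : ℕ) : Mer :=
  (1 - qE q (2 * (X - C ω + 1 - 2 * (M : ℂ[X])) + 4 * (j : ℂ[X]))) /
      (1 - qE q (2 * (X - C ω + 1 - 2 * (M : ℂ[X])))) *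
    (qP q (2 * (X - C ω - 2 * (M : ℂ[X]) + 1)) j * qP q (-2 * (N : ℂ[X])) j *
        qP q (-2 * (M : ℂ[X])) j * qP q (-2 * (C ω - 1 + (M : ℂ[X]))) j /
      (qP q 2 j * qP q (2 * (X - C ω + 2 + (N : ℂ[X]) - 2 * (M : ℂ[X]))) j *
        qP q (2 * (X - C ω + 2 - (M : ℂ[X]))) j * qP q (2 * (X + 1 - (M : ℂ[X]))) j)) *
    qE q (2 * (j : ℂ[X]) * (X + (N : ℂ[X]) + 1))

/-- The squared norm of the `q`-Racah polynomial of degree `k`. -/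
noncomputable def racahNorm (ω : ℂ) (N M k : ℕ) : Mer :=
  qP q (2 * (C ω - X - 1 + 2 * (M : ℂ[X]) - (N : ℂ[X]))) N * qP q (-2 * (X + (N : ℂ[X]))) N /
      (qP q (2 * (C ω - X - 1 + (M : ℂ[X]) - (N : ℂ[X]))) N *
        qP q (-2 * (X + (N : ℂ[X]) - (M : ℂ[X]))) N) *
    ((1 - qE q (-2 * (X + 1 + (N : ℂ[X])))) /
      (1 - qE q (-2 * (X + 1 + (N : ℂ[X])) + 4 * (k : ℂ[X])))) *
    (qP q 2 k * qP q (-2 * X) k * qP q (-2 * (X + (N : ℂ[X]) - (M : ℂ[X]))) k *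
        qP q (2 * (C ω - X - 1 + (M : ℂ[X]) - (N : ℂ[X]))) k /
      (qP q (-2 * (X + 1 + (N : ℂ[X]))) k * qP q (-2 * (N : ℂ[X])) k * qP q (-2 * (M : ℂ[X])) k *
        qP q (-2 * (C ω - 1 + (M : ℂ[X]))) k)) *
    qE q (2 * (k : ℂ[X]) * (X - C ω + 1 - 2 * (M : ℂ[X])))

end Algebra

end DynSU2

open DynSU2

/-! Left multiplication by `Δ(x)` turns `A ⊗ A` into an `A`-module (`delta`). Writing `γ^{N+1-k}
α^k` as `γ` or `α` times an element of degree `N`, and moving `α` to the right past powers of `γ`,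
gives a recursion in `N` that defines candidates `matEl` for the matrix elements; `delta_basisV`
confirms them. They are unique because the elements `γ^{N-j} α^j` are linearly independent over the
functions of `λ`: under `π^0` they send `e_0` to nonzero multiples of distinct basis vectors
(`sum_tm_basisV_injective`). Comparing coefficients with the same independence yields further
recursions (`matEl_alpha_succ`, `matEl_right_succ`, `matEl_right_zero`), and induction with the
first of them gives the formula `delta_matEl` for the coproduct.

Action in `π^ω`. The recursions that split off a generator on the right express `π^ω(t^{N+1}_{kj})
e_m` by matrix elements of degree `N` applied to `e_m` and `e_{m±1}`. For rows `k ≥ 1` the claimed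
functions satisfy the same recursion because of a three-term contiguous relation between terminating
balanced `₄φ₃` series (`phi_contiguous`), which is proved by telescoping; row `0` has only one term
and needs a Pascal type identity (`tVal_succ_zero`). Induction on `N` then proves `dynRep_matEl`.
The cancelled form of the series is used throughout, so no value of `ω` is excluded.

Orthogonality in the algebra. With the antipode `S`, the matrix `(S(t_{kj}))` is a two-sided inverse
of `(t_{kj})` (`sum_antipode_mul`, `sum_mul_antipode`). The composite `τ = * ∘ S` is an antilinear
automorphism that exchanges `λ` and `μ` and is compatible with the coproduct up to a flip. On the
last row it is computed by recursion (`tau_matEl_top`), and the compatibility extends this to all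
rows: `τ` transposes the matrix up to the factors `Γ^N` (`tau_matEl`). Since `S = * ∘ τ`, the
inverse matrix consists of the `t_{jk}^*` with these factors, which is the pair of orthogonality
relations.

Adjoints. Declaring the `e_m` orthogonal with squared norms `Γ^ω_m` makes the action of `x^*`
adjoint to that of `x`, up to shifts. This is checked on generators and inherited by the matrix
elements (`IsAdjointable.matEl`), so the action of `t_{kj}^*` follows from that of `t_{kj}`.
Evaluating the first relation on `e_{M-l}` and reading the coefficient of `e_{M-k}` leaves a finite
sum (`sum_tCoefReg_mul`).

`q`-Racah polynomials. With the sum of the indices of `T_{jk,M-k}` fixed to `M`, its prefactor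
splits into a function of `j` times a function of `k` (`tFactor_eq_mul`). The squares of these
functions, together with the `Γ`'s, are the weight and the squared norm (`racahWeight_mul`,
`racahNorm_mul`). If `ω` is one of `0, -1, …, -(M-1)`, then `Γ^ω` vanishes for some indices, but
then the `e_m` with `m ≥ K` span a submodule for a suitable `K`, on which a reduced weight `gamW`
serves instead (`exists_adjWeight`). The dual system is the statement that a one-sided inverse of a
square matrix is two-sided, combined with the symmetry of the series in degree and variable. -/

namespace DynSU2

open Polynomial Mer

variable (q : Set.Ioo (0 : ℝ) 1)

namespace FSL2

/-! ### The coproduct as an action on `A ⊗ A`, and the matrix elements by recursion. -/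

/-- The action of `Δ(x)` on `A ⊗ A` by left multiplication. -/
noncomputable abbrev delta : FSL2 q →ₐ[ℂ] Module.End ℂ (TT q) := (deltaData q).lift

section Delta

variable (s u : FSL2 q)

lemma delta_a : delta q (a q) (tm s u) = tm (a q * s) (a q * u) + tm (b q * s) (c q * u) := by
  rw [delta, SLData.lift_a]; rfl

lemma delta_b : delta q (b q) (tm s u) = tm (a q * s) (b q * u) + tm (b q * s) (d q * u) := by
  rw [delta, SLData.lift_b]; rfl

lemma delta_c : delta q (c q) (tm s u) = tm (c q * s) (a q * u) + tm (d q * s) (c q * u) := by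
  rw [delta, SLData.lift_c]; rfl

lemma delta_d : delta q (d q) (tm s u) = tm (c q * s) (b q * u) + tm (d q * s) (d q * u) := by
  rw [delta, SLData.lift_d]; rfl

lemma delta_l (f : Mer) : delta q (l q f) (tm s u) = tm (l q f * s) u := by
  rw [delta, SLData.lift_l]; exact lTensor_tm q f s u

lemma delta_r (f : Mer) : delta q (r q f) (tm s u) = tm s (r q f * u) := by
  rw [delta, SLData.lift_r]; exact rTensor_tm q f s u

end Delta

@[simp] lemma tm_zero_left (u : FSL2 q) : tm (0 : FSL2 q) u = 0 := TensorProduct.zero_tmul _ _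
@[simp] lemma tm_zero_right (s : FSL2 q) : tm s (0 : FSL2 q) = 0 := TensorProduct.tmul_zero _ _

/-- `Φ(λ) Φ(λ+1) ⋯ Φ(λ+n-1)`, where `Φ = qF`. -/
noncomputable def prodPhi (n : ℕ) : Mer := ∏ i ∈ Finset.range n, shift (i : ℂ) (fPhi q)

@[simp] lemma prodPhi_zero : prodPhi q 0 = 1 := rfl

lemma prodPhi_succ (n : ℕ) : prodPhi q (n + 1) = prodPhi q n * shift (n : ℂ) (fPhi q) :=
  Finset.prod_range_succ _ _

lemma c_pow_l (n : ℕ) (f : Mer) : c q ^ n * l q f = l q (shift n f) * c q ^ n := by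
  induction n generalizing f with
  | zero => simp
  | succ n ih =>
    rw [pow_succ, mul_assoc, c_l, ← mul_assoc, ih, shift_shift, mul_assoc]
    push_cast; rfl

/-- Each passage of `α` past one `γ` costs a factor `Φ(λ)`, and the powers of `γ` already to its
left shift the argument of that factor. -/
lemma a_mul_c_pow (n : ℕ) : a q * c q ^ n = l q (prodPhi q n) * (c q ^ n * a q) := by
  induction n with
  | zero => simp
  | succ n ih =>
    have h := (data q).ac
    simp only [data] at h
    rw [pow_succ, ← mul_assoc, ih, mul_assoc, mul_assoc, h, ← mul_assoc (c q ^ n), c_pow_l,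
      prodPhi_succ, map_mul]
    simp only [mul_assoc]

/-- The basis `γ^{N-j} α^j` of the corepresentation `V_N`. -/
noncomputable def basisV (N j : ℕ) : FSL2 q := c q ^ (N - j) * a q ^ j

lemma c_mul_basisV {N j : ℕ} (h : j ≤ N) : c q * basisV q N j = basisV q (N + 1) j := by
  rw [basisV, basisV, ← mul_assoc, ← pow_succ', Nat.succ_sub h]

lemma a_mul_basisV (N j : ℕ) :
    a q * basisV q N j = l q (prodPhi q (N - j)) * basisV q (N + 1) (j + 1) := by
  rw [basisV, basisV, ← mul_assoc, a_mul_c_pow, Nat.add_sub_add_right, pow_succ']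
  simp only [mul_assoc]

/-- The matrix elements `t^N_{kj}`, by recursion on `N`. -/
noncomputable def matEl : ℕ → ℕ → ℕ → FSL2 q
  | 0, _, 0 => 1
  | 0, _, _ + 1 => 0
  | N + 1, k, 0 => if k ≤ N then d q * matEl N k 0 else b q * matEl N N 0
  | N + 1, k, j + 1 =>
    if k ≤ N then d q * matEl N k (j + 1) + r q (prodPhi q (N - j)) * (c q * matEl N k j)
    else b q * matEl N N (j + 1) + r q (prodPhi q (N - j)) * (a q * matEl N N j)

lemma matEl_zero_zero (k : ℕ) : matEl q 0 k 0 = 1 := by rw [matEl]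

lemma matEl_succ_zero {N k : ℕ} (h : k ≤ N) : matEl q (N + 1) k 0 = d q * matEl q N k 0 := by
  rw [matEl, if_pos h]

lemma matEl_succ_succ {N k : ℕ} (h : k ≤ N) (j : ℕ) : matEl q (N + 1) k (j + 1) =
    d q * matEl q N k (j + 1) + r q (prodPhi q (N - j)) * (c q * matEl q N k j) := by
  rw [matEl, if_pos h]

lemma matEl_top_zero (N : ℕ) : matEl q (N + 1) (N + 1) 0 = b q * matEl q N N 0 := by
  rw [matEl, if_neg (by omega)]

lemma matEl_top_succ (N j : ℕ) : matEl q (N + 1) (N + 1) (j + 1) =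
    b q * matEl q N N (j + 1) + r q (prodPhi q (N - j)) * (a q * matEl q N N j) := by
  rw [matEl, if_neg (by omega)]

/-- Makes the recursion uniform in the column: the boundary terms that appear when sums in degree
`N` are rewritten as sums in degree `N + 1` disappear. -/
lemma matEl_of_lt {N j : ℕ} (k : ℕ) (h : N < j) : matEl q N k j = 0 := by
  induction N generalizing k j with
  | zero => obtain ⟨j, rfl⟩ := Nat.exists_eq_succ_of_ne_zero h.ne'; rw [matEl]
  | succ N ih =>
    obtain ⟨j, rfl⟩ := Nat.exists_eq_succ_of_ne_zero (Nat.ne_zero_of_lt h)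
    rw [matEl, ih _ (by omega), ih _ (by omega), ih _ (by omega), ih _ (by omega)]
    simp

/-- Each of `Δ(α)` and `Δ(γ)` has one summand that raises the column by one and one that keeps it.
This collects both by column. -/
lemma sum_tm_succ (N : ℕ) (x y : ℕ → FSL2 q) (hx : x (N + 1) = 0) (v w : ℕ → FSL2 q) :
    ∑ j ∈ Finset.range (N + 1), (tm (y j) (w (j + 1)) + tm (x j) (v j)) =
      tm (x 0) (v 0) + ∑ j ∈ Finset.range (N + 1),
        (tm (x (j + 1)) (v (j + 1)) + tm (y j) (w (j + 1))) := by
  have h := Finset.sum_range_succ' (fun j => tm (x j) (v j)) (N + 1)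
  rw [Finset.sum_range_succ, hx, tm_zero_left, add_zero] at h
  rw [Finset.sum_add_distrib, h, Finset.sum_add_distrib]
  abel

/-- The defining property of the matrix elements, as an identity of operators. -/
lemma delta_basisV {N k : ℕ} (hk : k ≤ N) (s u : FSL2 q) : delta q (basisV q N k) (tm s u) =
    ∑ j ∈ Finset.range (N + 1), tm (matEl q N k j * s) (basisV q N j * u) := by
  induction N generalizing k with
  | zero =>
    obtain rfl : k = 0 := by omega
    simp [basisV, matEl_zero_zero]
  | succ N ih =>
    have hc : ∀ j ∈ Finset.range (N + 1), c q * (basisV q N j * u) = basisV q (N + 1) j * u :=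
      fun j hj => by
        rw [← mul_assoc, c_mul_basisV q (Nat.lt_succ_iff.1 (Finset.mem_range.1 hj))]
    have ha : ∀ j, a q * (basisV q N j * u) =
        l q (prodPhi q (N - j)) * (basisV q (N + 1) (j + 1) * u) := fun j => by
      rw [← mul_assoc, a_mul_basisV, mul_assoc]
    -- One computation for both cases: `(y, e)` is `(γ, δ)` in the rows `k ≤ N` and `(α, β)` in the
    -- last row.
    have key : ∀ (y e : FSL2 q) (x : ℕ → FSL2 q), x (N + 1) = 0 →
        ∑ j ∈ Finset.range (N + 1), (tm (y * (x j * s)) (a q * (basisV q N j * u)) +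
          tm (e * (x j * s)) (c q * (basisV q N j * u))) =
        tm (e * x 0 * s) (basisV q (N + 1) 0 * u) + ∑ j ∈ Finset.range (N + 1),
          tm ((e * x (j + 1) + r q (prodPhi q (N - j)) * (y * x j)) * s)
            (basisV q (N + 1) (j + 1) * u) := by
      intro y e x hx
      -- The function of `λ` produced by moving `α` in the second factor crosses the tensor sign and
      -- becomes the function of `μ` in the recursion.
      rw [Finset.sum_congr rfl fun j hj => by rw [hc j hj, ha j, ← tm_balance]]
      rw [sum_tm_succ q N (fun j => e * (x j * s))
        (fun j => r q (prodPhi q (N - j)) * (y * (x j * s))) (by simp [hx])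
        (fun j => basisV q (N + 1) j * u) (fun j => basisV q (N + 1) j * u)]
      simp only [add_mul, mul_assoc, tm_add_left]
    rw [Finset.sum_range_succ']
    rcases Nat.lt_or_ge N k with h | h
    · obtain rfl : k = N + 1 := by omega
      have e : basisV q (N + 1) (N + 1) = a q * basisV q N N := by simp [a_mul_basisV]
      rw [e, map_mul, Module.End.mul_apply, ih le_rfl, map_sum]
      simp only [delta_a]
      rw [key _ _ _ (matEl_of_lt q _ (Nat.lt_succ_self N)), matEl_top_zero, add_comm]
      simp only [matEl_top_succ]
    · rw [← c_mul_basisV q h, map_mul, Module.End.mul_apply, ih h, map_sum]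
      simp only [delta_c]
      rw [key _ _ _ (matEl_of_lt q _ (Nat.lt_succ_self N)), matEl_succ_zero q h, add_comm]
      simp only [matEl_succ_succ q h]

/-! ### Uniqueness -/

/-- The coefficient functional `x ↦ (π^0(x) e_0)_n`, twisted so that it is linear over `Mer`. -/
noncomputable def coefFun (n : ℕ) : FLeft q →ₗ[Mer] Mer where
  toFun x := shift (2 * n) (dynRep q 0 x.out (Finsupp.single 0 1) n)
  map_add' x y := by
    change shift _ (dynRep q 0 (x.out + y.out) _ n) = _
    rw [map_add, LinearMap.add_apply, Finsupp.add_apply, map_add]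
  map_smul' f x := by
    change shift _ (dynRep q 0 (l q f * x.out) _ n) = f * shift _ _
    -- In `π^0` the element `f(λ)` multiplies the coefficient of `e_n` by `f` shifted by `-2n`; the
    -- shift by `2n` in the functional undoes this.
    have key : ∀ y : HSpace, (repData q 0).l f y n = shift (-(2 * n)) f * y n := by
      intro y
      induction y using Finsupp.induction_linear with
      | zero => simp
      | add y z hy hz => rw [map_add, Finsupp.add_apply, hy, hz, Finsupp.add_apply, mul_add]
      | single k g =>
        change opMul _ f _ n = _
        rw [opMul_single]
        rcases eq_or_ne k n with rfl | h
        · simp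
        · simp [Finsupp.single_eq_of_ne' h]
    rw [map_mul, Module.End.mul_apply, dynRep, SLData.lift_l, key, map_mul, shift_shift]
    simp

/-- `α` fixes `e_0` because `A_0 = 1`, and each `γ` raises the index by one. Distinct `j` therefore
give multiples of distinct basis vectors. -/
lemma dynRep_basisV_zero (N j : ℕ) : dynRep q 0 (basisV q N j) (Finsupp.single 0 1) =
    Finsupp.single (N - j) ((-qE q (-1)) ^ (N - j)) := by
  have h1 : ∀ j, dynRep q 0 (a q ^ j) (Finsupp.single 0 1) = Finsupp.single 0 1 := by
    intro j
    induction j with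
    | zero => simp
    | succ j ih =>
      rw [pow_succ', map_mul, Module.End.mul_apply, ih, dynRep, SLData.lift_a]
      change opS _ _ _ _ = _
      have h := lin_ne₃ q 2 0 0
      rw [opS_single, coefA_eq, map_one, mul_one]
      simp only [pow_zero, one_pow, mul_one, one_mul, id] at h ⊢
      rw [div_self h]
  have h2 : ∀ n, dynRep q 0 (c q ^ n) (Finsupp.single 0 1) =
      Finsupp.single n ((-qE q (-1)) ^ n) := by
    intro n
    induction n with
    | zero => simp
    | succ n ih =>
      rw [pow_succ', map_mul, Module.End.mul_apply, ih, dynRep, SLData.lift_c]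
      change opS _ _ _ _ = _
      rw [opS_single, map_pow, shift_const, pow_succ']
  rw [basisV, map_mul, Module.End.mul_apply, h1, h2]

lemma coefFun_basisV {N j n : ℕ} (hj : j ≤ N) (hn : n ≤ N) :
    coefFun q (N - n) (show FLeft q from basisV q N j) =
      if j = n then (-qE q (-1)) ^ (N - n) else 0 := by
  change shift _ (dynRep q 0 (basisV q N j) _ _) = _
  rw [dynRep_basisV_zero]
  split_ifs with h
  · rw [h, Finsupp.single_eq_same, map_pow, shift_const]
  · rw [Finsupp.single_eq_of_ne (by omega), map_zero]

/-- The elements `γ^{N-j} α^j` are linearly independent over the left copy of `Mer`. -/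
lemma sum_tm_basisV_injective {N : ℕ} {x y : ℕ → FSL2 q}
    (h : ∑ j ∈ Finset.range (N + 1), tm (x j) (basisV q N j) =
      ∑ j ∈ Finset.range (N + 1), tm (y j) (basisV q N j)) {n : ℕ} (hn : n ≤ N) : x n = y n := by
  -- Applying the functional to the second tensor factor kills every term except the one with index
  -- `n`, which keeps an invertible constant.
  have key : ∀ z : ℕ → FSL2 q, (TensorProduct.rid Mer (FRight q)
      ((coefFun q (N - n)).lTensor (FRight q) (∑ j ∈ Finset.range (N + 1),
        tm (z j) (basisV q N j)))) = r q ((-qE q (-1)) ^ (N - n)) * z n := by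
    intro z
    rw [map_sum, map_sum, Finset.sum_eq_single_of_mem n (Finset.mem_range.2 (by omega))]
    · rw [tm, LinearMap.lTensor_tmul, coefFun_basisV q hn hn, if_pos rfl, TensorProduct.rid_tmul]
      rfl
    · intro j hj hjn
      rw [tm, LinearMap.lTensor_tmul,
        coefFun_basisV q (Nat.lt_succ_iff.1 (Finset.mem_range.1 hj)) hn, if_neg hjn,
        TensorProduct.rid_tmul, zero_smul]
  have h1 := key x
  rw [h, key y] at h1
  have h2 : (-qE q (-1)) ^ (N - n) ≠ 0 :=
    pow_ne_zero _ (neg_ne_zero.2 (by rw [qE_neg_one]; exact inv_ne_zero (cQ_ne q)))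
  have h3 := congrArg (r q ((-qE q (-1)) ^ (N - n))⁻¹ * ·) h1
  simp only [← mul_assoc, ← map_mul, inv_mul_cancel₀ h2, map_one, one_mul] at h3
  exact h3.symm

lemma isMatrixElements_matEl (N : ℕ) :
    IsMatrixElements q N fun k j : Fin (N + 1) => matEl q N k j := by
  intro k
  have h := delta_basisV q (Nat.lt_succ_iff.1 k.2) 1 1
  simp only [mul_one] at h
  rw [← Fin.sum_univ_eq_sum_range (fun j => tm (matEl q N k j) (basisV q N j))] at h
  exact h

lemma IsMatrixElements.eq_matEl {N : ℕ} {t : Fin (N + 1) → Fin (N + 1) → FSL2 q}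
    (h : IsMatrixElements q N t) (k j : Fin (N + 1)) : t k j = matEl q N k j := by
  have h1 := (h k).symm.trans (isMatrixElements_matEl q N k)
  -- The given family is extended by `0`, since the independence statement is indexed by natural
  -- numbers.
  have h2 : ∑ j ∈ Finset.range (N + 1), tm (if hj : j < N + 1 then t k ⟨j, hj⟩ else 0)
      (basisV q N j) = ∑ j ∈ Finset.range (N + 1), tm (matEl q N k j) (basisV q N j) := by
    rw [← Fin.sum_univ_eq_sum_range (fun j => tm (matEl q N k j) (basisV q N j)),
      ← Fin.sum_univ_eq_sum_range (fun j => tm (if hj : j < N + 1 then t k ⟨j, hj⟩ else 0)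
      (basisV q N j))]
    have h4 : ∀ i : Fin (N + 1), (if hi : (i : ℕ) < N + 1 then t k ⟨i, hi⟩ else 0) = t k i :=
      fun i => by rw [dif_pos i.2]
    simp only [h4]
    exact h1
  have h3 := sum_tm_basisV_injective q h2 (Nat.lt_succ_iff.1 j.2)
  rwa [dif_pos j.2] at h3

lemma existsUnique_matrixElements (N : ℕ) :
    ∃! t : Fin (N + 1) → Fin (N + 1) → FSL2 q, IsMatrixElements q N t :=
  ⟨_, isMatrixElements_matEl q N, fun _ h => funext fun k => funext fun j =>
    IsMatrixElements.eq_matEl q h k j⟩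

/-! ### The second recursion, weights and the coproduct of the matrix elements -/

/-- Two expansions of `Δ(α γ^{N-k} α^k)`: either multiply the expansion of `Δ(γ^{N-k} α^k)` by
`Δ(α)`, or first move `α` to its place in `γ^{N-k} α^{k+1}`. Independence of the basis identifies
the coefficients. This reaches row `k + 1` from row `k`, whereas the defining recursion stays in row
`k` except for the last one. -/
lemma matEl_alpha_succ {N k : ℕ} (h : k ≤ N) (j : ℕ) :
    l q (prodPhi q (N - k)) * matEl q (N + 1) (k + 1) (j + 1) =
      b q * matEl q N k (j + 1) + r q (prodPhi q (N - j)) * (a q * matEl q N k j) ∧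
    l q (prodPhi q (N - k)) * matEl q (N + 1) (k + 1) 0 = b q * matEl q N k 0 := by
  have h1 : delta q (a q * basisV q N k) (tm 1 1) =
      ∑ j ∈ Finset.range (N + 1), (tm (a q * matEl q N k j) (a q * basisV q N j) +
        tm (b q * matEl q N k j) (c q * basisV q N j)) := by
    rw [map_mul, Module.End.mul_apply, delta_basisV q h, map_sum]
    simp only [delta_a, mul_one]
  rw [a_mul_basisV, map_mul, Module.End.mul_apply, delta_basisV q (by omega : k + 1 ≤ N + 1),
    map_sum] at h1
  simp only [delta_l, mul_one] at h1
  have hc : ∀ j ∈ Finset.range (N + 1), c q * basisV q N j = basisV q (N + 1) j :=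
    fun j hj => c_mul_basisV q (Nat.lt_succ_iff.1 (Finset.mem_range.1 hj))
  have e : ∑ j ∈ Finset.range (N + 1), (tm (a q * matEl q N k j) (a q * basisV q N j) +
        tm (b q * matEl q N k j) (c q * basisV q N j)) = ∑ j ∈ Finset.range (N + 1),
        (tm (r q (prodPhi q (N - j)) * (a q * matEl q N k j)) (basisV q (N + 1) (j + 1)) +
        tm (b q * matEl q N k j) (basisV q (N + 1) j)) :=
    Finset.sum_congr rfl fun j hj => by rw [hc j hj, a_mul_basisV q N j, ← tm_balance]
  rw [e, sum_tm_succ q N (fun j => b q * matEl q N k j)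
        (fun j => r q (prodPhi q (N - j)) * (a q * matEl q N k j))
        (by simp [matEl_of_lt q k (Nat.lt_succ_self N)])
        (fun j => basisV q (N + 1) j) (fun j => basisV q (N + 1) j)] at h1
  have h2 : ∑ i ∈ Finset.range (N + 1 + 1), tm (l q (prodPhi q (N - k)) *
      matEl q (N + 1) (k + 1) i) (basisV q (N + 1) i) = ∑ i ∈ Finset.range (N + 1 + 1),
        tm (match i with
          | 0 => b q * matEl q N k 0
          | j + 1 => b q * matEl q N k (j + 1) + r q (prodPhi q (N - j)) * (a q * matEl q N k j))
        (basisV q (N + 1) i) := by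
    rw [h1, Finset.sum_range_succ' _ (N + 1), add_comm]
    exact congrArg (fun x => x + tm (b q * matEl q N k 0) (basisV q (N + 1) 0)) (Finset.sum_congr rfl fun i _ => (tm_add_left _ _ _).symm)
  have h3 := fun n (hn : n ≤ N + 1) => sum_tm_basisV_injective q h2 hn
  refine ⟨?_, h3 0 (by omega)⟩
  rcases Nat.lt_or_ge N j with hj | hj
  · rw [matEl_of_lt q _ (by omega), matEl_of_lt q _ (by omega), matEl_of_lt q _ (by omega)]
    simp
  · exact h3 (j + 1) (by omega)

/-- All terms of the recursion have the same bidegree, so the matrix element is bihomogeneous: its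
weight in `λ` depends on the row and that in `μ` on the column. -/
lemma matEl_weight {N k : ℕ} (hk : k ≤ N) (j : ℕ) (f : Mer) :
    matEl q N k j * l q f = l q (shift (N - 2 * k) f) * matEl q N k j ∧
    matEl q N k j * r q f = r q (shift (N - 2 * j) f) * matEl q N k j := by
  have hlr : ∀ f g, l q f * r q g = r q g * l q f := fun f g => (data q).lr f g
  induction N generalizing k j f with
  | zero =>
    obtain rfl : k = 0 := by omega
    rcases j with _ | j
    · simp [matEl_zero_zero]
    · simp [matEl_of_lt]
  | succ N ih =>
    rcases Nat.lt_or_ge N k with h | h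
    · obtain rfl : k = N + 1 := by omega
      rcases j with _ | j
      · rw [matEl_top_zero, mul_assoc, mul_assoc, (ih le_rfl 0 _).1, (ih le_rfl 0 _).2]
        constructor
        · rw [← mul_assoc, b_l, shift_shift, mul_assoc]
          push_cast; ring_nf
        · rw [← mul_assoc, b_r, shift_shift, mul_assoc]
          push_cast; ring_nf
      · rw [matEl_top_succ]
        simp only [add_mul, mul_add]
        constructor
        · congr 1
          · rw [mul_assoc, (ih le_rfl _ _).1, ← mul_assoc, b_l, shift_shift, mul_assoc]
            push_cast; ring_nf
          · rw [mul_assoc, mul_assoc, (ih le_rfl _ _).1, ← mul_assoc (a q), a_l, shift_shift,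
              mul_assoc, ← mul_assoc (r q _), ← hlr, mul_assoc]
            push_cast; ring_nf
        · congr 1
          · rw [mul_assoc, (ih le_rfl _ _).2, ← mul_assoc, b_r, shift_shift, mul_assoc]
            push_cast; ring_nf
          · rw [mul_assoc, mul_assoc, (ih le_rfl _ _).2, ← mul_assoc (a q), a_r, shift_shift,
              mul_assoc, ← mul_assoc (r q _), ← map_mul, mul_comm, map_mul, mul_assoc]
            push_cast; ring_nf
    · rcases j with _ | j
      · rw [matEl_succ_zero q h, mul_assoc, mul_assoc, (ih h 0 _).1, (ih h 0 _).2]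
        constructor
        · rw [← mul_assoc, d_l, shift_shift, mul_assoc]
          push_cast; ring_nf
        · rw [← mul_assoc, d_r, shift_shift, mul_assoc]
          push_cast; ring_nf
      · rw [matEl_succ_succ q h]
        simp only [add_mul, mul_add]
        constructor
        · congr 1
          · rw [mul_assoc, (ih h _ _).1, ← mul_assoc, d_l, shift_shift, mul_assoc]
            push_cast; ring_nf
          · rw [mul_assoc, mul_assoc, (ih h _ _).1, ← mul_assoc (c q), c_l, shift_shift,
              mul_assoc, ← mul_assoc (r q _), ← hlr, mul_assoc]
            push_cast; ring_nf
        · congr 1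
          · rw [mul_assoc, (ih h _ _).2, ← mul_assoc, d_r, shift_shift, mul_assoc]
            push_cast; ring_nf
          · rw [mul_assoc, mul_assoc, (ih h _ _).2, ← mul_assoc (c q), c_r, shift_shift,
              mul_assoc, ← mul_assoc (r q _), ← map_mul, mul_comm, map_mul, mul_assoc]
            push_cast; ring_nf

/-- The matrix elements form a corepresentation. -/
lemma delta_matEl {N k : ℕ} (hk : k ≤ N) (j : ℕ) (s u : FSL2 q) :
    delta q (matEl q N k j) (tm s u) =
      ∑ i ∈ Finset.range (N + 1), tm (matEl q N k i * s) (matEl q N i j * u) := by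
  induction N generalizing k j with
  | zero =>
    obtain rfl : k = 0 := by omega
    rcases j with _ | j
    · simp [matEl_zero_zero]
    · simp [matEl_of_lt]
  | succ N ih =>
    -- In the second tensor factor, row `i` comes from `matEl_succ_succ` and row `i + 1` from
    -- `matEl_alpha_succ`. The factor `prodPhi` on the left of the latter is exactly the one that
    -- the recursion for the first factor carries across the tensor sign.
    have key : ∀ (y e : FSL2 q) (x x' : ℕ → FSL2 q) (j : ℕ), x (N + 1) = 0 →
        x' 0 = e * x 0 → (∀ i, x' (i + 1) = e * x (i + 1) + r q (prodPhi q (N - i)) * (y * x i)) →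
        (∑ i ∈ Finset.range (N + 1),
          (tm (y * (x i * s)) (b q * (matEl q N i (j + 1) * u)) +
            tm (e * (x i * s)) (d q * (matEl q N i (j + 1) * u))) +
          ∑ i ∈ Finset.range (N + 1),
            (tm (y * (x i * s)) (r q (prodPhi q (N - j)) * (a q * (matEl q N i j * u))) +
            tm (e * (x i * s)) (r q (prodPhi q (N - j)) * (c q * (matEl q N i j * u)))) =
        ∑ i ∈ Finset.range (N + 1 + 1), tm (x' i * s) (matEl q (N + 1) i (j + 1) * u)) ∧
        (∑ i ∈ Finset.range (N + 1),
          (tm (y * (x i * s)) (b q * (matEl q N i 0 * u)) +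
            tm (e * (x i * s)) (d q * (matEl q N i 0 * u))) =
        ∑ i ∈ Finset.range (N + 1 + 1), tm (x' i * s) (matEl q (N + 1) i 0 * u)) := by
      intro y e x x' j hx hx0 hxs
      constructor
      · have h1 := sum_tm_succ q N (fun i => e * (x i * s))
          (fun i => r q (prodPhi q (N - i)) * (y * (x i * s))) (by simp [hx])
          (fun i => matEl q (N + 1) i (j + 1) * u) (fun i => matEl q (N + 1) i (j + 1) * u)
        rw [Finset.sum_range_succ' _ (N + 1), hx0]
        simp only [hxs, add_mul, tm_add_left, mul_assoc] at h1 ⊢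
        rw [add_comm (Finset.sum _ _) (tm (e * (x 0 * s)) _), ← h1, ← Finset.sum_add_distrib]
        refine Finset.sum_congr rfl fun i hi => ?_
        have hi' : i ≤ N := Nat.lt_succ_iff.1 (Finset.mem_range.1 hi)
        rw [tm_balance, ← mul_assoc (l q _), (matEl_alpha_succ q hi' j).1, matEl_succ_succ q hi']
        simp only [add_mul, mul_assoc, tm_add_right]
        abel
      · have h1 := sum_tm_succ q N (fun i => e * (x i * s))
          (fun i => r q (prodPhi q (N - i)) * (y * (x i * s))) (by simp [hx])
          (fun i => matEl q (N + 1) i 0 * u) (fun i => matEl q (N + 1) i 0 * u)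
        rw [Finset.sum_range_succ' _ (N + 1), hx0]
        simp only [hxs, add_mul, tm_add_left, mul_assoc] at h1 ⊢
        rw [add_comm (Finset.sum _ _) (tm (e * (x 0 * s)) _), ← h1]
        refine Finset.sum_congr rfl fun i hi => ?_
        have hi' : i ≤ N := Nat.lt_succ_iff.1 (Finset.mem_range.1 hi)
        rw [tm_balance, ← mul_assoc (l q _), (matEl_alpha_succ q hi' 0).2, matEl_succ_zero q hi']
        simp only [mul_assoc]
    have hN := fun k => matEl_of_lt q k (Nat.lt_succ_self N)
    rcases Nat.lt_or_ge N k with h | h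
    · obtain rfl : k = N + 1 := by omega
      rcases j with _ | j
      · rw [matEl_top_zero, map_mul, Module.End.mul_apply, ih le_rfl, map_sum]
        simp only [delta_b]
        exact (key (a q) (b q) _ _ 0 (hN _) (matEl_top_zero q N) (matEl_top_succ q N)).2
      · rw [matEl_top_succ, map_add, map_mul, map_mul, map_mul, LinearMap.add_apply,
          Module.End.mul_apply, Module.End.mul_apply, Module.End.mul_apply, ih le_rfl, ih le_rfl,
          map_sum, map_sum, map_sum]
        simp only [delta_b, delta_a, map_add, delta_r]
        exact (key (a q) (b q) _ _ j (hN _) (matEl_top_zero q N) (matEl_top_succ q N)).1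
    · rcases j with _ | j
      · rw [matEl_succ_zero q h, map_mul, Module.End.mul_apply, ih h, map_sum]
        simp only [delta_d]
        exact (key (c q) (d q) _ _ 0 (hN _) (matEl_succ_zero q h) (matEl_succ_succ q h)).2
      · rw [matEl_succ_succ q h, map_add, map_mul, map_mul, map_mul, LinearMap.add_apply,
          Module.End.mul_apply, Module.End.mul_apply, Module.End.mul_apply, ih h, ih h,
          map_sum, map_sum, map_sum]
        simp only [delta_d, delta_c, map_add, delta_r]
        exact (key (c q) (d q) _ _ j (hN _) (matEl_succ_zero q h) (matEl_succ_succ q h)).1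

end FSL2

end DynSU2

namespace DynSU2

open Polynomial Mer

variable (q : Set.Ioo (0 : ℝ) 1)

namespace FSL2

/-! ### The antipode and the transposition -/

variable {q} in
lemma induction {P : FSL2 q → Prop} (gen : ∀ x, P (gen q x)) (const : ∀ z : ℂ, P (algebraMap ℂ _ z))
    (mul : ∀ x y, P x → P y → P (x * y)) (add : ∀ x y, P x → P y → P (x + y)) (x : FSL2 q) :
    P x := by
  obtain ⟨x, rfl⟩ := RingQuot.mkAlgHom_surjective ℂ (Rel q) x
  induction x using FreeAlgebra.induction with
  | grade0 z => rw [AlgHom.commutes]; exact const z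
  | grade1 x => exact gen x
  | mul x y hx hy => rw [map_mul]; exact mul _ _ hx hy
  | add x y hx hy => rw [map_add]; exact add _ _ hx hy

section Star

variable (x y : FSL2 q)

lemma star_mul : star q (x * y) = star q y * star q x := by
  rw [star, map_mul]; rfl

lemma star_add : star q (x + y) = star q x + star q y := by
  rw [star, map_add]; rfl

lemma star_zero : star q (0 : FSL2 q) = 0 := by
  rw [star, map_zero]; rfl

lemma star_algebraMap (z : ℂ) :
    star q (algebraMap ℂ _ z) = algebraMap ℂ _ (starRingEnd ℂ z) := by
  rw [star, AlgHom.commutes]; rfl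

lemma star_one : star q (1 : FSL2 q) = 1 := by
  rw [star, map_one]; rfl

lemma star_a : star q (a q) = d q := by
  rw [star, SLData.lift_a]; rfl

lemma star_b : star q (b q) = -((q : ℝ) : ℂ) • c q := by
  rw [star, SLData.lift_b]; rfl

lemma star_c : star q (c q) = -((q : ℝ) : ℂ)⁻¹ • b q := by
  rw [star, SLData.lift_c]; rfl

lemma star_d : star q (d q) = a q := by
  rw [star, SLData.lift_d]; rfl

lemma star_l (f : Mer) : star q (l q f) = l q (bar f) := by
  rw [star, SLData.lift_l]; rfl

lemma star_r (f : Mer) : star q (r q f) = r q (bar f) := by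
  rw [star, SLData.lift_r]; rfl

lemma star_smul (z : ℂ) : star q (z • x) = starRingEnd ℂ z • star q x := by
  rw [Algebra.smul_def, star_mul, star_algebraMap, ← Algebra.commutes, ← Algebra.smul_def]

end Star

end FSL2

lemma bar_bar (f : Mer) : bar (bar f) = f := by
  induction f using Mer.ind with
  | h f hf => simp [bar_mk]

namespace FSL2

lemma star_star (x : FSL2 q) : star q (star q x) = x := by
  have hq := q_ne q
  induction x using FSL2.induction with
  | gen x =>
    rcases x with _ | _ | _ | _ | f | f
    · change star q (star q (a q)) = a q
      rw [star_a, star_d]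
    · change star q (star q (b q)) = b q
      rw [star_b, star_smul, star_c, smul_smul]
      simp [hq]
    · change star q (star q (c q)) = c q
      rw [star_c, star_smul, star_b, smul_smul]
      simp [hq]
    · change star q (star q (d q)) = d q
      rw [star_d, star_a]
    · change star q (star q (l q f)) = l q f
      rw [star_l, star_l, bar_bar]
    · change star q (star q (r q f)) = r q f
      rw [star_r, star_r, bar_bar]
  | const z => simp [star_algebraMap]
  | mul x y hx hy => rw [star_mul, star_mul, hx, hy]
  | add x y hx hy => rw [star_add, star_add, hx, hy]

/-! ### Normal form: functions of `λ`, then functions of `μ`, then generators. -/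

section NormalForm

variable (f g : Mer) (x : FSL2 q)

lemma a_l_assoc : a q * (l q f * x) = l q (shift (-1) f) * (a q * x) := by
  rw [← mul_assoc, a_l, mul_assoc]
lemma a_r_assoc : a q * (r q f * x) = r q (shift (-1) f) * (a q * x) := by
  rw [← mul_assoc, a_r, mul_assoc]
lemma b_l_assoc : b q * (l q f * x) = l q (shift (-1) f) * (b q * x) := by
  rw [← mul_assoc, b_l, mul_assoc]
lemma b_r_assoc : b q * (r q f * x) = r q (shift 1 f) * (b q * x) := by
  rw [← mul_assoc, b_r, mul_assoc]
lemma c_l_assoc : c q * (l q f * x) = l q (shift 1 f) * (c q * x) := by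
  rw [← mul_assoc, c_l, mul_assoc]
lemma c_r_assoc : c q * (r q f * x) = r q (shift (-1) f) * (c q * x) := by
  rw [← mul_assoc, c_r, mul_assoc]
lemma d_l_assoc : d q * (l q f * x) = l q (shift 1 f) * (d q * x) := by
  rw [← mul_assoc, d_l, mul_assoc]
lemma d_r_assoc : d q * (r q f * x) = r q (shift 1 f) * (d q * x) := by
  rw [← mul_assoc, d_r, mul_assoc]
lemma r_l : r q f * l q g = l q g * r q f := ((data q).lr g f).symm
lemma r_l_assoc : r q f * (l q g * x) = l q g * (r q f * x) := by
  rw [← mul_assoc, r_l, mul_assoc]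
lemma l_l : l q f * l q g = l q (f * g) := (map_mul _ _ _).symm
lemma r_r : r q f * r q g = r q (f * g) := (map_mul _ _ _).symm
lemma l_l_assoc : l q f * (l q g * x) = l q (f * g) * x := by
  rw [← mul_assoc, l_l]
lemma r_r_assoc : r q f * (r q g * x) = r q (f * g) * x := by
  rw [← mul_assoc, r_r]

end NormalForm

lemma shift_neg (α : ℂ) (f : Mer) : shift α (-f) = -shift α f := map_neg _ _

/-- `Φ(λ-1)`, where `Φ = qF`. -/
noncomputable def phi₁ : Mer := shift (-1) (fPhi q)

lemma phi₁_mul_psi : phi₁ q * fPsi q = 1 := shift_fPhi_mul_fPsi q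

lemma shift_phi₁ : shift 1 (phi₁ q) = fPhi q := shift_cancel _

lemma phi_mul_shift_psi : fPhi q * shift 1 (fPsi q) = 1 := by
  rw [← shift_phi₁, ← map_mul, phi₁_mul_psi, map_one]

lemma shift_psi_mul_phi : shift 1 (fPsi q) * fPhi q = 1 := by
  rw [mul_comm, phi_mul_shift_psi]

lemma psi_mul_phi₁ : fPsi q * phi₁ q = 1 := by
  rw [mul_comm, phi₁_mul_psi]

lemma ab_eq : a q * b q = r q (phi₁ q) * (b q * a q) := (data q).ab
lemma ac_eq : a q * c q = l q (fPhi q) * (c q * a q) := (data q).ac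
lemma bd_eq : b q * d q = l q (fPhi q) * (d q * b q) := (data q).bd
lemma cd_eq : c q * d q = r q (phi₁ q) * (d q * c q) := (data q).cd
lemma ad_eq : a q * d q = 1 + l q (fPhi q) * (c q * b q) := (data q).ad
lemma da_eq : d q * a q = 1 + r q (fPsi q) * (c q * b q) := (data q).da
lemma bc_eq : b q * c q = l q (fPhi q) - r q (fPhi q) +
    l q (fPhi q) * (r q (fPsi q) * (c q * b q)) := (data q).bc

/-- `S(β)` and `S(γ)` both carry a sign; the signs cancel where the two elements are multiplied. -/
lemma neg_l_neg_r (f g : Mer) (x : FSL2 q) :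
    l q (-f) * (r q (-g) * x) = l q f * (r q g * x) := by
  rw [← neg_one_smul ℂ f, ← neg_one_smul ℂ g, _root_.map_smul, _root_.map_smul, smul_mul_assoc,
    smul_mul_assoc, mul_smul_comm, smul_smul, neg_one_mul, neg_neg, one_smul]

open MulOpposite in
/-- The antipode, on the generators. -/
noncomputable def antipodeData : SLData q (FSL2 q)ᵐᵒᵖ where
  a := op (d q * (l q (phi₁ q) * r q (fPsi q)))
  b := op (b q * r q (-fPsi q))
  c := op (c q * l q (-phi₁ q))
  d := op (a q)
  l := (r q).toOpposite fun f g => by rw [Commute, SemiconjBy, ← map_mul, mul_comm, map_mul]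
  r := (l q).toOpposite fun f g => by rw [Commute, SemiconjBy, ← map_mul, mul_comm, map_mul]
  lr f g := unop_injective <| by
    simp only [unop_mul, unop_op, unop_neg, unop_add, unop_sub, unop_one, AlgHom.toOpposite_apply, Function.comp_apply, shift_neg, neg_mul, mul_neg, neg_neg, mul_assoc, a_l, a_r, b_l, b_r, c_l, c_r, d_l, d_r, a_l_assoc, a_r_assoc, b_l_assoc, b_r_assoc, c_l_assoc, c_r_assoc, d_l_assoc, d_r_assoc, r_l, r_l_assoc, l_l, r_r, l_l_assoc, r_r_assoc, shift_shift, shift_phi₁, ab_eq, ac_eq, bd_eq, cd_eq]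
  la f := unop_injective <| by
    simp only [unop_mul, unop_op, unop_neg, unop_add, unop_sub, unop_one, AlgHom.toOpposite_apply, Function.comp_apply, shift_neg, neg_mul, mul_neg, neg_neg, mul_assoc, a_l, a_r, b_l, b_r, c_l, c_r, d_l, d_r, a_l_assoc, a_r_assoc, b_l_assoc, b_r_assoc, c_l_assoc, c_r_assoc, d_l_assoc, d_r_assoc, r_l, r_l_assoc, l_l, r_r, l_l_assoc, r_r_assoc, shift_shift, shift_phi₁, ab_eq, ac_eq, bd_eq, cd_eq]
    rw [mul_comm (shift 1 f)]
  ra f := unop_injective <| by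
    simp only [unop_mul, unop_op, unop_neg, unop_add, unop_sub, unop_one, AlgHom.toOpposite_apply, Function.comp_apply, shift_neg, neg_mul, mul_neg, neg_neg, mul_assoc, a_l, a_r, b_l, b_r, c_l, c_r, d_l, d_r, a_l_assoc, a_r_assoc, b_l_assoc, b_r_assoc, c_l_assoc, c_r_assoc, d_l_assoc, d_r_assoc, r_l, r_l_assoc, l_l, r_r, l_l_assoc, r_r_assoc, shift_shift, shift_phi₁, ab_eq, ac_eq, bd_eq, cd_eq]
    rw [mul_comm (shift 1 f)]
  lb f := unop_injective <| by
    simp only [unop_mul, unop_op, unop_neg, unop_add, unop_sub, unop_one, AlgHom.toOpposite_apply, Function.comp_apply, shift_neg, neg_mul, mul_neg, neg_neg, mul_assoc, a_l, a_r, b_l, b_r, c_l, c_r, d_l, d_r, a_l_assoc, a_r_assoc, b_l_assoc, b_r_assoc, c_l_assoc, c_r_assoc, d_l_assoc, d_r_assoc, r_l, r_l_assoc, l_l, r_r, l_l_assoc, r_r_assoc, shift_shift, shift_phi₁, ab_eq, ac_eq, bd_eq, cd_eq]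
    rw [mul_comm (shift 1 f)]
  rb f := unop_injective <| by
    simp only [unop_mul, unop_op, unop_neg, unop_add, unop_sub, unop_one, AlgHom.toOpposite_apply, Function.comp_apply, shift_neg, neg_mul, mul_neg, neg_neg, mul_assoc, a_l, a_r, b_l, b_r, c_l, c_r, d_l, d_r, a_l_assoc, a_r_assoc, b_l_assoc, b_r_assoc, c_l_assoc, c_r_assoc, d_l_assoc, d_r_assoc, r_l, r_l_assoc, l_l, r_r, l_l_assoc, r_r_assoc, shift_shift, shift_phi₁, ab_eq, ac_eq, bd_eq, cd_eq]
  lc f := unop_injective <| by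
    simp only [unop_mul, unop_op, unop_neg, unop_add, unop_sub, unop_one, AlgHom.toOpposite_apply, Function.comp_apply, shift_neg, neg_mul, mul_neg, neg_neg, mul_assoc, a_l, a_r, b_l, b_r, c_l, c_r, d_l, d_r, a_l_assoc, a_r_assoc, b_l_assoc, b_r_assoc, c_l_assoc, c_r_assoc, d_l_assoc, d_r_assoc, r_l, r_l_assoc, l_l, r_r, l_l_assoc, r_r_assoc, shift_shift, shift_phi₁, ab_eq, ac_eq, bd_eq, cd_eq]
  rc f := unop_injective <| by
    simp only [unop_mul, unop_op, unop_neg, unop_add, unop_sub, unop_one, AlgHom.toOpposite_apply, Function.comp_apply, shift_neg, neg_mul, mul_neg, neg_neg, mul_assoc, a_l, a_r, b_l, b_r, c_l, c_r, d_l, d_r, a_l_assoc, a_r_assoc, b_l_assoc, b_r_assoc, c_l_assoc, c_r_assoc, d_l_assoc, d_r_assoc, r_l, r_l_assoc, l_l, r_r, l_l_assoc, r_r_assoc, shift_shift, shift_phi₁, ab_eq, ac_eq, bd_eq, cd_eq]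
    rw [mul_comm (shift 1 f)]
  ld f := unop_injective <| by
    simp only [unop_mul, unop_op, unop_neg, unop_add, unop_sub, unop_one, AlgHom.toOpposite_apply, Function.comp_apply, shift_neg, neg_mul, mul_neg, neg_neg, mul_assoc, a_l, a_r, b_l, b_r, c_l, c_r, d_l, d_r, a_l_assoc, a_r_assoc, b_l_assoc, b_r_assoc, c_l_assoc, c_r_assoc, d_l_assoc, d_r_assoc, r_l, r_l_assoc, l_l, r_r, l_l_assoc, r_r_assoc, shift_shift, shift_phi₁, ab_eq, ac_eq, bd_eq, cd_eq]
  rd f := unop_injective <| by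
    simp only [unop_mul, unop_op, unop_neg, unop_add, unop_sub, unop_one, AlgHom.toOpposite_apply, Function.comp_apply, shift_neg, neg_mul, mul_neg, neg_neg, mul_assoc, a_l, a_r, b_l, b_r, c_l, c_r, d_l, d_r, a_l_assoc, a_r_assoc, b_l_assoc, b_r_assoc, c_l_assoc, c_r_assoc, d_l_assoc, d_r_assoc, r_l, r_l_assoc, l_l, r_r, l_l_assoc, r_r_assoc, shift_shift, shift_phi₁, ab_eq, ac_eq, bd_eq, cd_eq]
  ab := unop_injective <| by
    simp only [unop_mul, unop_op, unop_neg, unop_add, unop_sub, unop_one, AlgHom.toOpposite_apply, Function.comp_apply, shift_neg, neg_mul, mul_neg, neg_neg, mul_assoc, a_l, a_r, b_l, b_r, c_l, c_r, d_l, d_r, a_l_assoc, a_r_assoc, b_l_assoc, b_r_assoc, c_l_assoc, c_r_assoc, d_l_assoc, d_r_assoc, r_l, r_l_assoc, l_l, r_r, l_l_assoc, r_r_assoc, shift_shift, shift_phi₁, ab_eq, ac_eq, bd_eq, cd_eq]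
    rw [show (1 : ℂ) + (-1 + -1) = -1 by norm_num, mul_comm (shift (-1) (fPhi q))]
  ac := unop_injective <| by
    simp only [unop_mul, unop_op, unop_neg, unop_add, unop_sub, unop_one, AlgHom.toOpposite_apply, Function.comp_apply, shift_neg, neg_mul, mul_neg, neg_neg, mul_assoc, a_l, a_r, b_l, b_r, c_l, c_r, d_l, d_r, a_l_assoc, a_r_assoc, b_l_assoc, b_r_assoc, c_l_assoc, c_r_assoc, d_l_assoc, d_r_assoc, r_l, r_l_assoc, l_l, r_r, l_l_assoc, r_r_assoc, shift_shift, shift_phi₁, ab_eq, ac_eq, bd_eq, cd_eq]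
    rw [neg_add_cancel, add_neg_cancel, shift_zero, shift_zero, shift_psi_mul_phi, psi_mul_phi₁]
  bd := unop_injective <| by
    simp only [unop_mul, unop_op, unop_neg, unop_add, unop_sub, unop_one, AlgHom.toOpposite_apply, Function.comp_apply, shift_neg, neg_mul, mul_neg, neg_neg, mul_assoc, a_l, a_r, b_l, b_r, c_l, c_r, d_l, d_r, a_l_assoc, a_r_assoc, b_l_assoc, b_r_assoc, c_l_assoc, c_r_assoc, d_l_assoc, d_r_assoc, r_l, r_l_assoc, l_l, r_r, l_l_assoc, r_r_assoc, shift_shift, shift_phi₁, ab_eq, ac_eq, bd_eq, cd_eq]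
    rw [neg_add_cancel, add_neg_cancel, shift_zero, shift_zero, shift_psi_mul_phi, psi_mul_phi₁]
  cd := unop_injective <| by
    simp only [unop_mul, unop_op, unop_neg, unop_add, unop_sub, unop_one, AlgHom.toOpposite_apply, Function.comp_apply, shift_neg, neg_mul, mul_neg, neg_neg, mul_assoc, a_l, a_r, b_l, b_r, c_l, c_r, d_l, d_r, a_l_assoc, a_r_assoc, b_l_assoc, b_r_assoc, c_l_assoc, c_r_assoc, d_l_assoc, d_r_assoc, r_l, r_l_assoc, l_l, r_r, l_l_assoc, r_r_assoc, shift_shift, shift_phi₁, ab_eq, ac_eq, bd_eq, cd_eq]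
    rw [show (1 : ℂ) + (-1 + -1) = -1 by norm_num, mul_comm (shift (-1) (fPhi q))]
  ad := unop_injective <| by
    simp only [unop_mul, unop_op, unop_neg, unop_add, unop_sub, unop_one, AlgHom.toOpposite_apply, Function.comp_apply, shift_neg, neg_mul, mul_neg, neg_neg, mul_assoc, a_l, a_r, b_l, b_r, c_l, c_r, d_l, d_r, a_l_assoc, a_r_assoc, b_l_assoc, b_r_assoc, c_l_assoc, c_r_assoc, d_l_assoc, d_r_assoc, r_l, r_l_assoc, l_l, r_r, l_l_assoc, r_r_assoc, shift_shift, shift_phi₁, ab_eq, ac_eq, bd_eq, cd_eq]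
    -- The image of the relation for `αδ` is `rel₂` divided by `Ψ(λ)`, whose inverse is `Φ(λ-1)`.
    have h := congrArg (l q (phi₁ q) * ·) (rel₂ q)
    simp only [mul_add, l_l, phi₁_mul_psi, map_one] at h
    rw [neg_add_cancel, add_neg_cancel, shift_zero, shift_zero, shift_psi_mul_phi, neg_l_neg_r]
    change l q (phi₁ q) * _ = 1 + l q (phi₁ q) * _
    rw [← h, add_comm, map_one, one_mul]
  da := unop_injective <| by
    simp only [unop_mul, unop_op, unop_neg, unop_add, unop_sub, unop_one, AlgHom.toOpposite_apply, Function.comp_apply, shift_neg, neg_mul, mul_neg, neg_neg, mul_assoc, a_l, a_r, b_l, b_r, c_l, c_r, d_l, d_r, a_l_assoc, a_r_assoc, b_l_assoc, b_r_assoc, c_l_assoc, c_r_assoc, d_l_assoc, d_r_assoc, r_l, r_l_assoc, l_l, r_r, l_l_assoc, r_r_assoc, shift_shift, shift_phi₁, ab_eq, ac_eq, bd_eq, cd_eq]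
    -- The image of the relation for `δα` is `rel₃` divided by `Φ(μ)`, whose inverse is `Ψ(μ+1)`.
    have h := congrArg (r q (shift 1 (fPsi q)) * ·) (rel₃ q)
    simp only [mul_add, r_r, shift_psi_mul_phi, map_one] at h
    rw [neg_add_cancel, shift_zero, shift_fPhi_mul_fPsi, ← r_l_assoc, ← h, neg_l_neg_r, map_one,
      one_mul]
  bc := unop_injective <| by
    simp only [unop_mul, unop_op, unop_neg, unop_add, unop_sub, unop_one, AlgHom.toOpposite_apply, Function.comp_apply, shift_neg, neg_mul, mul_neg, neg_neg, mul_assoc, a_l, a_r, b_l, b_r, c_l, c_r, d_l, d_r, a_l_assoc, a_r_assoc, b_l_assoc, b_r_assoc, c_l_assoc, c_r_assoc, d_l_assoc, d_r_assoc, r_l, r_l_assoc, l_l, r_r, l_l_assoc, r_r_assoc, shift_shift, shift_phi₁, ab_eq, ac_eq, bd_eq, cd_eq]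
    rw [neg_add_cancel, add_neg_cancel, shift_zero, shift_zero, shift_psi_mul_phi,
      shift_fPhi_mul_fPsi, bc_eq, neg_l_neg_r, neg_l_neg_r, map_one, map_one, one_mul, one_mul]
    abel

end FSL2

end DynSU2

namespace DynSU2

open Polynomial Mer

variable (q : Set.Ioo (0 : ℝ) 1)

namespace FSL2

/-- The antipode. -/
noncomputable def antipode (x : FSL2 q) : FSL2 q := ((antipodeData q).lift x).unop

section Antipode

variable (x y : FSL2 q) (f : Mer)

lemma antipode_mul : antipode q (x * y) = antipode q y * antipode q x := by
  rw [antipode, map_mul]; rfl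

lemma antipode_add : antipode q (x + y) = antipode q x + antipode q y := by
  rw [antipode, map_add]; rfl

lemma antipode_zero : antipode q 0 = 0 := by rw [antipode, map_zero]; rfl
lemma antipode_one : antipode q 1 = 1 := by rw [antipode, map_one]; rfl

lemma antipode_a : antipode q (a q) = d q * (l q (phi₁ q) * r q (fPsi q)) := by
  rw [antipode, SLData.lift_a]; rfl
lemma antipode_b : antipode q (b q) = b q * r q (-fPsi q) := by
  rw [antipode, SLData.lift_b]; rfl
lemma antipode_c : antipode q (c q) = c q * l q (-phi₁ q) := by
  rw [antipode, SLData.lift_c]; rfl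
lemma antipode_d : antipode q (d q) = a q := by
  rw [antipode, SLData.lift_d]; rfl
lemma antipode_l : antipode q (l q f) = r q f := by
  rw [antipode, SLData.lift_l]; rfl
lemma antipode_r : antipode q (r q f) = l q f := by
  rw [antipode, SLData.lift_r]; rfl

end Antipode

/-- The antilinear automorphism `τ = * ∘ S`, which transposes the matrix elements. -/
noncomputable def tau (x : FSL2 q) : FSL2 q := star q (antipode q x)

lemma bar_phi₁ : bar (phi₁ q) = phi₁ q := by
  rw [phi₁, bar_shift, bar_fPhi]; simp

section Tau

variable (x y : FSL2 q) (f : Mer)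

lemma tau_mul : tau q (x * y) = tau q x * tau q y := by
  rw [tau, antipode_mul, star_mul]; rfl
lemma tau_add : tau q (x + y) = tau q x + tau q y := by
  rw [tau, antipode_add, star_add]; rfl
lemma tau_zero : tau q 0 = 0 := by rw [tau, antipode_zero, star_zero]
lemma tau_one : tau q 1 = 1 := by rw [tau, antipode_one, star_one]

lemma smul_l_mul (z : ℂ) : z • (l q f * x) = l q (z • f) * x := by
  rw [_root_.map_smul, smul_mul_assoc]
lemma smul_r_mul (z : ℂ) : z • (r q f * x) = r q (z • f) * x := by
  rw [_root_.map_smul, smul_mul_assoc]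

lemma tau_a : tau q (a q) = l q (phi₁ q) * (r q (fPsi q) * a q) := by
  rw [tau, antipode_a, star_mul, star_mul, star_d, star_l, star_r, bar_phi₁, bar_fPsi, r_l,
    mul_assoc]
lemma tau_b : tau q (b q) = ((q : ℝ) : ℂ) • (r q (fPsi q) * c q) := by
  rw [tau, antipode_b, star_mul, star_b, star_r, map_neg bar, bar_fPsi, mul_smul_comm, smul_r_mul,
    neg_smul, smul_neg, neg_neg, smul_r_mul]
lemma tau_c : tau q (c q) = ((q : ℝ) : ℂ)⁻¹ • (l q (phi₁ q) * b q) := by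
  rw [tau, antipode_c, star_mul, star_c, star_l, map_neg bar, bar_phi₁, mul_smul_comm, smul_l_mul,
    neg_smul, smul_neg, neg_neg, smul_l_mul]
lemma tau_d : tau q (d q) = d q := by rw [tau, antipode_d, star_a]
lemma tau_l : tau q (l q f) = r q (bar f) := by rw [tau, antipode_l, star_r]
lemma tau_r : tau q (r q f) = l q (bar f) := by rw [tau, antipode_r, star_l]

lemma antipode_eq : antipode q x = star q (tau q x) := (star_star q _).symm

end Tau

/-- The map `x ⊗ y ↦ τ(y) ⊗ τ(x)`. -/
noncomputable def flipTau : TT q →+ TT q := TensorProduct.liftAddHom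
  (AddMonoidHom.mk' (fun s : FRight q => AddMonoidHom.mk'
      (fun t : FLeft q => tm (tau q t.out) (tau q s.out))
      (fun t t' => by rw [← tm_add_left, ← tau_add]; rfl))
    (fun s s' => by
      ext t
      change tm (tau q t.out) (tau q (s.out + s'.out)) =
        tm (tau q t.out) (tau q s.out) + tm (tau q t.out) (tau q s'.out)
      rw [← tm_add_right, tau_add]))
  (fun f s t => by
    change tm (tau q t.out) (tau q (r q f * s.out)) = tm (tau q (l q f * t.out)) (tau q s.out)
    rw [tau_mul, tau_mul, tau_l, tau_r, tm_balance])

lemma flipTau_tm (x y : FSL2 q) : flipTau q (tm x y) = tm (tau q y) (tau q x) := rfl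

variable {q} in
lemma tt_induction {P : TT q → Prop} (tm : ∀ x y, P (tm x y)) (add : ∀ x y, P x → P y → P (x + y))
    (t : TT q) : P t := by
  induction t using TensorProduct.induction_on with
  | zero => simpa using tm 0 0
  | tmul x y => exact tm x y
  | add s t hs ht => exact add s t hs ht

/-- Compatibility of `x` with the coproduct and the transposition. -/
def FlipCompat (x : FSL2 q) : Prop :=
  ∀ z, flipTau q (delta q x z) = delta q (tau q x) (flipTau q z)

variable {q} in
lemma FlipCompat.of_tm {x : FSL2 q} (h : ∀ s u, flipTau q (delta q x (tm s u)) =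
    delta q (tau q x) (tm (tau q u) (tau q s))) : FlipCompat q x := fun z => by
  induction z using tt_induction with
  | tm s u => exact h s u
  | add s t hs ht => simp only [map_add, hs, ht]

variable {q} in
-- Both `delta` and `tau` are multiplicative, so compatibility only has to be verified on
-- generators.
lemma FlipCompat.mul {x y : FSL2 q} (hx : FlipCompat q x) (hy : FlipCompat q y) :
    FlipCompat q (x * y) := fun z => by
  rw [map_mul, Module.End.mul_apply, hx, hy, tau_mul, map_mul, Module.End.mul_apply]

variable {q} in
lemma FlipCompat.add {x y : FSL2 q} (hx : FlipCompat q x) (hy : FlipCompat q y) :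
    FlipCompat q (x + y) := fun z => by
  rw [map_add, LinearMap.add_apply, map_add, hx, hy, tau_add, map_add, LinearMap.add_apply]

lemma flipCompat_zero : FlipCompat q 0 := fun z => by
  rw [tau_zero, map_zero, LinearMap.zero_apply, LinearMap.zero_apply, map_zero]

lemma flipCompat_one : FlipCompat q 1 := fun z => by
  rw [tau_one, map_one]; rfl

lemma flipCompat_r (f : Mer) : FlipCompat q (r q f) := .of_tm fun s u => by
  rw [delta_r, flipTau_tm, tau_mul, tau_r, delta_l]

lemma delta_mul (x y : FSL2 q) (z : TT q) : delta q (x * y) z = delta q x (delta q y z) := by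
  rw [map_mul]; rfl

lemma delta_smul (t : ℂ) (x : FSL2 q) (z : TT q) : delta q (t • x) z = t • delta q x z := by
  rw [_root_.map_smul]; rfl

lemma flipCompat_a : FlipCompat q (a q) := .of_tm fun s u => by
  have hq := q_ne q
  rw [delta_a, map_add, flipTau_tm, flipTau_tm]
  simp only [tau_mul, tau_a, tau_b, tau_c, delta_mul, delta_a, map_add, delta_r, delta_l,
    mul_assoc, smul_mul_assoc, tm_smul_left, tm_smul_right, smul_smul, mul_inv_cancel₀ hq, one_smul]
  congr 1
  -- The inner factors `Ψ(μ)` and `Φ(λ-1)` meet across the tensor sign and cancel.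
  rw [← r_l_assoc, tm_balance, l_l_assoc, psi_mul_phi₁, map_one, one_mul]

lemma flipCompat_b : FlipCompat q (b q) := .of_tm fun s u => by
  rw [delta_b, map_add, flipTau_tm, flipTau_tm]
  simp only [tau_mul, tau_a, tau_b, tau_d, delta_mul, delta_smul, delta_c, map_add, delta_r,
    mul_assoc, smul_mul_assoc, tm_smul_left, tm_smul_right, smul_add]
  congr 2
  rw [tm_balance, l_l_assoc, psi_mul_phi₁, map_one, one_mul]

lemma flipCompat_c : FlipCompat q (c q) := .of_tm fun s u => by
  rw [delta_c, map_add, flipTau_tm, flipTau_tm]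
  simp only [tau_mul, tau_a, tau_d, tau_c, delta_mul, delta_smul, delta_b, map_add, delta_l,
    mul_assoc, smul_mul_assoc, tm_smul_left, tm_smul_right, smul_add]
  congr 2
  rw [← r_l_assoc, tm_balance, l_l_assoc, psi_mul_phi₁, map_one, one_mul]

lemma flipCompat_d : FlipCompat q (d q) := .of_tm fun s u => by
  have hq := q_ne q
  rw [delta_d, map_add, flipTau_tm, flipTau_tm]
  simp only [tau_mul, tau_b, tau_d, tau_c, delta_d, mul_assoc, smul_mul_assoc, tm_smul_left,
    tm_smul_right, smul_smul, inv_mul_cancel₀ hq, one_smul]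
  congr 1
  rw [tm_balance, l_l_assoc, psi_mul_phi₁, map_one, one_mul]

/-- The recursion involves only `α`, `β`, `γ`, `δ` and functions of `μ`, for which compatibility is
already known. -/
lemma flipCompat_matEl {N k : ℕ} (hk : k ≤ N) (j : ℕ) : FlipCompat q (matEl q N k j) := by
  induction N generalizing k j with
  | zero =>
    rcases j with _ | j
    · rw [matEl_zero_zero]; exact flipCompat_one q
    · rw [matEl_of_lt q k (by omega)]; exact flipCompat_zero q
  | succ N ih =>
    rcases Nat.lt_or_ge N k with h | h
    · obtain rfl : k = N + 1 := by omega
      rcases j with _ | j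
      · rw [matEl_top_zero]; exact (flipCompat_b q).mul (ih le_rfl 0)
      · rw [matEl_top_succ]
        exact ((flipCompat_b q).mul (ih le_rfl _)).add
          ((flipCompat_r q _).mul ((flipCompat_a q).mul (ih le_rfl j)))
    · rcases j with _ | j
      · rw [matEl_succ_zero q h]; exact (flipCompat_d q).mul (ih h 0)
      · rw [matEl_succ_succ q h]
        exact ((flipCompat_d q).mul (ih h _)).add
          ((flipCompat_r q _).mul ((flipCompat_c q).mul (ih h j)))

/-- The map `x ⊗ y ↦ S(x) y`. -/
noncomputable def contract : TT q →+ FSL2 q := TensorProduct.liftAddHom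
  (AddMonoidHom.mk' (fun s : FRight q => AddMonoidHom.mk'
      (fun t : FLeft q => antipode q s.out * t.out)
      (fun t t' => by rw [← mul_add]; rfl))
    (fun s s' => by
      ext t
      change antipode q (s.out + s'.out) * t.out =
        antipode q s.out * t.out + antipode q s'.out * t.out
      rw [← add_mul, antipode_add]))
  (fun f s t => by
    change antipode q (r q f * s.out) * t.out = antipode q s.out * (l q f * t.out)
    rw [antipode_mul, antipode_r, mul_assoc])

lemma contract_tm (x y : FSL2 q) : contract q (tm x y) = antipode q x * y := rfl

lemma l_neg_mul (f : Mer) (x : FSL2 q) : l q (-f) * x = 0 - l q f * x := by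
  rw [eq_sub_iff_add_eq, ← add_mul, ← map_add, neg_add_cancel, map_zero, zero_mul]

lemma r_neg_mul (f : Mer) (x : FSL2 q) : r q (-f) * x = 0 - r q f * x := by
  rw [eq_sub_iff_add_eq, ← add_mul, ← map_add, neg_add_cancel, map_zero, zero_mul]

/-! ### The antipode axioms for the two by two matrix of generators. -/

lemma antipode_left_a : antipode q (a q) * a q + antipode q (b q) * c q = 1 := by
  have h := congrArg (r q (shift 1 (fPsi q)) * ·) (rel₃ q)
  simp only [mul_add, r_r, shift_psi_mul_phi, map_one] at h
  rw [antipode_a, antipode_b]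
  simp only [mul_assoc, d_l_assoc, d_r_assoc, b_r_assoc, shift_phi₁, shift_neg]
  rw [← r_l_assoc, ← h]
  simp only [l_neg_mul, r_neg_mul, mul_sub, mul_zero]
  abel

lemma antipode_left_b : antipode q (a q) * b q + antipode q (b q) * d q = 0 := by
  rw [antipode_a, antipode_b]
  simp only [mul_assoc, d_l_assoc, d_r_assoc, b_r_assoc, shift_phi₁, shift_neg, bd_eq,
    r_l_assoc]
  simp only [l_neg_mul, r_neg_mul, mul_sub, mul_zero]
  abel

lemma antipode_left_c : antipode q (c q) * a q + antipode q (d q) * c q = 0 := by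
  rw [antipode_c, antipode_d]
  simp only [mul_assoc, c_l_assoc, shift_phi₁, shift_neg, ac_eq]
  simp only [l_neg_mul, r_neg_mul, mul_sub, mul_zero]
  abel

lemma antipode_left_d : antipode q (c q) * b q + antipode q (d q) * d q = 1 := by
  rw [antipode_c, antipode_d]
  simp only [mul_assoc, c_l_assoc, shift_phi₁, shift_neg, ad_eq]
  simp only [l_neg_mul, r_neg_mul, mul_sub, mul_zero]
  abel

lemma antipode_right_d : d q * antipode q (d q) + c q * antipode q (b q) = 1 := by
  rw [antipode_b, antipode_d]
  simp only [b_r, c_r_assoc, shift_cancel', shift_neg, da_eq]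
  simp only [l_neg_mul, r_neg_mul, mul_sub, mul_zero]
  abel

lemma antipode_right_c : d q * antipode q (c q) + c q * antipode q (a q) = 0 := by
  rw [antipode_a, antipode_c]
  simp only [mul_assoc, c_l, d_l, d_r, d_l_assoc, d_r_assoc, c_l_assoc, c_r_assoc, r_l_assoc, r_l,
    shift_cancel', shift_neg, cd_eq, r_r_assoc, neg_mul, psi_mul_phi₁, map_one, one_mul]
  simp only [l_neg_mul, r_neg_mul, mul_sub, mul_zero]
  abel

lemma antipode_right_b : b q * antipode q (d q) + a q * antipode q (b q) = 0 := by
  rw [antipode_b, antipode_d]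
  simp only [b_r, a_r_assoc, shift_cancel', shift_neg, ab_eq, r_r_assoc, neg_mul, psi_mul_phi₁,
    map_one, one_mul]
  simp only [r_neg_mul, map_one, one_mul]
  abel

lemma antipode_right_a : b q * antipode q (c q) + a q * antipode q (a q) = 1 := by
  have h := congrArg (l q (phi₁ q) * ·) (rel₂ q)
  simp only [mul_add, l_l, phi₁_mul_psi, map_one] at h
  rw [antipode_a, antipode_c]
  simp only [mul_assoc, c_l, d_l, d_r, d_l_assoc, d_r_assoc, b_l_assoc, a_l_assoc, a_r_assoc,
    r_l_assoc, r_l, shift_cancel', shift_neg, ← h]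
  simp only [l_neg_mul, r_neg_mul, mul_sub, mul_zero]
  abel

/-! ### The orthogonality relations in the algebra -/

section Contract

variable (z : TT q)

/-- The antipode cancels from the inside: `S(αs) αu + S(βs) γu = S(s) (S(α)α + S(β)γ) u`. The other
three generators are treated in the same way. -/
lemma contract_a : contract q (delta q (a q) z) = contract q z := by
  induction z using tt_induction with
  | tm s u =>
    rw [delta_a, map_add, contract_tm, contract_tm, contract_tm, antipode_mul, antipode_mul,
      mul_assoc, mul_assoc, ← mul_add, ← mul_assoc, ← mul_assoc, ← add_mul, antipode_left_a,
      one_mul]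
  | add s t hs ht => rw [map_add, map_add, hs, ht, map_add]

lemma contract_b : contract q (delta q (b q) z) = 0 := by
  induction z using tt_induction with
  | tm s u =>
    rw [delta_b, map_add, contract_tm, contract_tm, antipode_mul, antipode_mul,
      mul_assoc, mul_assoc, ← mul_add, ← mul_assoc, ← mul_assoc, ← add_mul, antipode_left_b,
      zero_mul, mul_zero]
  | add s t hs ht => rw [map_add, map_add, hs, ht, add_zero]

lemma contract_c : contract q (delta q (c q) z) = 0 := by
  induction z using tt_induction with
  | tm s u =>
    rw [delta_c, map_add, contract_tm, contract_tm, antipode_mul, antipode_mul,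
      mul_assoc, mul_assoc, ← mul_add, ← mul_assoc, ← mul_assoc, ← add_mul, antipode_left_c,
      zero_mul, mul_zero]
  | add s t hs ht => rw [map_add, map_add, hs, ht, add_zero]

lemma contract_d : contract q (delta q (d q) z) = contract q z := by
  induction z using tt_induction with
  | tm s u =>
    rw [delta_d, map_add, contract_tm, contract_tm, contract_tm, antipode_mul, antipode_mul,
      mul_assoc, mul_assoc, ← mul_add, ← mul_assoc, ← mul_assoc, ← add_mul, antipode_left_d,
      one_mul]
  | add s t hs ht => rw [map_add, map_add, hs, ht, map_add]

/-- After contraction only the counit of a matrix element is left, and it is `δ_{kj}`. Keeping `z`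
arbitrary is what makes the induction possible, since inner factors of a product act on `z` first.
-/
lemma contract_matEl {N k : ℕ} (hk : k ≤ N) (j : ℕ) :
    contract q (delta q (matEl q N k j) z) = if k = j then contract q z else 0 := by
  have hrc : ∀ f, r q f * c q = c q * r q (shift 1 f) := (data q).rc
  have hra : ∀ f, r q f * a q = a q * r q (shift 1 f) := (data q).ra
  induction N generalizing k j z with
  | zero =>
    obtain rfl : k = 0 := by omega
    rcases j with _ | j
    · simp [matEl_zero_zero]
    · simp [matEl_of_lt]
  | succ N ih =>
    rcases Nat.lt_or_ge N k with h | h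
    · obtain rfl : k = N + 1 := by omega
      rcases j with _ | j
      · rw [matEl_top_zero, delta_mul, contract_b, if_neg (by omega)]
      · rw [matEl_top_succ, map_add, LinearMap.add_apply, map_add, delta_mul, contract_b, zero_add,
          ← mul_assoc, hra, mul_assoc, delta_mul, contract_a]
        rcases eq_or_ne N j with rfl | hj
        · rw [Nat.sub_self, prodPhi_zero, map_one, map_one, one_mul, ih _ le_rfl, if_pos rfl,
            if_pos rfl]
        -- The function of `μ`, already moved past `α`, is moved past the matrix element by its
        -- weight and absorbed into `z`; the induction hypothesis then gives `0`.
        · have h1 := (matEl_weight q (le_refl N) j (shift (-(N - 2 * j)) (shift 1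
            (prodPhi q (N - j))))).2
          rw [shift_shift (N - 2 * j), add_neg_cancel, shift_zero] at h1
          rw [← h1, delta_mul, ih _ le_rfl, if_neg hj, if_neg (by omega)]
    · rcases j with _ | j
      · rw [matEl_succ_zero q h, delta_mul, contract_d, ih _ h]
      · rw [matEl_succ_succ q h, map_add, LinearMap.add_apply, map_add, delta_mul, contract_d,
          ← mul_assoc, hrc, mul_assoc, delta_mul, contract_c, add_zero, ih _ h]

end Contract

/-- Contraction of the coproduct of a matrix element, acting on `1 ⊗ 1`. -/
lemma sum_antipode_mul {N k : ℕ} (hk : k ≤ N) (l : ℕ) :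
    ∑ j ∈ Finset.range (N + 1), antipode q (matEl q N k j) * matEl q N j l =
      if k = l then 1 else 0 := by
  have h := contract_matEl q (tm 1 1) hk l
  rw [delta_matEl q hk, map_sum, contract_tm, antipode_one] at h
  simpa only [mul_one, contract_tm] using h

/-- The map `x ⊗ y ↦ x S(y)` does not respect the relations `f(μ)x ⊗ y = x ⊗ f(λ)y`: the function
lands on the left of the product in one case and on its right in the other. The contraction argument
is therefore replaced by induction on `N`, expanding both `t` and `S(t)` by their recursions. -/
lemma sum_mul_antipode {N k : ℕ} (hk : k ≤ N) (l : ℕ) :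
    ∑ j ∈ Finset.range (N + 1), matEl q N k j * antipode q (matEl q N j l) =
      if k = l then 1 else 0 := by
  induction N generalizing k l with
  | zero =>
    obtain rfl : k = 0 := by omega
    rcases l with _ | l
    · simp [matEl_zero_zero, antipode_one]
    · simp [matEl_of_lt, antipode_zero]
  | succ N ih =>
    -- The weights in `μ` of `x t_{kj}` and of `S(t_{j+1,l})` are opposite, so a function of `μ`
    -- passes through their product unchanged.
    have w : ∀ k j l, k ≤ N → j ≤ N → ∀ f : Mer, ∀ x : FSL2 q,
        (∀ g, r q (shift (-1) g) * x = x * r q g) →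
        r q f * (x * matEl q N k j) * antipode q (matEl q (N + 1) (j + 1) l) =
        x * matEl q N k j * (antipode q (matEl q (N + 1) (j + 1) l) * r q f) := by
      intro k j l hk hj f x hx
      have h1 := (matEl_weight q (by omega : j + 1 ≤ N + 1) l
        (shift (-((N + 1 : ℕ) - 2 * (j + 1 : ℕ))) f)).1
      rw [shift_shift ((N + 1 : ℕ) - 2 * (j + 1 : ℕ)), add_neg_cancel, shift_zero] at h1
      have h2 := congrArg (antipode q) h1
      rw [antipode_mul, antipode_mul, antipode_l, antipode_l] at h2
      rw [← h2, ← mul_assoc (x * _), mul_assoc x, (matEl_weight q hk j _).2, ← mul_assoc x, ← hx,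
        shift_shift, shift_shift, mul_assoc (r q _) x]
      push_cast
      ring_nf
      simp
    -- Used with `(x, y) = (γ, δ)` for the rows `k ≤ N` and with `(α, β)` for the last row. The
    -- induction hypothesis leaves the combinations that appear in the antipode axioms for
    -- generators.
    have key : ∀ (x y : FSL2 q) (k : ℕ), k ≤ N → (∀ g, r q (shift (-1) g) * x = x * r q g) →
      ∑ j ∈ Finset.range (N + 1), y * matEl q N k j * antipode q (matEl q (N + 1) j l) +
        ∑ j ∈ Finset.range (N + 1), r q (prodPhi q (N - j)) * (x * matEl q N k j) *
          antipode q (matEl q (N + 1) (j + 1) l) =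
      (if k = l then y * antipode q (d q) + x * antipode q (b q) else 0) +
        (if k + 1 = l then (y * antipode q (c q) + x * antipode q (a q)) *
          FSL2.l q (prodPhi q (N - k)) else 0) := by
      intro x y k hk hx
      rw [← Finset.sum_add_distrib]
      have e : ∀ j ∈ Finset.range (N + 1), y * matEl q N k j * antipode q (matEl q (N + 1) j l) +
          r q (prodPhi q (N - j)) * (x * matEl q N k j) *
            antipode q (matEl q (N + 1) (j + 1) l) =
          y * (matEl q N k j * antipode q (matEl q N j l) * antipode q (d q)) +
          x * (matEl q N k j * antipode q (matEl q N j l) * antipode q (b q)) +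
          (match l with
            | 0 => 0
            | l + 1 => (y * (matEl q N k j * antipode q (matEl q N j l) * antipode q (c q)) +
              x * (matEl q N k j * antipode q (matEl q N j l) * antipode q (a q))) *
                FSL2.l q (prodPhi q (N - l))) := by
        intro j hj
        have hj' : j ≤ N := Nat.lt_succ_iff.1 (Finset.mem_range.1 hj)
        rw [w k j l hk hj' _ x hx]
        -- Row `j` of the antipode is expanded by the defining recursion. Row `j + 1` uses
        -- `matEl_alpha_succ`, in which the function moved to the right by `w` is exactly the factor
        -- needed.
        rcases l with _ | l
        · have h1 := congrArg (antipode q) (matEl_alpha_succ q hj' 0).2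
          rw [antipode_mul, antipode_mul, antipode_l] at h1
          rw [h1, matEl_succ_zero q hj', antipode_mul]
          simp only [mul_assoc, add_zero]
        · have h1 := congrArg (antipode q) (matEl_alpha_succ q hj' l).1
          rw [antipode_add, antipode_mul, antipode_mul, antipode_mul, antipode_mul, antipode_l,
            antipode_r] at h1
          rw [h1, matEl_succ_succ q hj', antipode_add, antipode_mul, antipode_mul, antipode_mul,
            antipode_r]
          simp only [mul_assoc, mul_add, add_mul]
          abel
      rw [Finset.sum_congr rfl e, Finset.sum_add_distrib, Finset.sum_add_distrib]
      simp only [← Finset.mul_sum, ← Finset.sum_mul]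
      rw [ih hk l]
      rcases l with _ | l
      · simp only [ite_mul, mul_ite, zero_mul, mul_zero, one_mul, Finset.sum_const_zero]
        split_ifs <;> simp at *
      · simp only [← Finset.sum_mul, Finset.sum_add_distrib, ← Finset.mul_sum, ih hk l,
          ite_mul, mul_ite, zero_mul, mul_zero, one_mul, Nat.add_right_cancel_iff]
        rcases eq_or_ne k l with rfl | h
        · simp
        · simp [h]
          split_ifs <;> simp
    rcases Nat.lt_or_ge N k with h | h
    · obtain rfl : k = N + 1 := by omega
      have h1 := key (a q) (b q) N le_rfl fun g => (a_r q g).symm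
      rw [antipode_right_a, antipode_right_b, Nat.sub_self, prodPhi_zero, map_one, mul_one,
        ite_self, zero_add] at h1
      rw [← h1, Finset.sum_range_succ', matEl_top_zero]
      simp only [matEl_top_succ, add_mul, Finset.sum_add_distrib]
      rw [Finset.sum_range_succ' (fun j => b q * matEl q N N j * _), Finset.sum_range_succ
        (fun j => b q * matEl q N N (j + 1) * _), matEl_of_lt q N (Nat.lt_succ_self N)]
      simp only [mul_zero, zero_mul, add_zero]
      abel
    · have h1 := key (c q) (d q) k h fun g => (c_r q g).symm
      rw [antipode_right_c, antipode_right_d, zero_mul, ite_self, add_zero] at h1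
      rw [← h1, Finset.sum_range_succ', matEl_succ_zero q h]
      simp only [matEl_succ_succ q h, add_mul, Finset.sum_add_distrib]
      rw [Finset.sum_range_succ' (fun j => d q * matEl q N k j * _), Finset.sum_range_succ
        (fun j => d q * matEl q N k (j + 1) * _), matEl_of_lt q k (Nat.lt_succ_self N)]
      simp only [mul_zero, zero_mul, add_zero]
      abel

end FSL2

end DynSU2

namespace DynSU2

open Polynomial Mer

/-! ### Shifted factorials and `q`-binomial coefficients over a field. -/

section QPoch

variable {F : Type*} [Field F]

lemma qPoch_zero (a p : F) : qPoch a p 0 = 1 := rfl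

lemma qPoch_succ (a p : F) (n : ℕ) : qPoch a p (n + 1) = qPoch a p n * (1 - a * p ^ n) :=
  Finset.prod_range_succ _ _

lemma qPoch_succ' (a p : F) (n : ℕ) : qPoch a p (n + 1) = (1 - a) * qPoch (a * p) p n := by
  rw [qPoch, Finset.prod_range_succ', mul_comm, pow_zero, mul_one]
  simp only [qPoch, pow_succ', mul_assoc]

lemma qPoch_add (a p : F) (m n : ℕ) :
    qPoch a p (m + n) = qPoch a p m * qPoch (a * p ^ m) p n := by
  rw [qPoch, Finset.prod_range_add]
  simp only [qPoch, pow_add, mul_assoc]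

lemma qPoch_ne_zero {a p : F} {n : ℕ} (h : ∀ i < n, 1 - a * p ^ i ≠ 0) : qPoch a p n ≠ 0 :=
  Finset.prod_ne_zero_iff.2 fun i hi => h i (Finset.mem_range.1 hi)

lemma qPoch_ne_zero_of_le {a p : F} {m n : ℕ} (hmn : m ≤ n) (h : qPoch a p n ≠ 0) :
    qPoch a p m ≠ 0 := by
  obtain ⟨k, rfl⟩ := Nat.exists_eq_add_of_le hmn
  rw [qPoch_add] at h
  exact left_ne_zero_of_mul h

lemma qPoch_eq_zero {a p : F} {n i : ℕ} (hi : i < n) (h : a * p ^ i = 1) : qPoch a p n = 0 :=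
  Finset.prod_eq_zero (Finset.mem_range.2 hi) (by rw [h, sub_self])

lemma qPochInt_natCast (a p : F) (n : ℕ) : qPochInt a p n = qPoch a p n := rfl

/-- For negative `n` the factor `1 - a p^n` belongs to the denominator of `(a; p)_n` and is removed
by the step to `n + 1`; this is where its nonvanishing matters. -/
lemma qPochInt_add_one (a p : F) (hp : p ≠ 0) (n : ℤ) (h : 1 - a * p ^ n ≠ 0) :
    qPochInt a p (n + 1) = qPochInt a p n * (1 - a * p ^ n) := by
  rcases n with n | n
  · change qPoch a p (n + 1) = qPoch a p n * (1 - a * p ^ (n : ℤ))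
    rw [zpow_natCast]
    exact qPoch_succ a p n
  · rcases n with _ | n
    · change (1 : F) = (qPoch _ _ 1)⁻¹ * _
      have e : (Int.negSucc 0 : ℤ) = -1 := rfl
      rw [e] at h ⊢
      rw [qPoch_succ, qPoch_zero]
      simp only [pow_zero, mul_one, one_mul, CharP.cast_eq_zero, zero_add]
      rw [inv_mul_cancel₀ h]
    · have e : (Int.negSucc (n + 1) : ℤ) = -((n : ℤ) + 1 + 1) := rfl
      have e2 : (Int.negSucc (n + 1) : ℤ) + 1 = Int.negSucc n := rfl
      rw [e2]
      change (qPoch (a * p ^ (-((n : ℤ) + 1))) p (n + 1))⁻¹ =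
        (qPoch (a * p ^ (-(((n + 1 : ℕ) : ℤ) + 1))) p (n + 1 + 1))⁻¹ * _
      rw [e] at h ⊢
      push_cast
      have e3 : a * p ^ (-((n : ℤ) + 1 + 1)) * p = a * p ^ (-((n : ℤ) + 1)) := by
        rw [mul_assoc, ← zpow_add_one₀ hp]; ring_nf
      rw [qPoch_succ' _ _ (n + 1), mul_inv, e3, mul_comm (1 - _)⁻¹, mul_assoc, inv_mul_cancel₀ h,
        mul_one]

lemma qBinom_zero (p : F) (N : ℕ) (hp : ∀ k : ℕ, 1 - p ^ (k + 1) ≠ 0) : qBinom p N 0 = 1 := by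
  have h : qPoch p p N ≠ 0 := qPoch_ne_zero fun i _ => by rw [← pow_succ']; exact hp i
  rw [qBinom, qPoch_zero, one_mul, Nat.sub_zero, div_self h]

lemma qBinom_succ_succ (p : F) {N j : ℕ} (hp : ∀ k : ℕ, 1 - p ^ (k + 1) ≠ 0) :
    qBinom p N j = qBinom p (N + 1) (j + 1) * (1 - p ^ (j + 1)) / (1 - p ^ (N + 1)) := by
  have h : ∀ n, qPoch p p n ≠ 0 := fun n =>
    qPoch_ne_zero fun i _ => by rw [← pow_succ']; exact hp i
  have h1 := hp j; have h2 := hp N; have h3 := h j; have h4 := h (N - j); have h5 := h N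
  rw [qBinom, qBinom, qPoch_succ, qPoch_succ, Nat.add_sub_add_right, ← pow_succ', ← pow_succ']
  field_simp

lemma qBinom_succ (p : F) {N j : ℕ} (hj : j ≤ N) (hp : ∀ k : ℕ, 1 - p ^ (k + 1) ≠ 0) :
    qBinom p N j = qBinom p (N + 1) j * (1 - p ^ (N + 1 - j)) / (1 - p ^ (N + 1)) := by
  have h : ∀ n, qPoch p p n ≠ 0 := fun n =>
    qPoch_ne_zero fun i _ => by rw [← pow_succ']; exact hp i
  have h1 := hp (N - j); have h2 := hp N; have h3 := h j; have h4 := h (N - j); have h5 := h N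
  rw [qBinom, qBinom, Nat.succ_sub hj, qPoch_succ p p N, qPoch_succ p p (N - j), ← pow_succ',
    ← pow_succ']
  field_simp

end QPoch

variable (q : Set.Ioo (0 : ℝ) 1)

/-! ### Exponentials in `λ` as monomials in `q^{2λ}`, `q^{2ω}` and `q`. -/

/-- The function `q^{2λ}`. -/
noncomputable abbrev cZ : Mer := qE q (2 * X)

lemma cZ_ne : cZ q ≠ 0 := qE_two_ne_zero q

lemma qE_int_mul (n : ℤ) (P : ℂ[X]) : qE q (n * P) = qE q P ^ n := by
  rcases n with n | n
  · rw [Int.ofNat_eq_natCast, Int.cast_natCast, zpow_natCast]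
    exact qE_nat_mul q n P
  · rw [Int.cast_negSucc, neg_mul, qE_neg, qE_nat_mul, zpow_negSucc]

/-- With all exponentials written as monomials, identities between meromorphic functions become
identities of rational expressions in `z = q^{2λ}`, `Y = q^{2ω}` and `q`. -/
lemma qE_mono {P : ℂ[X]} (ω : ℂ) (a b c : ℤ)
    (h : P = 2 * ((a : ℂ[X]) * X + (b : ℂ[X]) * C ω) + (c : ℂ[X])) :
    qE q P = cZ q ^ a * cY q ω ^ b * cQ q ^ c := by
  rw [h, show 2 * ((a : ℂ[X]) * X + (b : ℂ[X]) * C ω) + (c : ℂ[X]) =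
    (a : ℂ[X]) * (2 * X) + (b : ℂ[X]) * (2 * C ω) + (c : ℂ[X]) by ring, qE_add, qE_add,
    qE_int_mul, qE_int_mul, qE_two_C, qE_intCast]

lemma qE_mono₀ {P : ℂ[X]} (a c : ℤ) (h : P = 2 * ((a : ℂ[X]) * X) + (c : ℂ[X])) :
    qE q P = cZ q ^ a * cQ q ^ c := by
  rw [qE_mono q 0 a 0 c (by rw [h]; simp), zpow_zero, mul_one]

lemma qE_two : qE q 2 = cQ q ^ 2 := by
  simpa using qE_natCast q 2

lemma shift_cQ (s : ℂ) : shift s (cQ q) = cQ q := AlgHom.commutes _ _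
lemma shift_cY (ω s : ℂ) : shift s (cY q ω) = cY q ω := AlgHom.commutes _ _

lemma shift_cZ (n : ℤ) {s : ℂ} (h : s = n) : shift s (cZ q) = cQ q ^ (2 * n) * cZ q := by
  rw [h, shift_z]

lemma shift_qPoch (s : ℂ) (a p : Mer) (n : ℕ) :
    shift s (qPoch a p n) = qPoch (shift s a) (shift s p) n := by
  simp [qPoch, map_prod]

lemma cQ_zpow_ne_one {n : ℤ} (hn : n ≠ 0) : cQ q ^ n ≠ 1 := by
  rw [cQ, ← map_zpow₀, ← map_one (algebraMap ℂ Mer)]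
  intro h
  have h1 := (algebraMap ℂ Mer).injective h
  have h2 : (q : ℝ) ^ n = 1 := by exact_mod_cast h1
  exact hn ((zpow_eq_one_iff_right₀ q.2.1.le q.2.2.ne).1 h2)

/-- Translation by `1` multiplies `z^n` by `q^{2n} ≠ 1` and fixes constants. All nonvanishing of
linear factors that involve `λ` rests on this, for every `ω`. -/
lemma cZ_zpow_mul_ne {n : ℤ} (hn : n ≠ 0) (w : ℂ) : cZ q ^ n * algebraMap ℂ Mer w ≠ 1 := by
  intro h
  have h1 := congrArg (shift 1) h
  rw [map_mul, map_zpow₀, shift_cZ q 1 (by norm_num), AlgHom.commutes, mul_zpow, mul_assoc, h,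
    map_one, mul_one, ← zpow_mul] at h1
  exact cQ_zpow_ne_one q (by omega) h1

lemma one_sub_mono_ne {a : ℤ} (ha : a ≠ 0) (ω : ℂ) (b c : ℤ) :
    1 - cZ q ^ a * cY q ω ^ b * cQ q ^ c ≠ 0 := by
  rw [mul_assoc, cY, cQ, ← map_zpow₀, ← map_zpow₀, ← map_mul]
  exact sub_ne_zero.2 (cZ_zpow_mul_ne q ha _).symm

lemma one_sub_cQ_ne {c : ℤ} (hc : c ≠ 0) : 1 - cQ q ^ c ≠ 0 :=
  sub_ne_zero.2 (cQ_zpow_ne_one q hc).symm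

lemma one_sub_pow_ne (k : ℕ) : 1 - (cQ q ^ 2) ^ (k + 1) ≠ 0 := by
  rw [← pow_mul, ← zpow_natCast]
  exact one_sub_cQ_ne q (by positivity)

/-- A linear factor that depends on `λ` does not vanish. -/
lemma qP_ne {P : ℂ[X]} (ω : ℂ) (a b c : ℤ)
    (h : P = 2 * ((a : ℂ[X]) * X + (b : ℂ[X]) * C ω) + (c : ℂ[X])) (ha : a ≠ 0) (n : ℕ) :
    qP q P n ≠ 0 := by
  rw [qP, qE_mono q ω a b c h, qE_two]
  refine qPoch_ne_zero fun i _ => ?_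
  rw [← pow_mul, ← zpow_natCast, mul_assoc, ← zpow_add₀ (cQ_ne q)]
  exact one_sub_mono_ne q ha ω b _

/-- Because `q` is positive, conjugation only reaches the coefficients of the exponent. Expressions
with real `ω` are thus invariant under `bar`. -/
lemma bar_qE' (P : ℂ[X]) : bar (qE q P) = qE q (P.map (starRingEnd ℂ)) := by
  simp only [qE, bar_mk]
  congr 1
  ext z
  have h : ((q : ℝ) : ℂ).arg ≠ Real.pi := by
    rw [Complex.arg_ofReal_of_nonneg q.2.1.le]
    exact Real.pi_pos.ne
  have h2 := Complex.cpow_conj ((q : ℝ) : ℂ) (P.eval (starRingEnd ℂ z)) h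
  rw [Complex.conj_ofReal] at h2
  have h3 : starRingEnd ℂ (P.eval (starRingEnd ℂ z)) = (P.map (starRingEnd ℂ)).eval z := by
    rw [eval_map, ← eval₂_at_apply, Complex.conj_conj]
  rw [← h3, h2]

/-- The product of the shifted quotients `Φ` telescopes. -/
lemma prodPhi_eq (n : ℕ) : FSL2.prodPhi q n =
    (1 - cZ q * (cQ q ^ 2) ^ (n + 1)) / (cQ q ^ n * (1 - cZ q * cQ q ^ 2)) := by
  have hQ := cQ_ne q
  have hl : ∀ m : ℕ, 1 - cZ q * (cQ q ^ 2) ^ m ≠ 0 := fun m => by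
    have h := one_sub_mono_ne q (a := 1) one_ne_zero 0 0 (2 * m : ℕ)
    rwa [zpow_one, zpow_zero, mul_one, zpow_natCast, pow_mul] at h
  have h1 := hl 1
  rw [pow_one] at h1
  induction n with
  | zero => rw [FSL2.prodPhi_zero, zero_add, pow_one, pow_zero, one_mul, div_self h1]
  | succ n ih =>
    have h2 := hl (n + 1)
    have e : shift (n : ℂ) (fPhi q) = (1 - cZ q * (cQ q ^ 2) ^ (n + 2)) /
        (cQ q * (1 - cZ q * (cQ q ^ 2) ^ (n + 1))) := by
      simp only [fPhi_eq', map_div₀, map_mul, map_sub, map_pow, map_one, shift_cQ]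
      have hz : cQ q ^ (2 * (n : ℤ)) = (cQ q ^ 2) ^ n := by
        rw [zpow_mul, zpow_natCast]
        norm_cast
      rw [shift_cZ q n (by simp), hz, ← neg_div_neg_eq]
      congr 1 <;> ring
    rw [FSL2.prodPhi_succ, ih, e]
    field_simp
    ring

lemma bar_prodPhi (n : ℕ) : bar (FSL2.prodPhi q n) = FSL2.prodPhi q n := by
  simp [FSL2.prodPhi, map_prod, bar_shift, bar_fPhi]

end DynSU2

namespace DynSU2

open Polynomial Mer

/-! ### The norms of the corepresentation and the transposition -/

section Field

variable {F : Type*} [Field F]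

/-- The function `Γ^N_k` in terms of `z = q^{2λ}` and `p = q²`. -/
noncomputable def gamN (p z : F) (N k : ℕ) : F :=
  qBinom p N k * qPoch (p ^ k / (p ^ (N + 1) * z)) p k / qPoch z⁻¹ p k

/-- The recursion that transposition of the last row imposes on `Γ^N`. The variable `s` stands for
`Γ^N_{i+1}(λ+1)`, except at the end `i = N`, where the corresponding matrix element is absent and `s
= 0`. -/
lemma gamN_rec (p z : F) (hp : p ≠ 0) (hz : z ≠ 0) (hp' : ∀ k : ℕ, 1 - p ^ (k + 1) ≠ 0)
    (hz' : ∀ n : ℤ, 1 - p ^ n * z ≠ 0) {N i n : ℕ} (h : N = i + n) (s : F)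
    (hs : n ≠ 0 → s = gamN p (p * z) N (i + 1)) (hs' : n = 0 → s = 0) :
    p * s + (1 - z * p ^ (n + 1)) ^ 2 / (p ^ n * (1 - z * p) * (1 - z)) * gamN p (p⁻¹ * z) N i =
      p * gamN p z (N + 1) (i + 1) := by
  subst h
  have hinv : ∀ k : ℕ, 1 - z⁻¹ * p ^ k ≠ 0 := fun k => by
    have h1 := hz' (-k)
    intro h2
    apply h1
    rw [zpow_neg, zpow_natCast]
    field_simp at h2 ⊢
    linear_combination -h2
  have hB : qPoch (z⁻¹ * p) p i ≠ 0 := qPoch_ne_zero fun k _ => by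
    rw [mul_assoc, ← pow_succ']; exact hinv _
  have h0 := hinv 0
  have hi := hinv i
  have h1 : 1 - z ≠ 0 := by simpa using hz' 0
  have h2 : 1 - z * p ≠ 0 := by simpa [mul_comm] using hz' 1
  have h3 := hp' (i + n)
  rw [pow_zero, mul_one] at h0
  have hzi : qPoch z⁻¹ p i = (1 - z⁻¹) * qPoch (z⁻¹ * p) p i / (1 - z⁻¹ * p ^ i) := by
    rw [eq_div_iff hi, ← qPoch_succ, qPoch_succ']
  -- The three numerators start at `w`, `w` and `w p`. All terms are therefore rational multiples of
  -- one common quotient of shifted factorials.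
  set w := (p ^ (n + 1) * z)⁻¹ with hw
  have e1 : p ^ (i + 1) / (p ^ (i + n + 1 + 1) * z) = w := by
    rw [hw, show i + n + 1 + 1 = (i + 1) + (n + 1) by ring, pow_add p (i + 1)]
    field_simp
  have e2 : p ^ (i + 1) / (p ^ (i + n + 1) * (p * z)) = w := by
    rw [← e1, pow_succ p (i + n + 1), mul_assoc]
  have e3 : p ^ i / (p ^ (i + n + 1) * (p⁻¹ * z)) = w * p := by
    rw [hw, show i + n + 1 = i + (n + 1) by ring, pow_add p i]
    field_simp
  have g1 : gamN p z (i + n + 1) (i + 1) = qBinom p (i + n + 1) (i + 1) *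
      ((1 - w) * qPoch (w * p) p i) / ((1 - z⁻¹) * qPoch (z⁻¹ * p) p i) := by
    rw [gamN, e1, qPoch_succ', qPoch_succ']
  have g3 : gamN p (p⁻¹ * z) (i + n) i =
      qBinom p (i + n + 1) (i + 1) * (1 - p ^ (i + 1)) / (1 - p ^ (i + n + 1)) *
        qPoch (w * p) p i / qPoch (z⁻¹ * p) p i := by
    rw [gamN, e3, qBinom_succ_succ p hp', mul_inv, inv_inv, mul_comm p]
  have g2 : s = qBinom p (i + n + 1) (i + 1) * (1 - p ^ n) / (1 - p ^ (i + n + 1)) *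
      ((1 - w) * qPoch (w * p) p i) / ((1 - (p * z)⁻¹) * qPoch z⁻¹ p i) := by
    rcases n with _ | n
    · rw [hs' rfl]; simp
    · rw [hs (by simp), gamN, e2, qPoch_succ', qPoch_succ', qBinom_succ p (by omega) hp',
        show i + (n + 1) + 1 - (i + 1) = n + 1 by omega,
        show (p * z)⁻¹ * p = z⁻¹ by field_simp]
  have h4 : 1 - (p * z)⁻¹ ≠ 0 := by
    intro h
    apply h2
    field_simp at h
    linear_combination -h
  rw [g1, g2, g3, hzi]
  have h5 : z - 1 ≠ 0 := fun h => h1 (by linear_combination -h)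
  have h6 : p * z - 1 ≠ 0 := fun h => h2 (by linear_combination -h)
  have h7 : z - p ^ i ≠ 0 := by
    intro h
    apply hi
    field_simp
    linear_combination h
  rw [hw]
  have hk : p ^ (i + n + 1) = p ^ i * p ^ n * p := by ring
  rw [hk] at h3 ⊢
  rw [pow_succ p n, pow_succ p i]
  -- What remains is a rational identity in `p`, `z`, `v = p^n` and `y = p^i`.
  generalize hv : p ^ n = v at *
  have hv0 : v ≠ 0 := hv ▸ pow_ne_zero _ hp
  generalize p ^ i = y at *
  generalize qPoch ((v * p * z)⁻¹ * p) p i = A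
  generalize qPoch (z⁻¹ * p) p i = B at *
  generalize qBinom p _ _ = b
  clear hz' hinv hs hs' e1 e2 e3 g1 g2 g3 hw hk hp' hzi
  have h8 : 1 - p * z ≠ 0 := by rwa [mul_comm] at h2
  have h9 : 1 - p * v * y ≠ 0 := by convert h3 using 2; ring
  field_simp
  ring

end Field

variable (q : Set.Ioo (0 : ℝ) 1)

lemma one_sub_cQ_sq_zpow_mul_cZ_ne (n : ℤ) : 1 - (cQ q ^ 2) ^ n * cZ q ≠ 0 := by
  have h := one_sub_mono_ne q one_ne_zero 0 0 (2 * n)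
  rwa [zpow_one, zpow_zero, mul_one, mul_comm, zpow_mul, zpow_ofNat] at h

lemma gammaN_eq {N k : ℕ} : gammaN q N k = gamN (cQ q ^ 2) (cZ q) N k := by
  have hQ := cQ_ne q
  have h1 : qE q (2 * ((k : ℂ[X]) - (N : ℂ[X]) - X - 1)) =
      (cQ q ^ 2) ^ k / ((cQ q ^ 2) ^ (N + 1) * cZ q) := by
    rw [qE_mono₀ q (-1) (2 * (k - N - 1)) (by push_cast; ring), zpow_neg_one,
      show (2 * ((k : ℤ) - N - 1)) = ((2 * k : ℕ) : ℤ) - ((2 * (N + 1) : ℕ) : ℤ) by push_cast; ring,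
      zpow_sub₀ hQ, zpow_natCast, zpow_natCast, pow_mul, pow_mul]
    field_simp
  have h2 : qE q (-2 * X) = (cZ q)⁻¹ := by
    rw [qE_mono₀ q (-1) 0 (by push_cast; ring), zpow_neg_one, zpow_zero, mul_one]
  rw [gammaN, gamN, qP, qP, h1, h2, qE_two]

lemma shift_gammaN (s : ℂ) (n : ℤ) (h : s = n) (N k : ℕ) :
    shift s (gammaN q N k) = gamN (cQ q ^ 2) ((cQ q ^ 2) ^ n * cZ q) N k := by
  simp only [gammaN_eq, gamN, qBinom, map_div₀, map_mul, shift_qPoch, map_pow, shift_cQ, map_inv₀,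
    shift_cZ q n h, zpow_mul, zpow_ofNat]

lemma gammaN_ne {N k : ℕ} : gammaN q N k ≠ 0 := by
  have h : ∀ n, qPoch (cQ q ^ 2) (cQ q ^ 2) n ≠ 0 := fun n =>
    qPoch_ne_zero fun i _ => by rw [← pow_succ']; exact one_sub_pow_ne q i
  refine div_ne_zero (mul_ne_zero ?_ ?_) ?_
  · rw [qBinom, qE_two]
    exact div_ne_zero (h _) (mul_ne_zero (h _) (h _))
  · exact qP_ne q 0 (-1) 0 (2 * (k - N - 1)) (by push_cast; ring) (by norm_num) _
  · exact qP_ne q 0 (-1) 0 0 (by push_cast; ring) (by norm_num) _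

lemma gammaN_zero (N : ℕ) : gammaN q N 0 = 1 := by
  rw [gammaN_eq, gamN, qPoch_zero, qPoch_zero, qBinom_zero _ _ (one_sub_pow_ne q)]
  simp

lemma bar_gammaN (N k : ℕ) : bar (gammaN q N k) = gammaN q N k := by
  simp [gammaN_eq, gamN, qBinom, qPoch, map_prod, bar_qE, cQ, bar_const]

lemma gammaN_rec {N i : ℕ} (h : i ≤ N) (s : Mer) (hs : i < N → s = shift 1 (gammaN q N (i + 1)))
    (hs' : i = N → s = 0) :
    cQ q * s + FSL2.prodPhi q (N - i) * (FSL2.prodPhi q (N - i) *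
      (FSL2.phi₁ q * shift (-1) (gammaN q N i))) = cQ q * gammaN q (N + 1) (i + 1) := by
  obtain ⟨n, rfl⟩ := Nat.exists_eq_add_of_le h
  have hQ := cQ_ne q
  have key := gamN_rec (cQ q ^ 2) (cZ q) (pow_ne_zero 2 hQ) (cZ_ne q) (one_sub_pow_ne q)
    (one_sub_cQ_sq_zpow_mul_cZ_ne q) (N := i + n) rfl s
    (fun hn => by rw [hs (by omega), shift_gammaN q 1 1 (by simp), zpow_one])
    (fun hn => hs' (by omega))
  have h1 := one_sub_cQ_sq_zpow_mul_cZ_ne q 0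
  have h2 := one_sub_cQ_sq_zpow_mul_cZ_ne q 1
  rw [zpow_zero, one_mul] at h1
  rw [zpow_one, mul_comm] at h2
  rw [shift_gammaN q (-1) (-1) (by simp), gammaN_eq, zpow_neg_one, Nat.add_sub_cancel_left,
    prodPhi_eq, FSL2.phi₁, shift_neg_fPhi]
  refine mul_left_cancel₀ hQ ?_
  rw [← mul_assoc (cQ q) (cQ q), ← pow_two, ← key]
  have e : (cQ q ^ 2 * qE q (2 * X) - 1) / (cQ q * (qE q (2 * X) - 1)) =
      (1 - cZ q * cQ q ^ 2) / (cQ q * (1 - cZ q)) := by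
    rw [← neg_div_neg_eq]
    congr 1 <;> ring
  have e2 : (cQ q ^ 2) ^ n = cQ q ^ n * cQ q ^ n := by rw [← pow_mul]; ring
  rw [e, mul_add, ← mul_assoc (cQ q) (cQ q), ← pow_two, e2]
  congr 1
  field_simp

namespace FSL2

/-- The end `i = N` of the recursion for `Γ^N`, where only the term coming from `α` is present. -/
lemma psi_mul_shift_inv_gammaN (N : ℕ) :
    fPsi q * shift (-1) (gammaN q N N)⁻¹ = (cQ q)⁻¹ * (gammaN q (N + 1) (N + 1))⁻¹ := by
  have h := gammaN_rec q (le_refl N) 0 (by simp) (by simp)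
  rw [Nat.sub_self, prodPhi_zero, one_mul, one_mul, mul_zero, zero_add] at h
  rw [← mul_inv, ← h, map_inv₀, mul_inv, eq_inv_of_mul_eq_one_right (phi₁_mul_psi q)]

lemma cQ_smul (f : Mer) : ((q : ℝ) : ℂ) • f = cQ q * f := Algebra.smul_def _ _

/-- The transposition of the last row of the matrix elements. -/
lemma tau_matEl_top {N j : ℕ} (h : j ≤ N) : tau q (matEl q N N j) =
    l q (gammaN q N j) * (r q (gammaN q N N)⁻¹ * basisV q N j) := by
  induction N generalizing j with
  | zero =>
    obtain rfl : j = 0 := by omega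
    simp [matEl_zero_zero, tau_one, gammaN_zero, basisV]
  | succ N ih =>
    have hc : ∀ i ≤ N, tau q (b q * matEl q N N i) =
        l q (cQ q * shift 1 (gammaN q N i)) *
          (r q ((cQ q)⁻¹ * (gammaN q (N + 1) (N + 1))⁻¹) * basisV q (N + 1) i) := fun i hi => by
      rw [tau_mul, ih hi, tau_b, smul_mul_assoc, mul_assoc, c_l_assoc, c_r_assoc,
        c_mul_basisV q hi, r_l_assoc, r_r_assoc, psi_mul_shift_inv_gammaN, smul_l_mul, cQ_smul]
    -- Constants `q` and `q⁻¹` sit on the `λ` side and on the `μ` side; as scalars they cancel.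
    have hQ : ∀ (f : Mer) (x : FSL2 q), l q (cQ q * f) * (r q ((cQ q)⁻¹ *
        (gammaN q (N + 1) (N + 1))⁻¹) * x) = l q f * (r q (gammaN q (N + 1) (N + 1))⁻¹ * x) := by
      intro f x
      rw [map_mul, map_mul, cQ, ← map_inv₀, AlgHom.commutes, AlgHom.commutes,
        Algebra.algebraMap_eq_smul_one, Algebra.algebraMap_eq_smul_one]
      simp only [smul_mul_assoc, one_mul, mul_smul_comm, smul_smul,
        mul_inv_cancel₀ (q_ne q), inv_mul_cancel₀ (q_ne q), one_smul]
    rcases j with _ | i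
    · rw [matEl_top_zero, hc 0 (by omega), hQ, gammaN_zero, gammaN_zero, map_one]
    · have hi : i ≤ N := by omega
      have ha : tau q (r q (prodPhi q (N - i)) * (a q * matEl q N N i)) =
          l q (prodPhi q (N - i) * (prodPhi q (N - i) *
            (phi₁ q * shift (-1) (gammaN q N i)))) *
          (r q ((cQ q)⁻¹ * (gammaN q (N + 1) (N + 1))⁻¹) * basisV q (N + 1) (i + 1)) := by
        rw [tau_mul, tau_mul, ih hi, tau_a, tau_r, bar_prodPhi]
        simp only [mul_assoc, a_l_assoc, a_r_assoc, a_mul_basisV, r_l_assoc, r_r_assoc, l_l_assoc,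
          r_l]
        rw [← psi_mul_shift_inv_gammaN]
        congr 2
        ring
      rw [matEl_top_succ, tau_add, ha]
      -- Both terms of the recursion contribute for `i < N`; for `i = N` the term with `β` vanishes,
      -- which is the case `s = 0` of `gammaN_rec`.
      rcases hi.lt_or_eq with hlt | rfl
      · rw [hc (i + 1) (by omega), ← add_mul, ← map_add,
          gammaN_rec q hi _ (fun _ => rfl) (fun h => absurd h hlt.ne), hQ]
      · rw [matEl_of_lt q _ (Nat.lt_succ_self i), mul_zero, tau_zero, zero_add, ← hQ]
        have h := gammaN_rec q (le_refl i) 0 (by simp) (by simp)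
        rw [mul_zero, zero_add] at h
        rw [h]

end FSL2
end DynSU2

namespace DynSU2

open Polynomial Mer
variable (q : Set.Ioo (0 : ℝ) 1)

namespace FSL2

/-- The transposition of the matrix elements. -/
lemma tau_matEl {N k j : ℕ} (hk : k ≤ N) (hj : j ≤ N) : tau q (matEl q N k j) =
    l q (gammaN q N j) * (r q (gammaN q N k)⁻¹ * matEl q N j k) := by
  -- Flipping `Δ(t_{Nj})` gives the sum of `τ(t_{ij}) ⊗ τ(t_{Ni})`. By the formula for the last row,
  -- `τ(t_{Nj})` is a multiple of `γ^{N-j} α^j`, whose coproduct is known, and `τ(t_{Ni})` is a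
  -- multiple of `γ^{N-i} α^i`. So both sides are expansions in the same basis once `Γ^N_N(μ)` is
  -- cleared.
  have h := flipCompat_matEl q (le_refl N) j (tm 1 1)
  rw [flipTau_tm, tau_one, delta_matEl q le_rfl, tau_matEl_top q hj, delta_mul, delta_mul,
    delta_basisV q hj, map_sum, map_sum, map_sum] at h
  have h2 := congrArg (delta q (r q (gammaN q N N))) h
  rw [map_sum, map_sum] at h2
  have h3 : ∑ i ∈ Finset.range (N + 1), tm (r q (gammaN q N i) * tau q (matEl q N i j))
      (basisV q N i) = ∑ i ∈ Finset.range (N + 1), tm (l q (gammaN q N j) * matEl q N j i)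
      (basisV q N i) := by
    refine Eq.trans (Finset.sum_congr rfl fun i hi => ?_) (h2.trans
      (Finset.sum_congr rfl fun i hi => ?_))
    · rw [mul_one, mul_one, flipTau_tm,
        tau_matEl_top q (Nat.lt_succ_iff.1 (Finset.mem_range.1 hi)), delta_r, r_l_assoc, r_r_assoc,
        mul_inv_cancel₀ (gammaN_ne q), map_one, one_mul, tm_balance]
    · rw [delta_r, delta_l, delta_r, r_r_assoc, mul_inv_cancel₀ (gammaN_ne q), map_one, one_mul,
        mul_one, mul_one]
  have h4 := sum_tm_basisV_injective q h3 hk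
  rw [← r_l_assoc, ← h4, r_r_assoc, inv_mul_cancel₀ (gammaN_ne q), map_one, one_mul]

/-- As `*` is an involution, `S = * ∘ τ`; the transposition formula thus turns the inverse matrix
into adjoints with norms, and the antipode identities into orthogonality relations. -/
lemma antipode_matEl {N k j : ℕ} (hk : k ≤ N) (hj : j ≤ N) : antipode q (matEl q N k j) =
    star q (matEl q N j k) * (l q (gammaN q N j) * r q (gammaN q N k)⁻¹) := by
  rw [antipode_eq, tau_matEl q hk hj, star_mul, star_mul, star_l, star_r, map_inv₀, bar_gammaN,
    bar_gammaN, mul_assoc, r_l]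

lemma sum_star_mul_matEl {N k l' : ℕ} (hk : k ≤ N) :
    ∑ j ∈ Finset.range (N + 1), star q (matEl q N j k) *
      (l q (gammaN q N j) * r q (gammaN q N k)⁻¹) * matEl q N j l' = if k = l' then 1 else 0 := by
  rw [← sum_antipode_mul q hk l']
  exact Finset.sum_congr rfl fun j hj => by
    rw [antipode_matEl q hk (Nat.lt_succ_iff.1 (Finset.mem_range.1 hj))]

lemma sum_matEl_mul_star {N k l' : ℕ} (hk : k ≤ N) (hl : l' ≤ N) :
    ∑ j ∈ Finset.range (N + 1), matEl q N k j * star q (matEl q N l' j) *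
      (l q (gammaN q N l') * r q (gammaN q N j)⁻¹) = if k = l' then 1 else 0 := by
  rw [← sum_mul_antipode q hk l']
  exact Finset.sum_congr rfl fun j hj => by
    rw [antipode_matEl q (Nat.lt_succ_iff.1 (Finset.mem_range.1 hj)) hl, mul_assoc]

end FSL2
end DynSU2

namespace DynSU2

/-! ### A contiguous relation for terminating balanced `₄φ₃` series -/

section Contiguous

variable {F : Type*} [Field F]

/-- The terms of a `₄φ₃` series, multiplied by `(x; p)_k`. -/
noncomputable def phiTerm (p a b c d u v x : F) (k i : ℕ) : F :=
  qPoch a p i * qPoch b p i * qPoch c p i * qPoch d p i * qPoch (x * p ^ i) p (k - i) /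
    (qPoch p p i * qPoch u p i * qPoch v p i) * p ^ i

lemma qPoch_mul_right (a p : F) (i : ℕ) :
    (1 - a) * qPoch (a * p) p i = qPoch a p i * (1 - a * p ^ i) := by
  rw [← qPoch_succ', qPoch_succ]

/-- One step of the telescoping in `sum_phiTerm_sub`, with `y = p^n` and the common factor removed.
Balancing is essential: it allows the products `abcdp` and `uvx` to be exchanged. -/
lemma contiguous_alg {p a b c d u v x y : F} (ha : a ≠ 0) (hb : b ≠ 0) (hab : a ≠ b)
    (h : a * b * c * d * p = u * v * x) :
    (1 - c) * (1 - d) * y * ((1 - u * y) * (1 - v * y) * (1 - x * y)) =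
      y * ((b - u) * (b - v) * (b - x) / (b * (b - a)) * (1 - a * y) +
        (a - u) * (a - v) * (a - x) / (a * (a - b)) * (1 - b * y)) * ((1 - c * y) * (1 - d * y)) +
      ((1 - c * d * (p * y)) * ((1 - a * y) * (1 - b * y) * (1 - c * y) * (1 - d * y)) -
        (1 - c * d * y) * (1 - y) * ((1 - u * y) * (1 - v * y) * (1 - x * y))) := by
  have h1 : b - a ≠ 0 := sub_ne_zero.2 hab.symm
  have h2 : a - b ≠ 0 := sub_ne_zero.2 hab
  -- The apparent pole at `a = b` cancels between the two quotients, and balancing replaces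
  -- `uvx/(ab)` by `cdp`.
  have e : (b - u) * (b - v) * (b - x) / (b * (b - a)) * (1 - a * y) +
        (a - u) * (a - v) * (a - x) / (a * (a - b)) * (1 - b * y) =
      (a + b - u - v - x) + c * d * p - y * (a * b - (u * v + u * x + v * x)) -
        y * (c * d * p) * (a + b) := by
    have h3 : c * d * p = u * v * x / (a * b) := by
      rw [← h]; field_simp
    have h4 : a - b = -(b - a) := by ring
    rw [h3, h4]
    field_simp
    ring
  rw [e]
  linear_combination ((1 - c) * (1 - d) * y ^ 4 + (1 - c * d * y) * (1 - y) * y ^ 3) * h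

/-- This and the next four lemmas only regroup factors, so as to exhibit the common factor `W` of
`sum_phiTerm_sub`. -/
lemma phi_alg₁ {A B C D X P U V y c d u v un vn xn : F} (hc : c ≠ 0) (hd : d ≠ 0) (hun : un ≠ 0)
    (hvn : vn ≠ 0) : u * v * (A * B * C * D * (xn * X) / (P * U * V) * y) =
      A * B * C * D * X / (P * U * V) * (u * v) / (c * d * un * vn) * (c * d * y * (un * vn * xn)) := by
  have h : c * d * un * vn ≠ 0 := mul_ne_zero (mul_ne_zero (mul_ne_zero hc hd) hun) hvn
  have h2 : A * B * C * D * X / (P * U * V) * (u * v) / (c * d * un * vn) *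
      (c * d * y * (un * vn * xn)) = A * B * C * D * X / (P * U * V) * (u * v) * y * xn *
        ((c * d * un * vn) / (c * d * un * vn)) := by ring
  rw [h2, div_self h]
  ring

lemma phi_alg₂ {A B C D X P U V y c d u v an cn dn un vn : F} :
    (A * an) * (B * (C * cn / c) * (D * dn / d) * X) / (P * (U * un / u) * (V * vn / v)) * y =
      A * B * C * D * X / (P * U * V) * (u * v) / (c * d * un * vn) *
        (y * an * (cn * dn)) := by
  simp only [div_eq_mul_inv, mul_inv, inv_inv]
  ring

lemma phi_alg₃ {A B C D X P U V y c d u v bn cn dn un vn : F} :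
    (B * bn) * A * ((C * cn / c) * (D * dn / d) * X) / (P * (U * un / u) * (V * vn / v)) * y =
      A * B * C * D * X / (P * U * V) * (u * v) / (c * d * un * vn) *
        (y * bn * (cn * dn)) := by
  simp only [div_eq_mul_inv, mul_inv, inv_inv]
  ring

lemma phi_alg₄ {A B C D X P U V y c d u v an bn cn dn pn un vn e : F} (hp : pn ≠ 0) (hy : y ≠ 0) :
    u * v * (A * an * (B * bn) * (C * cn) * (D * dn) * X / (P * pn * (U * un) * (V * vn)) * y) *
      (e * pn / (y * c * d)) = A * B * C * D * X / (P * U * V) * (u * v) / (c * d * un * vn) *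
        (e * (an * bn * cn * dn)) := by
  have h : u * v * (A * an * (B * bn) * (C * cn) * (D * dn) * X / (P * pn * (U * un) * (V * vn)) * y) *
      (e * pn / (y * c * d)) = (pn * pn⁻¹) * (y * y⁻¹) * (A * B * C * D * X / (P * U * V) * (u * v) /
        (c * d * un * vn) * (e * (an * bn * cn * dn))) := by ring
  rw [h, mul_inv_cancel₀ hp, mul_inv_cancel₀ hy, one_mul, one_mul]

lemma phi_alg₅ {W y c d e e' : F} (hc : c ≠ 0) (hd : d ≠ 0) (hy : y ≠ 0) :
    W * (c * d * y * e) * (e' / (y * c * d)) = W * (e' * e) := by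
  rw [mul_div_assoc', div_eq_iff (mul_ne_zero (mul_ne_zero hy hc) hd)]
  ring

/-- Indefinite summation: the combination of the three series has closed partial sums, a rational
multiple of the next term of the first series. Induction on `n` reduces this to `contiguous_alg`. -/
lemma sum_phiTerm_sub {p a b c d u v x : F} {k : ℕ} (hp : p ≠ 0) (ha : a ≠ 0) (hb : b ≠ 0)
    (hab : a ≠ b) (h : a * b * c * d * p = u * v * x) (hc : 1 - c ≠ 0) (hd : 1 - d ≠ 0)
    (hp' : ∀ i : ℕ, 1 - p ^ (i + 1) ≠ 0) (hu : ∀ i ≤ k, 1 - u * p ^ i ≠ 0)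
    (hv : ∀ i ≤ k, 1 - v * p ^ i ≠ 0) {n : ℕ} (hn : n ≤ k + 1) :
    ∑ i ∈ Finset.range n, ((1 - u) * (1 - v) * phiTerm p a b c d u v x (k + 1) i -
      (1 - a) * ((b - u) * (b - v) * (b - x) / (b * (b - a))) *
        phiTerm p (a * p) b (c * p) (d * p) (u * p) (v * p) (x * p) k i -
      (1 - b) * ((a - u) * (a - v) * (a - x) / (a * (a - b))) *
        phiTerm p a (b * p) (c * p) (d * p) (u * p) (v * p) (x * p) k i) =
    (1 - u) * (1 - v) * phiTerm p a b c d u v x (k + 1) n *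
      ((1 - c * d * p ^ n) * (1 - p ^ n) / (p ^ n * (1 - c) * (1 - d))) := by
  induction n with
  | zero => simp
  | succ n ih =>
    have hpp : ∀ i, qPoch p p i ≠ 0 := fun i =>
      qPoch_ne_zero fun j _ => by rw [← pow_succ']; exact hp' j
    have hn' : n ≤ k := by omega
    have hu0 : 1 - u ≠ 0 := by simpa using hu 0 (Nat.zero_le _)
    have hv0 : 1 - v ≠ 0 := by simpa using hv 0 (Nat.zero_le _)
    have hun := hu n hn'
    have hvn := hv n hn'
    have hU : qPoch u p n ≠ 0 := qPoch_ne_zero fun i hi => hu i (by omega)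
    have hV : qPoch v p n ≠ 0 := qPoch_ne_zero fun i hi => hv i (by omega)
    have key := contiguous_alg (y := p ^ n) ha hb hab h
    rw [Finset.sum_range_succ, ih (by omega)]
    have ex : x * p * p ^ n = x * p ^ (n + 1) := by ring
    have hx : qPoch (x * p ^ n) p (k + 1 - n) = (1 - x * p ^ n) * qPoch (x * p ^ (n + 1)) p (k - n) := by
      rw [Nat.succ_sub hn', qPoch_succ', pow_succ, mul_assoc x]
    have tc : qPoch (c * p) p n = qPoch c p n * (1 - c * p ^ n) / (1 - c) := by
      rw [eq_div_iff hc, mul_comm, qPoch_mul_right]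
    have td : qPoch (d * p) p n = qPoch d p n * (1 - d * p ^ n) / (1 - d) := by
      rw [eq_div_iff hd, mul_comm, qPoch_mul_right]
    have tu : qPoch (u * p) p n = qPoch u p n * (1 - u * p ^ n) / (1 - u) := by
      rw [eq_div_iff hu0, mul_comm, qPoch_mul_right]
    have tv : qPoch (v * p) p n = qPoch v p n * (1 - v * p ^ n) / (1 - v) := by
      rw [eq_div_iff hv0, mul_comm, qPoch_mul_right]
    -- The factor shared by the terms of all three series and by the closed form at `n` and `n + 1`.
    set W := qPoch a p n * qPoch b p n * qPoch c p n * qPoch d p n *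
      qPoch (x * p ^ (n + 1)) p (k - n) / (qPoch p p n * qPoch u p n * qPoch v p n) *
      ((1 - u) * (1 - v)) / ((1 - c) * (1 - d) * (1 - u * p ^ n) * (1 - v * p ^ n)) with hW
    have t1 : (1 - u) * (1 - v) * phiTerm p a b c d u v x (k + 1) n =
        W * ((1 - c) * (1 - d) * p ^ n *
          ((1 - u * p ^ n) * (1 - v * p ^ n) * (1 - x * p ^ n))) := by
      rw [phiTerm, hx, hW]
      exact phi_alg₁ hc hd hun hvn
    have t2 : (1 - a) * phiTerm p (a * p) b (c * p) (d * p) (u * p) (v * p) (x * p) k n =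
        W * (p ^ n * (1 - a * p ^ n) * ((1 - c * p ^ n) * (1 - d * p ^ n))) := by
      have e : ∀ A B : F, (1 - a) * (qPoch (a * p) p n * A / B * p ^ n) =
        ((1 - a) * qPoch (a * p) p n) * A / B * p ^ n := fun A B => by ring
      rw [phiTerm, mul_assoc (qPoch (a * p) p n), mul_assoc (qPoch (a * p) p n),
        mul_assoc (qPoch (a * p) p n), e, qPoch_mul_right,
        tc, td, tu, tv, ex, hW]
      exact phi_alg₂
    have t3 : (1 - b) * phiTerm p a (b * p) (c * p) (d * p) (u * p) (v * p) (x * p) k n =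
        W * (p ^ n * (1 - b * p ^ n) * ((1 - c * p ^ n) * (1 - d * p ^ n))) := by
      have e : ∀ A B C : F, (1 - b) * (C * qPoch (b * p) p n * A / B * p ^ n) =
        ((1 - b) * qPoch (b * p) p n) * C * A / B * p ^ n := fun A B C => by ring
      rw [phiTerm, mul_assoc (qPoch a p n * _), mul_assoc (qPoch a p n * _), e, qPoch_mul_right, tc, td, tu, tv, ex, hW]
      exact phi_alg₃
    have t4 : (1 - u) * (1 - v) * phiTerm p a b c d u v x (k + 1) (n + 1) *
        ((1 - c * d * p ^ (n + 1)) * (1 - p ^ (n + 1)) / (p ^ (n + 1) * (1 - c) * (1 - d))) =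
        W * ((1 - c * d * (p * p ^ n)) *
          ((1 - a * p ^ n) * (1 - b * p ^ n) * (1 - c * p ^ n) * (1 - d * p ^ n))) := by
      have h1 := hp' n
      rw [phiTerm, Nat.add_sub_add_right, qPoch_succ a, qPoch_succ b, qPoch_succ c, qPoch_succ d,
        qPoch_succ p, qPoch_succ u, qPoch_succ v, ← pow_succ', hW]
      exact phi_alg₄ h1 (pow_ne_zero _ hp)
    have t5 : (1 - u) * (1 - v) * phiTerm p a b c d u v x (k + 1) n *
        ((1 - c * d * p ^ n) * (1 - p ^ n) / (p ^ n * (1 - c) * (1 - d))) =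
        W * ((1 - c * d * p ^ n) * (1 - p ^ n) *
          ((1 - u * p ^ n) * (1 - v * p ^ n) * (1 - x * p ^ n))) := by
      rw [t1]
      exact phi_alg₅ hc hd (pow_ne_zero _ hp)
    rw [t4, t5, t1]
    linear_combination (W) * key - ((b - u) * (b - v) * (b - x) / (b * (b - a))) * t2 -
      ((a - u) * (a - v) * (a - x) / (a * (a - b))) * t3

/-- The contiguous relation behind the recursion of the matrix elements. -/
lemma phi_contiguous {p a b c d u v x : F} {k : ℕ} (hp : p ≠ 0) (ha : a ≠ 0) (hb : b ≠ 0)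
    (hab : a ≠ b) (h : a * b * c * d * p = u * v * x) (hc : c * p ^ (k + 1) = 1) (hd : 1 - d ≠ 0)
    (hp' : ∀ i : ℕ, 1 - p ^ (i + 1) ≠ 0) (hu : ∀ i ≤ k, 1 - u * p ^ i ≠ 0)
    (hv : ∀ i ≤ k, 1 - v * p ^ i ≠ 0) :
    (1 - u) * (1 - v) * ∑ i ∈ Finset.range (k + 2), phiTerm p a b c d u v x (k + 1) i =
      (1 - a) * ((b - u) * (b - v) * (b - x) / (b * (b - a))) * ∑ i ∈ Finset.range (k + 1),
        phiTerm p (a * p) b (c * p) (d * p) (u * p) (v * p) (x * p) k i +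
      (1 - b) * ((a - u) * (a - v) * (a - x) / (a * (a - b))) * ∑ i ∈ Finset.range (k + 1),
        phiTerm p a (b * p) (c * p) (d * p) (u * p) (v * p) (x * p) k i := by
  have hpk : p ^ (k + 1) ≠ 0 := pow_ne_zero _ hp
  have hc1 : 1 - c ≠ 0 := fun h0 => hp' k (by
    rw [← sub_eq_zero.1 h0, one_mul] at hc
    rw [hc, sub_self])
  have key := sum_phiTerm_sub hp ha hb hab h hc1 hd hp' hu hv le_rfl
  rw [Finset.sum_sub_distrib, Finset.sum_sub_distrib, ← Finset.mul_sum, ← Finset.mul_sum,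
    ← Finset.mul_sum] at key
  -- At `n = k + 1` termination, `c p^{k+1} = 1`, turns the rational multiplier into `-1`. The
  -- closed form is then minus the last term of the longer series, which completes its sum.
  have e : (1 - c * d * p ^ (k + 1)) * (1 - p ^ (k + 1)) / (p ^ (k + 1) * (1 - c) * (1 - d)) = -1 := by
    have e1 : c * d * p ^ (k + 1) = d := by rw [mul_right_comm, hc, one_mul]
    have e2 : p ^ (k + 1) * (1 - c) = p ^ (k + 1) - 1 := by rw [mul_sub, mul_comm _ c, hc, mul_one]
    have e3 : p ^ (k + 1) - 1 ≠ 0 := by rw [← e2]; exact mul_ne_zero hpk hc1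
    rw [e1, e2]
    field_simp
    ring
  rw [e] at key
  rw [Finset.sum_range_succ]
  linear_combination key

end Contiguous
end DynSU2

namespace DynSU2

/-! ### The matrix elements in the dynamical representation, over a field -/

section Ratios

variable {F : Type*} [Field F]

/-- Genericity of `z = q^{2λ}` with respect to `p = q²` and `Y = q^{2ω}`. -/
structure GenericPoint (Q p z Y : F) : Prop where
  hQ : Q ≠ 0
  hQp : p = Q ^ 2
  hz : z ≠ 0
  hY : Y ≠ 0
  hp : p ≠ 0
  h1 : ∀ n : ℤ, n ≠ 0 → 1 - p ^ n ≠ 0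
  h2 : ∀ n : ℤ, 1 - z * p ^ n ≠ 0
  h3 : ∀ n : ℤ, 1 - z / Y * p ^ n ≠ 0

/-- The prefactor of the function `T_{kjm}`. -/
noncomputable def tPre (Q p z Y : F) (N k j m : ℕ) : F :=
  (-1) ^ (j + k) *
    (z ^ k * Q ^ (2 * k + m * ((N : ℤ) - k - j) + ((k : ℤ) - j) * ((N : ℤ) - j + 1) : ℤ)) *
    qBinom p N j *
    (qPochInt (z * p ^ (1 + k - j - m : ℤ)) p ((N : ℤ) - k - j) *
      qPoch (p ^ (-(m + j) : ℤ)) p k) /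
    (qPoch (z * p ^ (1 - j : ℤ)) p (N - j) * qPoch (z / Y * p ^ (2 + N - 2 * j - 2 * m : ℤ)) p k)

/-- The terms of the sum in the function `T_{kjm}`. -/
noncomputable def tTerm (p z Y : F) (N k j m i : ℕ) : F :=
  phiTerm p (p ^ (-j : ℤ)) (p ^ (-(N + 1 - j) : ℤ) / z) (p ^ (-k : ℤ))
    (z / Y * p ^ (1 - 2 * m - 2 * j + k : ℤ)) (p ^ (-N : ℤ)) (p ^ (-(m + j) : ℤ))
    (p ^ (1 - m - j : ℤ) / Y) k i

/-- The function `T_{kjm}`. -/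
noncomputable def tVal (Q p z Y : F) (N k j m : ℕ) : F :=
  tPre Q p z Y N k j m * ∑ i ∈ Finset.range (k + 1), tTerm p z Y N k j m i

variable {Q p z Y : F}

lemma GenericPoint.one_sub_pow_ne (h : GenericPoint Q p z Y) (k : ℕ) : 1 - p ^ (k + 1) ≠ 0 := by
  exact_mod_cast h.h1 (k + 1) (by omega)

/-- Compares the first coefficient of the contiguous relation with the coefficient of `π^ω(α)`:
lowering `N`, `k` and `j` together changes the prefactor by their quotient, up to the normalising
factors `1 - u` and `1 - v`. -/
lemma tPre_ratio₁ (h : GenericPoint Q p z Y) {N k j m : ℕ} (hj : j ≤ N) :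
    tPre Q p z Y (N + 1) (k + 1) (j + 1) m *
      ((1 - p ^ (-(j + 1 : ℕ) : ℤ)) *
        ((p ^ (-((N + 1 : ℕ) + 1 - (j + 1 : ℕ)) : ℤ) / z - p ^ (-(N + 1 : ℕ) : ℤ)) *
          (p ^ (-((N + 1 : ℕ) + 1 - (j + 1 : ℕ)) : ℤ) / z - p ^ (-(m + (j + 1 : ℕ)) : ℤ)) *
          (p ^ (-((N + 1 : ℕ) + 1 - (j + 1 : ℕ)) : ℤ) / z - p ^ (1 - m - (j + 1 : ℕ) : ℤ) / Y) /
        (p ^ (-((N + 1 : ℕ) + 1 - (j + 1 : ℕ)) : ℤ) / z *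
          (p ^ (-((N + 1 : ℕ) + 1 - (j + 1 : ℕ)) : ℤ) / z - p ^ (-(j + 1 : ℕ) : ℤ))))) =
    (1 - p ^ (-(N + 1 : ℕ) : ℤ)) * (1 - p ^ (-(m + (j + 1 : ℕ)) : ℤ)) *
      (Q ^ (-m : ℤ) * (1 - z / Y * p ^ (N - 2 * j - m + 1 : ℤ)) /
        (1 - z / Y * p ^ (N - 2 * j - 2 * m + 1 : ℤ))) * tPre Q p z Y N k j m := by
  obtain ⟨n, rfl⟩ := Nat.exists_eq_add_of_le hj
  have hp := h.hp
  have hz := h.hz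
  have hY := h.hY
  have hB := qBinom_succ_succ p (N := j + n) (j := j) h.one_sub_pow_ne
  have i1 : z * p ^ (1 + k - j - m : ℤ) * p ^ ((j + n : ℕ) - k - j - 1 : ℤ) =
      z * p ^ (n - j - m : ℤ) := by
    rw [mul_assoc, ← zpow_add₀ hp]; push_cast; ring_nf
  have hI := qPochInt_add_one (z * p ^ (1 + k - j - m : ℤ)) p hp ((j + n : ℕ) - k - j - 1 : ℤ)
    (by rw [i1]; exact h.h2 _)
  rw [i1, sub_add_cancel] at hI
  have d1 := qPoch_mul_right (z * p ^ (-j : ℤ)) p n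
  rw [mul_assoc z _ p, ← zpow_add_one₀ hp, mul_assoc z _ (p ^ n), ← zpow_natCast p n,
    ← zpow_add₀ hp] at d1
  have g1 := h.h2 (-j)
  have g2 := h.h2 (-j + n)
  have g3 := h.h2 (n - j - m)
  have g4 := h.h3 ((j + n : ℕ) - 2 * j - 2 * m + 1)
  have g5 := h.one_sub_pow_ne j
  have g6 := h.one_sub_pow_ne (j + n)
  have e1 : (-1 : F) ^ (j + 1 + (k + 1)) = (-1) ^ (j + k) := by
    rw [show j + 1 + (k + 1) = j + k + 2 by ring, pow_add]; simp
  have e2 : Q ^ (2 * (k + 1 : ℕ) + m * (((j + n + 1 : ℕ) : ℤ) - (k + 1 : ℕ) - (j + 1 : ℕ)) +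
        (((k + 1 : ℕ) : ℤ) - (j + 1 : ℕ)) * (((j + n + 1 : ℕ) : ℤ) - (j + 1 : ℕ) + 1) : ℤ) =
      Q ^ (2 * k + m * (((j + n : ℕ) : ℤ) - k - j) +
        ((k : ℤ) - j) * (((j + n : ℕ) : ℤ) - j + 1) : ℤ) * (p * Q ^ (-m : ℤ)) := by
    rw [h.hQp, ← zpow_natCast Q 2, ← zpow_add₀ h.hQ, ← zpow_add₀ h.hQ]
    congr 1; push_cast; ring
  have e3 : qPochInt (z * p ^ (1 + (k + 1 : ℕ) - (j + 1 : ℕ) - m : ℤ)) p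
      (((j + n + 1 : ℕ) : ℤ) - (k + 1 : ℕ) - (j + 1 : ℕ)) =
      qPochInt (z * p ^ (1 + k - j - m : ℤ)) p ((j + n : ℕ) - k - j - 1 : ℤ) := by
    congr 1 <;> push_cast <;> ring_nf
  have e4 : qPoch (p ^ (-(m + (j + 1 : ℕ)) : ℤ)) p (k + 1) =
      (1 - p ^ (-(m + (j + 1 : ℕ)) : ℤ)) * qPoch (p ^ (-(m + j) : ℤ)) p k := by
    rw [qPoch_succ', ← zpow_add_one₀ hp]; congr 3; push_cast; ring
  have e5 : qPoch (z * p ^ (1 - (j + 1 : ℕ) : ℤ)) p (j + n + 1 - (j + 1)) =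
      qPoch (z * p ^ (-j : ℤ)) p n := by
    congr 1
    · congr 2; push_cast; ring
    · omega
  have e6 : qPoch (z / Y * p ^ (2 + (j + n + 1 : ℕ) - 2 * (j + 1 : ℕ) - 2 * m : ℤ)) p (k + 1) =
      (1 - z / Y * p ^ ((j + n : ℕ) - 2 * j - 2 * m + 1 : ℤ)) *
        qPoch (z / Y * p ^ (2 + (j + n : ℕ) - 2 * j - 2 * m : ℤ)) p k := by
    rw [qPoch_succ', mul_assoc (z / Y), ← zpow_add_one₀ hp]
    congr 2
    · congr 2; push_cast; ring
    · congr 2; push_cast; ring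
  have e7 : qPoch (z * p ^ (1 - j : ℤ)) p n = qPoch (z * p ^ (-j : ℤ)) p n *
      (1 - z * p ^ (-j + n : ℤ)) / (1 - z * p ^ (-j : ℤ)) := by
    rw [eq_div_iff g1, ← d1, mul_comm]; congr 3; ring_nf
  rw [tPre, tPre, e1, e2, e3, e4, e5, e6, hI, hB, Nat.add_sub_cancel_left, e7, pow_succ z k]
  generalize qPoch (z * p ^ (-j : ℤ)) p n = D1
  generalize qPoch (z / Y * p ^ (2 + (j + n : ℕ) - 2 * j - 2 * m : ℤ)) p k = D2
  generalize qPoch (p ^ (-(m + j) : ℤ)) p k = P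
  generalize qPochInt (z * p ^ (1 + k - j - m : ℤ)) p ((j + n : ℕ) - k - j - 1 : ℤ) = I
  generalize qBinom p (j + n + 1) (j + 1) = B
  generalize Q ^ (2 * k + m * (((j + n : ℕ) : ℤ) - k - j) +
        ((k : ℤ) - j) * (((j + n : ℕ) : ℤ) - j + 1) : ℤ) = E
  generalize Q ^ (-m : ℤ) = M'
  generalize (-1 : F) ^ (j + k) = S
  generalize z ^ k = zk
  clear e1 e2 e3 e4 e5 e6 e7 hI hB d1 i1
  have hJ : p ^ j ≠ 0 := pow_ne_zero _ hp
  have hM : p ^ m ≠ 0 := pow_ne_zero _ hp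
  have hn : p ^ n ≠ 0 := pow_ne_zero _ hp
  rw [pow_succ] at g5 g6
  rw [pow_add] at g6
  push_cast at *
  simp only [zpow_add₀ hp, zpow_sub₀ hp, zpow_neg, two_mul, zpow_natCast, zpow_one, neg_add, pow_succ, pow_add] at *
  generalize p ^ j = J at *
  generalize p ^ m = M at *
  generalize p ^ n = n' at *
  have c1 : (J * n' * p * p / (J * p))⁻¹ = (n' * p)⁻¹ := by field_simp
  have c2 : (n' * p)⁻¹ / z - J⁻¹ * n'⁻¹ * p⁻¹ = (n' * p * z)⁻¹ * (1 - z * J⁻¹) := by field_simp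
  have c3 : (n' * p)⁻¹ / z - M⁻¹ * (J⁻¹ * p⁻¹) = (n' * p * z)⁻¹ * (1 - z * (n' / J / M)) := by
    field_simp
  have c4 : (n' * p)⁻¹ / z - p / M / (J * p) / Y =
      (n' * p * z)⁻¹ * (1 - z / Y * (J * n' / (J * J) / M * p)) := by field_simp
  have c5 : (n' * p)⁻¹ / z - J⁻¹ * p⁻¹ = (n' * p * z)⁻¹ * (1 - z * (J⁻¹ * n')) := by field_simp
  have c6 : 1 - J⁻¹ * p⁻¹ = -(1 - J * p) * (J * p)⁻¹ := by field_simp; ring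
  have c7 : 1 - J⁻¹ * n'⁻¹ * p⁻¹ = -(1 - J * n' * p) * (J * n' * p)⁻¹ := by field_simp; ring
  rw [c1, c2, c3, c4, c5, c6, c7]
  generalize 1 - z * J⁻¹ = A1 at *
  generalize 1 - z * (J⁻¹ * n') = A2 at *
  generalize 1 - z * (n' / J / M) = A3 at *
  generalize 1 - z / Y * (J * n' / (J * J) / (M * M) * p) = A4 at *
  generalize 1 - z / Y * (J * n' / (J * J) / M * p) = A5 at *
  generalize 1 - J * p = A6 at *
  generalize 1 - J * n' * p = A7 at *
  -- After all linear factors are named, what is left is a monomial identity in `z`, `p`, `J = p^j`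
  -- and `n' = p^n`.
  have core : z * p * (-A6 * (J * p)⁻¹ * ((n' * p * z)⁻¹ * A1 * ((n' * p * z)⁻¹ * A3) *
      ((n' * p * z)⁻¹ * A5) / ((n' * p)⁻¹ / z * ((n' * p * z)⁻¹ * A2)))) =
      -A7 * (J * n' * p)⁻¹ * A5 * (A6 / A7) * A3 * (A1 / A2) := by
    field_simp
  simp only [div_eq_mul_inv, mul_inv, inv_inv] at core ⊢
  linear_combination (S * zk * E * M' * B * I * (1 - M⁻¹ * (J⁻¹ * p⁻¹)) * P * D1⁻¹ * D2⁻¹ * A4⁻¹) *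
    core

/-- The counterpart for the second series, where `N`, `k` and `m` are lowered and `j` stays. The
quotient is the coefficient of `π^ω(β)` times the factor from moving `γ` past `α^j`. -/
lemma tPre_ratio₂ (h : GenericPoint Q p z Y) {N k j m : ℕ} (hj : j ≤ N) :
    tPre Q p z Y (N + 1) (k + 1) j (m + 1) *
      ((1 - p ^ (-((N + 1 : ℕ) + 1 - j) : ℤ) / z) *
        ((p ^ (-j : ℤ) - p ^ (-(N + 1 : ℕ) : ℤ)) *
          (p ^ (-j : ℤ) - p ^ (-((m + 1 : ℕ) + j) : ℤ)) *
          (p ^ (-j : ℤ) - p ^ (1 - (m + 1 : ℕ) - j : ℤ) / Y) /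
        (p ^ (-j : ℤ) * (p ^ (-j : ℤ) - p ^ (-((N + 1 : ℕ) + 1 - j) : ℤ) / z)))) =
    (1 - p ^ (-(N + 1 : ℕ) : ℤ)) * (1 - p ^ (-((m + 1 : ℕ) + j) : ℤ)) *
      ((1 - z * p ^ (N - j + 2 : ℤ)) / (Q ^ j * (1 - z * p ^ (N + 2 - 2 * j : ℤ))) *
        ((1 - p ^ (m + 1)) * (1 - Y * p ^ m) / ((1 - z * p ^ (N - 2 * j + 1 : ℤ)) *
          (1 - Y / z * p ^ (2 * m + 2 * j - N - 1 : ℤ))))) * tPre Q p z Y N k j m := by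
  obtain ⟨n, rfl⟩ := Nat.exists_eq_add_of_le hj
  have hp := h.hp
  have hz := h.hz
  have hY := h.hY
  have hB := qBinom_succ p hj h.one_sub_pow_ne
  have g1 := h.h2 ((j + n : ℕ) - 2 * j + 1)
  have g2 := h.h2 ((j + n : ℕ) - 2 * j + 2)
  have g4 := h.h3 ((j + n : ℕ) - 2 * j - 2 * m + 1)
  have g5 := h.one_sub_pow_ne n
  have g6 := h.one_sub_pow_ne (j + n)
  have e1 : (-1 : F) ^ (j + (k + 1)) = - (-1) ^ (j + k) := by ring
  have e2 : Q ^ (2 * (k + 1 : ℕ) + (m + 1 : ℕ) * (((j + n + 1 : ℕ) : ℤ) - (k + 1 : ℕ) - j) +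
        (((k + 1 : ℕ) : ℤ) - j) * (((j + n + 1 : ℕ) : ℤ) - j + 1) : ℤ) =
      Q ^ (2 * k + m * (((j + n : ℕ) : ℤ) - k - j) +
        ((k : ℤ) - j) * (((j + n : ℕ) : ℤ) - j + 1) : ℤ) * (p ^ (n + 2) * (Q ^ j)⁻¹) := by
    rw [h.hQp, ← pow_mul, ← zpow_natCast Q (2 * _), ← zpow_natCast Q j, ← zpow_neg,
      ← zpow_add₀ h.hQ, ← zpow_add₀ h.hQ]
    congr 1; push_cast; ring
  have e3 : qPochInt (z * p ^ (1 + (k + 1 : ℕ) - j - (m + 1 : ℕ) : ℤ)) p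
      (((j + n + 1 : ℕ) : ℤ) - (k + 1 : ℕ) - j) =
      qPochInt (z * p ^ (1 + k - j - m : ℤ)) p ((j + n : ℕ) - k - j : ℤ) := by
    congr 1 <;> push_cast <;> ring_nf
  have e4 : qPoch (p ^ (-((m + 1 : ℕ) + j) : ℤ)) p (k + 1) =
      (1 - p ^ (-((m + 1 : ℕ) + j) : ℤ)) * qPoch (p ^ (-(m + j) : ℤ)) p k := by
    rw [qPoch_succ', ← zpow_add_one₀ hp]; congr 3; push_cast; ring
  have e5 : qPoch (z * p ^ (1 - j : ℤ)) p (j + n + 1 - j) =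
      qPoch (z * p ^ (1 - j : ℤ)) p n * (1 - z * p ^ ((j + n : ℕ) - 2 * j + 1 : ℤ)) := by
    rw [show j + n + 1 - j = n + 1 by omega, qPoch_succ, mul_assoc z, ← zpow_natCast p n,
      ← zpow_add₀ hp]
    congr 4; push_cast; ring
  have e6 : qPoch (z / Y * p ^ (2 + (j + n + 1 : ℕ) - 2 * j - 2 * (m + 1 : ℕ) : ℤ)) p (k + 1) =
      (1 - z / Y * p ^ ((j + n : ℕ) - 2 * j - 2 * m + 1 : ℤ)) *
        qPoch (z / Y * p ^ (2 + (j + n : ℕ) - 2 * j - 2 * m : ℤ)) p k := by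
    rw [qPoch_succ', mul_assoc (z / Y), ← zpow_add_one₀ hp]
    congr 2
    · congr 2; push_cast; ring
    · congr 2; push_cast; ring
  rw [tPre, tPre, e1, e2, e3, e4, e5, e6, hB, Nat.add_sub_cancel_left, pow_succ z k,
    show j + n + 1 - j = n + 1 by omega]
  generalize qPoch (z * p ^ (1 - j : ℤ)) p n = D1
  generalize qPoch (z / Y * p ^ (2 + (j + n : ℕ) - 2 * j - 2 * m : ℤ)) p k = D2
  generalize qPoch (p ^ (-(m + j) : ℤ)) p k = P
  generalize qPochInt (z * p ^ (1 + k - j - m : ℤ)) p ((j + n : ℕ) - k - j : ℤ) = I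
  generalize qBinom p (j + n + 1) j = B
  generalize Q ^ (2 * k + m * (((j + n : ℕ) : ℤ) - k - j) +
        ((k : ℤ) - j) * (((j + n : ℕ) : ℤ) - j + 1) : ℤ) = E
  generalize Q ^ j = M'
  generalize (-1 : F) ^ (j + k) = S
  generalize z ^ k = zk
  clear e1 e2 e3 e4 e5 e6 hB
  have hJ : p ^ j ≠ 0 := pow_ne_zero _ hp
  have hM : p ^ m ≠ 0 := pow_ne_zero _ hp
  have hn : p ^ n ≠ 0 := pow_ne_zero _ hp
  push_cast at *
  simp only [zpow_add₀ hp, zpow_sub₀ hp, zpow_neg, two_mul, zpow_natCast, zpow_one, neg_add, pow_succ, pow_add,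
    zpow_ofNat, pow_zero, one_mul] at *
  generalize p ^ j = J at *
  generalize p ^ m = M at *
  generalize p ^ n = n' at *
  have c1 : (J * n' * p * p / J)⁻¹ = (n' * p * p)⁻¹ := by field_simp
  have c2 : 1 - (n' * p * p)⁻¹ / z = -(n' * p * p * z)⁻¹ * (1 - z * (J * n' / J * (p * p))) := by
    field_simp; ring
  have c3 : J⁻¹ - J⁻¹ * n'⁻¹ * p⁻¹ = -(J * n' * p)⁻¹ * (1 - n' * p) := by field_simp; ring
  have c4 : J⁻¹ - M⁻¹ * p⁻¹ * J⁻¹ = -(J * M * p)⁻¹ * (1 - M * p) := by field_simp; ring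
  have c5 : J⁻¹ - p / (M * p) / J / Y = -(J * M * Y)⁻¹ * (1 - Y * M) := by field_simp; ring
  have c6 : J⁻¹ - (n' * p * p)⁻¹ / z = -(n' * p * p * z)⁻¹ * (1 - z * (J * n' / (J * J) * (p * p))) := by
    field_simp; ring
  have c7 : 1 - Y / z * (M * M * (J * J) / (J * n') / p) = -(Y * M * M * J / (z * n' * p)) *
    (1 - z / Y * (J * n' / (J * J) / (M * M) * p)) := by field_simp; ring
  have c8 : 1 - z * (J * n' * (p * p) / (J * J)) = 1 - z * (J * n' / (J * J) * (p * p)) := by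
    field_simp
  have c9 : 1 - J⁻¹ * n'⁻¹ * p⁻¹ = -(1 - J * n' * p) * (J * n' * p)⁻¹ := by field_simp; ring
  rw [c1, c2, c3, c4, c5, c6, c7, c8, c9]
  generalize 1 - z * (J * n' / (J * J) * p) = A1 at *
  generalize 1 - z * (J * n' / (J * J) * (p * p)) = A2 at *
  generalize 1 - z * (J * n' / J * (p * p)) = A3 at *
  generalize 1 - z / Y * (J * n' / (J * J) / (M * M) * p) = A4 at *
  generalize 1 - M * p = A5 at *
  generalize 1 - n' * p = A6 at *
  generalize 1 - J * n' * p = A7 at *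
  generalize 1 - Y * M = A8 at *
  have core : -(z * (n' * p * p)) * (-(n' * p * p * z)⁻¹ * A3 * (-(J * n' * p)⁻¹ * A6 *
      (-(J * M * p)⁻¹ * A5) * (-(J * M * Y)⁻¹ * A8) / (J⁻¹ * (-(n' * p * p * z)⁻¹ * A2)))) =
      -A7 * (J * n' * p)⁻¹ * (A3 / A2) * (A5 * A8 / (-(Y * M * M * J / (z * n' * p)))) *
        (A6 / A7) := by
    field_simp
  simp only [div_eq_mul_inv, mul_inv, inv_inv] at core ⊢
  linear_combination (S * zk * E * M'⁻¹ * B * I * (1 - M⁻¹ * p⁻¹ * J⁻¹) * P * D1⁻¹ * D2⁻¹ * A4⁻¹ *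
    A1⁻¹) * core

/-- The coefficient `A` of the recursion for `T_{kjm}`. -/
noncomputable def recA (Q p z Y : F) (N j m : ℕ) : F :=
  Q ^ (-m : ℤ) * (1 - z / Y * p ^ (N - 2 * j - m + 1 : ℤ)) /
    (1 - z / Y * p ^ (N - 2 * j - 2 * m + 1 : ℤ))

/-- The factor that comes from moving `γ` to the left of the basis vector `γ^{N-j} α^j`. -/
noncomputable def recPsi (Q p z : F) (N j : ℕ) : F :=
  (1 - z * p ^ (N - j + 2 : ℤ)) / (Q ^ j * (1 - z * p ^ (N + 2 - 2 * j : ℤ)))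

/-- The coefficient `B` of the recursion for `T_{kjm}`. -/
noncomputable def recB (p z Y : F) (N j m : ℕ) : F :=
  (1 - p ^ (m + 1)) * (1 - Y * p ^ m) / ((1 - z * p ^ (N - 2 * j + 1 : ℤ)) *
          (1 - Y / z * p ^ (2 * m + 2 * j - N - 1 : ℤ)))

/-- The coefficient `D` of the recursion for `T_{0jm}`. -/
noncomputable def recD (Q p z : F) (N j m : ℕ) : F :=
  Q ^ m * (1 - z * p ^ (N - 2 * j + 1 - m : ℤ)) / (1 - z * p ^ (N - 2 * j + 1 : ℤ))

lemma balanced_div {a b c d u v x : F} (hz : z ≠ 0) (e : a * b * c * d * p = u * v * x) :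
    a * (b / z) * c * (z / Y * d) * p = u * v * (x / Y) := by
  rw [mul_div_assoc' (u * v), ← e]
  field_simp

/-- The contiguous relation in disguise. Multiplying `a = p^{-j}` by `p` lowers `j`, and multiplying
`b` by `p` lowers `m`; in both cases the other parameters move with `N` and `k`. The hypothesis `hm`
keeps the factors of `(p^{-(m+j)}; p)_i` that occur from vanishing; without it the target vector is
`0` and no formula is needed. -/
lemma tVal_succ_succ (h : GenericPoint Q p z Y) {N k j m : ℕ} (hk : k ≤ N) (hj : j ≤ N + 1)
    (hm : k + 1 ≤ m + j) : tVal Q p z Y (N + 1) (k + 1) j m =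
      (if j = 0 then 0 else recA Q p z Y N (j - 1) m * tVal Q p z Y N k (j - 1) m) +
      (if j = N + 1 ∨ m = 0 then 0 else
        recPsi Q p z N j * recB p z Y N j (m - 1) * tVal Q p z Y N k j (m - 1)) := by
  have hp := h.hp
  have hz := h.hz
  have hY := h.hY
  have hu0 : 1 - p ^ (-(N + 1 : ℕ) : ℤ) ≠ 0 := h.h1 _ (by omega)
  have hv0 : 1 - p ^ (-(m + j) : ℤ) ≠ 0 := h.h1 _ (by omega)
  have key := phi_contiguous (p := p) (a := p ^ (-j : ℤ))
    (b := p ^ (-((N + 1 : ℕ) + 1 - j) : ℤ) / z) (c := p ^ (-(k + 1 : ℕ) : ℤ))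
    (d := z / Y * p ^ (1 - 2 * m - 2 * j + (k + 1 : ℕ) : ℤ)) (u := p ^ (-(N + 1 : ℕ) : ℤ))
    (v := p ^ (-(m + j) : ℤ)) (x := p ^ (1 - m - j : ℤ) / Y) (k := k) hp (zpow_ne_zero _ hp)
    (div_ne_zero (zpow_ne_zero _ hp) hz)
    -- The two numerator parameters `a` and `b` differ because their quotient involves `z`.
    (by
      intro e
      apply h.h2 (N + 2 - 2 * j)
      rw [eq_div_iff hz] at e
      have e2 : z * p ^ (N + 2 - 2 * j : ℤ) = (p ^ (-j : ℤ) * z) * p ^ ((N + 1 : ℕ) + 1 - j : ℤ) := by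
        rw [mul_comm (p ^ (-j : ℤ)), mul_assoc, ← zpow_add₀ hp]; congr 2; push_cast; ring
      rw [e2, e, ← zpow_add₀ hp, neg_add_cancel, zpow_zero, sub_self])
    (by
      have e1 : p ^ (-j : ℤ) * p ^ (-((N + 1 : ℕ) + 1 - j) : ℤ) * p ^ (-(k + 1 : ℕ) : ℤ) *
          p ^ (1 - 2 * m - 2 * j + (k + 1 : ℕ) : ℤ) * p =
          p ^ (-(N + 1 : ℕ) : ℤ) * p ^ (-(m + j) : ℤ) * p ^ (1 - m - j : ℤ) := by
        rw [← zpow_add₀ hp, ← zpow_add₀ hp, ← zpow_add₀ hp, ← zpow_add₀ hp, ← zpow_add₀ hp,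
          ← zpow_add_one₀ hp]
        congr 1; push_cast; ring
      exact balanced_div hz e1)
    (by rw [← zpow_natCast, ← zpow_add₀ hp, neg_add_cancel, zpow_zero]) (h.h3 _) h.one_sub_pow_ne
    (fun i hi => by rw [← zpow_natCast, ← zpow_add₀ hp]; exact h.h1 _ (by omega))
    (fun i hi => by rw [← zpow_natCast, ← zpow_add₀ hp]; exact h.h1 _ (by omega))
  -- Recognises a shifted series as one of lower degree once its seven parameters are identified.
  have hc : ∀ (N j m i : ℕ) (a b c d u v x : F), a = p ^ (-j : ℤ) → b = p ^ (-(N + 1 - j) : ℤ) / z →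
      c = p ^ (-k : ℤ) → d = z / Y * p ^ (1 - 2 * m - 2 * j + k : ℤ) → u = p ^ (-N : ℤ) →
      v = p ^ (-(m + j) : ℤ) → x = p ^ (1 - m - j : ℤ) / Y →
      phiTerm p a b c d u v x k i = tTerm p z Y N k j m i := by
    rintro N j m i _ _ _ _ _ _ _ rfl rfl rfl rfl rfl rfl rfl; rfl
  rw [← mul_right_inj' (mul_ne_zero hu0 hv0), tVal, mul_left_comm]
  change _ * (_ * ∑ i ∈ Finset.range (k + 2), tTerm p z Y (N + 1) (k + 1) j m i) = _
  have key' : (1 - p ^ (-(N + 1 : ℕ) : ℤ)) * (1 - p ^ (-(m + j) : ℤ)) *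
      ∑ i ∈ Finset.range (k + 2), tTerm p z Y (N + 1) (k + 1) j m i = _ := key
  rw [key', mul_add, mul_add]
  congr 1
  · split_ifs with h0
    · subst h0
      simp
    · obtain ⟨j, rfl⟩ := Nat.exists_eq_succ_of_ne_zero h0
      rw [Nat.succ_eq_add_one, Nat.add_sub_cancel, ← mul_assoc, tPre_ratio₁ h (by omega), tVal,
        recA, ← mul_assoc, ← mul_assoc]
      congr 1
      refine Finset.sum_congr rfl fun i _ => hc _ _ _ _ _ _ _ _ _ _ _ ?_ ?_ ?_ ?_ ?_ ?_ ?_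
      · rw [← zpow_add_one₀ hp]; congr 1; push_cast; ring
      · congr 2; push_cast; ring
      · rw [← zpow_add_one₀ hp]; congr 1; push_cast; ring
      · rw [mul_assoc, ← zpow_add_one₀ hp]; congr 2; push_cast; ring
      · rw [← zpow_add_one₀ hp]; congr 1; push_cast; ring
      · rw [← zpow_add_one₀ hp]; congr 1; push_cast; ring
      · rw [div_mul_eq_mul_div, ← zpow_add_one₀ hp]; congr 2; push_cast; ring
  · split_ifs with h0
    · rcases h0 with h0 | h0 <;> subst h0 <;> simp
    · push Not at h0
      obtain ⟨m, rfl⟩ := Nat.exists_eq_succ_of_ne_zero h0.2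
      have r2 := tPre_ratio₂ h (N := N) (k := k) (j := j) (m := m) (by omega)
      change _ = _ * (recPsi Q p z N j * recB p z Y N j m) * _ at r2
      rw [Nat.succ_eq_add_one, Nat.add_sub_cancel, ← mul_assoc, r2, tVal, mul_assoc _ (tPre _ _ _ _ _ _ _ _),
        mul_assoc _ (_ * _)]
      congr 3
      refine Finset.sum_congr rfl fun i _ => hc _ _ _ _ _ _ _ _ _ _ _ ?_ ?_ ?_ ?_ ?_ ?_ ?_
      · rfl
      · rw [div_mul_eq_mul_div, ← zpow_add_one₀ hp]; congr 2; push_cast; ring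
      · rw [← zpow_add_one₀ hp]; congr 1; push_cast; ring
      · rw [mul_assoc, ← zpow_add_one₀ hp]; congr 2; push_cast; ring
      · rw [← zpow_add_one₀ hp]; congr 1; push_cast; ring
      · rw [← zpow_add_one₀ hp]; congr 1; push_cast; ring
      · rw [div_mul_eq_mul_div, ← zpow_add_one₀ hp]; congr 2; push_cast; ring

/-- For `k = 0` the series consists of its first term. -/
lemma tVal_zero (N j m : ℕ) : tVal Q p z Y N 0 j m = tPre Q p z Y N 0 j m := by
  simp [tVal, tTerm, phiTerm, qPoch_zero]

lemma tPre_zero {N j n m : ℕ} (hN : N = j + n) : tPre Q p z Y N 0 j m =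
    (-1) ^ j * Q ^ (m * n - j * (n + 1) : ℤ) * qBinom p N j *
      qPoch (z * p ^ (1 - j - m : ℤ)) p n / qPoch (z * p ^ (1 - j : ℤ)) p n := by
  subst hN
  have e1 : (2 * (0 : ℕ) + m * (((j + n : ℕ) : ℤ) - (0 : ℕ) - j) +
      (((0 : ℕ) : ℤ) - j) * (((j + n : ℕ) : ℤ) - j + 1) : ℤ) = m * n - j * (n + 1) := by
    push_cast; ring
  have e2 : ((j + n : ℕ) - (0 : ℕ) - j : ℤ) = (n : ℕ) := by push_cast; ring
  have e3 : (1 + (0 : ℕ) - j - m : ℤ) = 1 - j - m := by push_cast; ring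
  rw [tPre, e1, e2, e3, qPochInt_natCast, Nat.add_sub_cancel_left]
  simp only [pow_zero, qPoch_zero, one_mul, mul_one, add_zero]

/-- The contribution of `γ` to row `0`, as a fraction of the value in degree `N + 1`. -/
lemma tPre_zero_ratio₁ (h : GenericPoint Q p z Y) {j n m : ℕ} :
    -Q⁻¹ * tPre Q p z Y (j + n) 0 j (m + 1) = tPre Q p z Y (j + n + 1) 0 (j + 1) m *
      (p ^ n * (1 - p ^ (j + 1)) / (1 - p ^ (j + n + 1)) * (1 - z * p ^ (-j : ℤ)) /
        (1 - z * p ^ (n - j : ℤ))) := by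
  have hp := h.hp
  have g1 := h.h2 (-j)
  have g2 := h.h2 (n - j)
  rw [tPre_zero rfl, tPre_zero (show j + n + 1 = (j + 1) + n by ring),
    qBinom_succ_succ p h.one_sub_pow_ne]
  have e1 : Q ^ ((m + 1 : ℕ) * n - j * (n + 1) : ℤ) =
      Q ^ (m * n - (j + 1 : ℕ) * (n + 1) : ℤ) * (Q * p ^ n) := by
    rw [h.hQp, ← pow_mul, ← pow_succ', ← zpow_natCast, ← zpow_add₀ h.hQ]
    congr 1; push_cast; ring
  have e2 : z * p ^ (1 - (j + 1 : ℕ) - m : ℤ) = z * p ^ (1 - j - (m + 1 : ℕ) : ℤ) := by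
    congr 2; push_cast; ring
  have e3 : z * p ^ (1 - (j + 1 : ℕ) : ℤ) = z * p ^ (-j : ℤ) := by congr 2; push_cast; ring
  have e4 : qPoch (z * p ^ (1 - j : ℤ)) p n = qPoch (z * p ^ (-j : ℤ)) p n *
      (1 - z * p ^ (n - j : ℤ)) / (1 - z * p ^ (-j : ℤ)) := by
    have := qPoch_mul_right (z * p ^ (-j : ℤ)) p n
    rw [mul_assoc z _ p, ← zpow_add_one₀ hp, mul_assoc z _ (p ^ n), ← zpow_natCast p n,
      ← zpow_add₀ hp] at this
    rw [eq_div_iff g1, mul_comm, show (1 - j : ℤ) = -j + 1 by ring, this,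
      show (-j + n : ℤ) = n - j by ring]
  rw [e1, e2, e3, e4, pow_succ (-1 : F)]
  have hq : Q⁻¹ * Q = 1 := inv_mul_cancel₀ h.hQ
  simp only [div_eq_mul_inv, mul_inv, inv_inv]
  generalize (1 - p ^ (j + n + 1))⁻¹ = A1
  generalize (1 - z * p ^ (n - j : ℤ))⁻¹ = A2
  generalize (qPoch (z * p ^ (-j : ℤ)) p n)⁻¹ = A3
  generalize Q ^ (m * n - (j + 1 : ℕ) * (n + 1) : ℤ) = E
  linear_combination (-(-1) ^ j * E * p ^ n * qBinom p (j + n + 1) (j + 1) * (1 - p ^ (j + 1)) * A1 *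
    qPoch (z * p ^ (1 - j - (m + 1 : ℕ) : ℤ)) p n * A3 * A2 * (1 - z * p ^ (-j : ℤ))) * hq

/-- The contribution of `δ` to row `0`, as a fraction of the value in degree `N + 1`. -/
lemma tPre_zero_ratio₂ (h : GenericPoint Q p z Y) {j n m : ℕ} :
    recPsi Q p z (j + n) j * recD Q p z (j + n) j m * tPre Q p z Y (j + n) 0 j m =
      tPre Q p z Y (j + n + 1) 0 j m *
        ((1 - z * p ^ (n + 2)) * (1 - p ^ (n + 1)) /
          ((1 - z * p ^ (n + 2 - j : ℤ)) * (1 - p ^ (j + n + 1)))) := by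
  have hp := h.hp
  have hQ := h.hQ
  have g1 := h.h2 (n - j + 1)
  have g2 := h.h2 (n - j + 1 - m)
  rw [tPre_zero rfl, tPre_zero (show j + n + 1 = j + (n + 1) by ring),
    qBinom_succ p (Nat.le_add_right j n) h.one_sub_pow_ne, recPsi, recD]
  have e1 : Q ^ (m * n - j * (n + 1) : ℤ) =
      Q ^ (m * (n + 1 : ℕ) - j * ((n + 1 : ℕ) + 1) : ℤ) * (Q ^ j * (Q ^ m)⁻¹) := by
    rw [← zpow_natCast, ← zpow_natCast, ← zpow_neg, ← zpow_add₀ hQ, ← zpow_add₀ hQ]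
    congr 1; push_cast; ring
  have e2 : qPoch (z * p ^ (1 - j - m : ℤ)) p (n + 1) = qPoch (z * p ^ (1 - j - m : ℤ)) p n *
      (1 - z * p ^ (n - j + 1 - m : ℤ)) := by
    rw [qPoch_succ, mul_assoc z, ← zpow_natCast, ← zpow_add₀ hp]; congr 4; ring
  have e3 : qPoch (z * p ^ (1 - j : ℤ)) p (n + 1) = qPoch (z * p ^ (1 - j : ℤ)) p n *
      (1 - z * p ^ (n - j + 1 : ℤ)) := by
    rw [qPoch_succ, mul_assoc z, ← zpow_natCast, ← zpow_add₀ hp]; congr 4; ring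
  have e4 : (((j + n : ℕ) : ℤ) - j + 2 : ℤ) = (n + 2 : ℕ) := by push_cast; ring
  have e5 : (((j + n : ℕ) : ℤ) + 2 - 2 * j : ℤ) = n + 2 - j := by push_cast; ring
  have e6 : (((j + n : ℕ) : ℤ) - 2 * j + 1 - m : ℤ) = n - j + 1 - m := by push_cast; ring
  have e7 : (((j + n : ℕ) : ℤ) - 2 * j + 1 : ℤ) = n - j + 1 := by push_cast; ring
  rw [e1, e2, e3, e4, e5, e6, e7, zpow_natCast, show j + n + 1 - j = n + 1 by omega]
  have hj : Q ^ j * (Q ^ j)⁻¹ = 1 := mul_inv_cancel₀ (pow_ne_zero _ hQ)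
  have hm : Q ^ m * (Q ^ m)⁻¹ = 1 := mul_inv_cancel₀ (pow_ne_zero _ hQ)
  simp only [div_eq_mul_inv, mul_inv, inv_inv]
  generalize (Q ^ j)⁻¹ = J at *
  generalize (Q ^ m)⁻¹ = M at *
  generalize Q ^ (m * (n + 1 : ℕ) - j * ((n + 1 : ℕ) + 1) : ℤ) = E
  generalize (1 - p ^ (j + n + 1))⁻¹ = A1
  generalize (1 - z * p ^ (n + 2 - j : ℤ))⁻¹ = A2
  generalize (1 - z * p ^ (n - j + 1 : ℤ))⁻¹ = A3
  generalize (qPoch (z * p ^ (1 - j : ℤ)) p n)⁻¹ = A4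
  generalize 1 - z * p ^ (n - j + 1 - m : ℤ) = A5
  generalize qPoch (z * p ^ (1 - j - m : ℤ)) p n = A6
  generalize qBinom p (j + n + 1) j = A7
  generalize z * p ^ (n + 2) = A8
  linear_combination ((1 - A8) * A2 * A5 * A3 * (-1) ^ j * E * (A7 * (1 - p ^ (n + 1)) * A1) * A6 *
    A4) * (hm + Q ^ m * M * hj)

/-- The two fractions above add up to `1`, a Pascal type identity. In the first and the last column
only one contribution is present and its fraction is `1`. -/
lemma tVal_succ_zero (h : GenericPoint Q p z Y) {N j m : ℕ} (hj : j ≤ N + 1) :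
    tVal Q p z Y (N + 1) 0 j m =
      (if j = 0 then 0 else -Q⁻¹ * tVal Q p z Y N 0 (j - 1) (m + 1)) +
      (if j = N + 1 then 0 else
        recPsi Q p z N j * recD Q p z N j m * tVal Q p z Y N 0 j m) := by
  have hp := h.hp
  simp only [tVal_zero]
  rcases j with _ | j
  · have h1 := h.h2 (N + 2)
    have h2 := h.one_sub_pow_ne N
    have h3 := tPre_zero_ratio₂ h (j := 0) (n := N) (m := m)
    rw [Nat.zero_add] at h3
    rw [if_pos rfl, if_neg (by omega), h3, zero_add]
    push_cast
    rw [sub_zero, ← zpow_natCast p (N + 2)]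
    push_cast
    rw [div_self (mul_ne_zero h1 h2), mul_one]
  · rw [if_neg (by omega), Nat.add_sub_cancel]
    obtain ⟨n, rfl⟩ := Nat.exists_eq_add_of_le (Nat.le_of_succ_le_succ hj)
    rw [tPre_zero_ratio₁ h]
    have g1 := h.h2 (n - j)
    have g3 := h.one_sub_pow_ne (j + n)
    have hJ : p ^ j ≠ 0 := pow_ne_zero _ hp
    rcases n with _ | n
    · have g2 := h.h2 (-j)
      rw [Nat.add_zero] at g3
      simp only [Nat.add_zero, if_true, add_zero, pow_zero, one_mul, CharP.cast_eq_zero, zero_sub]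
      rw [div_self g3, one_mul, div_self g2, mul_one]
    · have h3 := tPre_zero_ratio₂ h (j := j + 1) (n := n) (m := m)
      rw [show j + 1 + n = j + (n + 1) by ring] at h3
      rw [if_neg (by omega), h3, ← mul_add]
      -- Factoring out the prefactor leaves the assertion that the two fractions sum to `1`.
      nth_rewrite 1 [← mul_one (tPre _ _ _ _ _ _ _ _)]
      congr 1
      have e1 : (n + 2 - (j + 1 : ℕ) : ℤ) = ((n + 1 : ℕ) : ℤ) - j := by push_cast; ring
      rw [e1]
      rw [zpow_sub₀ hp, zpow_natCast, zpow_natCast] at g1 ⊢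
      rw [zpow_neg, zpow_natCast]
      have e2 : p ^ (j + (n + 1) + 1) = p ^ j * p * p ^ (n + 1) := by ring
      rw [e2] at g3 ⊢
      rw [show n + 2 = n + 1 + 1 by ring, pow_succ p (n + 1), pow_succ p j]
      generalize p ^ j = J at *
      generalize p ^ (n + 1) = n' at *
      rw [div_mul_eq_mul_div, div_div, mul_comm (1 - J * p * n'), ← add_div,
        eq_div_iff (mul_ne_zero g1 g3)]
      field_simp
      ring

end Ratios
end DynSU2

namespace DynSU2

open Polynomial Mer

variable (q : Set.Ioo (0 : ℝ) 1)

/-! ### From formulas over a field to meromorphic functions of `λ`. -/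

section Translation

/-- No `ω` has to be excluded: each factor required to be nonzero involves `q^{2λ}` or is `1` minus
a nontrivial power of `q`. -/
lemma genericPoint (ω : ℂ) : GenericPoint (cQ q) (cQ q ^ 2) (cZ q) (cY q ω) where
  hQ := cQ_ne q
  hQp := rfl
  hz := cZ_ne q
  hY := cY_ne q ω
  hp := pow_ne_zero 2 (cQ_ne q)
  h1 n hn := by
    have h := one_sub_cQ_ne q (c := 2 * n) (by omega)
    rwa [zpow_mul, zpow_ofNat] at h
  h2 n := by
    rw [mul_comm]
    exact one_sub_cQ_sq_zpow_mul_cZ_ne q n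
  h3 n := by
    have h := one_sub_mono_ne q (a := 1) one_ne_zero ω (-1) (2 * n)
    rwa [zpow_one, zpow_neg_one, zpow_mul, zpow_ofNat, ← div_eq_mul_inv] at h

lemma qE_even {P : ℂ[X]} (ω : ℂ) (a b c : ℤ)
    (h : P = 2 * ((a : ℂ[X]) * X + (b : ℂ[X]) * C ω + (c : ℂ[X]))) :
    qE q P = cZ q ^ a * cY q ω ^ b * (cQ q ^ 2) ^ c := by
  rw [qE_mono q ω a b (2 * c) (by rw [h]; push_cast; ring), zpow_mul, zpow_ofNat]

lemma qE_even_const (P : ℂ[X]) (c : ℤ) (h : P = 2 * (c : ℂ[X])) : qE q P = (cQ q ^ 2) ^ c := by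
  rw [qE_even q 0 0 0 c (by rw [h]; simp), zpow_zero, zpow_zero, one_mul, one_mul]

lemma qE_even_X (P : ℂ[X]) (c : ℤ) (h : P = 2 * (X + (c : ℂ[X]))) :
    qE q P = cZ q * (cQ q ^ 2) ^ c := by
  rw [qE_even q 0 1 0 c (by rw [h]; simp), zpow_zero, zpow_one, mul_one]

lemma qE_even_X_sub (P : ℂ[X]) (ω : ℂ) (c : ℤ) (h : P = 2 * (X - C ω + (c : ℂ[X]))) :
    qE q P = cZ q / cY q ω * (cQ q ^ 2) ^ c := by
  rw [qE_even q ω 1 (-1) c (by rw [h]; simp; ring), zpow_neg_one, zpow_one, ← div_eq_mul_inv]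

lemma qE_even_sub_X (P : ℂ[X]) (ω : ℂ) (c : ℤ) (h : P = 2 * (C ω - X + (c : ℂ[X]))) :
    qE q P = cY q ω / cZ q * (cQ q ^ 2) ^ c := by
  rw [qE_even q ω (-1) 1 c (by rw [h]; simp; ring), zpow_neg_one, zpow_one, mul_comm (cZ q)⁻¹,
    ← div_eq_mul_inv]

lemma qE_even_neg_om (P : ℂ[X]) (ω : ℂ) (c : ℤ) (h : P = 2 * (-C ω + (c : ℂ[X]))) :
    qE q P = (cQ q ^ 2) ^ c / cY q ω := by
  rw [qE_even q ω 0 (-1) c (by rw [h]; simp), zpow_neg_one, zpow_zero, one_mul, mul_comm,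
    ← div_eq_mul_inv]

lemma qE_even_om (P : ℂ[X]) (ω : ℂ) (c : ℤ) (h : P = 2 * (C ω + (c : ℂ[X]))) :
    qE q P = cY q ω * (cQ q ^ 2) ^ c := by
  rw [qE_even q ω 0 1 c (by rw [h]; simp), zpow_one, zpow_zero, one_mul]

lemma qE_even_neg_X (P : ℂ[X]) (c : ℤ) (h : P = 2 * (-X + (c : ℂ[X]))) :
    qE q P = (cQ q ^ 2) ^ c / cZ q := by
  rw [qE_even q 0 (-1) 0 c (by rw [h]; simp), zpow_neg_one, zpow_zero, mul_one, mul_comm,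
    ← div_eq_mul_inv]

lemma tFactor_eq (ω : ℂ) (N k j m : ℕ) :
    tFactor q ω N k j m = tPre (cQ q) (cQ q ^ 2) (cZ q) (cY q ω) N k j m := by
  rw [tFactor, tPre, qP, qP, qP,
    qE_mono₀ (P := 2 * (k : ℂ[X]) * (X + 1) + (m : ℂ[X]) * ((N : ℂ[X]) - (k : ℂ[X]) - (j : ℂ[X])) +
      ((k : ℂ[X]) - (j : ℂ[X])) * ((N : ℂ[X]) - (j : ℂ[X]) + 1)) q k (2 * k + m * ((N : ℤ) - k - j) + ((k : ℤ) - j) * ((N : ℤ) - j + 1))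
      (by push_cast; ring),
    qE_even_X q (2 * (X + 1 + (k : ℂ[X]) - (j : ℂ[X]) - (m : ℂ[X]))) (1 + k - j - m) (by push_cast; ring),
    qE_even_const q (-2 * ((m : ℂ[X]) + (j : ℂ[X]))) (-(m + j)) (by push_cast; ring),
    qE_even_X q (2 * (X + 1 - (j : ℂ[X]))) (1 - j) (by push_cast; ring),
    qE_even_X_sub q (2 * (X - C ω + 2 + (N : ℂ[X]) - 2 * (j : ℂ[X]) - 2 * (m : ℂ[X]))) ω (2 + N - 2 * j - 2 * m)
      (by push_cast; ring), qE_two, zpow_natCast]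

lemma tTerm_eq (ω : ℂ) (N k j m i : ℕ) :
    qP q (-2 * (j : ℂ[X])) i * qP q (-2 * ((N : ℂ[X]) + X + 1 - (j : ℂ[X]))) i *
        qP q (-2 * (k : ℂ[X])) i *
        qP q (2 * (X - C ω + 1 - 2 * (m : ℂ[X]) - 2 * (j : ℂ[X]) + (k : ℂ[X]))) i *
        qP q (-2 * (C ω - 1 + (m : ℂ[X]) + (j : ℂ[X])) + 2 * (i : ℂ[X])) (k - i) /
      (qP q 2 i * qP q (-2 * (N : ℂ[X])) i * qP q (-2 * ((m : ℂ[X]) + (j : ℂ[X]))) i) *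
        qE q 2 ^ i = tTerm (cQ q ^ 2) (cZ q) (cY q ω) N k j m i := by
  have hQ := pow_ne_zero 2 (cQ_ne q)
  have e : (cQ q ^ 2) ^ (1 - m - j : ℤ) / cY q ω * (cQ q ^ 2) ^ i =
      (cQ q ^ 2) ^ (1 - m - j + i : ℤ) / cY q ω := by
    rw [zpow_add₀ hQ, zpow_natCast, div_mul_eq_mul_div]
  rw [tTerm, phiTerm, e]
  simp only [qP]
  rw [qE_even_const q (-2 * (j : ℂ[X])) (-j) (by push_cast; ring),
    qE_even_neg_X q (-2 * ((N : ℂ[X]) + X + 1 - (j : ℂ[X]))) (-(N + 1 - j)) (by push_cast; ring),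
    qE_even_const q (-2 * (k : ℂ[X])) (-k) (by push_cast; ring),
    qE_even_X_sub q (2 * (X - C ω + 1 - 2 * (m : ℂ[X]) - 2 * (j : ℂ[X]) + (k : ℂ[X]))) ω (1 - 2 * m - 2 * j + k)
      (by push_cast; ring),
    qE_even_neg_om q (-2 * (C ω - 1 + (m : ℂ[X]) + (j : ℂ[X])) + 2 * (i : ℂ[X])) ω (1 - m - j + i) (by push_cast; ring),
    qE_even_const q (-2 * (N : ℂ[X])) (-N) (by push_cast; ring),
    qE_even_const q (-2 * ((m : ℂ[X]) + (j : ℂ[X]))) (-(m + j)) (by push_cast; ring), qE_two]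

lemma qPoch_neg_eq_zero {F : Type*} [Field F] {p : F} (hp : p ≠ 0) {n i : ℕ} (h : n < i) :
    qPoch (p ^ (-n : ℤ)) p i = 0 :=
  qPoch_eq_zero h (by rw [zpow_neg, zpow_natCast, inv_mul_cancel₀ (pow_ne_zero _ hp)])

lemma tTerm_eq_zero {F : Type*} [Field F] {p z Y : F} (hp : p ≠ 0) {N k j m i : ℕ} (h : j < i) :
    tTerm p z Y N k j m i = 0 := by
  rw [tTerm, phiTerm, qPoch_neg_eq_zero hp h]
  simp

lemma sum_range_eq_of_le {F : Type*} [AddCommMonoid F] {a b : ℕ} (hab : a ≤ b) {f : ℕ → F}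
    (h : ∀ i, a ≤ i → f i = 0) : ∑ i ∈ Finset.range a, f i = ∑ i ∈ Finset.range b, f i :=
  Finset.sum_subset (Finset.range_mono hab) fun i _ hi => h i (by simpa using hi)

/-- The two sums stop at `min j k` and at `k`; the additional terms contain `(p^{-j}; p)_i` with `i
> j` and vanish. -/
lemma tCoefReg_eq (ω : ℂ) (N k j m : ℕ) :
    tCoefReg q ω N k j m = tVal (cQ q) (cQ q ^ 2) (cZ q) (cY q ω) N k j m := by
  rw [tCoefReg, tVal, tFactor_eq]
  simp only [tTerm_eq]
  congr 1
  rcases Nat.le_total k j with h | h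
  · rw [min_eq_right h]
  · rw [min_eq_left h]
    exact sum_range_eq_of_le (by omega) fun i hi =>
      tTerm_eq_zero (pow_ne_zero 2 (cQ_ne q)) (by omega)

/-- A coefficient pulled out in front of `π^ω(t_{kj})` is shifted by the weight `N - 2j`. The
coefficients `recA`, `recB` and `recD` of the recursions are the shifted coefficients of `α`, `β`
and `δ`. -/
lemma shift_coefA (ω : ℂ) (N j m : ℕ) : shift ((N : ℂ) - 2 * j) (coefA q ω m) =
    recA (cQ q) (cQ q ^ 2) (cZ q) (cY q ω) N j m := by
  have e1 : shift ((N : ℂ) - 2 * j) (qE q (-(m : ℂ[X]))) = cQ q ^ (-m : ℤ) := by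
    rw [shift_qE, ← qE_intCast]; simp
  have e2 : shift ((N : ℂ) - 2 * j) (qE q (2 * (X - C ω - (m : ℂ[X]) + 1))) = _ :=
    (shift_qE q _ _).trans (qE_even_X_sub q _ ω (N - 2 * j - m + 1) (by simp [C_ofNat] <;> ring))
  have e3 : shift ((N : ℂ) - 2 * j) (qE q (2 * (X - C ω - 2 * (m : ℂ[X]) + 1))) = _ :=
    (shift_qE q _ _).trans
      (qE_even_X_sub q _ ω (N - 2 * j - 2 * m + 1) (by simp [C_ofNat] <;> ring))
  simp only [coefA, recA, map_div₀, map_mul, map_sub, map_one, e1, e2, e3]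

lemma shift_coefB (ω : ℂ) (N j m : ℕ) : shift ((N : ℂ) - 2 * j) (coefB q ω (m + 1)) =
    recB (cQ q ^ 2) (cZ q) (cY q ω) N j m := by
  have e1 : shift ((N : ℂ) - 2 * j) (qE q (2 * ((m + 1 : ℕ) : ℂ[X]))) = _ :=
    (shift_qE q _ _).trans (qE_even_const q _ (m + 1 : ℕ) (by simp))
  have e2 : shift ((N : ℂ) - 2 * j) (qE q (2 * (C ω + ((m + 1 : ℕ) : ℂ[X]) - 1))) = _ :=
    (shift_qE q _ _).trans (qE_even_om q _ ω (m : ℕ) (by simp <;> ring))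
  have e3 : shift ((N : ℂ) - 2 * j) (qE q (2 * (X + 1))) = _ :=
    (shift_qE q _ _).trans (qE_even_X q _ (N - 2 * j + 1) (by simp [C_ofNat] <;> ring))
  have e4 : shift ((N : ℂ) - 2 * j) (qE q (2 * (C ω + 2 * ((m + 1 : ℕ) : ℂ[X]) - X - 3))) = _ :=
    (shift_qE q _ _).trans
      (qE_even_sub_X q _ ω (2 * m + 2 * j - N - 1) (by simp [C_ofNat] <;> ring))
  simp only [coefB, recB, map_div₀, map_mul, map_sub, map_one, e1, e2, e3, e4, zpow_natCast]

lemma shift_coefD (N j m : ℕ) : shift ((N : ℂ) - 2 * j) (coefD q m) =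
    recD (cQ q) (cQ q ^ 2) (cZ q) N j m := by
  have e1 : shift ((N : ℂ) - 2 * j) (qE q (m : ℂ[X])) = cQ q ^ m := by
    rw [shift_qE, ← qE_natCast]; simp
  have e2 : shift ((N : ℂ) - 2 * j) (qE q (2 * (X + 1 - (m : ℂ[X])))) = _ :=
    (shift_qE q _ _).trans (qE_even_X q _ (N - 2 * j + 1 - m) (by simp [C_ofNat] <;> ring))
  have e3 : shift ((N : ℂ) - 2 * j) (qE q (2 * (X + 1))) = _ :=
    (shift_qE q _ _).trans (qE_even_X q _ (N - 2 * j + 1) (by simp [C_ofNat] <;> ring))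
  simp only [coefD, recD, map_div₀, map_mul, map_sub, map_one, e1, e2, e3]

end Translation

/-! ### Recursions that split off a generator on the right. -/

namespace FSL2

/-- The factor in `α^j γ = χ_j(λ) γ α^j`. -/
noncomputable def chi (j : ℕ) : Mer :=
  (1 - qE q (2 * (X + 2))) / (cQ q ^ j * (1 - qE q (2 * (X + 2 - (j : ℂ[X])))))

/-- Moving `γ` to the left past `j` factors `α` collects `Φ(λ)`, `Φ(λ-1)`, …, whose product
telescopes. -/
lemma a_pow_mul_c (j : ℕ) : a q ^ j * c q = l q (chi q j) * (c q * a q ^ j) := by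
  have hne : ∀ n : ℤ, 1 - qE q (2 * (X + (n : ℂ[X]))) ≠ 0 := fun n => by
    rw [qE_even_X q _ n rfl]
    exact (genericPoint q 0).h2 n
  induction j with
  | zero =>
    have h := hne 2
    push_cast at h
    simp only [chi, pow_zero, Nat.cast_zero, sub_zero, one_mul, mul_one, div_self h, map_one]
  | succ j ih =>
    rw [pow_succ', mul_assoc, ih, a_l_assoc, ← mul_assoc (a q), ac_eq, mul_assoc (l q _), l_l_assoc,
      mul_assoc (c q)]
    congr 2
    have h1 := hne 1
    have h2 := hne (1 - j)
    have e : fPhi q = (1 - qE q (2 * (X + 2))) / (cQ q * (1 - qE q (2 * (X + 1)))) := by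
      rw [fPhi_eq', qE_even_X q (2 * (X + 2)) 2 (by push_cast; ring),
        qE_even_X q (2 * (X + 1)) 1 (by push_cast; ring),
        ← neg_div_neg_eq, zpow_ofNat, zpow_one]
      congr 1 <;> ring
    rw [chi, chi, e, map_div₀, map_mul, map_pow, shift_cQ, map_sub, map_sub, map_one, shift_qE,
      shift_qE]
    have e1 : (2 * (X + 2 : ℂ[X])).comp (X + C (-1)) = 2 * (X + 1) := by simp; ring
    have e2 : (2 * (X + 2 - (j : ℂ[X]))).comp (X + C (-1)) = 2 * (X + 2 - ((j + 1 : ℕ) : ℂ[X])) := by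
      simp; ring
    have e3 : 2 * (X + ((1 : ℤ) : ℂ[X])) = 2 * (X + 1) := by push_cast; ring
    have e4 : 2 * (X + ((1 - j : ℤ) : ℂ[X])) = 2 * (X + 2 - ((j + 1 : ℕ) : ℂ[X])) := by
      push_cast; ring
    rw [e3] at h1
    rw [e4] at h2
    rw [e1, e2]
    have hQ := cQ_ne q
    field_simp
    ring

/-- The factor in `γ^{N-j} α^j γ = ψ_j(λ) γ^{N+1-j} α^j`. -/
noncomputable def psi (N j : ℕ) : Mer := shift ((N - j : ℕ) : ℂ) (chi q j)

lemma basisV_mul_a (N j : ℕ) : basisV q N j * a q = basisV q (N + 1) (j + 1) := by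
  rw [basisV, basisV, mul_assoc, ← pow_succ, Nat.add_sub_add_right]

lemma basisV_mul_c {N j : ℕ} (h : j ≤ N) :
    basisV q N j * c q = l q (psi q N j) * basisV q (N + 1) j := by
  rw [basisV, basisV, mul_assoc, a_pow_mul_c, ← mul_assoc, c_pow_l, psi, mul_assoc, ← mul_assoc (_ ^ _),
    ← pow_succ, Nat.succ_sub h]

lemma psi_eq {N j : ℕ} (h : j ≤ N) : psi q N j = recPsi (cQ q) (cQ q ^ 2) (cZ q) N j := by
  have e1 : shift ((N - j : ℕ) : ℂ) (qE q (2 * (X + 2))) = _ :=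
    (shift_qE q _ _).trans (qE_even_X q _ (N - j + 2) (by simp [Nat.cast_sub h] <;> ring))
  have e2 : shift ((N - j : ℕ) : ℂ) (qE q (2 * (X + 2 - (j : ℂ[X])))) = _ :=
    (shift_qE q _ _).trans (qE_even_X q _ (N + 2 - 2 * j) (by simp [Nat.cast_sub h] <;> ring))
  simp only [psi, chi, recPsi, map_div₀, map_mul, map_sub, map_one, map_pow, shift_cQ, e1, e2]

lemma sum_right_mul {N : ℕ} (t : ℕ → FSL2 q) (ht : t (N + 1) = 0) (y e : FSL2 q) :
    ∑ j ∈ Finset.range (N + 1), tm (t j * y) (basisV q N j * a q) +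
      ∑ j ∈ Finset.range (N + 1), tm (t j * e) (basisV q N j * c q) =
    ∑ j ∈ Finset.range (N + 1 + 1), tm ((if j = 0 then 0 else t (j - 1) * y) +
      r q (psi q N j) * (t j * e)) (basisV q (N + 1) j) := by
  simp only [tm_add_left, Finset.sum_add_distrib]
  congr 1
  · rw [Finset.sum_range_succ' _ (N + 1), if_pos rfl, tm_zero_left, add_zero]
    exact Finset.sum_congr rfl fun j _ => by
      rw [if_neg (by omega), Nat.add_sub_cancel, basisV_mul_a]
  · rw [Finset.sum_range_succ _ (N + 1), ht, zero_mul, mul_zero, tm_zero_left, add_zero]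
    exact Finset.sum_congr rfl fun j hj => by
      rw [tm_balance, basisV_mul_c q (Nat.lt_succ_iff.1 (Finset.mem_range.1 hj))]

/-- Expands `Δ(γ^{N-k} α^k · α)` and compares coefficients. With the generator on the right, `π^ω`
first moves `e_m` by one explicit step, after which the formula in degree `N` applies. -/
lemma matEl_right_succ {N k j : ℕ} (hk : k ≤ N) (hj : j ≤ N + 1) :
    matEl q (N + 1) (k + 1) j = (if j = 0 then 0 else matEl q N k (j - 1) * a q) +
      r q (psi q N j) * (matEl q N k j * b q) := by
  refine sum_tm_basisV_injective q (x := fun j => matEl q (N + 1) (k + 1) j)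
    (y := fun j => (if j = 0 then 0 else matEl q N k (j - 1) * a q) +
      r q (psi q N j) * (matEl q N k j * b q)) ?_ hj
  have h := delta_basisV q (Nat.succ_le_succ hk) 1 1
  rw [Nat.succ_eq_add_one, ← basisV_mul_a, delta_mul, delta_a, map_add, delta_basisV q hk,
    delta_basisV q hk] at h
  simp only [mul_one] at h
  rw [← sum_right_mul q _ (matEl_of_lt q k (Nat.lt_succ_self N))]
  exact h.symm

/-- The row that the previous recursion does not reach, obtained from `γ^{N+1} = γ^N · γ`. -/
lemma matEl_right_zero {N j : ℕ} (hj : j ≤ N + 1) :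
    matEl q (N + 1) 0 j = (if j = 0 then 0 else matEl q N 0 (j - 1) * c q) +
      r q (psi q N j) * (matEl q N 0 j * d q) := by
  refine sum_tm_basisV_injective q (x := fun j => matEl q (N + 1) 0 j)
    (y := fun j => (if j = 0 then 0 else matEl q N 0 (j - 1) * c q) +
      r q (psi q N j) * (matEl q N 0 j * d q)) ?_ hj
  have h := delta_basisV q (Nat.zero_le (N + 1)) 1 1
  have e : basisV q (N + 1) 0 = basisV q N 0 * c q := by
    simp [basisV, pow_succ]
  rw [e, delta_mul, delta_c, map_add, delta_basisV q (Nat.zero_le N),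
    delta_basisV q (Nat.zero_le N)] at h
  simp only [mul_one] at h
  rw [← sum_right_mul q _ (matEl_of_lt q 0 (Nat.lt_succ_self N))]
  exact h.symm

end FSL2

/-! ### The action of the matrix elements in `π^ω`. -/

section Action

lemma basisVec_natCast (m : ℕ) : basisVec m = Finsupp.single m 1 := rfl

lemma basisVec_of_neg {n : ℤ} (h : n < 0) : basisVec n = 0 := by
  obtain ⟨m, rfl⟩ := Int.eq_negSucc_of_lt_zero h
  rfl

lemma dynRep_a (ω : ℂ) (m : ℕ) (g : Mer) : dynRep q ω (FSL2.a q) (Finsupp.single m g) =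
    Finsupp.single m (coefA q ω m * shift (-1) g) := by
  rw [dynRep, SLData.lift_a]
  exact opS_single _ _ _ _ _

lemma dynRep_b (ω : ℂ) (m : ℕ) (g : Mer) : dynRep q ω (FSL2.b q) (Finsupp.single m g) =
    Finsupp.single (m - 1) (coefB q ω m * shift 1 g) := by
  rw [dynRep, SLData.lift_b]
  exact opS_single _ _ _ _ _

lemma dynRep_c (ω : ℂ) (m : ℕ) (g : Mer) : dynRep q ω (FSL2.c q) (Finsupp.single m g) =
    Finsupp.single (m + 1) (-(cQ q)⁻¹ * shift (-1) g) := by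
  rw [dynRep, SLData.lift_c, ← qE_neg_one]
  exact opS_single _ _ _ _ _

lemma dynRep_d (ω : ℂ) (m : ℕ) (g : Mer) : dynRep q ω (FSL2.d q) (Finsupp.single m g) =
    Finsupp.single m (coefD q m * shift 1 g) := by
  rw [dynRep, SLData.lift_d]
  exact opS_single _ _ _ _ _

lemma dynRep_l (ω : ℂ) (f : Mer) (m : ℕ) (g : Mer) : dynRep q ω (FSL2.l q f) (Finsupp.single m g) =
    Finsupp.single m (shift (-ω - 2 * m) f * g) := by
  rw [dynRep, SLData.lift_l]
  exact opMul_single _ _ _ _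

lemma dynRep_r (ω : ℂ) (f : Mer) (x : HSpace) : dynRep q ω (FSL2.r q f) x = f • x := by
  rw [dynRep, SLData.lift_r]
  induction x using Finsupp.induction_linear with
  | zero => rw [map_zero, smul_zero]
  | add x y hx hy => rw [map_add, hx, hy, smul_add]
  | single m g =>
    refine (opMul_single _ _ _ _).trans ?_
    rw [shift_zero, Finsupp.smul_single, smul_eq_mul]

/-- Scalars act as functions of `μ`, so semilinearity of the operator is the weight relation of the
matrix element. -/
lemma dynRep_matEl_smul (ω : ℂ) {N k : ℕ} (hk : k ≤ N) (j : ℕ) (f : Mer) (x : HSpace) :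
    dynRep q ω (FSL2.matEl q N k j) (f • x) =
      shift (N - 2 * j) f • dynRep q ω (FSL2.matEl q N k j) x := by
  rw [← dynRep_r q ω f, ← dynRep_r q ω, ← Module.End.mul_apply, ← Module.End.mul_apply, ← map_mul,
    ← map_mul, (FSL2.matEl_weight q hk j f).2]

/-- The action of the matrix elements in the dynamical representation. -/
theorem dynRep_matEl (ω : ℂ) {N k j : ℕ} (hk : k ≤ N) (hj : j ≤ N) (m : ℕ) :
    dynRep q ω (FSL2.matEl q N k j) (basisVec m) =
      tCoefReg q ω N k j m • basisVec ((m : ℤ) + j - k) := by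
  rw [tCoefReg_eq]
  have hg := genericPoint q ω
  -- Valid also for `n = 0`: the coefficient `B_0` and the vector `e_{-1}` are both `0`.
  have hb : ∀ n : ℕ, dynRep q ω (FSL2.b q) (basisVec n) = coefB q ω n • basisVec ((n : ℤ) - 1) := by
    intro n
    rcases n with _ | n
    · rw [basisVec_natCast, dynRep_b, coefB_zero]; simp
    · rw [basisVec_natCast, dynRep_b, show (((n + 1 : ℕ) : ℤ) - 1) = (n : ℕ) by push_cast; ring,
        basisVec_natCast, Finsupp.smul_single, map_one]
      rfl
  induction N generalizing k j m with
  | zero =>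
    obtain rfl : k = 0 := by omega
    obtain rfl : j = 0 := by omega
    have h1 : tVal (cQ q) (cQ q ^ 2) (cZ q) (cY q ω) 0 0 0 m = 1 := by
      rw [tVal_zero, tPre_zero (show 0 = 0 + 0 from rfl), qBinom_zero _ _ (one_sub_pow_ne q)]
      simp [qPoch_zero]
    rw [FSL2.matEl_zero_zero, map_one, Module.End.one_apply, h1, one_smul]
    simp
  | succ N ih =>
    -- The column `N + 1`, in which the matrix elements of degree `N` vanish, is treated apart from
    -- the induction hypothesis.
    have ih' : ∀ {k j : ℕ} (m : ℕ), k ≤ N → j ≤ N + 1 → j ≠ N + 1 →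
        dynRep q ω (FSL2.matEl q N k j) (basisVec m) =
          tVal (cQ q) (cQ q ^ 2) (cZ q) (cY q ω) N k j m • basisVec ((m : ℤ) + j - k) :=
      fun m hk hj hj' => ih hk (by omega) m
    rcases k with _ | k
    · rw [FSL2.matEl_right_zero q hj, tVal_succ_zero hg hj, map_add, LinearMap.add_apply, add_smul]
      congr 1
      · split_ifs with h0
        · simp
        · obtain ⟨j, rfl⟩ := Nat.exists_eq_succ_of_ne_zero h0
          have e : Finsupp.single (m + 1) (-(cQ q)⁻¹ * shift (-1) 1) =
              (-(cQ q)⁻¹) • basisVec (m + 1 : ℕ) := by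
            rw [basisVec_natCast, Finsupp.smul_single, map_one]; rfl
          rw [map_mul, Module.End.mul_apply, basisVec_natCast, dynRep_c, e,
            dynRep_matEl_smul q ω (Nat.zero_le N), Nat.succ_eq_add_one, Nat.add_sub_cancel,
            ih (Nat.zero_le N) (by omega), smul_smul, map_neg, map_inv₀, shift_cQ]
          congr 2
          push_cast; ring
      · split_ifs with h0
        · subst h0
          rw [FSL2.matEl_of_lt q 0 (Nat.lt_succ_self N)]
          simp
        · have e : Finsupp.single m (coefD q m * shift 1 1) = coefD q m • basisVec (m : ℕ) := by
            rw [basisVec_natCast, Finsupp.smul_single, map_one]; rfl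
          rw [map_mul, Module.End.mul_apply, dynRep_r, map_mul, Module.End.mul_apply,
            basisVec_natCast, dynRep_d, e, dynRep_matEl_smul q ω (Nat.zero_le N),
            ih' m (Nat.zero_le N) hj h0, smul_smul, smul_smul, shift_coefD, FSL2.psi_eq q (by omega)]
    · have hk' : k ≤ N := by omega
      -- If the target index is negative, the recursion for the coefficients is not available, but
      -- both contributions land on vectors `e_i` with `i < 0` or have coefficient `0`.
      rcases Nat.lt_or_ge (m + j) (k + 1) with hm | hm
      · rw [basisVec_of_neg (n := (m : ℤ) + j - (k + 1 : ℕ)) (by push_cast; omega), smul_zero,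
          FSL2.matEl_right_succ q hk' hj, map_add,
          LinearMap.add_apply]
        have e : Finsupp.single m (coefA q ω m * shift (-1) 1) = coefA q ω m • basisVec (m : ℕ) := by
          rw [basisVec_natCast, Finsupp.smul_single, map_one]; rfl
        have h1 : dynRep q ω (if j = 0 then 0 else FSL2.matEl q N k (j - 1) * FSL2.a q)
            (basisVec m) = 0 := by
          split_ifs with h0
          · simp
          · rw [map_mul, Module.End.mul_apply, basisVec_natCast, dynRep_a, e,
              dynRep_matEl_smul q ω hk', ih hk' (by omega),
              basisVec_of_neg (n := (m : ℤ) + (j - 1 : ℕ) - k) (by omega)]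
            simp
        rw [h1, zero_add, map_mul, Module.End.mul_apply, dynRep_r, map_mul, Module.End.mul_apply, hb,
          dynRep_matEl_smul q ω hk']
        rcases m with _ | m
        · rw [coefB_zero]; simp
        · rw [show (((m + 1 : ℕ) : ℤ) - 1) = (m : ℕ) by push_cast; ring]
          by_cases h0 : j = N + 1
          · rw [h0, FSL2.matEl_of_lt q k (Nat.lt_succ_self N)]; simp
          · rw [ih' m hk' hj h0, basisVec_of_neg (n := (m : ℤ) + j - k) (by omega)]; simp
      · rw [FSL2.matEl_right_succ q hk' hj, tVal_succ_succ hg hk' hj hm, map_add,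
          LinearMap.add_apply, add_smul]
        congr 1
        · split_ifs with h0
          · simp
          · obtain ⟨j, rfl⟩ := Nat.exists_eq_succ_of_ne_zero h0
            have e : Finsupp.single m (coefA q ω m * shift (-1) 1) =
                coefA q ω m • basisVec (m : ℕ) := by
              rw [basisVec_natCast, Finsupp.smul_single, map_one]; rfl
            rw [map_mul, Module.End.mul_apply, basisVec_natCast, dynRep_a, e,
              dynRep_matEl_smul q ω hk', Nat.succ_eq_add_one, Nat.add_sub_cancel,
              ih hk' (by omega), smul_smul, shift_coefA]
            congr 2
            push_cast; ring
        · rw [map_mul, Module.End.mul_apply, dynRep_r, map_mul, Module.End.mul_apply, hb,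
            dynRep_matEl_smul q ω hk']
          split_ifs with h0
          · rcases h0 with h0 | h0
            · subst h0
              rw [FSL2.matEl_of_lt q k (Nat.lt_succ_self N)]
              simp
            · subst h0
              rw [coefB_zero]; simp
          · push Not at h0
            obtain ⟨m, rfl⟩ := Nat.exists_eq_succ_of_ne_zero h0.2
            rw [show (((m.succ : ℕ) : ℤ) - 1) = (m : ℕ) by push_cast; ring, ih' m hk' hj h0.1,
              smul_smul, smul_smul, Nat.succ_eq_add_one, Nat.add_sub_cancel, shift_coefB,
              FSL2.psi_eq q (by omega)]
            congr 2
            push_cast; ring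

end Action
end DynSU2

namespace DynSU2

open Polynomial Mer

variable (q : Set.Ioo (0 : ℝ) 1)

/-! ### Adjoints with respect to a weight on the basis vectors. -/

section Adjoint

/-- A weight on the basis vectors `e_m`, `K ≤ m`, whose span is stable under `π^ω`, for which the
generators are adjoint to their images under `*`. -/
structure IsAdjWeight (ω : ℝ) (K : ℕ) (G : ℕ → Mer) : Prop where
  lower : coefB q ω K = 0
  diag : ∀ m, K ≤ m → coefD q m * G m = shift 1 (coefA q ω m * G m)
  raise : ∀ m, K ≤ m → shift 1 (G (m + 1)) = coefB q ω (m + 1) * G m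

/-- The element `x` has weight `s` with respect to `f(μ)`, and the action of `x^*` is the adjoint
of that of `x`. -/
structure IsAdjointable (ω : ℝ) (K : ℕ) (G : ℕ → Mer) (s : ℤ) (x : FSL2 q) : Prop where
  weight : ∀ (f : Mer) v, dynRep q ω x (f • v) = shift s f • dynRep q ω x v
  stable : ∀ n, K ≤ n → ∀ m < K, ∀ g, dynRep q ω x (Finsupp.single n g) m = 0
  stable_star : ∀ n, K ≤ n → ∀ m < K, ∀ g, dynRep q ω (FSL2.star q x) (Finsupp.single n g) m = 0
  adjoint : ∀ m n, K ≤ m → K ≤ n → ∀ g, dynRep q ω (FSL2.star q x) (Finsupp.single m g) n * G n =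
    shift (-s) (bar (dynRep q ω x (Finsupp.single n 1) m) * G m * g)

variable {q} {ω : ℝ} {K : ℕ} {G : ℕ → Mer}

lemma finsupp_eq_sum_of_subset (v : HSpace) {S : Finset ℕ} (h : v.support ⊆ S) :
    v = ∑ i ∈ S, Finsupp.single i (v i) :=
  (Finsupp.sum_single v).symm.trans
    (Finsupp.sum_of_support_subset v h _ fun i _ => Finsupp.single_zero i)

namespace IsAdjointable

lemma add {s : ℤ} {x y : FSL2 q} (hx : IsAdjointable q ω K G s x)
    (hy : IsAdjointable q ω K G s y) : IsAdjointable q ω K G s (x + y) where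
  weight f v := by
    rw [map_add, LinearMap.add_apply, hx.weight, hy.weight, LinearMap.add_apply, smul_add]
  stable n hn m hm g := by
    rw [map_add, LinearMap.add_apply, Finsupp.add_apply, hx.stable n hn m hm, hy.stable n hn m hm,
      add_zero]
  stable_star n hn m hm g := by
    rw [FSL2.star_add, map_add, LinearMap.add_apply, Finsupp.add_apply, hx.stable_star n hn m hm,
      hy.stable_star n hn m hm, add_zero]
  adjoint m n hm hn g := by
    rw [FSL2.star_add, map_add, map_add, LinearMap.add_apply, LinearMap.add_apply,
      Finsupp.add_apply, Finsupp.add_apply, map_add, add_mul, add_mul, add_mul, map_add,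
      hx.adjoint m n hm hn, hy.adjoint m n hm hn]

lemma zero (s : ℤ) : IsAdjointable q ω K G s 0 where
  weight f v := by simp
  stable n hn m hm g := by simp
  stable_star n hn m hm g := by simp [FSL2.star_zero]
  adjoint m n hm hn g := by simp [FSL2.star_zero]

/-- Adjoints reverse products, just as `*` does. Both sides are sums over an intermediate index `i`;
the shift in the adjoint relation is compensated by the semilinearity of `x`. -/
lemma mul {s t : ℤ} {x y : FSL2 q} (hx : IsAdjointable q ω K G s x)
    (hy : IsAdjointable q ω K G t y) : IsAdjointable q ω K G (s + t) (x * y) where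
  weight f v := by
    rw [map_mul, Module.End.mul_apply, hy.weight, hx.weight, shift_shift, Module.End.mul_apply]
    push_cast; rfl
  stable n hn m hm g := by
    rw [map_mul, Module.End.mul_apply,
      finsupp_eq_sum_of_subset (dynRep q ω y (Finsupp.single n g)) (le_refl _), map_sum,
      Finsupp.finsetSum_apply]
    refine Finset.sum_eq_zero fun i _ => ?_
    rcases Nat.lt_or_ge i K with hi | hi
    · rw [hy.stable n hn i hi, Finsupp.single_zero, map_zero, Finsupp.zero_apply]
    · exact hx.stable i hi m hm _
  stable_star n hn m hm g := by
    rw [FSL2.star_mul, map_mul, Module.End.mul_apply,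
      finsupp_eq_sum_of_subset (dynRep q ω (FSL2.star q x) (Finsupp.single n g)) (le_refl _),
      map_sum, Finsupp.finsetSum_apply]
    refine Finset.sum_eq_zero fun i _ => ?_
    rcases Nat.lt_or_ge i K with hi | hi
    · rw [hx.stable_star n hn i hi, Finsupp.single_zero, map_zero, Finsupp.zero_apply]
    · exact hy.stable_star i hi m hm _
  adjoint m n hm hn g := by
    rw [FSL2.star_mul, map_mul (dynRep q ω), map_mul (dynRep q ω), Module.End.mul_apply,
      Module.End.mul_apply]
    set v := dynRep q ω (FSL2.star q x) (Finsupp.single m g) with hv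
    set w := dynRep q ω y (Finsupp.single n 1) with hw
    obtain ⟨S, hSv, hSw⟩ : ∃ S, v.support ⊆ S ∧ w.support ⊆ S :=
      ⟨_, Finset.subset_union_left, Finset.subset_union_right⟩
    rw [finsupp_eq_sum_of_subset v hSv, finsupp_eq_sum_of_subset w hSw,
      map_sum, map_sum, Finsupp.finsetSum_apply, Finsupp.finsetSum_apply, Finset.sum_mul, map_sum,
      Finset.sum_mul, Finset.sum_mul, map_sum]
    refine Finset.sum_congr rfl fun i _ => ?_
    -- Below `K` the weight is unrelated to the action, but stability ensures that such intermediate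
    -- vectors do not occur.
    rcases Nat.lt_or_ge i K with hi | hi
    · rw [hv, hw, hx.stable_star m hm i hi, hy.stable n hn i hi]
      simp
    · have e : Finsupp.single i (w i) = w i • Finsupp.single i (1 : Mer) := by
        rw [Finsupp.smul_single, smul_eq_mul, mul_one]
      have key := hx.adjoint m i hm hi g
      have e2 : (starRingEnd ℂ) (s : ℂ) = s := by simp
      have e3 : -((s + t : ℤ) : ℂ) = -t + -s := by push_cast; ring
      -- The weight `G i` of the intermediate vector is the link: it is the left-hand factor in the
      -- adjoint relation for `x` and the right-hand one in that for `y`.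
      have e4 : bar (w i) * G i * v i = bar (w i) * (v i * G i) := by ring
      rw [← hv] at key
      rw [hy.adjoint i n hi hn, ← hw, e4, key, e, hx.weight, Finsupp.smul_apply, smul_eq_mul,
        map_mul bar, bar_shift, e2, e3, ← shift_shift]
      simp only [map_mul, shift_shift]
      rw [neg_add_cancel, add_zero]
      ring

lemma r (f : Mer) : IsAdjointable q ω K G 0 (FSL2.r q f) where
  weight g v := by rw [dynRep_r, dynRep_r, smul_comm]; simp
  stable n hn m hm g := by
    rw [dynRep_r, Finsupp.smul_apply, Finsupp.single_eq_of_ne (by omega), smul_zero]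
  stable_star n hn m hm g := by
    rw [FSL2.star_r, dynRep_r, Finsupp.smul_apply, Finsupp.single_eq_of_ne (by omega), smul_zero]
  adjoint m n hm hn g := by
    rw [FSL2.star_r, dynRep_r, dynRep_r, Finsupp.smul_apply, Finsupp.smul_apply]
    rcases eq_or_ne m n with rfl | h
    · rw [Finsupp.single_eq_same, Finsupp.single_eq_same]
      simp; ring
    · rw [Finsupp.single_eq_of_ne h.symm, Finsupp.single_eq_of_ne h]
      simp

lemma one : IsAdjointable q ω K G 0 1 := by
  rw [← map_one (FSL2.r q)]
  exact r 1

lemma smul_single_eq (x : FSL2 q) (s : ℤ) (c : ℕ → Mer) (e : ℕ → ℕ)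
    (h : ∀ n g, dynRep q ω x (Finsupp.single n g) = Finsupp.single (e n) (c n * shift s g))
    (f : Mer) (v : HSpace) : dynRep q ω x (f • v) = shift s f • dynRep q ω x v := by
  induction v using Finsupp.induction_linear with
  | zero => simp
  | add v w hv hw => rw [smul_add, map_add, hv, hw, map_add, smul_add]
  | single n g =>
    rw [Finsupp.smul_single, h, h, Finsupp.smul_single, smul_eq_mul, smul_eq_mul, map_mul]
    congr 1; ring

lemma bar_coefA (m : ℕ) : bar (coefA q ω m) = coefA q ω m := by
  simp [coefA, bar_qE']

lemma bar_coefB (m : ℕ) : bar (coefB q ω m) = coefB q ω m := by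
  simp [coefB, bar_qE']

lemma bar_coefD (m : ℕ) : bar (coefD q m) = coefD q m := by
  simp [coefD, bar_qE']

lemma bar_cQ : bar (cQ q) = cQ q := by simp [cQ, bar_const]

variable (hG : IsAdjWeight q ω K G)
include hG

lemma a : IsAdjointable q ω K G (-1) (FSL2.a q) where
  weight := smul_single_eq _ (-1) (coefA q ω) id fun n g => by rw [dynRep_a]; simp
  stable n hn m hm g := by rw [dynRep_a, Finsupp.single_eq_of_ne (by omega)]
  stable_star n hn m hm g := by
    rw [FSL2.star_a, dynRep_d, Finsupp.single_eq_of_ne (by omega)]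
  adjoint m n hm hn g := by
    rw [FSL2.star_a, dynRep_a, dynRep_d]
    rcases eq_or_ne m n with rfl | h
    · rw [Finsupp.single_eq_same, Finsupp.single_eq_same, map_one, mul_one, bar_coefA, map_mul]
      push_cast
      rw [neg_neg, ← hG.diag m hm]
      ring
    · rw [Finsupp.single_eq_of_ne h.symm, Finsupp.single_eq_of_ne h]
      simp

lemma d : IsAdjointable q ω K G 1 (FSL2.d q) where
  weight := smul_single_eq _ 1 (coefD q) id fun n g => by rw [dynRep_d]; simp
  stable n hn m hm g := by rw [dynRep_d, Finsupp.single_eq_of_ne (by omega)]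
  stable_star n hn m hm g := by
    rw [FSL2.star_d, dynRep_a, Finsupp.single_eq_of_ne (by omega)]
  adjoint m n hm hn g := by
    rw [FSL2.star_d, dynRep_d, dynRep_a]
    rcases eq_or_ne m n with rfl | h
    · rw [Finsupp.single_eq_same, Finsupp.single_eq_same, map_one, mul_one, bar_coefD,
        hG.diag m hm, map_mul, shift_shift]
      push_cast
      rw [neg_add_cancel, shift_zero]
      ring
    · rw [Finsupp.single_eq_of_ne h.symm, Finsupp.single_eq_of_ne h]
      simp

lemma b : IsAdjointable q ω K G 1 (FSL2.b q) where
  weight := smul_single_eq _ 1 (coefB q ω) (fun n => n - 1) fun n g => by rw [dynRep_b]; simp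
  stable n hn m hm g := by
    rw [dynRep_b]
    rcases eq_or_ne n K with rfl | h
    · rw [hG.lower]; simp
    · rw [Finsupp.single_eq_of_ne (by omega)]
  stable_star n hn m hm g := by
    rw [FSL2.star_b, _root_.map_smul, LinearMap.smul_apply, dynRep_c, Finsupp.smul_apply,
      Finsupp.single_eq_of_ne (by omega), smul_zero]
  adjoint m n hm hn g := by
    rw [FSL2.star_b, _root_.map_smul, LinearMap.smul_apply, dynRep_c, dynRep_b, Finsupp.smul_apply]
    rcases eq_or_ne n (m + 1) with rfl | h
    · rw [Finsupp.single_eq_same, Nat.add_sub_cancel, Finsupp.single_eq_same, map_one, mul_one,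
        bar_coefB, ← hG.raise m hm, map_mul, shift_shift, neg_smul, FSL2.cQ_smul]
      push_cast
      rw [neg_add_cancel, shift_zero]
      have := cQ_ne q
      field_simp
    · rw [Finsupp.single_eq_of_ne h]
      rcases n with _ | n
      · rw [coefB_zero]; simp
      · rw [Finsupp.single_eq_of_ne (by omega)]; simp

lemma c : IsAdjointable q ω K G (-1) (FSL2.c q) where
  weight := smul_single_eq _ (-1) (fun _ => -(cQ q)⁻¹) (fun n => n + 1) fun n g => by
    rw [dynRep_c]; simp
  stable n hn m hm g := by rw [dynRep_c, Finsupp.single_eq_of_ne (by omega)]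
  stable_star n hn m hm g := by
    rw [FSL2.star_c, _root_.map_smul, LinearMap.smul_apply, dynRep_b, Finsupp.smul_apply]
    rcases eq_or_ne n K with rfl | h
    · rw [hG.lower]; simp
    · rw [Finsupp.single_eq_of_ne (by omega), smul_zero]
  adjoint m n hm hn g := by
    have e : ((q : ℝ) : ℂ)⁻¹ • (1 : Mer) = (cQ q)⁻¹ := by
      rw [Algebra.smul_def, mul_one, map_inv₀, cQ]
    have e2 : ∀ f : Mer, (-((q : ℝ) : ℂ)⁻¹) • f = -(cQ q)⁻¹ * f := fun f => by
      rw [← e]; simp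
    rw [FSL2.star_c, _root_.map_smul, LinearMap.smul_apply, dynRep_b, dynRep_c, Finsupp.smul_apply]
    rcases eq_or_ne m (n + 1) with rfl | h
    · rw [Finsupp.single_eq_same, Nat.add_sub_cancel, Finsupp.single_eq_same, map_one, mul_one, e2,
        map_neg, map_inv₀, bar_cQ, map_mul, map_mul, map_neg, map_inv₀, shift_cQ]
      push_cast
      rw [neg_neg, hG.raise n hn]
      ring
    · rw [Finsupp.single_eq_of_ne h]
      rcases m with _ | m
      · rw [coefB_zero]; simp
      · rw [Finsupp.single_eq_of_ne (by omega)]; simp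

/-- The class of adjointable elements contains the generators and the functions of `μ` and is closed
under products, and under sums of equal weight; the recursion does the rest. -/
lemma matEl {N k : ℕ} (hk : k ≤ N) (j : ℕ) :
    IsAdjointable q ω K G (N - 2 * j) (FSL2.matEl q N k j) := by
  induction N generalizing k j with
  | zero =>
    obtain rfl : k = 0 := by omega
    rcases j with _ | j
    · rw [FSL2.matEl_zero_zero]; exact one
    · rw [FSL2.matEl_of_lt q 0 (Nat.succ_pos j)]; exact zero _
  | succ N ih =>
    have aux : ∀ (k : ℕ) (hk : k ≤ N) (x y : FSL2 q) (hx : IsAdjointable q ω K G 1 x)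
        (hy : IsAdjointable q ω K G (-1) y) (j : ℕ), IsAdjointable q ω K G ((N + 1 : ℕ) - 2 * (j + 1 : ℕ))
        (x * FSL2.matEl q N k (j + 1) +
          FSL2.r q (FSL2.prodPhi q (N - j)) * (y * FSL2.matEl q N k j)) := by
      intro k hk x y hx hy j
      have h1 := hx.mul (ih hk (j + 1))
      have h2 := (r (FSL2.prodPhi q (N - j))).mul (hy.mul (ih hk j))
      refine add ?_ ?_
      · convert h1 using 1; push_cast; ring
      · convert h2 using 1; push_cast; ring
    have aux0 : ∀ (k : ℕ) (hk : k ≤ N) (x : FSL2 q) (hx : IsAdjointable q ω K G 1 x),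
        IsAdjointable q ω K G ((N + 1 : ℕ) - 2 * (0 : ℕ)) (x * FSL2.matEl q N k 0) := by
      intro k hk x hx
      have h1 := hx.mul (ih hk 0)
      convert h1 using 1; push_cast; ring
    rcases Nat.lt_or_ge N k with h | h
    · obtain rfl : k = N + 1 := by omega
      rcases j with _ | j
      · rw [FSL2.matEl_top_zero]
        exact aux0 N le_rfl _ (b hG)
      · rw [FSL2.matEl_top_succ]
        exact aux N le_rfl _ _ (b hG) (a hG) j
    · rcases j with _ | j
      · rw [FSL2.matEl_succ_zero q h]
        exact aux0 k h _ (d hG)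
      · rw [FSL2.matEl_succ_succ q h]
        exact aux k h _ _ (d hG) (c hG) j

end IsAdjointable

lemma qPochInt_map {F E : Type*} [Field F] [Field E] (f : F →+* E) (a p : F) (n : ℤ) :
    f (qPochInt a p n) = qPochInt (f a) (f p) n := by
  rcases n with n | n
  · simp [qPochInt, qPoch, map_prod]
  · simp [qPochInt, qPoch, map_prod]

lemma bar_qP (P : ℂ[X]) (n : ℕ) : bar (qP q P n) = qP q (P.map (starRingEnd ℂ)) n := by
  simp [qP, qPoch, map_prod, bar_qE']

lemma bar_qBinom (N k : ℕ) : bar (qBinom (qE q 2) N k) = qBinom (qE q 2) N k := by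
  simp [qBinom, qPoch, map_prod, bar_qE']

/-- For real `ω` every exponent in the formula is a polynomial with real coefficients. -/
lemma bar_tCoefReg (N k j m : ℕ) : bar (tCoefReg q ω N k j m) = tCoefReg q ω N k j m := by
  simp only [tCoefReg, tFactor, map_mul, map_div₀, map_sum, qPochInt_map bar, bar_qP, bar_qBinom,
    bar_qE', map_pow, map_neg, map_one]
  simp

lemma star_matEl_weight {N k : ℕ} (hk : k ≤ N) (j : ℕ) (f : Mer) :
    FSL2.star q (FSL2.matEl q N k j) * FSL2.l q f =
      FSL2.l q (shift (2 * k - N) f) * FSL2.star q (FSL2.matEl q N k j) ∧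
    FSL2.star q (FSL2.matEl q N k j) * FSL2.r q f =
      FSL2.r q (shift (2 * j - N) f) * FSL2.star q (FSL2.matEl q N k j) := by
  have h1 := congrArg (FSL2.star q) (FSL2.matEl_weight q hk j (shift (2 * k - N) (bar f))).1
  have h2 := congrArg (FSL2.star q) (FSL2.matEl_weight q hk j (shift (2 * j - N) (bar f))).2
  simp only [FSL2.star_mul, FSL2.star_l, FSL2.star_r, bar_shift, bar_bar, shift_shift] at h1 h2
  have e : ∀ i : ℕ, (starRingEnd ℂ) (2 * i - N : ℂ) = 2 * i - N := fun i => by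
    rw [map_sub, map_mul, map_natCast, map_natCast, Complex.conj_ofNat]
  have e2 : ∀ i : ℕ, (N - 2 * i + (2 * i - N) : ℂ) = 0 := fun i => by ring
  rw [e2, map_zero, shift_zero, e] at h1 h2
  exact ⟨h1.symm, h2.symm⟩

lemma shift_cZ_injective {a b : ℤ} (h : shift (a : ℂ) (cZ q) = shift (b : ℂ) (cZ q)) : a = b := by
  rw [shift_cZ q a rfl, shift_cZ q b rfl] at h
  by_contra hab
  refine cQ_zpow_ne_one q (n := 2 * a - 2 * b) (by omega) ?_
  rw [zpow_sub₀ (cQ_ne q), mul_right_cancel₀ (cZ_ne q) h, div_self (zpow_ne_zero _ (cQ_ne q))]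

/-- The index of a basis vector is visible in the action of `f(λ)` against that of `f(μ)`. An
operator of definite weights therefore changes the index by a definite amount, here `k - j`. No
condition on `ω` or on a weight function is involved. -/
lemma star_matEl_support {N k j m i : ℕ} (hk : k ≤ N) (h : i + j ≠ m + k) (g : Mer) :
    dynRep q ω (FSL2.star q (FSL2.matEl q N k j)) (Finsupp.single m g) i = 0 := by
  -- The function is chosen so that, acting through `λ`, it multiplies `e_m` by `q^{2λ}`, which is
  -- compared with the same function acting through `μ`.
  have h1 := congrArg (fun x => dynRep q ω x (Finsupp.single m g) i)
    (star_matEl_weight hk j (shift (ω + 2 * m) (cZ q))).1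
  have h2 := congrArg (fun x => dynRep q ω x (Finsupp.single m g) i)
    (star_matEl_weight hk j (cZ q)).2
  have hl : ∀ (f : Mer) (v : HSpace), dynRep q ω (FSL2.l q f) v i =
      shift (-ω - 2 * i) f * v i := by
    intro f v
    induction v using Finsupp.induction_linear with
    | zero => simp
    | add v w hv hw => rw [map_add, Finsupp.add_apply, hv, hw, Finsupp.add_apply, mul_add]
    | single n g =>
      rw [dynRep_l]
      rcases eq_or_ne i n with rfl | hn
      · simp
      · rw [Finsupp.single_eq_of_ne hn, Finsupp.single_eq_of_ne hn, mul_zero]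
  simp only [map_mul, Module.End.mul_apply, hl, dynRep_l, dynRep_r, shift_shift,
    Finsupp.smul_single, Finsupp.smul_apply, smul_eq_mul] at h1 h2
  rw [show (-ω - 2 * m + (ω + 2 * m) : ℂ) = 0 by ring, shift_zero, h2, ← sub_eq_zero, ← sub_mul,
    mul_eq_zero, sub_eq_zero] at h1
  -- A nonzero coefficient would force two integer shifts of `q^{2λ}` to agree, hence the shifts
  -- themselves, which is the relation between indices that was excluded.
  refine h1.resolve_left fun h1 => h ?_
  have h3 := shift_cZ_injective (q := q) (a := 2 * j - N) (b := 2 * k - N - 2 * i + 2 * m) (by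
    push_cast
    rw [h1]
    congr 2
    ring)
  omega

/-- The action of the adjoints of the matrix elements. -/
lemma star_matEl_apply (hG : IsAdjWeight q ω K G) {N k j m n : ℕ} (hk : k ≤ N) (hj : j ≤ N)
    (h : n + j = m + k) (hm : K ≤ m) (hn : K ≤ n) (g : Mer) :
    dynRep q ω (FSL2.star q (FSL2.matEl q N k j)) (Finsupp.single m g) n * G n =
      shift (2 * j - N) (tCoefReg q ω N k j n * G m * g) := by
  have h1 := (IsAdjointable.matEl hG hk j).adjoint m n hm hn g
  rw [h1, ← basisVec_natCast, dynRep_matEl q ω hk hj, show (n : ℤ) + j - k = (m : ℕ) by omega,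
    basisVec_natCast, Finsupp.smul_apply, Finsupp.single_eq_same, smul_eq_mul, mul_one,
    bar_tCoefReg]
  push_cast
  rw [neg_sub]

end Adjoint
end DynSU2

namespace DynSU2

open Polynomial Mer

/-! ### The weights `Γ^ω_k` and their reduced forms. -/

section GenericWeight

variable {F : Type*} [Field F]

/-- The function `Γ_k^ω` with `(q^{2ω}; q²)_k` replaced by `(q^{2(ω+K)}; q²)_{k-K}`. -/
noncomputable def gamW (p z Y : F) (K k : ℕ) : F :=
  qPoch p p k * qPoch (Y * p ^ K) p (k - K) /
    (qPoch (z * p ^ (1 - k : ℤ)) p k * qPoch (Y / z * p ^ (k - 1 : ℤ)) p k)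

variable {Q p z Y : F} (h : GenericPoint Q p z Y)
include h

/-- Up to an invertible monomial this factor is `1 - (z/Y) p^{-n}`. -/
lemma GenericPoint.sub_X_ne (n : ℤ) : 1 - Y / z * p ^ n ≠ 0 := by
  have h1 := h.h3 (-n)
  have e : 1 - Y / z * p ^ n = -(Y / z * p ^ n) * (1 - z / Y * p ^ (-n)) := by
    have hz := h.hz
    have hY := h.hY
    have hp := zpow_ne_zero n h.hp
    rw [zpow_neg]
    field_simp
    ring
  rw [e]
  exact mul_ne_zero (neg_ne_zero.2 (mul_ne_zero (div_ne_zero h.hY h.hz) (zpow_ne_zero _ h.hp))) h1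

/-- The adjointness of `α` and `δ`. Replacing `z` by `p z` changes each factorial in the denominator
by its end factors only, and those are the factors in the coefficients `A_m` and `D_m`. The index
`K` plays no role, as the factorials in the numerator do not involve `z`. -/
lemma gamW_diag (K m : ℕ) :
    Q ^ m * (1 - z * p ^ (1 - m : ℤ)) / (1 - z * p) * gamW p z Y K m =
      Q ^ (-m : ℤ) * (1 - z / Y * p ^ (2 - m : ℤ)) / (1 - z / Y * p ^ (2 - 2 * m : ℤ)) *
        gamW p (p * z) Y K m := by
  have hp := h.hp
  have hz := h.hz
  have hY := h.hY
  have a1 : 1 - z * p ≠ 0 := by simpa using h.h2 1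
  have a2 := h.sub_X_ne (m - 2)
  have a3 := h.h3 (2 - 2 * m)
  have a4 := h.h2 (1 - m)
  have a5 := h.sub_X_ne (2 * m - 2)
  have e1 : (1 - z * p ^ (1 - m : ℤ)) * qPoch (p * z * p ^ (1 - m : ℤ)) p m =
      qPoch (z * p ^ (1 - m : ℤ)) p m * (1 - z * p) := by
    have := qPoch_mul_right (z * p ^ (1 - m : ℤ)) p m
    rw [mul_assoc z _ (p ^ m), ← zpow_natCast, ← zpow_add₀ hp, sub_add_cancel, zpow_one] at this
    rw [← this]
    congr 2; ring
  have e2 : (1 - Y / z * p ^ (m - 2 : ℤ)) * qPoch (Y / z * p ^ (m - 1 : ℤ)) p m =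
      qPoch (Y / (p * z) * p ^ (m - 1 : ℤ)) p m * (1 - Y / z * p ^ (2 * m - 2 : ℤ)) := by
    have := qPoch_mul_right (Y / z * p ^ (m - 2 : ℤ)) p m
    rw [mul_assoc _ _ (p ^ m), mul_assoc _ _ p, ← zpow_natCast, ← zpow_add₀ hp,
      ← zpow_add_one₀ hp] at this
    convert this using 3
    · congr 3; ring
    · rw [mul_comm p z, div_mul_eq_div_div, div_mul_eq_mul_div, mul_div_assoc, div_eq_mul_inv _ p,
        ← zpow_sub_one₀ hp]
      congr 2; ring
    · congr 2; ring
  have e3 : Q ^ m * (1 - z / Y * p ^ (2 - 2 * m : ℤ)) * (1 - Y / z * p ^ (m - 2 : ℤ)) =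
      Q ^ (-m : ℤ) * (1 - z / Y * p ^ (2 - m : ℤ)) * (1 - Y / z * p ^ (2 * m - 2 : ℤ)) := by
    have hQ := h.hQ
    have hQm := pow_ne_zero m hQ
    rw [show (2 - 2 * m : ℤ) = 2 + (-m) + (-m) by ring, show (2 - m : ℤ) = 2 + (-m) by ring,
      show (2 * m - 2 : ℤ) = m + m + (-2) by ring, show (m - 2 : ℤ) = m + (-2) by ring]
    simp only [zpow_add₀ hp, zpow_neg, zpow_natCast, zpow_ofNat]
    rw [h.hQp, pow_right_comm]
    field_simp
    ring
  have hP : ∀ n : ℤ, qPoch (z * p ^ n) p m ≠ 0 := fun n => qPoch_ne_zero fun i _ => by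
    rw [mul_assoc, ← zpow_natCast, ← zpow_add₀ hp]
    exact h.h2 _
  have hR : ∀ n : ℤ, qPoch (Y / z * p ^ n) p m ≠ 0 := fun n => qPoch_ne_zero fun i _ => by
    rw [mul_assoc, ← zpow_natCast, ← zpow_add₀ hp]
    exact h.sub_X_ne _
  have b1 := hP (1 - m)
  have b2 := hR (m - 1)
  have b3 : qPoch (p * z * p ^ (1 - m : ℤ)) p m ≠ 0 :=
    right_ne_zero_of_mul (e1 ▸ mul_ne_zero b1 a1)
  have b4 : qPoch (Y / (p * z) * p ^ (m - 1 : ℤ)) p m ≠ 0 :=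
    left_ne_zero_of_mul (e2 ▸ mul_ne_zero a2 b2)
  rw [gamW, gamW]
  generalize qPoch (p * z * p ^ (1 - m : ℤ)) p m = P₁ at *
  generalize qPoch (z * p ^ (1 - m : ℤ)) p m = P₀ at *
  generalize qPoch (Y / (p * z) * p ^ (m - 1 : ℤ)) p m = R₁ at *
  generalize qPoch (Y / z * p ^ (m - 1 : ℤ)) p m = R₀ at *
  generalize 1 - z * p = c₁ at *
  generalize 1 - z / Y * p ^ (2 - 2 * m : ℤ) = c₂ at *
  generalize 1 - z / Y * p ^ (2 - m : ℤ) = c₃ at *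
  generalize 1 - Y / z * p ^ (m - 2 : ℤ) = c₄ at *
  generalize 1 - Y / z * p ^ (2 * m - 2 : ℤ) = c₅ at *
  generalize 1 - z * p ^ (1 - m : ℤ) = c₆ at *
  generalize qPoch p p m * qPoch (Y * p ^ K) p (m - K) = A
  generalize Q ^ m = Q₁ at *
  generalize Q ^ (-m : ℤ) = Q₂ at *
  rw [div_mul_div_comm, div_mul_div_comm,
    div_eq_div_iff (mul_ne_zero a1 (mul_ne_zero b1 b2)) (mul_ne_zero a3 (mul_ne_zero b3 b4))]
  refine mul_left_cancel₀ a2 ?_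
  linear_combination A * (Q₁ * c₂ * c₄ * R₁) * e1 + A * P₀ * c₁ * R₁ * e3 - A * Q₂ * c₃ * c₁ * P₀ * e2

/-- The adjointness of `β` and `γ`. The shift keeps the starting points of both factorials in the
denominator, so raising the index only appends factors; they make up `B_{m+1}`. -/
lemma gamW_raise {K m : ℕ} (hK : K ≤ m) :
    gamW p (p * z) Y K (m + 1) = (1 - p ^ (m + 1)) * (1 - Y * p ^ m) /
      ((1 - z * p) * (1 - Y / z * p ^ (2 * m - 1 : ℤ))) * gamW p z Y K m := by
  have hp := h.hp
  have e1 : qPoch (p * z * p ^ (1 - (m + 1 : ℕ) : ℤ)) p (m + 1) =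
      qPoch (z * p ^ (1 - m : ℤ)) p m * (1 - z * p) := by
    have e : p * z * p ^ (1 - (m + 1 : ℕ) : ℤ) = z * p ^ (1 - m : ℤ) := by
      rw [mul_comm p z, mul_assoc, ← zpow_one_add₀ hp]; congr 2; push_cast; ring
    rw [e, qPoch_succ, mul_assoc z, ← zpow_natCast, ← zpow_add₀ hp, sub_add_cancel, zpow_one]
  have e2 : qPoch (Y / (p * z) * p ^ ((m + 1 : ℕ) - 1 : ℤ)) p (m + 1) =
      qPoch (Y / z * p ^ (m - 1 : ℤ)) p m * (1 - Y / z * p ^ (2 * m - 1 : ℤ)) := by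
    have e : Y / (p * z) * p ^ ((m + 1 : ℕ) - 1 : ℤ) = Y / z * p ^ (m - 1 : ℤ) := by
      rw [mul_comm p z, div_mul_eq_div_div, div_mul_eq_mul_div, mul_div_assoc, div_eq_mul_inv _ p,
        ← zpow_sub_one₀ hp]
      congr 2; push_cast; ring
    rw [e, qPoch_succ, mul_assoc (Y / z), ← zpow_natCast, ← zpow_add₀ hp]
    congr 4; ring
  rw [gamW, gamW, e1, e2, Nat.succ_sub hK, qPoch_succ, qPoch_succ, ← pow_succ', mul_assoc Y,
    ← pow_add, Nat.add_sub_cancel' hK]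
  simp only [div_eq_mul_inv, mul_inv]
  ring

end GenericWeight

variable (q : Set.Ioo (0 : ℝ) 1)

lemma shift_gamW (n : ℤ) {s : ℂ} (hs : s = n) (ω : ℂ) (K m : ℕ) :
    shift s (gamW (cQ q ^ 2) (cZ q) (cY q ω) K m) =
      gamW (cQ q ^ 2) ((cQ q ^ 2) ^ n * cZ q) (cY q ω) K m := by
  simp only [gamW, map_div₀, map_mul, shift_qPoch, map_pow, shift_cQ, map_zpow₀, shift_cY,
    shift_cZ q n hs, zpow_mul, zpow_ofNat]

lemma gammaW_eq (ω : ℂ) (k : ℕ) : gammaW q ω k = gamW (cQ q ^ 2) (cZ q) (cY q ω) 0 k := by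
  rw [gammaW, gamW, qP, qP, qP, qP, qE_two, qE_even_om q (2 * C ω) ω 0 (by simp),
    qE_even_X q (2 * (X - (k : ℂ[X]) + 1)) (1 - k) (by push_cast; ring),
    qE_even_sub_X q (2 * (C ω - X + (k : ℂ[X]) - 1)) ω (k - 1) (by push_cast; ring), zpow_zero,
    pow_zero, Nat.sub_zero]

lemma shift_coefA_eq (ω : ℂ) (m : ℕ) : shift 1 (coefA q ω m) =
    cQ q ^ (-m : ℤ) * (1 - cZ q / cY q ω * (cQ q ^ 2) ^ (2 - m : ℤ)) /
      (1 - cZ q / cY q ω * (cQ q ^ 2) ^ (2 - 2 * m : ℤ)) := by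
  have e1 : shift 1 (qE q (-(m : ℂ[X]))) = cQ q ^ (-m : ℤ) := by
    rw [shift_qE, ← qE_intCast]; simp
  have e2 : shift 1 (qE q (2 * (X - C ω - (m : ℂ[X]) + 1))) = _ :=
    (shift_qE q _ _).trans (qE_even_X_sub q _ ω (2 - m) (by simp; ring))
  have e3 : shift 1 (qE q (2 * (X - C ω - 2 * (m : ℂ[X]) + 1))) = _ :=
    (shift_qE q _ _).trans
      (qE_even_X_sub q _ ω (2 - 2 * m) (by simp; ring))
  simp only [coefA, map_div₀, map_mul, map_sub, map_one, e1, e2, e3]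

lemma coefB_succ_eq (ω : ℂ) (m : ℕ) : coefB q ω (m + 1) =
    (1 - (cQ q ^ 2) ^ (m + 1)) * (1 - cY q ω * (cQ q ^ 2) ^ m) / ((1 - cZ q * cQ q ^ 2) *
      (1 - cY q ω / cZ q * (cQ q ^ 2) ^ (2 * m - 1 : ℤ))) := by
  rw [coefB, qE_even_const q (2 * ((m + 1 : ℕ) : ℂ[X])) (m + 1) (by push_cast; ring),
    qE_even_om q (2 * (C ω + ((m + 1 : ℕ) : ℂ[X]) - 1)) ω m (by push_cast; ring),
    qE_even_X q (2 * (X + 1)) 1 (by push_cast; ring),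
    qE_even_sub_X q (2 * (C ω + 2 * ((m + 1 : ℕ) : ℂ[X]) - X - 3)) ω (2 * m - 1) (by push_cast; ring),
    zpow_one, zpow_natCast, ← Nat.cast_succ, zpow_natCast]

lemma coefD_eq' (m : ℕ) : coefD q m =
    cQ q ^ m * (1 - cZ q * (cQ q ^ 2) ^ (1 - m : ℤ)) / (1 - cZ q * cQ q ^ 2) := by
  rw [coefD, qE_natCast, qE_even_X q (2 * (X + 1 - (m : ℂ[X]))) (1 - m) (by push_cast; ring),
    qE_even_X q (2 * (X + 1)) 1 (by push_cast; ring), zpow_one]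

/-- Dropping the first `K` factors of `(q^{2ω}; q²)_k` rescales the weight above `K` and leaves the
recursion there intact. The only requirement is `B_K = 0`, so that `β` does not lead below `K`. -/
lemma isAdjWeight_gamW {ω : ℝ} {K : ℕ} (h : coefB q ω K = 0) :
    IsAdjWeight q ω K (gamW (cQ q ^ 2) (cZ q) (cY q ω) K) where
  lower := h
  diag m _ := by
    rw [map_mul, shift_gamW q 1 (by norm_num), shift_coefA_eq, coefD_eq', zpow_one]
    exact gamW_diag (genericPoint q ω) K m
  raise m hm := by
    rw [shift_gamW q 1 (by norm_num), coefB_succ_eq, zpow_one]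
    exact gamW_raise (genericPoint q ω) hm

lemma isAdjWeight_gammaW (ω : ℝ) : IsAdjWeight q ω 0 (gammaW q ω) := by
  have e : gammaW q ω = gamW (cQ q ^ 2) (cZ q) (cY q ω) 0 := funext fun k => gammaW_eq q ω k
  rw [e]
  exact isAdjWeight_gamW q (coefB_zero q ω)

/-- The factors of `(q^{2ω}; q²)_k` for real `ω`. -/
lemma one_sub_cY_mul_ne {ω : ℝ} {i : ℤ} (h : ω ≠ -(i : ℝ)) :
    1 - cY q ω * (cQ q ^ 2) ^ i ≠ 0 := by
  have e : cY q ω * (cQ q ^ 2) ^ i = algebraMap ℂ Mer (((q : ℝ) ^ (2 * (ω + i)) : ℝ) : ℂ) := by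
    rw [Complex.ofReal_cpow q.2.1.le, ← qE_C, ← qE_even_om q (2 * (C (ω : ℂ) + (i : ℂ[X]))) ω i rfl]
    congr 1
    push_cast
    simp [C_ofNat]
  rw [e, sub_ne_zero, ← map_one (algebraMap ℂ Mer)]
  intro h1
  have h2 : (q : ℝ) ^ (2 * (ω + i)) = 1 := by exact_mod_cast ((algebraMap ℂ Mer).injective h1).symm
  have h3 := congrArg Real.log h2
  rw [Real.log_rpow q.2.1, Real.log_one, mul_eq_zero] at h3
  rcases h3 with h3 | h3
  · exact h (by linarith)
  · exact (Real.log_neg q.2.1 q.2.2).ne h3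

/-- Only the factors with index between `K` and `k` depend on `ω` alone; all others are nonzero for
generic reasons. -/
lemma gamW_ne {ω : ℝ} {K k : ℕ} (h : ∀ i, K ≤ i → i < k → ω ≠ -(i : ℝ)) :
    gamW (cQ q ^ 2) (cZ q) (cY q ω) K k ≠ 0 := by
  have hg := genericPoint q ω
  have hp := hg.hp
  refine div_ne_zero (mul_ne_zero ?_ ?_) (mul_ne_zero ?_ ?_)
  · exact qPoch_ne_zero fun i _ => by rw [← pow_succ']; exact one_sub_pow_ne q i
  · refine qPoch_ne_zero fun i hi => ?_
    rw [mul_assoc, ← pow_add, ← zpow_natCast (cQ q ^ 2)]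
    exact one_sub_cY_mul_ne q (by exact_mod_cast h _ (by omega) (by omega))
  · refine qPoch_ne_zero fun i _ => ?_
    rw [mul_assoc, ← zpow_natCast (cQ q ^ 2) i, ← zpow_add₀ hp]
    exact hg.h2 _
  · refine qPoch_ne_zero fun i _ => ?_
    rw [mul_assoc, ← zpow_natCast (cQ q ^ 2) i, ← zpow_add₀ hp]
    exact hg.sub_X_ne _

/-- The orthogonality relations in the algebra, evaluated in the dynamical representation. -/
lemma sum_tCoefReg_mul {ω : ℝ} {K : ℕ} {G : ℕ → Mer} (hG : IsAdjWeight q ω K G) {N M k l : ℕ}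
    (hk : k ≤ min M N) (hl : l ≤ min M N) (hK : K + min M N ≤ M) :
    ∑ j ∈ Finset.range (min M N + 1), G (M - j) * (shift (-ω - 2 * M + 2 * j) (gammaN q N j) *
      (gammaN q N k)⁻¹) * tCoefReg q ω N j k (M - k) * tCoefReg q ω N j l (M - l) =
        if k = l then shift (N - 2 * k) (G (M - k)) else 0 := by
  -- The relation is applied to `e_{M-l}` and the coefficient of `e_{M-k}` is read off; in the
  -- `j`-th summand the intermediate vector is `e_{M-j}`.
  have h := congrArg (fun x => dynRep q ω x (basisVec (M - l : ℕ)) (M - k) * G (M - k))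
    (FSL2.sum_star_mul_matEl q (l' := l) (show k ≤ N by omega))
  simp only [map_sum, LinearMap.sum_apply, Finsupp.finsetSum_apply, Finset.sum_mul] at h
  have hj : ∀ j ≤ N, dynRep q ω (FSL2.star q (FSL2.matEl q N j k) *
      (FSL2.l q (gammaN q N j) * FSL2.r q (gammaN q N k)⁻¹) * FSL2.matEl q N j l)
        (basisVec (M - l : ℕ)) (M - k) * G (M - k) = if j ≤ M then
      shift (2 * k - N) (G (M - j) * (shift (-ω - 2 * M + 2 * j) (gammaN q N j) *
        (gammaN q N k)⁻¹) * tCoefReg q ω N j k (M - k) * tCoefReg q ω N j l (M - l)) else 0 := by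
    intro j hj
    rw [map_mul, map_mul, map_mul, Module.End.mul_apply, Module.End.mul_apply,
      Module.End.mul_apply, dynRep_matEl q ω hj (by omega)]
    -- For `j ≤ M` the bound `hK` gives `K ≤ M - j`, since `j ≤ N` too, and the adjoint formula
    -- applies. For `j > M` the intermediate vector is `0`, so the sum stops at `min M N`.
    split_ifs with hM
    · rw [show (((M - l : ℕ) : ℤ) + l - j) = (M - j : ℕ) by omega, basisVec_natCast, dynRep_r,
        Finsupp.smul_single, Finsupp.smul_single, dynRep_l,
        star_matEl_apply hG hj (by omega) (by omega) (by omega) (by omega)]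
      rw [Nat.cast_sub hM, show (-ω - 2 * ((M : ℂ) - j)) = -ω - 2 * M + 2 * j by ring, smul_eq_mul,
        smul_eq_mul]
      congr 1; ring
    · rw [basisVec_of_neg (by omega)]
      simp
  have h2 : ∑ j ∈ Finset.range (min M N + 1), shift (2 * k - N) (G (M - j) *
      (shift (-ω - 2 * M + 2 * j) (gammaN q N j) * (gammaN q N k)⁻¹) *
        tCoefReg q ω N j k (M - k) * tCoefReg q ω N j l (M - l)) =
      (if k = l then G (M - k) else 0) := by
    refine Eq.trans ?_ (h.trans ?_)
    · rw [Finset.sum_congr (s₁ := Finset.range (N + 1)) rfl fun j hj' =>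
        hj j (Nat.lt_succ_iff.1 (Finset.mem_range.1 hj'))]
      rw [← Finset.sum_filter]
      refine Finset.sum_congr ?_ fun _ _ => rfl
      ext j
      simp only [Finset.mem_range, Finset.mem_filter]
      omega
    · split_ifs with hkl
      · rw [map_one, Module.End.one_apply, hkl, basisVec_natCast, Finsupp.single_eq_same, one_mul]
      · simp
  -- Undoes the shift that all summands have received from the adjoint of `t_{jk}`.
  have h3 := congrArg (shift (N - 2 * k)) h2
  simp only [map_sum, shift_shift, show (N - 2 * k + (2 * k - N) : ℂ) = 0 by ring, shift_zero] at h3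
  rw [h3]
  split_ifs <;> simp

end DynSU2

namespace DynSU2

open Polynomial Mer

variable (q : Set.Ioo (0 : ℝ) 1)

/-! ### `q`-Racah polynomials, their symmetry and their cancelled form. -/

/-- The terms of the `q`-Racah polynomial `R_k(μ(j))`. -/
noncomputable def racahTerm (ω : ℂ) (N M k j i : ℕ) : Mer :=
  qP q (-2 * (k : ℂ[X])) i * qP q (-2 * ((N : ℂ[X]) + X + 1 - (k : ℂ[X]))) i *
    qP q (-2 * (j : ℂ[X])) i *
      qP q (2 * (X - C ω + 1 - 2 * (M : ℂ[X]) + (j : ℂ[X]))) i /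
    (qP q 2 i * qP q (-2 * (N : ℂ[X])) i * qP q (-2 * (C ω - 1 + (M : ℂ[X]))) i *
      qP q (-2 * (M : ℂ[X])) i) * qE q 2 ^ i

lemma qE_two_zpow (n : ℤ) : qE q 2 ^ n = qE q (2 * (n : ℂ[X])) := by
  rw [mul_comm, qE_int_mul]

lemma qE_two_pow (n : ℕ) : qE q 2 ^ n = qE q (2 * (n : ℂ[X])) := by
  exact_mod_cast qE_two_zpow q n

lemma racah_eq_sum (ω : ℂ) (N M k j : ℕ) :
    racah q ω N M k j = ∑ i ∈ Finset.range (k + 1), racahTerm q ω N M k j i := by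
  have h1 : qE q (-2 * ((N : ℂ[X]) + 1)) * qE q (-2 * (X + 1)) * qE q 2 ^ (k + 1) =
      qE q (-2 * ((N : ℂ[X]) + X + 1 - (k : ℂ[X]))) := by
    rw [qE_two_pow, ← qE_add, ← qE_add]; congr 1; push_cast; ring
  have h2 : qE q (-2 * ((M : ℂ[X]) + 1)) * qE q (2 * (X - C ω + 1 - (M : ℂ[X]))) *
      qE q 2 ^ (j + 1) = qE q (2 * (X - C ω + 1 - 2 * (M : ℂ[X]) + (j : ℂ[X]))) := by
    rw [qE_two_pow, ← qE_add, ← qE_add]; congr 1; push_cast; ring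
  have h3 : qE q (-2 * ((N : ℂ[X]) + 1)) * qE q 2 = qE q (-2 * (N : ℂ[X])) := by
    rw [← qE_add]; congr 1; ring
  have h4 : qE q (-2 * (X + 1)) * qE q (2 * (X - C ω + 1 - (M : ℂ[X]))) * qE q 2 =
      qE q (-2 * (C ω - 1 + (M : ℂ[X]))) := by
    rw [← qE_add, ← qE_add]; congr 1; ring
  have h5 : qE q (-2 * ((M : ℂ[X]) + 1)) * qE q 2 = qE q (-2 * (M : ℂ[X])) := by
    rw [← qE_add]; congr 1; ring
  have h6 : ∀ n : ℕ, qE q 2 ^ (-(n : ℤ)) = qE q (-2 * (n : ℂ[X])) := fun n => by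
    rw [qE_two_zpow]; congr 1; push_cast; ring
  simp only [racah, qRacah, h1, h2, h3, h4, h5, h6, racahTerm, qP]

lemma qP_neg_eq_zero {n i : ℕ} (h : n < i) : qP q (-2 * (n : ℂ[X])) i = 0 := by
  rw [qP, qE_even_const q (-2 * (n : ℂ[X])) (-n) (by push_cast; ring), qE_two]
  exact qPoch_neg_eq_zero (pow_ne_zero 2 (cQ_ne q)) h

lemma racahTerm_eq_zero (ω : ℂ) (N M : ℕ) {k j i : ℕ} (h : min k j < i) :
    racahTerm q ω N M k j i = 0 := by
  rcases min_lt_iff.1 h with h | h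
  · rw [racahTerm, qP_neg_eq_zero q h]; simp
  · rw [racahTerm, qP_neg_eq_zero q h]; simp

/-- The series terminates through its degree as well as through its variable; the symmetric bound is
needed for duality and for the cancellation of denominators. -/
lemma racah_eq_sum_min (ω : ℂ) (N M k j : ℕ) :
    racah q ω N M k j = ∑ i ∈ Finset.range (min k j + 1), racahTerm q ω N M k j i := by
  rw [racah_eq_sum]
  exact (sum_range_eq_of_le (by omega) fun i hi => racahTerm_eq_zero q ω N M (by omega)).symm

lemma racah_swap {F : Type*} [Field F] (a b c d p u v x w : F) :
    a * b * c * d / (p * u * x * v) * w = c * d * a * b / (p * v * x * u) * w := by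
  rw [show a * b * c * d = c * d * a * b by ring, show p * u * x * v = p * v * x * u by ring]

/-- Exchanging degree and variable, and `(a, b)` with `(c, d)`, permutes the parameters of the `₄φ₃`
series, so the dual polynomials are the same numbers. -/
lemma racahDual_eq_racah (ω : ℂ) (N M k j : ℕ) : racahDual q ω N M j k = racah q ω N M k j := by
  have h1 : qE q (-2 * ((M : ℂ[X]) + 1)) * qE q (2 * (X - C ω + 1 - (M : ℂ[X]))) *
      qE q 2 ^ (j + 1) = qE q (2 * (X - C ω + 1 - 2 * (M : ℂ[X]) + (j : ℂ[X]))) := by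
    rw [qE_two_pow, ← qE_add, ← qE_add]; congr 1; push_cast; ring
  have h2 : qE q (-2 * ((N : ℂ[X]) + 1)) * qE q (-2 * (X + 1)) * qE q 2 ^ (k + 1) =
      qE q (-2 * ((N : ℂ[X]) + X + 1 - (k : ℂ[X]))) := by
    rw [qE_two_pow, ← qE_add, ← qE_add]; congr 1; push_cast; ring
  have h3 : qE q (-2 * ((N : ℂ[X]) + 1)) * qE q 2 = qE q (-2 * (N : ℂ[X])) := by
    rw [← qE_add]; congr 1; ring
  have h4 : qE q (2 * (X - C ω + 1 - (M : ℂ[X]))) * qE q (-2 * (X + 1)) * qE q 2 =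
      qE q (-2 * (C ω - 1 + (M : ℂ[X]))) := by
    rw [← qE_add, ← qE_add]; congr 1; ring
  have h5 : qE q (-2 * ((M : ℂ[X]) + 1)) * qE q 2 = qE q (-2 * (M : ℂ[X])) := by
    rw [← qE_add]; congr 1; ring
  have h6 : ∀ n : ℕ, qE q 2 ^ (-(n : ℤ)) = qE q (-2 * (n : ℂ[X])) := fun n => by
    rw [qE_two_zpow]; congr 1; push_cast; ring
  have e : racahDual q ω N M j k = ∑ i ∈ Finset.range (j + 1), racahTerm q ω N M k j i := by
    simp only [racahDual, qRacah, h1, h2, h3, h4, h5, h6, racahTerm, qP]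
    refine Finset.sum_congr rfl fun i _ => ?_
    exact racah_swap _ _ _ _ _ _ _ _ _
  rw [e, racah_eq_sum_min, eq_comm]
  exact sum_range_eq_of_le (by omega) fun i hi => racahTerm_eq_zero q ω N M (by omega)

lemma qP_eq_mul (P : ℂ[X]) {i k : ℕ} (h : i ≤ k) :
    qP q P k = qP q P i * qP q (P + 2 * (i : ℂ[X])) (k - i) := by
  obtain ⟨n, rfl⟩ := Nat.exists_eq_add_of_le h
  rw [qP, qPoch_add, Nat.add_sub_cancel_left, qP, qP, qE_add, ← qE_two_pow]

lemma tCoef_eq (ω : ℂ) (N k j m : ℕ) : tCoef q ω N k j m = tFactor q ω N k j m *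
    (qP q (-2 * (C ω - 1 + (m : ℂ[X]) + (j : ℂ[X]))) k * racah q ω N (m + j) j k) := by
  rw [tCoef, racah, mul_assoc]
  push_cast
  rw [sub_sub _ (m : ℂ[X])]

/-- Termwise cancellation `(x; q²)_k / (x; q²)_i = (x q^{2i}; q²)_{k-i}`. Terms beyond `min j k`
vanish, so only `(x; q²)_{min j k}` has to be nonzero. -/
lemma tCoef_eq_tCoefReg {ω : ℂ} {N k j m : ℕ}
    (h : qP q (-2 * (C ω - 1 + (m : ℂ[X]) + (j : ℂ[X]))) (min j k) ≠ 0) :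
    tCoef q ω N k j m = tCoefReg q ω N k j m := by
  rw [tCoef_eq, tCoefReg, racah_eq_sum_min, Finset.mul_sum]
  congr 1
  refine Finset.sum_congr rfl fun i hi => ?_
  have hi' : i ≤ min j k := Nat.lt_succ_iff.1 (Finset.mem_range.1 hi)
  have h1 : qP q (-2 * (C ω - 1 + (m : ℂ[X]) + (j : ℂ[X]))) i ≠ 0 := qPoch_ne_zero_of_le hi' h
  rw [qP_eq_mul q _ (hi'.trans (min_le_right j k)), racahTerm]
  have e1 : -2 * (C ω - 1 + ((m + j : ℕ) : ℂ[X])) = -2 * (C ω - 1 + (m : ℂ[X]) + (j : ℂ[X])) := by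
    push_cast; ring
  have e2 : 2 * (X - C ω + 1 - 2 * ((m + j : ℕ) : ℂ[X]) + (k : ℂ[X])) =
      2 * (X - C ω + 1 - 2 * (m : ℂ[X]) - 2 * (j : ℂ[X]) + (k : ℂ[X])) := by
    push_cast; ring
  have e3 : -2 * ((m + j : ℕ) : ℂ[X]) = -2 * ((m : ℂ[X]) + (j : ℂ[X])) := by push_cast; ring
  rw [e1, e2, e3]
  generalize qP q (-2 * (C ω - 1 + (m : ℂ[X]) + (j : ℂ[X]))) i = x at *
  simp only [div_eq_mul_inv, mul_inv]
  rw [← mul_assoc]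
  -- The only place where the hypothesis on `ω` enters.
  have e4 : x * x⁻¹ = 1 := mul_inv_cancel₀ h1
  generalize x⁻¹ = y at *
  linear_combination (qP q (-2 * (C ω - 1 + (m : ℂ[X]) + (j : ℂ[X])) + 2 * (i : ℂ[X])) (k - i) *
    qP q (-2 * (j : ℂ[X])) i * qP q (-2 * ((N : ℂ[X]) + X + 1 - (j : ℂ[X]))) i *
    qP q (-2 * (k : ℂ[X])) i *
    qP q (2 * (X - C ω + 1 - 2 * (m : ℂ[X]) - 2 * (j : ℂ[X]) + (k : ℂ[X]))) i *
    (qP q 2 i)⁻¹ * (qP q (-2 * (N : ℂ[X])) i)⁻¹ * (qP q (-2 * ((m : ℂ[X]) + (j : ℂ[X]))) i)⁻¹ *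
    qE q 2 ^ i) * e4

lemma qP_neg_om_ne {ω : ℝ} {n : ℕ} {P : ℂ[X]} (c : ℤ) (hP : P = -2 * (C (ω : ℂ) - 1 + (c : ℂ[X])))
    (h : ∀ i : ℕ, i < n → ω ≠ 1 - (c : ℝ) + i) : qP q P n ≠ 0 := by
  have hp := pow_ne_zero 2 (cQ_ne q)
  rw [qP, qE_even_neg_om q P ω (1 - c) (by rw [hP]; push_cast; ring), qE_two]
  refine qPoch_ne_zero fun i hi => ?_
  have h1 := one_sub_cY_mul_ne q (ω := ω) (i := c - 1 - i) (by
    intro h2; exact h i hi (by rw [h2]; push_cast; ring))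
  intro h2
  apply h1
  have hY := cY_ne q (ω : ℂ)
  have e : (cQ q ^ 2) ^ (1 - c) / cY q ω * (cQ q ^ 2) ^ i =
      (cY q ω * (cQ q ^ 2) ^ (c - 1 - i : ℤ))⁻¹ := by
    rw [mul_inv, ← zpow_neg, div_mul_eq_mul_div, ← zpow_natCast (cQ q ^ 2) i, ← zpow_add₀ hp, div_eq_mul_inv,
      mul_comm]
    congr 2; ring
  rw [e, sub_eq_zero, eq_comm, inv_eq_one] at h2
  rw [h2, sub_self]

end DynSU2

namespace DynSU2

/-! ### Weight and squared norm as quotients of `Γ`'s, over a field. -/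

section GenericNorm

variable {F : Type*} [Field F]

/-- Reversal of the order of the factors. -/
lemma qPoch_rev {a b p : F} {j : ℕ} (hp : p ≠ 0) (h : b * a * p ^ j = p) :
    qPoch a p j = (-a) ^ j * (∏ i ∈ Finset.range j, p ^ i) * qPoch b p j := by
  have e : (-a) ^ j = ∏ i ∈ Finset.range j, (-a) := by simp
  rw [qPoch, ← Finset.prod_range_reflect, ← Finset.prod_range_reflect (fun i => p ^ i), qPoch, e,
    ← Finset.prod_mul_distrib, ← Finset.prod_mul_distrib]
  refine Finset.prod_congr rfl fun i hi => ?_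
  obtain ⟨n, rfl⟩ := Nat.exists_eq_add_of_lt (Finset.mem_range.1 hi)
  rw [show i + n + 1 - 1 - i = n by omega]
  have h1 : b * a * p ^ (i + n) = 1 := by
    rw [pow_succ, ← mul_assoc] at h
    exact mul_right_cancel₀ hp (h.trans (one_mul p).symm)
  rw [pow_add] at h1
  linear_combination (-1 : F) * h1

lemma qBinom_eq {p : F} {n k : ℕ} (hp : ∀ k : ℕ, 1 - p ^ (k + 1) ≠ 0) :
    qBinom p (n + k) k = qPoch (p * p ^ n) p k / qPoch p p k := by
  have h : qPoch p p n ≠ 0 := qPoch_ne_zero fun i _ => by rw [← pow_succ']; exact hp i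
  rw [qBinom, Nat.add_sub_cancel, qPoch_add, mul_comm (qPoch p p k), mul_div_mul_left _ _ h]

variable {Q p z Y s : F}

/-- Isolates `Γ^ω_{n+j} / Γ^ω_n`. In both denominators the starting point moves with the index, so
the factorials overlap; splitting one product in two ways (`e2`) cancels the overlap. -/
lemma gamW_add (h : GenericPoint Q p z Y) (hs : Y = s * z) {K n j : ℕ} (hK : K ≤ n) :
    gamW p z Y K (n + j) = gamW p z Y K n *
      (qPoch (p * p ^ n) p j * qPoch (Y * p ^ n) p j * qPoch (s * p ^ n / p) p j) /
      (qPoch (z * p / (p ^ n * p ^ j)) p j * qPoch (s * p ^ n * p ^ n / p) p (2 * j)) := by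
  have hp := h.hp
  have hz := h.hz
  have hC := pow_ne_zero n hp
  have hJ := pow_ne_zero j hp
  have hP : ∀ (n : ℤ) m, qPoch (z * p ^ n) p m ≠ 0 := fun n m => qPoch_ne_zero fun i _ => by
    rw [mul_assoc, ← zpow_natCast, ← zpow_add₀ hp]
    exact h.h2 _
  have hR : ∀ (n : ℤ) m, qPoch (s * p ^ n) p m ≠ 0 := fun n m => qPoch_ne_zero fun i _ => by
    rw [mul_assoc, ← zpow_natCast, ← zpow_add₀ hp]
    have := h.sub_X_ne (n + i)
    rwa [hs, mul_div_assoc, div_self hz, mul_one] at this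
  have es : Y / z = s := by rw [hs, mul_div_assoc, div_self hz, mul_one]
  have c1 : z * p ^ (1 - (n + j : ℕ) : ℤ) = z * p / (p ^ n * p ^ j) := by
    rw [zpow_sub₀ hp, zpow_one, zpow_natCast, pow_add, mul_div_assoc]
  have c2 : z * p ^ (1 - n : ℤ) = z * p / p ^ n := by
    rw [zpow_sub₀ hp, zpow_one, zpow_natCast, mul_div_assoc]
  have c3 : s * p ^ ((n + j : ℕ) - 1 : ℤ) = s * p ^ n * p ^ j / p := by
    rw [zpow_sub₀ hp, zpow_one, zpow_natCast, pow_add, mul_div_assoc', mul_assoc]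
  have c4 : s * p ^ (n - 1 : ℤ) = s * p ^ n / p := by
    rw [zpow_sub₀ hp, zpow_one, zpow_natCast, mul_div_assoc']
  have c5 : s * p ^ (2 * n - 1 : ℤ) = s * p ^ n * p ^ n / p := by
    rw [zpow_sub₀ hp, zpow_one, two_mul, zpow_add₀ hp, zpow_natCast, mul_div_assoc', mul_assoc]
  have e1 : qPoch (z * p / (p ^ n * p ^ j)) p (n + j) =
      qPoch (z * p / (p ^ n * p ^ j)) p j * qPoch (z * p / p ^ n) p n := by
    rw [add_comm n j, qPoch_add]
    congr 2
    field_simp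
  have e2 : qPoch (s * p ^ n / p) p j * qPoch (s * p ^ n * p ^ j / p) p (n + j) =
      qPoch (s * p ^ n / p) p n * qPoch (s * p ^ n * p ^ n / p) p (2 * j) := by
    have := (qPoch_add (s * p ^ n / p) p j (n + j)).symm.trans
      ((by congr 1; ring : qPoch (s * p ^ n / p) p (j + (n + j)) =
        qPoch (s * p ^ n / p) p (n + 2 * j)).trans (qPoch_add (s * p ^ n / p) p n (2 * j)))
    rwa [div_mul_eq_mul_div, div_mul_eq_mul_div] at this
  have n1 := hP (1 - (n + j : ℕ)) j
  have n2 := hP (1 - n) n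
  have n3 := hR ((n + j : ℕ) - 1) (n + j)
  have n4 := hR (n - 1) n
  have n5 := hR (2 * n - 1) (2 * j)
  rw [c1] at n1
  rw [c2] at n2
  rw [c3] at n3
  rw [c4] at n4
  rw [c5] at n5
  rw [gamW, gamW, es, c1, c2, c3, c4, e1, qPoch_add p p n j, Nat.sub_add_comm hK, qPoch_add _ _ (n - K) j,
    mul_assoc Y, ← pow_add, Nat.add_sub_cancel' hK, ← pow_succ', pow_succ]
  generalize qPoch (s * p ^ n / p) p j = a₁ at *
  generalize qPoch (s * p ^ n * p ^ j / p) p (n + j) = a₂ at *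
  generalize qPoch (s * p ^ n / p) p n = a₃ at *
  generalize qPoch (s * p ^ n * p ^ n / p) p (2 * j) = a₄ at *
  generalize qPoch (z * p / (p ^ n * p ^ j)) p j = a₅ at *
  generalize qPoch (z * p / p ^ n) p n = a₆ at *
  generalize qPoch (p ^ n * p) p j = a₇
  generalize qPoch (Y * p ^ n) p j = a₈
  generalize qPoch p p n = a₉
  generalize qPoch (Y * p ^ K) p (n - K) = a₁₀
  rw [div_mul_eq_mul_div, div_div, div_eq_div_iff (mul_ne_zero (mul_ne_zero n1 n2) n3)
    (mul_ne_zero (mul_ne_zero n2 n4) (mul_ne_zero n1 n5))]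
  linear_combination (-a₉ * a₁₀ * a₇ * a₈ * a₅ * a₆) * e2

/-- The weight of the `q`-Racah polynomials in terms of `p = q²`, `z = q^{2λ}`, `s = q^{2(ω-λ)}`,
`A = p^M`, `B = p^N` and `J = p^j`. -/
noncomputable def weightF (p z s A B J : F) (j : ℕ) : F :=
  (1 - p * J ^ 2 / (s * A ^ 2)) / (1 - p / (s * A ^ 2)) *
    (qPoch (p / (s * A ^ 2)) p j * qPoch B⁻¹ p j * qPoch A⁻¹ p j * qPoch (p / (A * s * z)) p j /
      (qPoch p p j * qPoch (p ^ 2 * B / (s * A ^ 2)) p j * qPoch (p ^ 2 / (s * A)) p j *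
        qPoch (z * p / A) p j)) * (z * p * B) ^ j

lemma GenericPoint.qPoch_z_ne (h : GenericPoint Q p z Y) {a : F} (n : ℤ) (ha : a = z * p ^ n)
    (m : ℕ) : qPoch a p m ≠ 0 := qPoch_ne_zero fun i _ => by
  rw [ha, mul_assoc, ← zpow_natCast, ← zpow_add₀ h.hp, mul_comm]
  exact mul_comm z _ ▸ h.h2 _

lemma GenericPoint.one_sub_s_ne (h : GenericPoint Q p z Y) (hs : Y = s * z) {a : F} (n : ℤ)
    (ha : a = s * p ^ n) : 1 - a ≠ 0 := by
  have h1 := h.sub_X_ne n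
  rwa [hs, mul_div_assoc, div_self h.hz, mul_one, ← ha] at h1

lemma GenericPoint.qPoch_s_ne (h : GenericPoint Q p z Y) (hs : Y = s * z) {a : F} (n : ℤ)
    (ha : a = s * p ^ n) (m : ℕ) : qPoch a p m ≠ 0 := qPoch_ne_zero fun i _ => by
  refine h.one_sub_s_ne hs (n + i) ?_
  rw [ha, mul_assoc, zpow_add₀ h.hp, zpow_natCast]

lemma GenericPoint.one_sub_inv_s_ne (h : GenericPoint Q p z Y) (hs : Y = s * z) {a : F} (n : ℤ)
    (ha : a = p ^ n / s) : 1 - a ≠ 0 := by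
  have h1 := h.h3 n
  have hz := h.hz
  have e : z / Y * p ^ n = p ^ n / s := by
    rw [hs, mul_comm s z, div_mul_eq_div_div, div_self hz, div_mul_eq_mul_div, one_mul]
  rwa [e, ← ha] at h1

lemma GenericPoint.qPoch_inv_s_ne (h : GenericPoint Q p z Y) (hs : Y = s * z) {a : F} (n : ℤ)
    (ha : a = p ^ n / s) (m : ℕ) : qPoch a p m ≠ 0 := qPoch_ne_zero fun i _ => by
  refine h.one_sub_inv_s_ne hs (n + i) ?_
  rw [ha, div_mul_eq_mul_div, zpow_add₀ h.hp, zpow_natCast]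

/-- Identifies the weight `w_j` with the product of `Γ`'s and squared `j`-dependent factors that the
representation produces; here `n = M - j` and `m = N - j`. Multiplying by `Γ_M` instead of dividing
keeps the identity valid where `Γ_M` vanishes. -/
lemma weightF_mul_gamW (h : GenericPoint Q p z Y) (hs : Y = s * z) {K n j m : ℕ} (hK : K ≤ n)
    {A B : F} (hA : A = p ^ n * p ^ j) (hB : B = p ^ m * p ^ j) :
    weightF p z s A B (p ^ j) j * gamW p z Y K (n + j) = gamW p z Y K n *
      gamN p (s * p ^ n * p ^ n)⁻¹ (m + j) j * ((z ^ 2 * p ^ 3 * B / A) ^ j *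
        (qPoch A⁻¹ p j / (qPoch (z * p / A) p j * qPoch (p ^ 2 * B / (s * A ^ 2)) p j)) ^ 2) *
        qPoch (p / (A * s * z)) p j ^ 2 := by
  have hp := h.hp
  have hz := h.hz
  have hs0 : s ≠ 0 := fun h0 => h.hY (by rw [hs, h0, zero_mul])
  have hC := pow_ne_zero n hp
  have hJ := pow_ne_zero j hp
  have hD := pow_ne_zero m hp
  have hA0 : A ≠ 0 := hA ▸ mul_ne_zero hC hJ
  have hB0 : B ≠ 0 := hB ▸ mul_ne_zero hD hJ
  -- Reversals: the `Γ`'s supply factorials in terms of `M - j`, while the weight has factorials in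
  -- terms of `M`. The products of powers of `p` that appear cancel.
  have r1 := qPoch_rev (a := p * p ^ n) (b := A⁻¹) (j := j) hp (by rw [hA]; field_simp)
  have r2 := qPoch_rev (a := Y * p ^ n) (b := p / (A * s * z)) (j := j) hp
    (by rw [hA, hs]; field_simp)
  have r3 := qPoch_rev (a := s * p ^ n / p) (b := p ^ 2 / (s * A)) (j := j) hp
    (by rw [hA]; field_simp)
  have r4 := qPoch_rev (a := p * p ^ m) (b := B⁻¹) (j := j) hp (by rw [hB]; field_simp)
  have r5 := qPoch_rev (a := p ^ j / (p ^ (m + j + 1) * (s * p ^ n * p ^ n)⁻¹))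
    (b := p ^ 2 * B / (s * A ^ 2)) (j := j) hp
    (by rw [hA, hB, pow_succ p (m + j), pow_add]; field_simp)
  have r6 := qPoch_rev (a := s * p ^ n * p ^ n * p ^ j / p) (b := p ^ 2 / (s * A ^ 2)) (j := j) hp
    (by rw [hA]; field_simp)
  have e1 : qPoch (s * p ^ n * p ^ n / p) p (2 * j) = qPoch (s * p ^ n * p ^ n / p) p j *
      qPoch (s * p ^ n * p ^ n * p ^ j / p) p j := by
    rw [two_mul, qPoch_add, div_mul_eq_mul_div]
  have e2 : qPoch (s * p ^ n * p ^ n / p) p j = (1 - s * p ^ n * p ^ n / p) *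
      qPoch (s * p ^ n * p ^ n) p j / (1 - s * p ^ n * p ^ n * p ^ j / p) := by
    have := qPoch_mul_right (s * p ^ n * p ^ n / p) p j
    rw [div_mul_cancel₀ _ hp, div_mul_eq_mul_div] at this
    rw [this, mul_div_cancel_right₀]
    exact h.one_sub_s_ne hs (2 * n + j - 1)
      (by rw [zpow_sub₀ hp, zpow_add₀ hp, two_mul, zpow_add₀ hp, zpow_one, zpow_natCast,
            zpow_natCast]; ring)
  have e3 : qPoch (p / (s * A ^ 2)) p j = (1 - p / (s * A ^ 2)) * qPoch (p ^ 2 / (s * A ^ 2)) p j /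
      (1 - p * p ^ j / (s * A ^ 2)) := by
    have := qPoch_mul_right (p / (s * A ^ 2)) p j
    rw [div_mul_eq_mul_div, div_mul_eq_mul_div, ← pow_two] at this
    rw [this, mul_div_cancel_right₀]
    exact h.one_sub_inv_s_ne hs (1 + j - 2 * n - 2 * j)
      (by rw [hA, zpow_sub₀ hp, zpow_sub₀ hp, zpow_add₀ hp, two_mul, two_mul, zpow_add₀ hp,
            zpow_add₀ hp, zpow_one, zpow_natCast, zpow_natCast]; field_simp)
  rw [gamW_add h hs hK, weightF, e1, e2, e3, gamN, qBinom_eq h.one_sub_pow_ne, r1, r2, r3, r4, r5,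
    r6, inv_inv]
  have hE : ∏ i ∈ Finset.range j, p ^ i ≠ 0 := Finset.prod_ne_zero_iff.2 fun i _ => pow_ne_zero i hp
  have g1 : qPoch p p j ≠ 0 := qPoch_ne_zero fun i _ => by
    rw [← pow_succ']; exact h.one_sub_pow_ne i
  have g2 : qPoch (p ^ 2 * B / (s * A ^ 2)) p j ≠ 0 := h.qPoch_inv_s_ne hs (2 + m - 2 * n - j) (by
    rw [hA, hB, zpow_sub₀ hp, zpow_sub₀ hp, zpow_add₀ hp, two_mul, zpow_add₀ hp, zpow_ofNat,
      zpow_natCast, zpow_natCast, zpow_natCast]; field_simp) j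
  have g3 : qPoch (p ^ 2 / (s * A ^ 2)) p j ≠ 0 := h.qPoch_inv_s_ne hs (2 - 2 * n - 2 * j) (by
    rw [hA, zpow_sub₀ hp, zpow_sub₀ hp, two_mul, two_mul, zpow_add₀ hp, zpow_add₀ hp, zpow_ofNat,
      zpow_natCast, zpow_natCast]; field_simp) j
  have g4 : qPoch (p ^ 2 / (s * A)) p j ≠ 0 := h.qPoch_inv_s_ne hs (2 - n - j) (by
    rw [hA, zpow_sub₀ hp, zpow_sub₀ hp, zpow_ofNat, zpow_natCast, zpow_natCast]; field_simp) j
  have g5 : qPoch (z * p / A) p j ≠ 0 := h.qPoch_z_ne (1 - n - j) (by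
    rw [hA, zpow_sub₀ hp, zpow_sub₀ hp, zpow_one, zpow_natCast, zpow_natCast]; field_simp) j
  have g6 : qPoch (s * p ^ n * p ^ n) p j ≠ 0 := h.qPoch_s_ne hs (n + n) (by
    rw [zpow_add₀ hp, zpow_natCast, mul_assoc]) j
  have f1 : 1 - s * p ^ n * p ^ n / p ≠ 0 := h.one_sub_s_ne hs (n + n - 1) (by
    rw [zpow_sub₀ hp, zpow_add₀ hp, zpow_natCast, zpow_one]; ring)
  have f2 : 1 - s * p ^ n * p ^ n * p ^ j / p ≠ 0 := h.one_sub_s_ne hs (n + n + j - 1) (by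
    rw [zpow_sub₀ hp, zpow_add₀ hp, zpow_add₀ hp, zpow_natCast, zpow_natCast, zpow_one]; ring)
  have f3 : 1 - p / (s * A ^ 2) ≠ 0 := h.one_sub_inv_s_ne hs (1 - 2 * n - 2 * j) (by
    rw [hA, zpow_sub₀ hp, zpow_sub₀ hp, two_mul, two_mul, zpow_add₀ hp, zpow_add₀ hp, zpow_one,
      zpow_natCast, zpow_natCast]; field_simp)
  have c1 : 1 - p * (p ^ j) ^ 2 / (s * A ^ 2) =
      -(p / (s * p ^ n * p ^ n)) * (1 - s * p ^ n * p ^ n / p) := by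
    rw [hA]; field_simp; ring
  have c2 : 1 - p * p ^ j / (s * A ^ 2) =
      -(p / (s * p ^ n * p ^ n * p ^ j)) * (1 - s * p ^ n * p ^ n * p ^ j / p) := by
    rw [hA]; field_simp; ring
  rw [c1, c2, ← hA]
  generalize qPoch p p j = a₁ at *
  generalize qPoch (p ^ 2 * B / (s * A ^ 2)) p j = a₂ at *
  generalize qPoch (p ^ 2 / (s * A ^ 2)) p j = a₃ at *
  generalize qPoch (p ^ 2 / (s * A)) p j = a₄ at *
  generalize qPoch (z * p / A) p j = a₅ at *
  generalize qPoch (p / (A * s * z)) p j = a₆ at *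
  generalize qPoch A⁻¹ p j = a₇ at *
  generalize qPoch B⁻¹ p j = a₈ at *
  generalize 1 - s * p ^ n * p ^ n / p = b₁ at *
  generalize 1 - s * p ^ n * p ^ n * p ^ j / p = b₂ at *
  generalize 1 - p / (s * A ^ 2) = b₃ at *
  generalize qPoch (s * p ^ n * p ^ n) p j = a₉ at *
  generalize gamW p z Y K n = G
  generalize ∏ i ∈ Finset.range j, p ^ i = E at *
  clear r1 r2 r3 r4 r5 r6 e1 e2 e3 c1 c2
  rw [pow_succ p (m + j), pow_add p m j, hA, hB, hs, neg_pow (p * p ^ n), neg_pow (s * z * p ^ n),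
    neg_pow (s * p ^ n / p), neg_pow (s * p ^ n * p ^ n * p ^ j / p), neg_pow (p * p ^ m),
    neg_pow (p ^ j / _)]
  have hε : (-1 : F) ^ j ≠ 0 := pow_ne_zero j (neg_ne_zero.2 one_ne_zero)
  simp only [div_eq_mul_inv, mul_inv, inv_inv, mul_pow, inv_pow]
  rw [pow_right_comm z 2 j, pow_right_comm p 3 j]
  generalize (-1 : F) ^ j = ε at *
  clear h hA0 hB0 hA hB
  generalize p ^ n = C at *
  generalize p ^ m = D at *
  generalize p ^ j = J at *
  have d1 := pow_ne_zero j hC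
  have d2 := pow_ne_zero j hD
  have d3 := pow_ne_zero j hJ
  have d4 := pow_ne_zero j hz
  have d5 := pow_ne_zero j hs0
  generalize C ^ j = C' at *
  generalize D ^ j = D' at *
  generalize J ^ j = J' at *
  generalize s ^ j = s' at *
  field_simp

/-- The exponents satisfy `k(k-1) + k = k²`, which avoids dividing `k(k-1)` by two. -/
lemma prod_pow_sq (p : F) (k : ℕ) : (∏ i ∈ Finset.range k, p ^ i) ^ 2 * p ^ k = (p ^ k) ^ k := by
  induction k with
  | zero => simp
  | succ k ih =>
    rw [Finset.prod_range_succ, mul_pow, pow_succ p k, mul_pow _ p, pow_succ _ k, ← ih,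
      pow_succ p k]
    ring

/-- The squared norm of the `q`-Racah polynomials in terms of `p = q²`, `z = q^{2λ}`,
`s = q^{2(ω-λ)}`, `A = p^M`, `B = p^N` and `L = p^k`. -/
noncomputable def normF (p z s A B L : F) (N k : ℕ) : F :=
  qPoch (s * A ^ 2 / (p * B)) p N * qPoch (z * B)⁻¹ p N /
      (qPoch (s * A / (p * B)) p N * qPoch (A / (z * B)) p N) *
    ((1 - (z * p * B)⁻¹) / (1 - L ^ 2 / (z * p * B))) *
    (qPoch p p k * qPoch z⁻¹ p k * qPoch (A / (z * B)) p k * qPoch (s * A / (p * B)) p k /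
      (qPoch (z * p * B)⁻¹ p k * qPoch B⁻¹ p k * qPoch A⁻¹ p k * qPoch (p / (A * s * z)) p k)) *
    (p / (s * A ^ 2)) ^ k

/-- The analogue for `h_k`, with `n = N - k` and `m = M - k`. Since `h_k` has `(p/(Asz); p)_k` in
its denominator, `hx` is needed here. -/
lemma normF_mul_gamW (h : GenericPoint Q p z Y) (hs : Y = s * z) {K n k m : ℕ} (hK : K ≤ m)
    {A B : F} (hA : A = p ^ m * p ^ k) (hB : B = p ^ n * p ^ k)
    (hx : qPoch (p / (A * s * z)) p k ≠ 0) :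
    normF p z s A B (p ^ k) (n + k) k * (A ^ n / ((p ^ n) ^ (2 * k) * p ^ k) *
      (qBinom p (n + k) k * qPoch (z * p / A) p n / qPoch (z * p / p ^ k) p n) ^ 2) *
        gamW p z Y K (m + k) =
      gamN p z (n + k) k * gamW p (p ^ n * (p ^ k)⁻¹ * z) Y K m := by
  have hp := h.hp
  have hz := h.hz
  have hs0 : s ≠ 0 := fun h0 => h.hY (by rw [hs, h0, zero_mul])
  have hC := pow_ne_zero m hp
  have hL := pow_ne_zero k hp
  have hD := pow_ne_zero n hp
  have hA0 : A ≠ 0 := hA ▸ mul_ne_zero hC hL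
  have hB0 : B ≠ 0 := hB ▸ mul_ne_zero hD hL
  -- the factors that depend on `s`
  have s1 : qPoch (s * A / (p * B)) p (m + k) = qPoch (s * A / (p * B)) p k *
      qPoch (s * p ^ m * p ^ k / (p ^ n * p)) p m := by
    rw [add_comm, qPoch_add]
    congr 2
    rw [hA, hB]; field_simp
  have s2 : qPoch (s * A / (p * B)) p (n + k) * qPoch (s * A / p) p (m + k) =
      qPoch (s * A / (p * B)) p (m + k) * qPoch (s * A ^ 2 / (p * B)) p (n + k) := by
    have e1 : s * A / (p * B) * p ^ (n + k) = s * A / p := by rw [pow_add, ← hB]; field_simp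
    have e2 : s * A / (p * B) * p ^ (m + k) = s * A ^ 2 / (p * B) := by
      rw [pow_add, ← hA]; field_simp
    rw [← e1, ← e2, ← qPoch_add, ← qPoch_add, add_comm]
  -- the factors that depend on `z`
  have z1 : qPoch (z * p / A) p (m + k) * qPoch (z * p) p n = qPoch (z * p / A) p n *
      (qPoch (z * p * p ^ n / (p ^ m * p ^ k)) p m * qPoch (z * p * p ^ n / p ^ k) p k) := by
    have e1 : z * p / A * p ^ (m + k) = z * p := by rw [pow_add, ← hA]; field_simp
    have e2 : z * p / A * p ^ n = z * p * p ^ n / (p ^ m * p ^ k) := by rw [hA]; field_simp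
    have e3 : z * p * p ^ n / (p ^ m * p ^ k) * p ^ m = z * p * p ^ n / p ^ k := by field_simp
    have e4 := qPoch_add (z * p / A) p (m + k) n
    rw [e1, add_comm (m + k) n, qPoch_add _ _ n, e2, qPoch_add _ _ m k, e3] at e4
    exact e4.symm
  have z2 : qPoch (z * p / A) p (n + k) =
      qPoch (z * p / A) p n * qPoch (z * p * p ^ n / (p ^ m * p ^ k)) p k := by
    rw [qPoch_add]
    congr 2
    rw [hA]; field_simp
  have z3 : qPoch (z * p / p ^ k) p k * qPoch (z * p) p n =
      qPoch (z * p / p ^ k) p n * qPoch (z * p * p ^ n / p ^ k) p k := by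
    have e1 : z * p / p ^ k * p ^ k = z * p := by field_simp
    have e2 : z * p / p ^ k * p ^ n = z * p * p ^ n / p ^ k := by field_simp
    rw [← e2, ← qPoch_add, add_comm, qPoch_add, e1]
  have z4 : qPoch (z * p / p ^ k) p k * qPoch (z * p) p (n + k) =
      qPoch (z * p / p ^ k) p n * qPoch (z * p * p ^ n / p ^ k) p k *
        qPoch (z * p * p ^ n) p k := by
    rw [← z3, mul_assoc, ← qPoch_add]
  have z5 : (1 - z * p * p ^ n / p ^ k) * qPoch (z * p ^ 2 * p ^ n / p ^ k) p k =
      qPoch (z * p * p ^ n / p ^ k) p k * (1 - z * p * p ^ n) := by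
    have := qPoch_mul_right (z * p * p ^ n / p ^ k) p k
    rw [div_mul_cancel₀ _ hL] at this
    rw [← this]
    congr 2; ring
  have z6 : (1 - z * p * p ^ n) * qPoch (z * p ^ 2 * p ^ n) p k =
      qPoch (z * p * p ^ n) p k * (1 - z * p * p ^ n * p ^ k) := by
    rw [← qPoch_mul_right]
    congr 2; ring
  -- Reversals bring all factorials in `z` to increasing powers of `z`, so that the overlaps
  -- recorded above can be cancelled.
  have r1 := qPoch_rev (a := (z * B)⁻¹) (b := z * p) (j := n + k) hp
    (by rw [hB, pow_add]; field_simp)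
  have r2 := qPoch_rev (a := A / (z * B)) (b := z * p / A) (j := n + k) hp
    (by rw [hB, pow_add]; field_simp)
  have r3 := qPoch_rev (a := z⁻¹) (b := z * p / p ^ k) (j := k) hp (by field_simp)
  have r4 := qPoch_rev (a := A / (z * B)) (b := z * p * p ^ n / (p ^ m * p ^ k)) (j := k) hp
    (by rw [hA, hB]; field_simp)
  have r5 := qPoch_rev (a := (z * p * B)⁻¹) (b := z * p ^ 2 * p ^ n) (j := k) hp
    (by rw [hB]; field_simp)
  have r6 := qPoch_rev (a := p ^ k / (p ^ (n + k + 1) * z)) (b := z * p ^ 2 * p ^ n / p ^ k) (j := k)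
    hp (by rw [pow_succ p (n + k), pow_add]; field_simp)
  have r7 := qPoch_rev (a := p * p ^ m) (b := A⁻¹) (j := k) hp (by rw [hA]; field_simp)
  have r8 := qPoch_rev (a := Y * p ^ m) (b := p / (A * s * z)) (j := k) hp
    (by rw [hA, hs]; field_simp)
  have r9 := qPoch_rev (a := p * p ^ n) (b := B⁻¹) (j := k) hp (by rw [hB]; field_simp)
  have w1 : gamW p z Y K (m + k) = qPoch p p m * qPoch (p * p ^ m) p k *
      (qPoch (Y * p ^ K) p (m - K) * qPoch (Y * p ^ m) p k) /
        (qPoch (z * p / A) p (m + k) * qPoch (s * A / p) p (m + k)) := by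
    have e1 : z * p ^ (1 - (m + k : ℕ) : ℤ) = z * p / A := by
      rw [hA, zpow_sub₀ hp, zpow_one, zpow_natCast, pow_add, mul_div_assoc]
    have e2 : Y / z * p ^ ((m + k : ℕ) - 1 : ℤ) = s * A / p := by
      rw [hA, hs, mul_div_assoc s z z, div_self hz, mul_one, zpow_sub₀ hp, zpow_one, zpow_natCast,
        pow_add, mul_div_assoc']
    rw [gamW, e1, e2, qPoch_add p p m k, Nat.sub_add_comm hK, qPoch_add _ _ (m - K) k,
      mul_assoc Y, ← pow_add, Nat.add_sub_cancel' hK]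
  have w2 : gamW p (p ^ n * (p ^ k)⁻¹ * z) Y K m = qPoch p p m * qPoch (Y * p ^ K) p (m - K) /
        (qPoch (z * p * p ^ n / (p ^ m * p ^ k)) p m *
          qPoch (s * p ^ m * p ^ k / (p ^ n * p)) p m) := by
    have e1 : p ^ n * (p ^ k)⁻¹ * z * p ^ (1 - m : ℤ) = z * p * p ^ n / (p ^ m * p ^ k) := by
      rw [zpow_sub₀ hp, zpow_one, zpow_natCast]; field_simp
    have e2 : Y / (p ^ n * (p ^ k)⁻¹ * z) * p ^ (m - 1 : ℤ) = s * p ^ m * p ^ k / (p ^ n * p) := by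
      rw [hs, zpow_sub₀ hp, zpow_one, zpow_natCast]; field_simp
    rw [gamW, e1, e2]
  have zc : ∀ (a b c d : ℕ) (e : ℤ), (e = a + b - c - d) → z * p ^ a * p ^ b / (p ^ c * p ^ d) = z * p ^ e :=
    fun a b c d e he => by
      rw [he, zpow_sub₀ hp, zpow_sub₀ hp, zpow_add₀ hp]; simp only [zpow_natCast]; field_simp
  have n1 : qPoch (s * A / (p * B)) p (n + k) ≠ 0 := h.qPoch_s_ne hs (m - n - 1) (by
    rw [hA, hB, zpow_sub₀ hp, zpow_sub₀ hp, zpow_one, zpow_natCast, zpow_natCast]; field_simp) _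
  have n2 : qPoch (s * A / p) p (m + k) ≠ 0 := h.qPoch_s_ne hs (m + k - 1) (by
    rw [hA, zpow_sub₀ hp, zpow_add₀ hp, zpow_one, zpow_natCast, zpow_natCast]; field_simp) _
  have n3 : qPoch (z * p / A) p n ≠ 0 := h.qPoch_z_ne _
    (by rw [← zc 1 0 m k _ rfl, hA, pow_one, pow_zero, mul_one]) _
  have n4 : qPoch (z * p * p ^ n / (p ^ m * p ^ k)) p m ≠ 0 := h.qPoch_z_ne _
    (by rw [← zc 1 n m k _ rfl, pow_one]) _
  have n5 : qPoch (z * p * p ^ n / (p ^ m * p ^ k)) p k ≠ 0 := h.qPoch_z_ne _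
    (by rw [← zc 1 n m k _ rfl, pow_one]) _
  have n6 : qPoch (z * p / p ^ k) p n ≠ 0 := h.qPoch_z_ne _
    (by rw [← zc 1 0 0 k _ rfl, pow_one, pow_zero, mul_one, one_mul]) _
  have n7 : qPoch (z * p / p ^ k) p k ≠ 0 := h.qPoch_z_ne _
    (by rw [← zc 1 0 0 k _ rfl, pow_one, pow_zero, mul_one, one_mul]) _
  have n8 : qPoch (z * p * p ^ n / p ^ k) p k ≠ 0 := h.qPoch_z_ne _
    (by rw [← zc 1 n 0 k _ rfl, pow_one, pow_zero, one_mul]) _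
  have n9 : qPoch (z * p * p ^ n) p k ≠ 0 := h.qPoch_z_ne _
    (by rw [← zc 1 n 0 0 _ rfl, pow_one, pow_zero, one_mul, div_one]) _
  have n10 : qPoch p p k ≠ 0 := qPoch_ne_zero fun i _ => by
    rw [← pow_succ']; exact h.one_sub_pow_ne i
  have hpm : ∀ m, qPoch (p * p ^ m) p k ≠ 0 := fun m => qPoch_ne_zero fun i _ => by
    rw [mul_assoc, ← pow_add, ← pow_succ']; exact h.one_sub_pow_ne _
  have n11 : qPoch A⁻¹ p k ≠ 0 := right_ne_zero_of_mul (r7 ▸ hpm m)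
  have n12 : qPoch B⁻¹ p k ≠ 0 := right_ne_zero_of_mul (r9 ▸ hpm n)
  have f0 : ∀ e : ℤ, 1 - z * p ^ e ≠ 0 := fun e => by rw [mul_comm]; exact mul_comm z _ ▸ h.h2 e
  have f1 : 1 - z * p * p ^ n ≠ 0 := by
    have := f0 (1 + n); rwa [zpow_add₀ hp, zpow_one, zpow_natCast, ← mul_assoc] at this
  have f2 : 1 - z * p * p ^ n / p ^ k ≠ 0 := by
    have := f0 (1 + n - k)
    rwa [zpow_sub₀ hp, zpow_add₀ hp, zpow_one, zpow_natCast, zpow_natCast, mul_div_assoc',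
      ← mul_assoc] at this
  have f3 : 1 - z * p * p ^ n * p ^ k ≠ 0 := by
    have := f0 (1 + n + k)
    rwa [zpow_add₀ hp, zpow_add₀ hp, zpow_one, zpow_natCast, zpow_natCast, ← mul_assoc,
      ← mul_assoc] at this
  have c1 : 1 - (z * p * B)⁻¹ = -(z * p * p ^ n * p ^ k)⁻¹ * (1 - z * p * p ^ n * p ^ k) := by
    rw [hB]; field_simp; ring
  have c2 : 1 - (p ^ k) ^ 2 / (z * p * B) =
      -(p ^ k / (z * p * p ^ n)) * (1 - z * p * p ^ n / p ^ k) := by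
    rw [hB]; field_simp; ring
  have z7 := eq_div_of_mul_eq n7 ((mul_comm _ _).trans z4)
  have z8 := eq_div_of_mul_eq f2 ((mul_comm _ _).trans z5)
  have z9 := eq_div_of_mul_eq f1 ((mul_comm _ _).trans z6)
  have z10 : qPoch (z * p / A) p (m + k) = qPoch (z * p / A) p n *
      qPoch (z * p * p ^ n / (p ^ m * p ^ k)) p m * qPoch (z * p / p ^ k) p k /
        qPoch (z * p / p ^ k) p n := by
    refine eq_div_of_mul_eq n6 (mul_right_cancel₀ n8 ?_)
    rw [mul_assoc, ← z3]
    linear_combination qPoch (z * p / p ^ k) p k * z1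
  have s3 := eq_div_of_mul_eq n1 ((mul_comm _ _).trans s2)
  rw [s1] at s3
  have n13 := n2
  rw [s3] at n13
  replace n13 := (div_ne_zero_iff.1 n13).1
  have n14 := left_ne_zero_of_mul (left_ne_zero_of_mul n13)
  have n15 := right_ne_zero_of_mul (left_ne_zero_of_mul n13)
  have n16 := right_ne_zero_of_mul n13
  rw [w1, w2, normF, gamN, qBinom_eq h.one_sub_pow_ne, c1, c2, s3, z10, r1, z7, r2, z2, r3, r4, r5,
    z9, r6, z8, r7, r8, r9]
  have hE : ∀ j, ∏ i ∈ Finset.range j, p ^ i ≠ 0 := fun j =>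
    Finset.prod_ne_zero_iff.2 fun i _ => pow_ne_zero i hp
  have hE1 := hE k
  have hE2 := hE (n + k)
  clear r1 r2 r3 r4 r5 r6 r7 r8 r9 z1 z2 z3 z4 z5 z6 z7 z8 z9 z10 s1 s2 s3 w1 w2 c1 c2 n2 n13 hE hpm
    f0 zc h
  generalize qPoch (s * A / (p * B)) p (n + k) = a₁ at *
  generalize qPoch (z * p / A) p n = a₃ at *
  generalize qPoch (z * p * p ^ n / (p ^ m * p ^ k)) p m = a₄ at *
  generalize qPoch (z * p * p ^ n / (p ^ m * p ^ k)) p k = a₅ at *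
  generalize qPoch (z * p / p ^ k) p n = a₆ at *
  generalize qPoch (z * p / p ^ k) p k = a₇ at *
  generalize qPoch (z * p * p ^ n / p ^ k) p k = a₈ at *
  generalize qPoch (z * p * p ^ n) p k = a₉ at *
  generalize qPoch p p k = a₁₀ at *
  generalize qPoch A⁻¹ p k = a₁₁ at *
  generalize qPoch B⁻¹ p k = a₁₂ at *
  generalize qPoch (p / (A * s * z)) p k = a₁₃ at *
  generalize qPoch (s * A / (p * B)) p k = a₁₄ at *
  generalize qPoch (s * p ^ m * p ^ k / (p ^ n * p)) p m = a₁₅ at *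
  generalize qPoch (s * A ^ 2 / (p * B)) p (n + k) = a₁₆ at *
  generalize qPoch p p m = a₁₇ at *
  generalize qPoch (Y * p ^ K) p (m - K) = a₁₈ at *
  generalize 1 - z * p * p ^ n / p ^ k = b₁ at *
  generalize 1 - z * p * p ^ n * p ^ k = b₂ at *
  generalize 1 - z * p * p ^ n = b₃ at *
  have hε : ∀ k, (-1 : F) ^ k ≠ 0 := fun k => pow_ne_zero k (neg_ne_zero.2 one_ne_zero)
  have hε3 : (-1 : F) ^ k * (-1) ^ k = 1 := by rw [← mul_pow]; simp
  have hE3 := prod_pow_sq p k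
  generalize ∏ i ∈ Finset.range k, p ^ i = E₁ at *
  generalize ∏ i ∈ Finset.range (n + k), p ^ i = E₂ at *
  rw [pow_succ p (n + k), neg_pow (z * B)⁻¹, neg_pow (A / (z * B)) (n + k), neg_pow z⁻¹,
    neg_pow (A / (z * B)) k, neg_pow (z * p * B)⁻¹, neg_pow (p ^ k / _), neg_pow (p * p ^ m),
    neg_pow (Y * p ^ m), neg_pow (p * p ^ n), hs]
  have hε1 := hε k
  have hε2 := hε (n + k)
  generalize (-1 : F) ^ k = ε₁ at *
  generalize (-1 : F) ^ (n + k) = ε₂ at *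
  clear hε
  simp only [div_eq_mul_inv, mul_inv, inv_inv, mul_pow, inv_pow, pow_add, hA, hB]
  rw [pow_mul _ 2 k]
  simp only [pow_right_comm _ 2 k]
  clear hA0 hB0 hA hB
  generalize p ^ m = C at *
  generalize p ^ n = D at *
  generalize p ^ k = L at *
  have d1 := pow_ne_zero k hC
  have d2 := pow_ne_zero k hD
  have d3 := pow_ne_zero k hL
  have d4 := pow_ne_zero k hz
  have d5 := pow_ne_zero k hs0
  have d6 := pow_ne_zero n hC
  have d7 := pow_ne_zero n hD
  have d8 := pow_ne_zero n hL
  have d9 := pow_ne_zero n hz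
  generalize C ^ k = C' at *
  generalize D ^ k = D' at *
  generalize L ^ k = L' at *
  generalize s ^ k = s' at *
  generalize z ^ k = z' at *
  generalize C ^ n = C'' at *
  generalize D ^ n = D'' at *
  generalize L ^ n = L'' at *
  generalize z ^ n = z'' at *
  field_simp
  -- The signs from the reversals square to `1`, and the remaining product of powers of `p` is
  -- eliminated by `prod_pow_sq`.
  rw [← hE3, show ε₁ ^ 4 = (ε₁ * ε₁) ^ 2 by ring, hε3]
  ring

end GenericNorm
end DynSU2

namespace DynSU2

open Polynomial Mer

variable (q : Set.Ioo (0 : ℝ) 1)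

/-! ### Weight, norm and prefactors as meromorphic functions. -/

section Weights

/-- `q^{2(ω-λ)}`. -/
noncomputable def cS (ω : ℂ) : Mer := cY q ω / cZ q

lemma cS_ne (ω : ℂ) : cS q ω ≠ 0 := div_ne_zero (cY_ne q ω) (cZ_ne q)

lemma cY_eq (ω : ℂ) : cY q ω = cS q ω * cZ q := (div_mul_cancel₀ _ (cZ_ne q)).symm

lemma qE_eq_div_cS {P : ℂ[X]} (ω : ℂ) (c : ℤ) (h : P = 2 * (X - C ω + (c : ℂ[X]))) :
    qE q P = (cQ q ^ 2) ^ c / cS q ω := by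
  rw [qE_even_X_sub q P ω c h, cS, div_div_eq_mul_div, div_mul_eq_mul_div, mul_comm]

lemma racahWeight_eq (ω : ℂ) (N M j : ℕ) : racahWeight q ω N M j =
    weightF (cQ q ^ 2) (cZ q) (cS q ω) ((cQ q ^ 2) ^ M) ((cQ q ^ 2) ^ N) ((cQ q ^ 2) ^ j) j := by
  have hp := pow_ne_zero 2 (cQ_ne q)
  have hz := cZ_ne q
  have hs := cS_ne q ω
  have hY := cY_eq q ω
  have h1 := qE_eq_div_cS q (P := 2 * (X - C ω + 1 - 2 * (M : ℂ[X])) + 4 * (j : ℂ[X])) ω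
    (1 - M - M + j + j) (by push_cast; ring)
  have h2 := qE_eq_div_cS q (P := 2 * (X - C ω + 1 - 2 * (M : ℂ[X]))) ω (1 - M - M)
    (by push_cast; ring)
  have h3 := qE_eq_div_cS q (P := 2 * (X - C ω - 2 * (M : ℂ[X]) + 1)) ω (1 - M - M)
    (by push_cast; ring)
  have h4 := qE_even_const q (-2 * (N : ℂ[X])) (-N) (by push_cast; ring)
  have h5 := qE_even_const q (-2 * (M : ℂ[X])) (-M) (by push_cast; ring)
  have h6 := qE_even_neg_om q (-2 * (C ω - 1 + (M : ℂ[X]))) ω (1 - M) (by push_cast; ring)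
  have h7 := qE_eq_div_cS q (P := 2 * (X - C ω + 2 + (N : ℂ[X]) - 2 * (M : ℂ[X]))) ω
    (1 + 1 + N - M - M) (by push_cast; ring)
  have h8 := qE_eq_div_cS q (P := 2 * (X - C ω + 2 - (M : ℂ[X]))) ω (1 + 1 - M)
    (by push_cast; ring)
  have h9 := qE_even_X q (2 * (X + 1 - (M : ℂ[X]))) (1 - M) (by push_cast; ring)
  have h10 : qE q (2 * (j : ℂ[X]) * (X + (N : ℂ[X]) + 1)) =
      (cZ q * cQ q ^ 2 * (cQ q ^ 2) ^ N) ^ j := by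
    rw [show 2 * (j : ℂ[X]) * (X + (N : ℂ[X]) + 1) =
      (j : ℂ[X]) * (2 * (X + ((N + 1 : ℤ) : ℂ[X]))) by push_cast; ring, qE_nat_mul,
      qE_even_X q _ _ rfl, zpow_add₀ hp, zpow_one, zpow_natCast]
    ring
  have a1 : (cQ q ^ 2) ^ (1 - M - M + j + j : ℤ) / cS q ω =
      cQ q ^ 2 * ((cQ q ^ 2) ^ j) ^ 2 / (cS q ω * ((cQ q ^ 2) ^ M) ^ 2) := by
    simp only [zpow_add₀ hp, zpow_sub₀ hp, zpow_natCast, zpow_one]; field_simp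
  have a2 : (cQ q ^ 2) ^ (1 - M - M : ℤ) / cS q ω =
      cQ q ^ 2 / (cS q ω * ((cQ q ^ 2) ^ M) ^ 2) := by
    simp only [zpow_sub₀ hp, zpow_natCast, zpow_one]; field_simp
  have a3 : ∀ n : ℕ, (cQ q ^ 2) ^ (-n : ℤ) = ((cQ q ^ 2) ^ n)⁻¹ := fun n => by
    rw [zpow_neg, zpow_natCast]
  have a4 : (cQ q ^ 2) ^ (1 - M : ℤ) / cY q ω =
      cQ q ^ 2 / ((cQ q ^ 2) ^ M * cS q ω * cZ q) := by
    rw [hY, zpow_sub₀ hp, zpow_one, zpow_natCast]; field_simp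
  have a5 : (cQ q ^ 2) ^ (1 + 1 + N - M - M : ℤ) / cS q ω =
      (cQ q ^ 2) ^ 2 * (cQ q ^ 2) ^ N / (cS q ω * ((cQ q ^ 2) ^ M) ^ 2) := by
    simp only [zpow_add₀ hp, zpow_sub₀ hp, zpow_natCast, zpow_one]; field_simp
  have a6 : (cQ q ^ 2) ^ (1 + 1 - M : ℤ) / cS q ω =
      (cQ q ^ 2) ^ 2 / (cS q ω * (cQ q ^ 2) ^ M) := by
    simp only [zpow_add₀ hp, zpow_sub₀ hp, zpow_natCast, zpow_one]; field_simp
  have a7 : cZ q * (cQ q ^ 2) ^ (1 - M : ℤ) = cZ q * cQ q ^ 2 / (cQ q ^ 2) ^ M := by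
    simp only [zpow_sub₀ hp, zpow_natCast, zpow_one]; field_simp
  rw [a1] at h1
  rw [a2] at h2 h3
  rw [a3] at h4 h5
  rw [a4] at h6
  rw [a5] at h7
  rw [a6] at h8
  rw [a7] at h9
  rw [racahWeight, weightF]
  simp only [qP, qE_two, h1, h2, h3, h4, h5, h6, h7, h8, h9, h10]

lemma racahNorm_eq (ω : ℂ) (N M k : ℕ) : racahNorm q ω N M k =
    normF (cQ q ^ 2) (cZ q) (cS q ω) ((cQ q ^ 2) ^ M) ((cQ q ^ 2) ^ N) ((cQ q ^ 2) ^ k) N k := by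
  have hp := pow_ne_zero 2 (cQ_ne q)
  have hz := cZ_ne q
  have hs := cS_ne q ω
  have hY := cY_eq q ω
  have h0 : ∀ c : ℤ, qE q (2 * (C ω - X + (c : ℂ[X]))) = cS q ω * (cQ q ^ 2) ^ c := fun c =>
    qE_even_sub_X q _ ω c rfl
  have h1 := h0 (M + M - 1 - N)
  have h2 := h0 (M - 1 - N)
  have h3 := qE_even_neg_X q (-2 * (X + (N : ℂ[X]))) (-N) (by push_cast; ring)
  have h4 := qE_even_neg_X q (-2 * (X + (N : ℂ[X]) - (M : ℂ[X]))) (M - N) (by push_cast; ring)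
  have h5 := qE_even_neg_X q (-2 * (X + 1 + (N : ℂ[X]))) (-N - 1) (by push_cast; ring)
  have h6 := qE_even_neg_X q (-2 * (X + 1 + (N : ℂ[X])) + 4 * (k : ℂ[X])) (k + k - N - 1)
    (by push_cast; ring)
  have h7 := qE_even_neg_X q (-2 * X) 0 (by push_cast; ring)
  have h8 := qE_even_const q (-2 * (N : ℂ[X])) (-N) (by push_cast; ring)
  have h9 := qE_even_const q (-2 * (M : ℂ[X])) (-M) (by push_cast; ring)
  have h10 := qE_even_neg_om q (-2 * (C ω - 1 + (M : ℂ[X]))) ω (1 - M) (by push_cast; ring)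
  have h11 : qE q (2 * (k : ℂ[X]) * (X - C ω + 1 - 2 * (M : ℂ[X]))) =
      ((cQ q ^ 2) ^ (1 - M - M : ℤ) / cS q ω) ^ k := by
    rw [← qE_eq_div_cS q (P := 2 * (X - C ω + 1 - 2 * (M : ℂ[X]))) ω (1 - M - M)
      (by push_cast; ring), ← qE_nat_mul]
    congr 1; ring
  have e1 : 2 * (C ω - X + ((M + M - 1 - N : ℤ) : ℂ[X])) =
      2 * (C ω - X - 1 + 2 * (M : ℂ[X]) - (N : ℂ[X])) := by push_cast; ring
  have e2 : 2 * (C ω - X + ((M - 1 - N : ℤ) : ℂ[X])) =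
      2 * (C ω - X - 1 + (M : ℂ[X]) - (N : ℂ[X])) := by push_cast; ring
  rw [e1] at h1
  rw [e2] at h2
  have a1 : cS q ω * (cQ q ^ 2) ^ (M + M - 1 - N : ℤ) =
      cS q ω * ((cQ q ^ 2) ^ M) ^ 2 / (cQ q ^ 2 * (cQ q ^ 2) ^ N) := by
    simp only [zpow_add₀ hp, zpow_sub₀ hp, zpow_one, zpow_natCast]; field_simp
  have a2 : cS q ω * (cQ q ^ 2) ^ (M - 1 - N : ℤ) =
      cS q ω * (cQ q ^ 2) ^ M / (cQ q ^ 2 * (cQ q ^ 2) ^ N) := by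
    simp only [zpow_add₀ hp, zpow_sub₀ hp, zpow_one, zpow_natCast]; field_simp
  have a3 : (cQ q ^ 2) ^ (-N : ℤ) / cZ q = (cZ q * (cQ q ^ 2) ^ N)⁻¹ := by
    rw [zpow_neg, zpow_natCast]; field_simp
  have a4 : (cQ q ^ 2) ^ (M - N : ℤ) / cZ q = (cQ q ^ 2) ^ M / (cZ q * (cQ q ^ 2) ^ N) := by
    simp only [zpow_sub₀ hp, zpow_natCast]; field_simp
  have a5 : (cQ q ^ 2) ^ (-N - 1 : ℤ) / cZ q = (cZ q * cQ q ^ 2 * (cQ q ^ 2) ^ N)⁻¹ := by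
    simp only [zpow_sub₀ hp, zpow_neg, zpow_natCast, zpow_one]; field_simp
  have a6 : (cQ q ^ 2) ^ (k + k - N - 1 : ℤ) / cZ q =
      ((cQ q ^ 2) ^ k) ^ 2 / (cZ q * cQ q ^ 2 * (cQ q ^ 2) ^ N) := by
    simp only [zpow_sub₀ hp, zpow_add₀ hp, zpow_natCast, zpow_one]; field_simp
  have a7 : (cQ q ^ 2) ^ (0 : ℤ) / cZ q = (cZ q)⁻¹ := by rw [zpow_zero, one_div]
  have a8 : ∀ n : ℕ, (cQ q ^ 2) ^ (-n : ℤ) = ((cQ q ^ 2) ^ n)⁻¹ := fun n => by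
    rw [zpow_neg, zpow_natCast]
  have a9 : (cQ q ^ 2) ^ (1 - M : ℤ) / cY q ω =
      cQ q ^ 2 / ((cQ q ^ 2) ^ M * cS q ω * cZ q) := by
    rw [hY, zpow_sub₀ hp, zpow_one, zpow_natCast]; field_simp
  have a10 : (cQ q ^ 2) ^ (1 - M - M : ℤ) / cS q ω =
      cQ q ^ 2 / (cS q ω * ((cQ q ^ 2) ^ M) ^ 2) := by
    simp only [zpow_sub₀ hp, zpow_natCast, zpow_one]; field_simp
  rw [a1] at h1
  rw [a2] at h2
  rw [a3] at h3
  rw [a4] at h4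
  rw [a5] at h5
  rw [a6] at h6
  rw [a7] at h7
  rw [a8] at h8 h9
  rw [a9] at h10
  rw [a10] at h11
  rw [racahNorm, normF]
  simp only [qP, qE_two, h1, h2, h3, h4, h5, h6, h7, h8, h9, h10, h11]

/-- The factor of `T_{jk,M-k}` that depends on `j`. -/
noncomputable def facJ (ω : ℂ) (N M j : ℕ) : Mer :=
  (-1) ^ j * (cZ q ^ j * cQ q ^ (j * (N - M + 3) : ℤ)) * (qPoch ((cQ q ^ 2) ^ M)⁻¹ (cQ q ^ 2) j /
    (qPoch (cZ q * cQ q ^ 2 / (cQ q ^ 2) ^ M) (cQ q ^ 2) j *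
      qPoch ((cQ q ^ 2) ^ 2 * (cQ q ^ 2) ^ N / (cS q ω * ((cQ q ^ 2) ^ M) ^ 2)) (cQ q ^ 2) j))

/-- The factor of `T_{jk,M-k}` that depends on `k`. -/
noncomputable def facK (N M k : ℕ) : Mer :=
  (-1) ^ k * cQ q ^ (M * N - M * k - 2 * k * N + 2 * k * k - k : ℤ) *
    (qBinom (cQ q ^ 2) N k * qPoch (cZ q * cQ q ^ 2 / (cQ q ^ 2) ^ M) (cQ q ^ 2) (N - k) /
      qPoch (cZ q * cQ q ^ 2 / (cQ q ^ 2) ^ k) (cQ q ^ 2) (N - k))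

/-- Splits a factorial of possibly negative length into a part without `j` and a part with `j`
alone, whatever the sign of `n - j`. -/
lemma qPochInt_sub {F : Type*} [Field F] {a p : F} (hp : p ≠ 0) {n : ℕ} (j : ℕ)
    (h : ∀ i : ℤ, 1 - a * p ^ i ≠ 0) :
    qPochInt (a * p ^ j) p ((n : ℤ) - j) = qPoch a p n / qPoch a p j := by
  induction n with
  | zero =>
    rcases j with _ | j
    · have h0 : qPochInt a p 0 = 1 := (qPochInt_natCast a p 0).trans (qPoch_zero a p)
      simp [h0, qPoch_zero]
    · have e : ((0 : ℕ) : ℤ) - (j + 1 : ℕ) = Int.negSucc j := by omega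
      rw [e]
      change (qPoch (a * p ^ (j + 1) * p ^ (-((j : ℤ) + 1))) p (j + 1))⁻¹ = _
      rw [mul_assoc, ← Nat.cast_succ, zpow_neg, zpow_natCast, mul_inv_cancel₀ (pow_ne_zero _ hp),
        mul_one, qPoch_zero, one_div]
  | succ n ih =>
    have e : a * p ^ j * p ^ ((n : ℤ) - j) = a * p ^ n := by
      rw [mul_assoc, zpow_sub₀ hp, zpow_natCast, zpow_natCast, mul_div_cancel₀ _ (pow_ne_zero _ hp)]
    have h1 := h n
    rw [zpow_natCast] at h1
    rw [show ((n + 1 : ℕ) : ℤ) - j = (n : ℤ) - j + 1 by push_cast; ring,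
      qPochInt_add_one _ _ hp _ (by rwa [e]), ih, e, qPoch_succ, div_mul_eq_mul_div]

/-- With `m = M - k` the starting points `q^{-2(m+k)}` and `q^{2(λ-ω+2+N-2k-2m)}` depend on `M`
only, the exponent of `q` becomes a sum of a term in `j` and one in `k`, and the mixed factorial
splits by `qPochInt_sub`. -/
lemma tFactor_eq_mul (ω : ℂ) {N M j k : ℕ} (hkN : k ≤ N) (hkM : k ≤ M) :
    tFactor q ω N j k (M - k) = facJ q ω N M j * facK q N M k := by
  have hg := genericPoint q ω
  have hp := pow_ne_zero 2 (cQ_ne q)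
  have hQ := cQ_ne q
  have hz := cZ_ne q
  have hs := cS_ne q ω
  have hc : ((M - k : ℕ) : ℤ) = M - k := by omega
  rw [tFactor_eq, tPre, facJ, facK, hc]
  have e1 : cZ q * (cQ q ^ 2) ^ (1 + j - k - (M - k) : ℤ) =
      cZ q * cQ q ^ 2 / (cQ q ^ 2) ^ M * (cQ q ^ 2) ^ j := by
    rw [show (1 + j - k - (M - k) : ℤ) = 1 + j - M by ring, zpow_sub₀ hp, zpow_add₀ hp, zpow_one,
      zpow_natCast, zpow_natCast]
    field_simp
  have e2 : (N : ℤ) - j - k = (N - k : ℕ) - j := by omega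
  have e3 : (cQ q ^ 2) ^ (-((M : ℤ) - k + k)) = ((cQ q ^ 2) ^ M)⁻¹ := by
    rw [sub_add_cancel, zpow_neg, zpow_natCast]
  have e4 : cZ q * (cQ q ^ 2) ^ (1 - k : ℤ) = cZ q * cQ q ^ 2 / (cQ q ^ 2) ^ k := by
    simp only [zpow_sub₀ hp, zpow_natCast, zpow_one]; field_simp
  have e5 : cZ q / cY q ω * (cQ q ^ 2) ^ (2 + N - 2 * k - 2 * (M - k) : ℤ) =
      (cQ q ^ 2) ^ 2 * (cQ q ^ 2) ^ N / (cS q ω * ((cQ q ^ 2) ^ M) ^ 2) := by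
    rw [show (2 + N - 2 * k - 2 * (M - k) : ℤ) = 1 + 1 + N - M - M by ring, cY_eq]
    simp only [zpow_add₀ hp, zpow_sub₀ hp, zpow_natCast, zpow_one]; field_simp
  have e6 : cQ q ^ (2 * j + (M - k) * ((N : ℤ) - j - k) + ((j : ℤ) - k) * ((N : ℤ) - k + 1)) =
      cQ q ^ (j * (N - M + 3) : ℤ) *
        cQ q ^ (M * N - M * k - 2 * k * N + 2 * k * k - k : ℤ) := by
    rw [← zpow_add₀ hQ]; congr 1; ring
  have hz' : ∀ i : ℤ, 1 - cZ q * cQ q ^ 2 / (cQ q ^ 2) ^ M * (cQ q ^ 2) ^ i ≠ 0 := fun i => by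
    have := hg.h2 (1 - M + i)
    rwa [zpow_add₀ hp, zpow_sub₀ hp, zpow_natCast, zpow_one, ← mul_assoc, mul_div_assoc'] at this
  rw [e6, e1, e2, e3, e4, e5, qPochInt_sub hp j hz', pow_add]
  simp only [div_eq_mul_inv, mul_inv]
  ring

/-- Squaring removes the sign and turns the power of `q` into a power of `q²`, the form required by
`weightF_mul_gamW`. -/
lemma facJ_sq (ω : ℂ) (N M j : ℕ) : facJ q ω N M j ^ 2 =
    (cZ q ^ 2 * (cQ q ^ 2) ^ 3 * (cQ q ^ 2) ^ N / (cQ q ^ 2) ^ M) ^ j *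
      (qPoch ((cQ q ^ 2) ^ M)⁻¹ (cQ q ^ 2) j /
        (qPoch (cZ q * cQ q ^ 2 / (cQ q ^ 2) ^ M) (cQ q ^ 2) j *
      qPoch ((cQ q ^ 2) ^ 2 * (cQ q ^ 2) ^ N / (cS q ω * ((cQ q ^ 2) ^ M) ^ 2)) (cQ q ^ 2) j)) ^ 2 := by
  have hQ := cQ_ne q
  rw [facJ, mul_pow, mul_pow, mul_pow]
  congr 1
  have e : (cQ q ^ (j * (N - M + 3) : ℤ)) ^ 2 =
      ((cQ q ^ 2) ^ 3 * (cQ q ^ 2) ^ N / (cQ q ^ 2) ^ M) ^ j := by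
    have hp := pow_ne_zero 2 hQ
    rw [← zpow_natCast, ← zpow_mul, show (j * (N - M + 3) * ((2 : ℕ) : ℤ) : ℤ) =
      ((2 : ℕ) : ℤ) * ((((3 : ℕ) : ℤ) + N - M) * j) by push_cast; ring, zpow_mul, zpow_natCast, zpow_mul,
      zpow_sub₀ hp, zpow_add₀ hp]
    simp only [zpow_natCast]
  rw [e, ← pow_mul, ← pow_mul, mul_comm j 2, pow_mul, pow_mul, neg_one_sq, one_pow, one_mul,
    ← mul_pow, mul_div_assoc', mul_assoc (cZ q ^ 2)]

lemma facK_sq {N M k n : ℕ} (h : N = n + k) : facK q N M k ^ 2 =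
    ((cQ q ^ 2) ^ M) ^ n / (((cQ q ^ 2) ^ n) ^ (2 * k) * (cQ q ^ 2) ^ k) *
      (qBinom (cQ q ^ 2) (n + k) k * qPoch (cZ q * cQ q ^ 2 / (cQ q ^ 2) ^ M) (cQ q ^ 2) n /
        qPoch (cZ q * cQ q ^ 2 / (cQ q ^ 2) ^ k) (cQ q ^ 2) n) ^ 2 := by
  have hQ := cQ_ne q
  subst h
  rw [facK, mul_pow, mul_pow, Nat.add_sub_cancel]
  congr 1
  have hp := pow_ne_zero 2 hQ
  rw [← pow_mul, mul_comm k 2, pow_mul, neg_one_sq, one_pow, one_mul, ← zpow_natCast, ← zpow_mul,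
    mul_comm _ ((2 : ℕ) : ℤ), zpow_mul, zpow_natCast]
  generalize cQ q ^ 2 = P at *
  rw [← pow_mul, ← pow_mul, ← pow_add,
    ← zpow_natCast _ (M * n), ← zpow_natCast _ (n * (2 * k) + k), ← zpow_sub₀ hp]
  congr 1
  push_cast
  ring

lemma cQ_inv_qPoch_ne {M j : ℕ} (h : j ≤ M) :
    qPoch ((cQ q ^ 2) ^ M)⁻¹ (cQ q ^ 2) j ≠ 0 := qPoch_ne_zero fun i hi => by
  have h1 := (genericPoint q 0).h1 (i - M) (by omega)
  rwa [zpow_sub₀ (pow_ne_zero 2 (cQ_ne q)), zpow_natCast, zpow_natCast, div_eq_mul_inv,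
    mul_comm] at h1

lemma qPoch_cZ_ne (m : ℤ) {a : Mer} (h : a = cZ q * (cQ q ^ 2) ^ m) (n : ℕ) :
    qPoch a (cQ q ^ 2) n ≠ 0 := (genericPoint q 0).qPoch_z_ne m h n

lemma facJ_ne (ω : ℂ) (N : ℕ) {M j : ℕ} (h : j ≤ M) : facJ q ω N M j ≠ 0 := by
  have hp := pow_ne_zero 2 (cQ_ne q)
  have hs := cS_ne q ω
  refine mul_ne_zero (mul_ne_zero (pow_ne_zero _ (neg_ne_zero.2 one_ne_zero))
    (mul_ne_zero (pow_ne_zero _ (cZ_ne q)) (zpow_ne_zero _ (cQ_ne q))))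
    (div_ne_zero (cQ_inv_qPoch_ne q h) (mul_ne_zero ?_ ?_))
  · exact qPoch_cZ_ne q (1 - M) (by rw [zpow_sub₀ hp, zpow_one, zpow_natCast, mul_div_assoc]) j
  · refine (genericPoint q ω).qPoch_inv_s_ne (cY_eq q ω) (1 + 1 + N - M - M) ?_ j
    simp only [zpow_add₀ hp, zpow_sub₀ hp, zpow_natCast, zpow_one]; field_simp

lemma facK_ne (N M k : ℕ) : facK q N M k ≠ 0 := by
  have hp := pow_ne_zero 2 (cQ_ne q)
  have h : ∀ n, qPoch (cQ q ^ 2) (cQ q ^ 2) n ≠ 0 := fun n =>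
    qPoch_ne_zero fun i _ => by rw [← pow_succ']; exact one_sub_pow_ne q i
  refine mul_ne_zero (mul_ne_zero (pow_ne_zero _ (neg_ne_zero.2 one_ne_zero))
    (zpow_ne_zero _ (cQ_ne q))) (div_ne_zero (mul_ne_zero
      (div_ne_zero (h _) (mul_ne_zero (h _) (h _))) ?_) ?_)
  · exact qPoch_cZ_ne q (1 - M) (by rw [zpow_sub₀ hp, zpow_one, zpow_natCast, mul_div_assoc]) _
  · exact qPoch_cZ_ne q (1 - k) (by rw [zpow_sub₀ hp, zpow_one, zpow_natCast, mul_div_assoc]) _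

lemma shift_gammaN' (ω : ℂ) (N j n : ℕ) {s : ℂ} (h : s = -ω - 2 * n) :
    shift s (gammaN q N j) =
      gamN (cQ q ^ 2) (cS q ω * (cQ q ^ 2) ^ n * (cQ q ^ 2) ^ n)⁻¹ N j := by
  have hp := pow_ne_zero 2 (cQ_ne q)
  have e : shift s (cZ q) = (cS q ω * (cQ q ^ 2) ^ n * (cQ q ^ 2) ^ n)⁻¹ := by
    rw [cZ, shift_qE, qE_eq_div_cS q ω (-n - n) (by rw [h]; simp [C_ofNat]; ring), zpow_sub₀ hp,
      zpow_neg, zpow_natCast, mul_inv, mul_inv, div_eq_mul_inv, div_eq_mul_inv]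
    ring
  simp only [gammaN_eq, gamN, qBinom, map_div₀, map_mul, shift_qPoch, map_pow, shift_cQ, map_inv₀,
    e]

lemma qP_neg_om_eq (ω : ℂ) (M j : ℕ) : qP q (-2 * (C ω - 1 + (M : ℂ[X]))) j =
    qPoch (cQ q ^ 2 / ((cQ q ^ 2) ^ M * cS q ω * cZ q)) (cQ q ^ 2) j := by
  have hp := pow_ne_zero 2 (cQ_ne q)
  have hs := cS_ne q ω
  have hz := cZ_ne q
  rw [qP, qE_two, qE_even_neg_om q (-2 * (C ω - 1 + (M : ℂ[X]))) ω (1 - M) (by push_cast; ring),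
    cY_eq, zpow_sub₀ hp, zpow_one, zpow_natCast]
  congr 1
  field_simp

/-- What converts the sum over `j` from the representation into a sum with weight `w_j`. The factor
`(x; q²)_j²` accounts for the two coefficients `T` in each summand. -/
lemma racahWeight_mul (ω : ℂ) {K N M j : ℕ} (hN : j ≤ N) (hM : K + j ≤ M) :
    racahWeight q ω N M j * gamW (cQ q ^ 2) (cZ q) (cY q ω) K M =
      gamW (cQ q ^ 2) (cZ q) (cY q ω) K (M - j) * shift (-ω - 2 * M + 2 * j) (gammaN q N j) *
        facJ q ω N M j ^ 2 * qP q (-2 * (C ω - 1 + (M : ℂ[X]))) j ^ 2 := by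
  obtain ⟨m, rfl⟩ := Nat.exists_eq_add_of_le' hN
  obtain ⟨n, rfl⟩ := Nat.exists_eq_add_of_le' ((Nat.le_add_left j K).trans hM)
  rw [Nat.add_sub_cancel, shift_gammaN' q ω (m + j) j n (by push_cast; ring), facJ_sq,
    qP_neg_om_eq, racahWeight_eq,
    weightF_mul_gamW (genericPoint q ω) (cY_eq q ω) (show K ≤ n by omega) (pow_add _ _ _)
      (pow_add _ _ _)]

/-- What converts the diagonal value into `h_k`. The shift of `Γ_{M-k}` is the one created by
removing the adjoint from the evaluated relation. -/
lemma racahNorm_mul (ω : ℂ) {K N M k : ℕ} (hN : k ≤ N) (hM : K + k ≤ M)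
    (hx : qP q (-2 * (C ω - 1 + (M : ℂ[X]))) k ≠ 0) :
    racahNorm q ω N M k * facK q N M k ^ 2 * gamW (cQ q ^ 2) (cZ q) (cY q ω) K M =
      gammaN q N k * shift (N - 2 * k) (gamW (cQ q ^ 2) (cZ q) (cY q ω) K (M - k)) := by
  have hp := pow_ne_zero 2 (cQ_ne q)
  obtain ⟨n, rfl⟩ := Nat.exists_eq_add_of_le' hN
  obtain ⟨m, rfl⟩ := Nat.exists_eq_add_of_le' ((Nat.le_add_left k K).trans hM)
  rw [qP_neg_om_eq] at hx
  have e : (cQ q ^ 2) ^ (n - k : ℤ) = (cQ q ^ 2) ^ n * ((cQ q ^ 2) ^ k)⁻¹ := by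
    rw [zpow_sub₀ hp, zpow_natCast, zpow_natCast, div_eq_mul_inv]
  rw [Nat.add_sub_cancel, shift_gamW q (n - k) (by push_cast; ring), facK_sq q rfl, racahNorm_eq,
    normF_mul_gamW (genericPoint q ω) (cY_eq q ω) (show K ≤ m by omega) (pow_add _ _ _)
      (pow_add _ _ _) hx, gammaN_eq, e]

end Weights
end DynSU2

namespace DynSU2

open Polynomial Mer

variable (q : Set.Ioo (0 : ℝ) 1)

/-! ### Orthogonality of the `q`-Racah polynomials and of the dual system. -/

section Orthogonality

/-- If `ω = -i` with `i < M`, then `B_{i+1} = 0`, and `K = i + 1` removes the vanishing factor. The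
hypothesis on `ω` says exactly that `i` is small enough for the vectors `e_{M-j}`, `j ≤ min M N`, to
lie in the submodule. Otherwise nothing vanishes up to `M` and `K = 0` will do. -/
lemma exists_adjWeight {N M : ℕ} {ω : ℝ} (h : ∀ i < min M N, ω ≠ 1 - (M : ℝ) + i) :
    ∃ K, K + min M N ≤ M ∧ coefB q ω K = 0 ∧
      ∀ k ≤ M, gamW (cQ q ^ 2) (cZ q) (cY q ω) K k ≠ 0 := by
  by_cases hi : ∃ i < M, ω = -(i : ℝ)
  · obtain ⟨i, hi, rfl⟩ := hi
    refine ⟨i + 1, ?_, ?_, fun k _ => gamW_ne q fun i' h1 _ h2 => ?_⟩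
    · by_contra hc
      refine h (M - 1 - i) (by omega) ?_
      rw [Nat.sub_sub, Nat.cast_sub (by omega)]
      push_cast; ring
    · have e : cY q (-(i : ℝ) : ℝ) * (cQ q ^ 2) ^ i = 1 := by
        rw [← zpow_natCast, ← qE_even_om q 0 _ i (by simp), qE_even_const q 0 0 (by simp), zpow_zero]
      rw [coefB_succ_eq, e, sub_self, mul_zero, zero_div]
    · have h3 : (i : ℝ) = i' := by linarith
      have h4 : i = i' := by exact_mod_cast h3
      omega
  · push Not at hi
    exact ⟨0, by omega, coefB_zero q ω, fun k hk => gamW_ne q fun i _ h2 => hi i (by omega)⟩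

variable {q} {N M : ℕ} {ω : ℝ}

lemma qP_neg_om_ne_of_le (h : ∀ i < min M N, ω ≠ 1 - (M : ℝ) + i) {j : ℕ} (hj : j ≤ min M N) :
    qP q (-2 * (C (ω : ℂ) - 1 + (M : ℂ[X]))) j ≠ 0 :=
  qP_neg_om_ne q M (by push_cast; ring) fun i hi => by exact_mod_cast h i (by omega)

lemma tCoefReg_sub_eq (h : ∀ i < min M N, ω ≠ 1 - (M : ℝ) + i) {j k : ℕ} (hj : j ≤ min M N)
    (hk : k ≤ min M N) : tCoef q ω N j k (M - k) = tCoefReg q ω N j k (M - k) := by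
  refine tCoef_eq_tCoefReg q ?_
  have e : -2 * (C (ω : ℂ) - 1 + ((M - k : ℕ) : ℂ[X]) + (k : ℂ[X])) =
      -2 * (C (ω : ℂ) - 1 + (M : ℂ[X])) := by
    rw [Nat.cast_sub (by omega)]; ring
  rw [e]
  exact qP_neg_om_ne_of_le h (by omega)

/-- Separates variables: apart from the polynomial, the coefficient is a product of a function of
`j` and a function of `k`. -/
lemma tCoefReg_eq_mul (h : ∀ i < min M N, ω ≠ 1 - (M : ℝ) + i) {j k : ℕ} (hj : j ≤ min M N)
    (hk : k ≤ min M N) : tCoefReg q ω N j k (M - k) = facJ q ω N M j * facK q N M k *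
      (qP q (-2 * (C (ω : ℂ) - 1 + (M : ℂ[X]))) j * racah q ω N M k j) := by
  have e : -2 * (C (ω : ℂ) - 1 + ((M - k : ℕ) : ℂ[X]) + (k : ℂ[X])) =
      -2 * (C (ω : ℂ) - 1 + (M : ℂ[X])) := by
    rw [Nat.cast_sub (by omega)]; ring
  rw [← tCoefReg_sub_eq h hj hk, tCoef_eq, tFactor_eq_mul q ω (by omega) (by omega), e,
    Nat.sub_add_cancel (by omega)]

/-- The orthogonality relations of the `q`-Racah polynomials. -/
theorem sum_racahWeight_mul (h : ∀ i < min M N, ω ≠ 1 - (M : ℝ) + i) {k l : ℕ}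
    (hk : k ≤ min M N) (hl : l ≤ min M N) :
    ∑ j ∈ Finset.range (min M N + 1), racahWeight q ω N M j * racah q ω N M k j *
      racah q ω N M l j = if k = l then racahNorm q ω N M k else 0 := by
  obtain ⟨K, hK, hB, hG⟩ := exists_adjWeight q h
  have key := sum_tCoefReg_mul q (isAdjWeight_gamW q hB) hk hl hK
  have hk0 := facK_ne q N M k
  have hl0 := facK_ne q N M l
  have hΓ : gammaN q N k ≠ 0 := gammaN_ne q
  have hGM := hG M le_rfl
  have e : ∀ j ∈ Finset.range (min M N + 1),
      gamW (cQ q ^ 2) (cZ q) (cY q ω) K (M - j) * (shift (-ω - 2 * M + 2 * j) (gammaN q N j) *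
        (gammaN q N k)⁻¹) * tCoefReg q ω N j k (M - k) * tCoefReg q ω N j l (M - l) =
      (gammaN q N k)⁻¹ * facK q N M k * facK q N M l * gamW (cQ q ^ 2) (cZ q) (cY q ω) K M *
        (racahWeight q ω N M j * racah q ω N M k j * racah q ω N M l j) := fun j hj => by
    have hj' : j ≤ min M N := Nat.lt_succ_iff.1 (Finset.mem_range.1 hj)
    have h1 := racahWeight_mul q ω (K := K) (N := N) (M := M) (j := j) (by omega) (by omega)
    rw [tCoefReg_eq_mul h hj' hk, tCoefReg_eq_mul h hj' hl]
    linear_combination (-(gammaN q N k)⁻¹ * facK q N M k * facK q N M l * racah q ω N M k j *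
      racah q ω N M l j) * h1
  rw [Finset.sum_congr rfl e, ← Finset.mul_sum] at key
  -- The factor independent of `j` is invertible, because `Γ_M` is nonzero for the reduced weight.
  have hc : (gammaN q N k)⁻¹ * facK q N M k * facK q N M l *
      gamW (cQ q ^ 2) (cZ q) (cY q ω) K M ≠ 0 :=
    mul_ne_zero (mul_ne_zero (mul_ne_zero (inv_ne_zero hΓ) hk0) hl0) hGM
  refine mul_left_cancel₀ hc (key.trans ?_)
  split_ifs with hkl
  · subst hkl
    have h2 := racahNorm_mul q ω (K := K) (N := N) (M := M) (k := k) (by omega) (by omega)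
      (qP_neg_om_ne_of_le h hk)
    rw [← mul_right_inj' hΓ, ← h2]
    field_simp
  · rw [mul_zero]

/-- Every factor on the right of `racahWeight_mul` is nonzero, in particular the reduced weight at
`M - j`. -/
lemma racahWeight_ne (h : ∀ i < min M N, ω ≠ 1 - (M : ℝ) + i) {j : ℕ} (hj : j ≤ min M N) :
    racahWeight q ω N M j ≠ 0 := by
  obtain ⟨K, hK, hB, hG⟩ := exists_adjWeight q h
  have h1 := racahWeight_mul q ω (K := K) (N := N) (M := M) (j := j) (by omega) (by omega)
  refine left_ne_zero_of_mul (b := gamW (cQ q ^ 2) (cZ q) (cY q ω) K M) ?_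
  rw [h1]
  refine mul_ne_zero (mul_ne_zero (mul_ne_zero (hG _ (by omega)) ?_) ?_) ?_
  · exact (_root_.map_ne_zero _).2 (gammaN_ne q)
  · exact pow_ne_zero 2 (facJ_ne q ω N (by omega))
  · exact pow_ne_zero 2 (qP_neg_om_ne_of_le h hj)

lemma racahNorm_ne (h : ∀ i < min M N, ω ≠ 1 - (M : ℝ) + i) {k : ℕ} (hk : k ≤ min M N) :
    racahNorm q ω N M k ≠ 0 := by
  obtain ⟨K, hK, hB, hG⟩ := exists_adjWeight q h
  have h2 := racahNorm_mul q ω (K := K) (N := N) (M := M) (k := k) (by omega) (by omega)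
    (qP_neg_om_ne_of_le h hk)
  refine left_ne_zero_of_mul (b := facK q N M k ^ 2)
    (left_ne_zero_of_mul (b := gamW (cQ q ^ 2) (cZ q) (cY q ω) K M) ?_)
  rw [h2]
  refine mul_ne_zero (gammaN_ne q) ?_
  exact (_root_.map_ne_zero _).2 (hG _ (by omega))

/-- Orthogonality of the rows of a square matrix implies orthogonality of its columns. -/
lemma dual_orthogonality {F : Type*} [Field F] {n : ℕ} (R : ℕ → ℕ → F) (w h : ℕ → F)
    (hw : ∀ j ≤ n, w j ≠ 0) (hh : ∀ k ≤ n, h k ≠ 0)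
    (hR : ∀ k ≤ n, ∀ l ≤ n, ∑ j ∈ Finset.range (n + 1), w j * R k j * R l j =
      if k = l then h k else 0) {i j : ℕ} (hi : i ≤ n) (hj : j ≤ n) :
    ∑ k ∈ Finset.range (n + 1), (h k)⁻¹ * R k i * R k j = if i = j then (w i)⁻¹ else 0 := by
  let A : Matrix (Fin (n + 1)) (Fin (n + 1)) F := Matrix.of fun k j => (h k)⁻¹ * R k j * w j
  let B : Matrix (Fin (n + 1)) (Fin (n + 1)) F := Matrix.of fun j l => R l j
  have hAB : A * B = 1 := by
    ext k l
    rw [Matrix.mul_apply, Matrix.one_apply]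
    have h1 := hR k (by omega) l (by omega)
    rw [← Fin.sum_univ_eq_sum_range (fun j => w j * R k j * R l j)] at h1
    have h2 : ∑ j, A k j * B j l = (h k)⁻¹ * ∑ j : Fin (n + 1), w j * R k j * R l j := by
      rw [Finset.mul_sum]
      exact Finset.sum_congr rfl fun j _ => by simp only [A, B, Matrix.of_apply]; ring
    rw [h2, h1]
    by_cases hkl : k = l
    · subst hkl
      rw [if_pos rfl, if_pos rfl, inv_mul_cancel₀ (hh k (by omega))]
    · rw [if_neg (by omega), if_neg hkl, mul_zero]
  -- The range of the degree and that of the variable have the same size `n + 1`, so the one-sided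
  -- inverse is two-sided.
  have hBA := mul_eq_one_comm.1 hAB
  have h3 := congrFun (congrFun hBA ⟨i, by omega⟩) ⟨j, by omega⟩
  rw [Matrix.mul_apply, Matrix.one_apply] at h3
  have h4 : ∑ k, B ⟨i, by omega⟩ k * A k ⟨j, by omega⟩ =
      (∑ k ∈ Finset.range (n + 1), (h k)⁻¹ * R k i * R k j) * w j := by
    rw [← Fin.sum_univ_eq_sum_range (fun k => (h k)⁻¹ * R k i * R k j), Finset.sum_mul]
    exact Finset.sum_congr rfl fun k _ => by simp only [A, B, Matrix.of_apply]; ring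
  rw [h4] at h3
  rw [← mul_left_inj' (hw j hj), h3]
  by_cases hij : i = j
  · subst hij
    rw [if_pos rfl, if_pos rfl, inv_mul_cancel₀ (hw i hi)]
  · rw [if_neg (by simpa using hij), if_neg hij, zero_mul]

/-- The orthogonality relations of the dual `q`-Racah polynomials. -/
theorem sum_racahDual_mul (h : ∀ i < min M N, ω ≠ 1 - (M : ℝ) + i) {i j : ℕ}
    (hi : i ≤ min M N) (hj : j ≤ min M N) :
    ∑ k ∈ Finset.range (min M N + 1), (racahNorm q ω N M k)⁻¹ * racahDual q ω N M i k *
      racahDual q ω N M j k = if i = j then (racahWeight q ω N M i)⁻¹ else 0 := by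
  simp only [racahDual_eq_racah]
  exact dual_orthogonality (fun k j => racah q ω N M k j) (racahWeight q ω N M)
    (racahNorm q ω N M) (fun _ => racahWeight_ne h) (fun _ => racahNorm_ne h)
    (fun _ hk _ hl => sum_racahWeight_mul h hk hl) hi hj

/-- The first orthogonality relation, evaluated in the dynamical representation. -/
theorem sum_gammaW_mul (h : ∀ i < M, ω ≠ -(i : ℝ)) {k l : ℕ} (hk : k ≤ min M N)
    (hl : l ≤ min M N) :
    ∑ j ∈ Finset.range (min M N + 1),
      gammaW q ω (M - j) * shift (-ω - 2 * M + 2 * j) (gammaN q N j) /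
        (shift (N - 2 * k) (gammaW q ω (M - k)) * gammaN q N k) *
        tCoef q ω N j k (M - k) * tCoef q ω N j l (M - l) = if k = l then 1 else 0 := by
  -- The stronger condition, under which `Γ^ω` itself can be used with `K = 0`, implies the one that
  -- makes the cancellation in `T` legitimate.
  have h' : ∀ i < min M N, ω ≠ 1 - (M : ℝ) + i := fun i hi h0 => by
    refine h (M - 1 - i) (by omega) ?_
    rw [h0, Nat.sub_sub, Nat.cast_sub (by omega)]
    push_cast; ring
  have key := sum_tCoefReg_mul q (isAdjWeight_gammaW q ω) hk hl (by omega)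
  have hG : shift (N - 2 * k) (gammaW q ω (M - k)) ≠ 0 := by
    rw [_root_.map_ne_zero, gammaW_eq]
    exact gamW_ne q fun i _ hi => h i (by omega)
  have e : ∀ j ∈ Finset.range (min M N + 1),
      gammaW q ω (M - j) * shift (-ω - 2 * M + 2 * j) (gammaN q N j) /
        (shift (N - 2 * k) (gammaW q ω (M - k)) * gammaN q N k) *
        tCoef q ω N j k (M - k) * tCoef q ω N j l (M - l) =
      (shift (N - 2 * k) (gammaW q ω (M - k)))⁻¹ *
        (gammaW q ω (M - j) * (shift (-ω - 2 * M + 2 * j) (gammaN q N j) * (gammaN q N k)⁻¹) *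
          tCoefReg q ω N j k (M - k) * tCoefReg q ω N j l (M - l)) := fun j hj => by
    have hj' : j ≤ min M N := Nat.lt_succ_iff.1 (Finset.mem_range.1 hj)
    rw [tCoefReg_sub_eq h' hj' hk, tCoefReg_sub_eq h' hj' hl, div_eq_mul_inv, mul_inv]
    ring
  rw [Finset.sum_congr rfl e, ← Finset.mul_sum, key]
  split_ifs
  · exact inv_mul_cancel₀ hG
  · exact mul_zero _

/-- The action of the adjoints of the matrix elements in the dynamical representation. -/
theorem dynRep_star_matEl {k j m n : ℕ} (hk : k ≤ N) (hj : j ≤ N) (g : Mer) (hn : n + j = m + k)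
    (h : ∀ i < m + k, ω ≠ -(i : ℝ)) :
    dynRep q ω (FSL2.star q (FSL2.matEl q N k j)) (Finsupp.single m g) =
      Finsupp.single n (shift (2 * j - N) (tCoef q ω N k j n) *
        (shift (2 * j - N) (gammaW q ω m) / gammaW q ω n) * shift (2 * j - N) g) := by
  have hG : gammaW q ω n ≠ 0 := by
    rw [gammaW_eq]
    exact gamW_ne q fun i _ hi => h i (by omega)
  have hT : tCoef q ω N k j n = tCoefReg q ω N k j n := by
    -- Since `n + j = m + k`, an exceptional value would be `ω = -(m + k - 1 - i)`, which is
    -- excluded.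
    refine tCoef_eq_tCoefReg q (qP_neg_om_ne q (n + j) (by push_cast; ring) fun i hi h0 => ?_)
    refine h (n + j - 1 - i) (by omega) ?_
    rw [h0, Nat.sub_sub, Nat.cast_sub (by omega)]
    push_cast; ring
  have h1 := star_matEl_apply (isAdjWeight_gammaW q ω) hk hj hn (Nat.zero_le m) (Nat.zero_le n) g
  ext i
  rcases eq_or_ne i n with rfl | hi
  · rw [Finsupp.single_eq_same, eq_div_of_mul_eq hG h1, hT, map_mul, map_mul]
    ring
  · rw [Finsupp.single_eq_of_ne hi]
    exact star_matEl_support hk (by omega) g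

end Orthogonality
end DynSU2

/-! ### The theorem. -/

theorem mainTheorem5 (q : Set.Ioo (0 : ℝ) 1) :
    -- the matrix elements exist and are unique
    (∀ N : ℕ, ∃! t : Fin (N + 1) → Fin (N + 1) → FSL2 q, FSL2.IsMatrixElements q N t) ∧
    (∀ (N : ℕ) (t : Fin (N + 1) → Fin (N + 1) → FSL2 q), FSL2.IsMatrixElements q N t →
      -- the action of the matrix elements in the dynamical representation, by `q`-Racah polynomials
      (∀ (ω : ℂ) (k j : Fin (N + 1)) (m : ℕ),
        qP q (-2 * (Polynomial.C ω - 1 + (m : Polynomial ℂ) + ((j : ℕ) : Polynomial ℂ)))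
          (min (j : ℕ) (k : ℕ)) ≠ 0 →
        dynRep q ω (t k j) (basisVec m) = tCoef q ω N k j m • basisVec ((m : ℤ) + j - k)) ∧
      -- the same, for all values of `ω`
      (∀ (ω : ℂ) (k j : Fin (N + 1)) (m : ℕ),
        dynRep q ω (t k j) (basisVec m) = tCoefReg q ω N k j m • basisVec ((m : ℤ) + j - k)) ∧
      -- the orthogonality relations in the algebra
      (∀ k l : Fin (N + 1),
        ∑ j : Fin (N + 1), FSL2.star q (t j k) *
          (FSL2.l q (gammaN q N j) * FSL2.r q (gammaN q N k)⁻¹) * t j l = if k = l then 1 else 0) ∧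
      (∀ k l : Fin (N + 1),
        ∑ j : Fin (N + 1), t k j * FSL2.star q (t l j) *
          (FSL2.l q (gammaN q N l) * FSL2.r q (gammaN q N j)⁻¹) = if k = l then 1 else 0) ∧
      -- the action of the adjoints of the matrix elements
      (∀ (ω : ℝ) (k j : Fin (N + 1)) (m n : ℕ) (g : Mer), n + (j : ℕ) = m + (k : ℕ) →
        (∀ i < m + (k : ℕ), ω ≠ -(i : ℝ)) →
        dynRep q ω (FSL2.star q (t k j)) (Finsupp.single m g) =
          Finsupp.single n (Mer.shift (2 * (j : ℕ) - N) (tCoef q ω N k j n) *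
            (Mer.shift (2 * (j : ℕ) - N) (gammaW q ω m) / gammaW q ω n) *
            Mer.shift (2 * (j : ℕ) - N) g)) ∧
      (∀ (ω : ℝ) (k j : Fin (N + 1)) (m : ℕ) (g : Mer), m + (k : ℕ) < (j : ℕ) →
        dynRep q ω (FSL2.star q (t k j)) (Finsupp.single m g) = 0)) ∧
    -- the first orthogonality relation, evaluated in the dynamical representation
    (∀ (N M : ℕ) (ω : ℝ), (∀ i < M, ω ≠ -(i : ℝ)) → ∀ k ≤ min M N, ∀ l ≤ min M N,
      ∑ j ∈ Finset.range (min M N + 1),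
        gammaW q ω (M - j) * Mer.shift (-ω - 2 * M + 2 * j) (gammaN q N j) /
          (Mer.shift (N - 2 * k) (gammaW q ω (M - k)) * gammaN q N k) *
          tCoef q ω N j k (M - k) * tCoef q ω N j l (M - l) = if k = l then 1 else 0) ∧
    (∀ (N M : ℕ) (ω : ℝ), (∀ i < min M N, ω ≠ 1 - (M : ℝ) + i) →
      -- the orthogonality relations of the `q`-Racah polynomials
      (∀ k ≤ min M N, ∀ l ≤ min M N,
        ∑ j ∈ Finset.range (min M N + 1),
          racahWeight q ω N M j * racah q ω N M k j * racah q ω N M l j =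
            if k = l then racahNorm q ω N M k else 0) ∧
      (∀ k ≤ min M N, racahWeight q ω N M k ≠ 0 ∧ racahNorm q ω N M k ≠ 0) ∧
      -- the orthogonality relations of the dual system
      (∀ i ≤ min M N, ∀ j ≤ min M N,
        ∑ k ∈ Finset.range (min M N + 1),
          (racahNorm q ω N M k)⁻¹ * racahDual q ω N M i k * racahDual q ω N M j k =
            if i = j then (racahWeight q ω N M i)⁻¹ else 0)) := by
  refine ⟨FSL2.existsUnique_matrixElements q, fun N t ht => ?_,
    fun N M ω h k hk l hl => sum_gammaW_mul h hk hl, fun N M ω h =>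
      ⟨fun k hk l hl => sum_racahWeight_mul h hk hl, fun k hk => ⟨racahWeight_ne h hk, racahNorm_ne h hk⟩,
        fun i hi j hj => sum_racahDual_mul h hi hj⟩⟩
  have hle : ∀ k : Fin (N + 1), (k : ℕ) ≤ N := fun k => Nat.lt_succ_iff.1 k.2
  -- By uniqueness every family of matrix elements is the recursive one.
  simp only [FSL2.IsMatrixElements.eq_matEl q ht]
  refine ⟨fun ω k j m h => ?_, fun ω k j m => dynRep_matEl q ω (hle k) (hle j) m, fun k l => ?_,
    fun k l => ?_, fun ω k j m n g hn h => dynRep_star_matEl (hle k) (hle j) g hn h,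
    fun ω k j m g h => ?_⟩
  · rw [dynRep_matEl q ω (hle k) (hle j), tCoef_eq_tCoefReg q h]
  · simp only [← Fin.val_inj (a := k)]
    rw [← FSL2.sum_star_mul_matEl q (hle k), ← Fin.sum_univ_eq_sum_range (fun j =>
      FSL2.star q (FSL2.matEl q N j k) *
        (FSL2.l q (gammaN q N j) * FSL2.r q (gammaN q N k)⁻¹) * FSL2.matEl q N j l)]
  · simp only [← Fin.val_inj (a := k)]
    rw [← FSL2.sum_matEl_mul_star q (hle k) (hle l), ← Fin.sum_univ_eq_sum_range (fun j =>
      FSL2.matEl q N k j * FSL2.star q (FSL2.matEl q N l j) *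
        (FSL2.l q (gammaN q N l) * FSL2.r q (gammaN q N j)⁻¹))]
  -- No index `i ≥ 0` satisfies `i + j = m + k`, so every coefficient vanishes by weight.
  · ext i
    exact star_matEl_support (hle k) (by omega) g
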